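/- Let $I=\mathbb N=\{0,1,2,\dots\}$ (put $l=0$) or $I=\mathbb Z$ (put $l=-\infty$), and let $\lambda(x),\mu(x)$, $x\in I$, be birth and death rates with $\lambda(x)>0$ and $\mu(x)>0$, except that $\mu(0)=0$ if $I=\mathbb N$. Let $\pi(0)=1$, $\pi(x)=\prod_{i=1}^{x}\frac{\lambda(i-1)}{\mu(i)}$ for $x\ge 1$ and $\pi(x)=\prod_{i=1}^{-x}\frac{\mu(x+i)}{\lambda(x+i-1)}$ for $x\le -1$. Assume that the infinite ends are natural boundaries: if $I=\mathbb N$, $$\sum_{j\ge 0}\frac{1}{\lambda(j)\pi(j)}\sum_{i=0}^{j}\pi(i)=\infty,\qquad \sum_{j\ge 0}\frac{1}{\lambda(j)\pi(j)}\sum_{i>j}\pi(i)=\infty ,$$ and if $I=\mathbb Z$, $$\sum_{j\ge1}\frac{1}{\lambda(j)\pi(j)}\sum_{i=1}^{j}\pi(i)=\sum_{j\ge1}\pi(j)\sum_{i=1}^{j-1}\frac{1}{\lambda(i)\pi(i)}=\sum_{j\le-1}\frac{1}{\lambda(j)\pi(j)}\sum_{i=j+1}^{-1}\pi(i)=\sum_{j\le-1}\pi(j)\sum_{i=j}^{-1}\frac{1}{\lambda(i)\pi(i)}=\infty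 .$$ Let $p_t(x,y)$ be the transition function of the birth and death chain with rates $(\lambda,\mu)$ (the $\mathcal D$-chain). Let $\hat p_t(x,y)$ be that of the dual chain, with birth rates $\hat\lambda(x)=\mu(x+1)$ and death rates $\hat\mu(x)=\lambda(x)$, absorbed (killed) at $-1$ if $I=\mathbb N$, and let $\hat\pi$ be its symmetrizing measure, given by the formula for $\pi$ with $(\hat\lambda,\hat\mu)$ in place of $(\lambda,\mu)$. Write $P_t\mathbf 1_{[l,y]}(x)=\sum_{l\le z\le y}p_t(x,z)$, $\hat P_t\mathbf 1_{[y,\infty)}(x)=\sum_{z\in I,\,z\ge y}\hat p_t(x,z)$, $\nabla f(x)=f(x+1)-f(x)$ and $\bar\nabla f(x)=f(x-1)-f(x)$. For $n\ge 0$ let $$W^{n,n+1}=\{(x,y)\in I^{n+1}\times I^n: x_1\le y_1<x_2\le y_2<\cdots<x_{n+1}\},$$ $$W^{n,n}=\{(x,y)\in I^{n}\times I^n: y_1\le x_1<y_2\le x_2<\cdots\le x_{n}\}.$$ For $(x,y),(x',y')\in W^{n,n+1}$, respectively $W^{n,n}$, let $\mathsf q_t((x,y),(x',y'))=\det\begin{pmatrix}\mathsf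 A&\mathsf B\\ \mathsf C&\mathsf D\end{pmatrix}$, where for $\mathsf q_t=\mathsf q_t^{n,n+1}$ $$\mathsf A_{ij}=p_t(x_i,x'_j),\quad \mathsf B_{ij}=\hat\pi(y'_j)\big(P_t\mathbf 1_{[l,y'_j]}(x_i)-\mathbf 1(j\ge i)\big),\quad \mathsf C_{ij}=\hat\pi(y_i)^{-1}\nabla_{y_i}\bar\nabla_{x'_j}P_t\mathbf 1_{[l,x'_j]}(y_i),\quad \mathsf D_{ij}=\hat p_t(y_i,y'_j),$$ and for $\mathsf q_t=\mathsf q_t^{n,n}$ $$\mathsf A_{ij}=\hat p_t(x_i,x'_j),\quad \mathsf B_{ij}=\pi(y'_j)\big(\hat P_t\mathbf 1_{[y'_j,\infty)}(x_i)-\mathbf 1(j\le i)\big),\quad \mathsf C_{ij}=\pi(y_i)^{-1}\bar\nabla_{y_i}\nabla_{x'_j}\hat P_t\mathbf 1_{[x'_j,\infty)}(y_i),\quad \mathsf D_{ij}=p_t(y_i,y'_j).$$ Let $\Phi_{s,t}$, $s\le t$, be the coalescing flow of $\mathcal D$-chains on $I$: independent two-sided Poisson processes of up arrows (rate $\lambda(x)$)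 and down arrows (rate $\mu(x)$) are attached to the sites $x$, and $\Phi_{s,t}(x)$ is the site reached at time $t$ by starting from $x$ at time $s$ and following the arrows with times in $(s,t]$. Let $\hat\Phi_{s,t}$ be the analogous flow of dual chains (on $\mathbb N\cup\{-1\}$ or $\mathbb Z$). Let $\Phi^*_{s,t}(y)=\sup\{w:\Phi_{-t,-s}(w)\le y\}$ and $\hat\Phi^*_{s,t}(y)=\inf\{w:\hat\Phi_{-t,-s}(w)\ge y\}$. Then the following hold. 1. The operators $(\mathsf Q_tf)(z)=\sum_{z'}\mathsf q_t(z,z')f(z')$, $t\ge0$, on bounded functions, with $\mathsf q=\mathsf q^{n,n+1}$ on $W^{n,n+1}$ and with $\mathsf q=\mathsf q^{n,n}$ on $W^{n,n}$, are well defined (the series converge absolutely) and form a sub-Markov semigroup: $\mathsf Q_0=\mathrm{Id}$, $\mathsf Q_t1\le1$, $\mathsf Q_tf\ge0$ for $f\ge0$, and $\mathsf Q_{t+s}=\mathsf Q_t\mathsf Q_s$. To each of the two semigroups one can associate a Markov process $(X,Y)$, with possibly finite lifetime, on $W^{n,n+1}$, respectively $W^{n,n}$. 2. For $t\ge0$ and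 $(x,y),(x',y')\in W^{n,n+1}$, $$\mathsf q_t^{n,n+1}((x,y),(x',y'))=\frac{\prod_{i=1}^n\hat\pi(y'_i)}{\prod_{i=1}^n\hat\pi(y_i)}\,\mathbb P\big(\Phi_{0,t}(x_i)=x'_i,\ \Phi^*_{-t,0}(y'_j)=y_j\ \text{for all } i,j\big)$$ $$=\frac{\prod_{i=1}^n\hat\pi(y'_i)}{\prod_{i=1}^n\hat\pi(y_i)}(-1)^n\nabla_{y_1}\cdots\nabla_{y_n}(-1)^{n+1}\bar\nabla_{x'_1}\cdots\bar\nabla_{x'_{n+1}}\mathbb P\big(\Phi_{0,t}(x_i)\le x'_i,\ \Phi_{0,t}(y_j)\le y'_j\ \text{for all } i,j\big).$$ 3. For $t\ge0$ and $(x,y),(x',y')\in W^{n,n}$, $$\mathsf q_t^{n,n}((x,y),(x',y'))=\frac{\prod_{i=1}^n\pi(y'_i)}{\prod_{i=1}^n\pi(y_i)}\,\mathbb P\big(\hat\Phi_{0,t}(x_i)=x'_i,\ \hat\Phi^*_{-t,0}(y'_j)=y_j\ \text{for all } i,j\big)$$ $$=\frac{\prod_{i=1}^n\pi(y'_i)}{\prod_{i=1}^n\pi(y_i)}(-1)^n\bar\nabla_{y_1}\cdots\bar\nabla_{y_n}(-1)^n\nabla_{x'_1}\cdots\nabla_{x'_n}\mathbb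 P\big(\hat\Phi_{0,t}(x_i)\ge x'_i,\ \hat\Phi_{0,t}(y_j)\ge y'_j\ \text{for all } i,j\big).$$ -/

import Mathlib

open MeasureTheory ProbabilityTheory
open scoped ENNReal NNReal

namespace CoalescingFlow

noncomputable section

/-! ### Rates, symmetrizing measures, boundary conditions -/

/-- The two lattices: `I = ℕ` (left end `l = 0`) and `I = ℤ` (left end `l = -∞`). -/
inductive Lattice
  | nat
  | int

/-- The sites of the lattice, as a subset of `ℤ`. -/
def Lattice.sites : Lattice → Set ℤ
  | .nat => Set.Ici 0
  | .int => Set.univ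

/-- The sites of the dual chain: `ℕ ∪ {-1}` if `I = ℕ`, and `ℤ` if `I = ℤ`. -/
def Lattice.dualSites : Lattice → Set ℤ
  | .nat => Set.Ici (-1)
  | .int => Set.univ

/-- Positivity of the birth rates `lam` and death rates `mu` on `I`; for `I = ℕ` the origin is
reflecting. Values outside `I` are irrelevant. -/
def AdmissibleRates (lam mu : ℤ → ℝ) : Lattice → Prop
  | .nat => (∀ x, 0 ≤ x → 0 < lam x) ∧ mu 0 = 0 ∧ ∀ x, 1 ≤ x → 0 < mu x
  | .int => ∀ x, 0 < lam x ∧ 0 < mu x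

/-- The birth rate of the dual chain. -/
def dualBirth (mu : ℤ → ℝ) (x : ℤ) : ℝ := mu (x + 1)

open Classical in
/-- The death rate of the dual chain; the state `-1` is absorbing when `I = ℕ`. -/
def dualDeath (I : Lattice) (lam : ℤ → ℝ) (x : ℤ) : ℝ := if x ∈ I.sites then lam x else 0

/-- The symmetrizing measure of the chain with birth rates `b` and death rates `d`,
normalized to be `1` at the origin. -/
def revMeasure (b d : ℤ → ℝ) (x : ℤ) : ℝ :=
  if 0 ≤ x then ∏ i ∈ Finset.Icc 1 x, b (i - 1) / d i
  else ∏ i ∈ Finset.Icc 1 (-x), d (x + i) / b (x + i - 1)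

/-- `π(x)` as an extended nonnegative number. -/
def mass (lam mu : ℤ → ℝ) (x : ℤ) : ℝ≥0∞ := ENNReal.ofReal (revMeasure lam mu x)

/-- `1 / (λ(x) π(x))` as an extended nonnegative number. -/
def scale (lam mu : ℤ → ℝ) (x : ℤ) : ℝ≥0∞ := ENNReal.ofReal (1 / (lam x * revMeasure lam mu x))

/-- The infinite endpoints of `I` are natural boundaries. -/
def NaturalBoundaries (lam mu : ℤ → ℝ) : Lattice → Prop
  | .nat =>
    (∑' j : Set.Ici (0 : ℤ), scale lam mu j * ∑ i ∈ Finset.Icc 0 (j : ℤ), mass lam mu i = ⊤) ∧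
    (∑' j : Set.Ici (0 : ℤ), scale lam mu j * ∑' i : Set.Ici ((j : ℤ) + 1), mass lam mu i = ⊤)
  | .int =>
    (∑' j : Set.Ici (1 : ℤ), scale lam mu j * ∑ i ∈ Finset.Icc 1 (j : ℤ), mass lam mu i = ⊤) ∧
    (∑' j : Set.Ici (1 : ℤ), mass lam mu j * ∑ i ∈ Finset.Icc 1 ((j : ℤ) - 1), scale lam mu i
      = ⊤) ∧
    (∑' j : Set.Iic (-1 : ℤ), scale lam mu j * ∑ i ∈ Finset.Icc ((j : ℤ) + 1) (-1), mass lam mu i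
      = ⊤) ∧
    (∑' j : Set.Iic (-1 : ℤ), mass lam mu j * ∑ i ∈ Finset.Icc (j : ℤ) (-1), scale lam mu i = ⊤)

/-! ### Transition functions -/

/-- The probability that the birth and death chain with birth rates `b` and death rates `d`,
started from `x`, is at `y` at time `t` after at most `k` jumps, obtained by decomposing with
respect to the first jump. -/
def transitionAux (b d : ℤ → ℝ) : ℕ → ℝ → ℤ → ℤ → ℝ≥0∞
  | 0, t, x, y => if x = y then ENNReal.ofReal (Real.exp (-(b x + d x) * t)) else 0
  | k + 1, t, x, y =>
    (if x = y then ENNReal.ofReal (Real.exp (-(b x + d x) * t)) else 0) +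
      ∫⁻ s in Set.Icc 0 t, ENNReal.ofReal (Real.exp (-(b x + d x) * s)) *
        (ENNReal.ofReal (b x) * transitionAux b d k (t - s) (x + 1) y +
          ENNReal.ofReal (d x) * transitionAux b d k (t - s) (x - 1) y)

/-- The transition function `p_t(x,y)` of the chain with birth rates `b` and death rates `d`. -/
def transition (b d : ℤ → ℝ) (t : ℝ) (x y : ℤ) : ℝ := (⨆ k, transitionAux b d k t x y).toReal

/-- `(P_t 1_S)(x) = ∑_{z ∈ S} p_t(x,z)` for a transition function `p`. -/
def indicatorProb (p : ℝ → ℤ → ℤ → ℝ) (t : ℝ) (S : Set ℤ) (x : ℤ) : ℝ :=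
  ∑' z : ℤ, S.indicator (p t x) z

/-- The transition function of the chain with rates `(lam, mu)`. -/
def pT (lam mu : ℤ → ℝ) : ℝ → ℤ → ℤ → ℝ := transition lam mu

/-- The transition function of the dual chain. -/
def pHat (I : Lattice) (lam mu : ℤ → ℝ) : ℝ → ℤ → ℤ → ℝ :=
  transition (dualBirth mu) (dualDeath I lam)

/-- `P_t 1_{[l,y]}(x)`. -/
def lowerProb (I : Lattice) (lam mu : ℤ → ℝ) (t : ℝ) (y x : ℤ) : ℝ :=
  indicatorProb (pT lam mu) t (I.sites ∩ Set.Iic y) x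

/-- `P̂_t 1_{[y,∞)}(x)`. -/
def upperProbHat (I : Lattice) (lam mu : ℤ → ℝ) (t : ℝ) (y x : ℤ) : ℝ :=
  indicatorProb (pHat I lam mu) t (I.sites ∩ Set.Ici y) x

/-- The symmetrizing measure of the dual chain. -/
def revMeasureHat (I : Lattice) (lam mu : ℤ → ℝ) : ℤ → ℝ := revMeasure (dualBirth mu) (dualDeath I lam)

/-! ### Interlacing spaces and block determinant kernels -/

/-- `W^{n,n+1}(I)`: pairs `(x,y)` with `x₁ ≤ y₁ < x₂ ≤ y₂ < ⋯ < x_{n+1}`. -/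
abbrev WSucc (I : Lattice) (n : ℕ) : Type :=
  {z : (Fin (n + 1) → ℤ) × (Fin n → ℤ) //
    (∀ i, z.1 i ∈ I.sites) ∧ (∀ i, z.2 i ∈ I.sites) ∧
    ∀ i : Fin n, z.1 i.castSucc ≤ z.2 i ∧ z.2 i < z.1 i.succ}

/-- `W^{n,n}(I)`: pairs `(x,y)` with `y₁ ≤ x₁ < y₂ ≤ x₂ < ⋯ ≤ x_n`. -/
abbrev WSame (I : Lattice) (n : ℕ) : Type :=
  {z : (Fin n → ℤ) × (Fin n → ℤ) //
    (∀ i, z.1 i ∈ I.sites) ∧ (∀ i, z.2 i ∈ I.sites) ∧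
    (∀ i, z.2 i ≤ z.1 i) ∧ ∀ i j : Fin n, (i : ℕ) + 1 = j → z.1 i < z.2 j}

/-- The discrete forward derivative `∇f(x) = f(x+1) - f(x)`. -/
def fwd (f : ℤ → ℝ) (x : ℤ) : ℝ := f (x + 1) - f x

/-- The discrete backward derivative `∇̄f(x) = f(x-1) - f(x)`. -/
def bwd (f : ℤ → ℝ) (x : ℤ) : ℝ := f (x - 1) - f x

/-- The kernel `q_t^{n,n+1}((x,y),(x',y'))`. -/
def qSucc (I : Lattice) (lam mu : ℤ → ℝ) (n : ℕ) (t : ℝ) (z z' : WSucc I n) : ℝ :=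
  (Matrix.fromBlocks
    (Matrix.of fun i j : Fin (n + 1) => pT lam mu t (z.1.1 i) (z'.1.1 j))
    (Matrix.of fun (i : Fin (n + 1)) (j : Fin n) => revMeasureHat I lam mu (z'.1.2 j) *
      (lowerProb I lam mu t (z'.1.2 j) (z.1.1 i) - if (i : ℕ) ≤ j then 1 else 0))
    (Matrix.of fun (i : Fin n) (j : Fin (n + 1)) => (revMeasureHat I lam mu (z.1.2 i))⁻¹ *
      fwd (fun y => bwd (fun x' => lowerProb I lam mu t x' y) (z'.1.1 j)) (z.1.2 i))
    (Matrix.of fun i j : Fin n => pHat I lam mu t (z.1.2 i) (z'.1.2 j))).det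

/-- The kernel `q_t^{n,n}((x,y),(x',y'))`. -/
def qSame (I : Lattice) (lam mu : ℤ → ℝ) (n : ℕ) (t : ℝ) (z z' : WSame I n) : ℝ :=
  (Matrix.fromBlocks
    (Matrix.of fun i j : Fin n => pHat I lam mu t (z.1.1 i) (z'.1.1 j))
    (Matrix.of fun i j : Fin n => revMeasure lam mu (z'.1.2 j) *
      (upperProbHat I lam mu t (z'.1.2 j) (z.1.1 i) - if (j : ℕ) ≤ i then 1 else 0))
    (Matrix.of fun i j : Fin n => (revMeasure lam mu (z.1.2 i))⁻¹ *
      bwd (fun y => fwd (fun x' => upperProbHat I lam mu t x' y) (z'.1.1 j)) (z.1.2 i))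
    (Matrix.of fun i j : Fin n => pT lam mu t (z.1.2 i) (z'.1.2 j))).det

/-! ### Sub-Markov semigroups and the associated Markov processes -/

/-- The operator `(Q f)(z) = ∑_{z'} q(z,z') f(z')`. -/
def kernelOp {X : Type*} (q : X → X → ℝ) (f : X → ℝ) (z : X) : ℝ := ∑' z', q z z' * f z'

/-- Bounded functions. -/
def IsBoundedFn {X : Type*} (f : X → ℝ) : Prop := ∃ C : ℝ, ∀ z, |f z| ≤ C

/-- `(Q t)_{t ≥ 0}` is a sub-Markov semigroup of operators on the bounded functions on `X`. -/
structure IsSubMarkovSemigroup {X : Type*} (Q : ℝ → (X → ℝ) → X → ℝ) : Prop where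
  bounded : ∀ t, 0 ≤ t → ∀ f, IsBoundedFn f → IsBoundedFn (Q t f)
  zero : ∀ f, IsBoundedFn f → Q 0 f = f
  le_one : ∀ t, 0 ≤ t → ∀ z, Q t (fun _ => 1) z ≤ 1
  nonneg : ∀ t, 0 ≤ t → ∀ f, IsBoundedFn f → (∀ z, 0 ≤ f z) → ∀ z, 0 ≤ Q t f z
  add : ∀ s t, 0 ≤ s → 0 ≤ t → ∀ f, IsBoundedFn f → Q (t + s) f = Q t (Q s f)

/-- There is a Markov process `Z` on `X`, with possibly finite lifetime `ζ`, with transition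
function `q`: `Z t = none` means that the process has been killed, which is the case exactly from
time `ζ` on; under `P z` the process starts from `z`, and its finite-dimensional distributions
before `ζ` are given by products of values of `q`. -/
def HasMarkovProcess {X : Type} (q : ℝ → X → X → ℝ) : Prop :=
  ∃ (Ω : Type) (_ : MeasurableSpace Ω) (P : X → Measure Ω) (Z : ℝ≥0 → Ω → Option X)
    (ζ : Ω → ℝ≥0∞),
    (∀ z, IsProbabilityMeasure (P z)) ∧
    (∀ t x, MeasurableSet {ω | Z t ω = some x}) ∧
    (∀ t ω, Z t ω = none ↔ ζ ω ≤ t) ∧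
    ∀ (k : ℕ) (τ : Fin (k + 1) → ℝ≥0) (c : Fin (k + 1) → X), τ 0 = 0 → Monotone τ →
      (P (c 0)).real {ω | ∀ i, Z (τ i) ω = some (c i)} =
        ∏ i : Fin k, q ((τ i.succ : ℝ) - τ i.castSucc) (c i.castSucc) (c i.succ)

/-! ### Coalescing flows -/

/-- A two-sided Poisson counting process of rate `r`, indexed by `ℝ` and vanishing at `0`. -/
structure IsPoissonProcess {Ω : Type*} [MeasurableSpace Ω] (P : Measure Ω) (N : ℝ → Ω → ℤ)
    (r : ℝ) : Prop where
  measurable : ∀ t, Measurable (N t)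
  zero : ∀ᵐ ω ∂P, N 0 ω = 0
  mono : ∀ᵐ ω ∂P, Monotone fun t => N t ω
  rightCont : ∀ᵐ ω ∂P, ∀ t, ContinuousWithinAt (fun s => N s ω) (Set.Ici t) t
  indep : HasIndepIncrements N P
  law : ∀ s t, s ≤ t → P.map (fun ω => N t ω - N s ω) =
    (poissonMeasure (Real.toNNReal (r * (t - s)))).map (fun m : ℕ => (m : ℤ))

/-- The direction of an arrow. -/
inductive Dir
  | up
  | down

/-- The displacement along an arrow. -/
def Dir.step : Dir → ℤ
  | .up => 1
  | .down => -1

/-- Independent Poisson processes of up and down arrows at the sites in `J`, with rates `b x` and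
`d x` at the site `x`. -/
structure IsArrowField {Ω : Type*} [MeasurableSpace Ω] (P : Measure Ω) (J : Set ℤ)
    (b d : ℤ → ℝ) (N : J × Dir → ℝ → Ω → ℤ) : Prop where
  up : ∀ x : J, IsPoissonProcess P (N (x, .up)) (b x)
  down : ∀ x : J, IsPoissonProcess P (N (x, .down)) (d x)
  indep : iIndepFun (fun k ω t => N k t ω) P

/-- The times of the arrows with direction `a` starting from the site `x`. -/
def arrowTimes {Ω : Type*} {J : Set ℤ} (N : J × Dir → ℝ → Ω → ℤ) (ω : Ω) (x : ℤ) (a : Dir) :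
    Set ℝ :=
  {t | ∃ h : x ∈ J, ¬ ContinuousAt (fun s => N (⟨x, h⟩, a) s ω) t}

/-- `Follows A s t x y`: starting at time `s` from `x` and following the arrows with times in
`(s, t]`, one is at `y` at time `t`. -/
inductive Follows (A : ℤ → Dir → Set ℝ) : ℝ → ℝ → ℤ → ℤ → Prop
  | stay {s t : ℝ} {x : ℤ} (hst : s ≤ t) (h : ∀ v ∈ Set.Ioc s t, ∀ a, v ∉ A x a) :
      Follows A s t x x
  | jump {s u t : ℝ} {x y : ℤ} {a : Dir} (hsu : s < u) (hut : u ≤ t) (hu : u ∈ A x a)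
      (h : ∀ v ∈ Set.Ioo s u, ∀ a', v ∉ A x a') (hrest : Follows A u t (x + a.step) y) :
      Follows A s t x y

open Classical in
/-- The random map `Φ_{s,t}`, for `s ≤ t`, determined by the arrows. (The default value is used
only on the null event that infinitely many arrows are followed between `s` and `t`.) -/
def flow {Ω : Type*} {J : Set ℤ} (N : J × Dir → ℝ → Ω → ℤ) (ω : Ω) (s t : ℝ) (x : ℤ) : ℤ :=
  if h : ∃ y, Follows (arrowTimes N ω) s t x y then h.choose else x

/-- The dual flow `Φ*_{s,t}(x) = sup {w ∈ J | Φ_{-t,-s}(w) ≤ x}`, as an extended integer. -/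
def dualFlowSup {Ω : Type*} {J : Set ℤ} (N : J × Dir → ℝ → Ω → ℤ) (ω : Ω) (s t : ℝ) (x : ℤ) :
    WithTop (WithBot ℤ) :=
  sSup ((fun w : ℤ => ((w : WithBot ℤ) : WithTop (WithBot ℤ))) ''
    {w | w ∈ J ∧ flow N ω (-t) (-s) w ≤ x})

/-- The dual flow `Φ*_{s,t}(x) = inf {w ∈ J | Φ_{-t,-s}(w) ≥ x}`, as an extended integer. -/
def dualFlowInf {Ω : Type*} {J : Set ℤ} (N : J × Dir → ℝ → Ω → ℤ) (ω : Ω) (s t : ℝ) (x : ℤ) :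
    WithTop (WithBot ℤ) :=
  sInf ((fun w : ℤ => ((w : WithBot ℤ) : WithTop (WithBot ℤ))) ''
    {w | w ∈ J ∧ x ≤ flow N ω (-t) (-s) w})

/-- The event `Φ_{0,t}(x_i) = x'_i` and `Φ*_{-t,0}(y'_j) = y_j` for all `i`, `j`, with
`Φ*` defined through the supremum. -/
def eventSup {Ω : Type*} {J : Set ℤ} (N : J × Dir → ℝ → Ω → ℤ) (t : ℝ) {k m : ℕ}
    (x : Fin k → ℤ) (y : Fin m → ℤ) (x' : Fin k → ℤ) (y' : Fin m → ℤ) : Set Ω :=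
  {ω | (∀ i, flow N ω 0 t (x i) = x' i) ∧
    ∀ j, dualFlowSup N ω (-t) 0 (y' j) = (((y j : ℤ) : WithBot ℤ) : WithTop (WithBot ℤ))}

/-- The event `Φ_{0,t}(x_i) = x'_i` and `Φ*_{-t,0}(y'_j) = y_j` for all `i`, `j`, with
`Φ*` defined through the infimum. -/
def eventInf {Ω : Type*} {J : Set ℤ} (N : J × Dir → ℝ → Ω → ℤ) (t : ℝ) {k m : ℕ}
    (x : Fin k → ℤ) (y : Fin m → ℤ) (x' : Fin k → ℤ) (y' : Fin m → ℤ) : Set Ω :=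
  {ω | (∀ i, flow N ω 0 t (x i) = x' i) ∧
    ∀ j, dualFlowInf N ω (-t) 0 (y' j) = (((y j : ℤ) : WithBot ℤ) : WithTop (WithBot ℤ))}

/-- `P(Φ_{0,t}(x_i) ≤ x'_i, Φ_{0,t}(y_j) ≤ y'_j for all i, j)`. -/
def lowerCdf {Ω : Type*} [MeasurableSpace Ω] (P : Measure Ω) {J : Set ℤ}
    (N : J × Dir → ℝ → Ω → ℤ) (t : ℝ) {k m : ℕ}
    (x : Fin k → ℤ) (y : Fin m → ℤ) (x' : Fin k → ℤ) (y' : Fin m → ℤ) : ℝ :=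
  P.real {ω | (∀ i, flow N ω 0 t (x i) ≤ x' i) ∧ ∀ j, flow N ω 0 t (y j) ≤ y' j}

/-- `P(Φ_{0,t}(x_i) ≥ x'_i, Φ_{0,t}(y_j) ≥ y'_j for all i, j)`. -/
def upperCdf {Ω : Type*} [MeasurableSpace Ω] (P : Measure Ω) {J : Set ℤ}
    (N : J × Dir → ℝ → Ω → ℤ) (t : ℝ) {k m : ℕ}
    (x : Fin k → ℤ) (y : Fin m → ℤ) (x' : Fin k → ℤ) (y' : Fin m → ℤ) : ℝ :=
  P.real {ω | (∀ i, x' i ≤ flow N ω 0 t (x i)) ∧ ∀ j, y' j ≤ flow N ω 0 t (y j)}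

/-- The iterated forward derivative `∇_{v₁} ⋯ ∇_{v_m} F`. -/
def fwdAll {m : ℕ} (F : (Fin m → ℤ) → ℝ) : (Fin m → ℤ) → ℝ :=
  (List.finRange m).foldr (fun i G v => fwd (fun w => G (Function.update v i w)) (v i)) F

/-- The iterated backward derivative `∇̄_{v₁} ⋯ ∇̄_{v_m} F`. -/
def bwdAll {m : ℕ} (F : (Fin m → ℤ) → ℝ) : (Fin m → ℤ) → ℝ :=
  (List.finRange m).foldr (fun i G v => bwd (fun w => G (Function.update v i w)) (v i)) F

end

end CoalescingFlow

/-!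
The kernels are analysed through bounded solutions of backward equations, and no generator is ever
exponentiated.

*Uniqueness.* For a jump process with finitely many kinds of moves on a countable set, a subsolution
of the backward equation which is bounded above obeys a maximum principle (`max_principle`) as soon
as there are functions with finite sublevel sets and bounded drift (`Confined`). For the chain
and for its dual, such functions are the sums in Feller's test for explosion; they are unbounded
because the infinite ends are neither exit nor entrance boundaries (`hasLyapunov_pT`,
`hasLyapunov_pHat`). Uniqueness shows that the generator commutes with the semigroup, and then that
the two chains are Siegmund dual (`siegmund_duality`) and reversible (`transition_reversible`). By
duality and reversibility, all entries of the block matrices are differences of the single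
function `g t x y = P_t 1_{[l,y]}(x)`.

*The flow.* Starting from distinct sites, the coalescing particles move independently until they
meet, so that their joint distribution function solves the backward equation of independent chains
(`IsArrowField.backward_equation`); if two starting points coincide, one particle may be omitted.
The determinant `det (g(zᵢ, z'ⱼ) - 1(i < j))` has the same two properties and the same initial
value, hence it is the joint distribution function (`eq_cdfDet_of_coalescing`,
`IsArrowField.measureReal_flow_le`). As paths cannot cross, `Φ*(y') = y` means
`Φ(y) ≤ y' < Φ(y + 1)`, and the probabilities of the theorem are iterated differences of the joint
distribution function at interlaced arguments (`IsArrowField.diffList_lowerCdf`). Determinants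
are multilinear, so these differences produce the block determinants (`diffList_eq_det_diffMatrix`,
`IsArrowField.measureReal_eventSup`).

*The semigroup.* The block determinant solves the backward equation of independent particles. On the
interlacing space it also solves that of interacting particles: the `y`-particles are autonomous and
push the `x`-particles, and a move of an `x`-particle which violates the interlacing is suppressed.
Indeed, moving an `x`-particle across a `y`-particle changes its row by a multiple of the row of the
`y`-particle, and the determinant vanishes when two `y`-particles collide or one of them leaves `I`
(`rowDet_interMove`). The interacting process does not explode (`confined_inter`), so the maximum
principle yields positivity, total mass at most one and the Chapman-Kolmogorov equations
(`isSubMarkovKernel_of_isSol`). The Markov process is constructed by Kolmogorov's extension theorem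
on the space with a cemetery added (`exists_isProjectiveLimit`,
`IsSubMarkovKernel.exists_markov_realization`).

The kernels on `W^{n,n}` are reduced to the same abstract system (`IsInterPair`) by reflection at
the origin, with the roles of the chain and the dual chain exchanged (`isInterPair_upper`).
-/

namespace CoalescingFlow

noncomputable section

/-! ### A maximum principle for backward equations with infinitely many states -/

/-- The generator `f ↦ ∑ₐ rₐ(z) (f(τₐ z) - f(z))` of a jump process with finitely many kinds of
moves `a`, where the move `a` leads from `z` to `τₐ z` at rate `rₐ(z)`. -/
def gen {S A : Type*} [Fintype A] (r : A → S → ℝ) (τ : A → S → S) (f : S → ℝ) (z : S) : ℝ :=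
  ∑ a, r a z * (f (τ a z) - f z)

/-- A criterion which prevents the process with generator `gen r τ`, killed on leaving `D`, from
exploding. The function `V` controls a part of the state; the function `H` controls the rest of
it, but only as long as `V` stays bounded. -/
def Confined {S A : Type*} [Fintype A] (D : Set S) (r : A → S → ℝ) (τ : A → S → S) : Prop :=
  ∃ (V H : S → ℝ) (C : ℝ) (CH : ℝ → ℝ), (∀ z, 0 ≤ V z) ∧ (∀ z, 0 ≤ H z) ∧
    (∀ z ∈ D, gen r τ V z ≤ C) ∧ (∀ K, ∀ z ∈ D, V z ≤ K → gen r τ H z ≤ CH K) ∧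
    ∀ K m, {z ∈ D | V z ≤ K ∧ H z ≤ m}.Finite

/-- A single function with finite sublevel sets on `D` and bounded drift confines the process. -/
lemma Confined.of_single {S A : Type*} [Fintype A] {D : Set S} {r : A → S → ℝ} {τ : A → S → S}
    (V : S → ℝ) (C : ℝ) (hV : ∀ z, 0 ≤ V z) (hC : ∀ z ∈ D, gen r τ V z ≤ C)
    (hf : ∀ K, {z ∈ D | V z ≤ K}.Finite) : Confined D r τ :=
  ⟨V, V, C, fun _ => C, hV, hV, hC, fun _ z hz _ => hC z hz, fun K _ =>
    (hf K).subset fun _ hz => ⟨hz.1, hz.2.1⟩⟩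

section MaxPrinciple

variable {S A : Type*} [Fintype A] {D : Set S} {r : A → S → ℝ} {τ : A → S → S}

open Set Filter Topology in
/-- The barrier `δ (V + C t) + ε (H + C' t) + η (1 + t)` cannot be crossed: outside a finite set of
states it exceeds the upper bound of `w`, and at a state of this finite set where it is touched,
the function `w` grows strictly more slowly than the barrier. -/
lemma le_barrier (hr : ∀ a, ∀ z ∈ D, 0 ≤ r a z) {V H : S → ℝ} {C C' M K m : ℝ}
    (hV : ∀ z, 0 ≤ V z) (hH : ∀ z, 0 ≤ H z) (hC0 : 0 ≤ C) (hC0' : 0 ≤ C')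
    (hC : ∀ z ∈ D, gen r τ V z ≤ C) (hC' : ∀ z ∈ D, V z ≤ K → gen r τ H z ≤ C')
    (hfin : {z ∈ D | V z ≤ K ∧ H z ≤ m}.Finite) {δ ε η : ℝ} (hδ : 0 < δ) (hε : 0 < ε) (hη : 0 < η)
    (hK : M ≤ δ * K) (hm : M ≤ ε * m)
    {T : ℝ} {w w' : ℝ → S → ℝ} (hM : ∀ t ∈ Icc 0 T, ∀ z ∈ D, w t z ≤ M)
    (hc : ∀ z ∈ D, ContinuousOn (fun t => w t z) (Icc 0 T))
    (hd : ∀ z ∈ D, ∀ t ∈ Ico 0 T, HasDerivWithinAt (fun t => w t z) (w' t z) (Ici t) t)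
    (hle : ∀ z ∈ D, ∀ t ∈ Ico 0 T, w' t z ≤ gen r τ (w t) z)
    (h0 : ∀ z, w 0 z ≤ 0) (hout : ∀ t ∈ Icc 0 T, ∀ z ∉ D, w t z ≤ 0) :
    ∀ t ∈ Icc 0 T, ∀ z ∈ D, w t z ≤ δ * (V z + C * t) + ε * (H z + C' * t) + η * (1 + t) := by
  set Z := {z ∈ D | V z ≤ K ∧ H z ≤ m} with hZ
  set b : ℝ → S → ℝ := fun t z => δ * (V z + C * t) + ε * (H z + C' * t) + η * (1 + t) with hb
  have hb0 : ∀ t ∈ Icc 0 T, ∀ z, 0 ≤ b t z := by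
    intro t ht z
    have := hV z; have := hH z; have := ht.1
    simp only [hb]; positivity
  have hoff : ∀ t ∈ Icc 0 T, ∀ z, z ∉ Z → w t z ≤ b t z := by
    intro t ht z hz
    by_cases hzD : z ∈ D
    · have ht0 := ht.1
      have h1 := mul_nonneg hC0 ht0
      have h2 := mul_nonneg hC0' ht0
      have : K < V z ∨ m < H z := by
        by_contra! hcon
        exact hz ⟨hzD, hcon⟩
      refine (hM t ht z hzD).trans ?_
      have e1 : 0 ≤ δ * (V z + C * t) := by have := hV z; positivity
      have e2 : 0 ≤ ε * (H z + C' * t) := by have := hH z; positivity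
      have e3 : 0 ≤ η * (1 + t) := by positivity
      rcases this with h | h
      · have : δ * K ≤ δ * (V z + C * t) := by gcongr; linarith
        simp only [hb]; linarith
      · have : ε * m ≤ ε * (H z + C' * t) := by gcongr; linarith
        simp only [hb]; linarith
    · exact (hout t ht z hzD).trans (hb0 t ht z)
  -- It remains to consider the finitely many states in `Z`; the set of times up to which the
  -- barrier is respected is closed, and it can be prolonged to the right of each of its points.
  have key : Icc 0 T ⊆ {t | ∀ z ∈ Z, w t z ≤ b t z} := by
    rcases lt_or_ge T 0 with hT | hT
    · simp [Icc_eq_empty (not_le.2 hT)]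
    apply IsClosed.Icc_subset_of_forall_exists_gt
    · have : {t | ∀ z ∈ Z, w t z ≤ b t z} ∩ Icc 0 T
          = Icc 0 T ∩ ⋂ z ∈ Z, {t ∈ Icc 0 T | w t z ≤ b t z} := by
        ext t
        simp only [mem_inter_iff, mem_ofPred_eq, mem_iInter]
        constructor
        · rintro ⟨h1, h2⟩
          exact ⟨h2, fun z hz => ⟨h2, h1 z hz⟩⟩
        · rintro ⟨h1, h2⟩
          exact ⟨fun z hz => (h2 z hz).2, h1⟩
      rw [this]
      refine isClosed_Icc.inter (isClosed_biInter fun z hz => ?_)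
      refine isClosed_Icc.isClosed_le (hc z hz.1) ?_
      fun_prop
    · intro z _
      exact (h0 z).trans (hb0 0 ⟨le_rfl, hT⟩ z)
    · rintro t ⟨ht, htT⟩ y hy
      have htI : t ∈ Icc 0 T := ⟨htT.1, htT.2.le⟩
      have hall : ∀ z, w t z ≤ b t z := fun z => by
        by_cases hz : z ∈ Z
        · exact ht z hz
        · exact hoff t htI z hz
      have hev : ∀ z ∈ Z, ∀ᶠ s in 𝓝[>] t, w s z ≤ b s z := by
        intro z hz
        have hbd : HasDerivWithinAt (fun s => b s z) (δ * C + ε * C' + η) (Ici t) t := by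
          have : HasDerivAt (fun s => b s z) (δ * (C * 1) + ε * (C' * 1) + η * 1) t := by
            simp only [hb]
            exact (((((hasDerivAt_id t).const_mul C).const_add (V z)).const_mul δ).add
              ((((hasDerivAt_id t).const_mul C').const_add (H z)).const_mul ε)).add
              (((hasDerivAt_id t).const_add 1).const_mul η)
          simpa using this.hasDerivWithinAt
        -- At a touching state `z`, the differences `w t (τ a z) - w t z` are at most those of the
        -- barrier, so that `gen w` is at most the drift of the barrier, which is at most its slope
        -- without the strictly positive term `η`.
        rcases (hall z).lt_or_eq with hlt | heq
        · have hcw : ContinuousWithinAt (fun s => w s z) (Ioi t) t :=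
            (hd z hz.1 t htT).continuousWithinAt.mono Ioi_subset_Ici_self
          have hcb : ContinuousWithinAt (fun s => b s z) (Ioi t) t :=
            hbd.continuousWithinAt.mono Ioi_subset_Ici_self
          exact (hcw.eventually_lt hcb hlt).mono fun _ h => h.le
        · have hlt : w' t z < δ * C + ε * C' + η := by
            have hg : gen r τ (w t) z ≤ δ * gen r τ V z + ε * gen r τ H z := by
              simp only [gen, Finset.mul_sum]
              rw [← Finset.sum_add_distrib]
              refine Finset.sum_le_sum fun a _ => ?_
              have h1 := hall (τ a z)
              have h2 : w t (τ a z) - w t z ≤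
                  δ * (V (τ a z) - V z) + ε * (H (τ a z) - H z) := by
                rw [heq]; simp only [hb] at h1 ⊢; linarith
              have := mul_le_mul_of_nonneg_left h2 (hr a z hz.1)
              linarith
            have h1 := mul_le_mul_of_nonneg_left (hC z hz.1) hδ.le
            have h2 := mul_le_mul_of_nonneg_left (hC' z hz.1 hz.2.1) hε.le
            have := hle z hz.1 t htT
            linarith
          have hdd := (hd z hz.1 t htT).sub hbd
          have hslope := (hasDerivWithinAt_iff_tendsto_slope' (by simp)).1
            (hdd.mono Ioi_subset_Ici_self)
          have hneg := hslope.eventually (gt_mem_nhds (sub_neg.2 hlt))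
          filter_upwards [hneg, self_mem_nhdsWithin] with s hs hst
          rw [slope_def_field, div_lt_iff₀ (sub_pos.2 hst)] at hs
          simp only [Pi.sub_apply] at hs
          linarith
      have hev' : ∀ᶠ s in 𝓝[>] t, ∀ z ∈ Z, w s z ≤ b s z :=
        (eventually_all_finite hfin).2 hev
      have := hev'.and (Ioc_mem_nhdsGT hy)
      obtain ⟨s, hs1, hs2⟩ := this.exists
      exact ⟨s, hs1, hs2⟩
  intro t ht z hz
  by_cases hzZ : z ∈ Z
  · exact key ht z hzZ
  · exact hoff t ht z hzZ

open Set in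
/-- The maximum principle: a subsolution of the backward equation which is bounded above, and
nonpositive initially and off `D`, is nonpositive. -/
theorem max_principle (hr : ∀ a, ∀ z ∈ D, 0 ≤ r a z) (hD : Confined D r τ)
    {T M : ℝ} {w w' : ℝ → S → ℝ} (hM : ∀ t ∈ Icc 0 T, ∀ z ∈ D, w t z ≤ M)
    (hc : ∀ z ∈ D, ContinuousOn (fun t => w t z) (Icc 0 T))
    (hd : ∀ z ∈ D, ∀ t ∈ Ico 0 T, HasDerivWithinAt (fun t => w t z) (w' t z) (Ici t) t)
    (hle : ∀ z ∈ D, ∀ t ∈ Ico 0 T, w' t z ≤ gen r τ (w t) z)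
    (h0 : ∀ z, w 0 z ≤ 0) (hout : ∀ t ∈ Icc 0 T, ∀ z ∉ D, w t z ≤ 0) :
    ∀ t ∈ Icc 0 T, ∀ z, w t z ≤ 0 := by
  obtain ⟨V, H, C, CH, hV, hH, hC, hCH, hfin⟩ := hD
  intro t ht z
  by_cases hz : z ∈ D
  swap
  · exact hout t ht z hz
  have ht0 : 0 ≤ t := ht.1
  have main : ∀ δ > 0, ∀ ε > 0, ∀ η > 0, w t z ≤ δ * (V z + max C 0 * t) +
      ε * (H z + max (CH (M / δ)) 0 * t) + η * (1 + t) := by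
    intro δ hδ ε hε η hη
    refine le_barrier (K := M / δ) (m := M / ε) hr hV hH (le_max_right _ _) (le_max_right _ _)
      (fun z hz => (hC z hz).trans (le_max_left _ _))
      (fun z hz h => (hCH _ z hz h).trans (le_max_left _ _)) (hfin _ _) hδ hε hη
      (by field_simp; rfl) (by field_simp; rfl) hM hc hd hle h0 hout t ht z hz
  -- Let `ε` and `η` tend to `0` for fixed `δ`, on which the drift bound of `H` depends, and then
  -- let `δ` tend to `0`.
  have main2 : ∀ δ > 0, w t z ≤ δ * (V z + max C 0 * t) := by
    intro δ hδ
    refine le_of_forall_pos_le_add fun e he => ?_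
    set h := H z + max (CH (M / δ)) 0 * t
    have hh : 0 ≤ h := add_nonneg (hH z) (mul_nonneg (le_max_right _ _) ht0)
    have := main δ hδ (e / 2 / (h + 1)) (by positivity) (e / 2 / (1 + t)) (by positivity)
    have e1 : e / 2 / (h + 1) * h ≤ e / 2 := by
      rw [div_mul_eq_mul_div, div_le_iff₀ (by positivity)]; nlinarith
    have e2 : e / 2 / (1 + t) * (1 + t) = e / 2 := by field_simp
    rw [e2] at this
    linarith
  set v := V z + max C 0 * t
  have hv : 0 ≤ v := add_nonneg (hV z) (mul_nonneg (le_max_right _ _) ht0)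
  refine le_of_forall_pos_le_add fun e he => ?_
  have := main2 (e / (v + 1)) (by positivity)
  have e1 : e / (v + 1) * v ≤ e := by
    rw [div_mul_eq_mul_div, div_le_iff₀ (by positivity)]; nlinarith
  linarith

/-- A solution of the backward equation `∂ₜ u = gen r τ u` at the states of `D`, for all times
`t ≥ 0` (with the one-sided derivative at `t = 0`). -/
def IsSol (D : Set S) (r : A → S → ℝ) (τ : A → S → S) (u : ℝ → S → ℝ) : Prop :=
  ∀ z ∈ D, ∀ t, 0 ≤ t → HasDerivWithinAt (fun s => u s z) (gen r τ (u t) z) (Set.Ici 0) t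

lemma IsSol.continuousOn {u : ℝ → S → ℝ} (hu : IsSol D r τ u) {z : S} (hz : z ∈ D) :
    ContinuousOn (fun t => u t z) (Set.Ici 0) :=
  fun t ht => (hu z hz t ht).continuousWithinAt

lemma gen_sub (f g : S → ℝ) (z : S) :
    gen r τ (fun z => f z - g z) z = gen r τ f z - gen r τ g z := by
  simp only [gen, ← Finset.sum_sub_distrib]
  exact Finset.sum_congr rfl fun a _ => by ring

lemma gen_congr {f g : S → ℝ} {z : S} (h : f z = g z)
    (h' : ∀ a, r a z ≠ 0 → f (τ a z) = g (τ a z)) : gen r τ f z = gen r τ g z := by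
  refine Finset.sum_congr rfl fun a _ => ?_
  by_cases ha : r a z = 0
  · simp [ha]
  · rw [h, h' a ha]

lemma gen_mono (hr : ∀ a, ∀ z ∈ D, 0 ≤ r a z) {f g : S → ℝ} {z : S} (hz : z ∈ D) (h : f z = g z)
    (h' : ∀ a, r a z ≠ 0 → f (τ a z) ≤ g (τ a z)) : gen r τ f z ≤ gen r τ g z := by
  refine Finset.sum_le_sum fun a _ => ?_
  by_cases ha : r a z = 0
  · simp [ha]
  · rw [h]
    exact mul_le_mul_of_nonneg_left (sub_le_sub_right (h' a ha) _) (hr a z hz)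

open Set in
/-- Comparison of two solutions `u ≤ v` of the backward equation on `D`, given that the inequality
holds initially on `D` and always at the states off `D` which can be reached from `D` in one
step. -/
theorem IsSol.le (hr : ∀ a, ∀ z ∈ D, 0 ≤ r a z) (hD : Confined D r τ) {u v : ℝ → S → ℝ}
    (hu : IsSol D r τ u) (hv : IsSol D r τ v)
    (hbd : ∀ T, 0 ≤ T → ∃ M, ∀ t ∈ Icc 0 T, ∀ z ∈ D, u t z - v t z ≤ M)
    (h0 : ∀ z ∈ D, u 0 z ≤ v 0 z)
    (hout : ∀ t, 0 ≤ t → ∀ z ∈ D, ∀ a, r a z ≠ 0 → τ a z ∉ D → u t (τ a z) ≤ v t (τ a z)) :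
    ∀ t, 0 ≤ t → ∀ z ∈ D, u t z ≤ v t z := by
  classical
  intro T hT
  obtain ⟨M, hM⟩ := hbd T hT
  set w : ℝ → S → ℝ := fun t z => if z ∈ D then u t z - v t z else 0 with hw
  have hwD : ∀ z ∈ D, (fun t => w t z) = fun t => u t z - v t z := by
    intro z hz; funext t; simp [hw, hz]
  have := max_principle (T := T) (M := M) (w := w)
    (w' := fun t z => gen r τ (fun z => u t z - v t z) z) hr hD
    (fun t ht z hz => by simpa [hw, hz] using hM t ht z hz)
    (fun z hz => by
      rw [hwD z hz]
      exact ((hu.continuousOn hz).sub (hv.continuousOn hz)).mono fun t ht => ht.1)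
    (fun z hz t ht => by
      rw [hwD z hz, gen_sub]
      exact ((hu z hz t ht.1).sub (hv z hz t ht.1)).mono (Ici_subset_Ici.2 ht.1))
    (fun z hz t ht => by
      refine gen_mono hr hz (by simp [hw, hz]) fun a ha => ?_
      by_cases hD' : τ a z ∈ D
      · simp [hw, hD']
      · simpa [hw, hD'] using hout t ht.1 z hz a ha hD')
    (fun z => by
      by_cases hz : z ∈ D
      · simpa [hw, hz] using h0 z hz
      · simp [hw, hz])
    (fun t _ z hz => by simp [hw, hz]) T ⟨hT, le_rfl⟩
  intro z hz
  have h := this z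
  simp only [hw, hz, if_true] at h
  linarith

/-- Uniqueness of bounded solutions of the backward equation. -/
theorem IsSol.eq (hr : ∀ a, ∀ z ∈ D, 0 ≤ r a z) (hD : Confined D r τ) {u v : ℝ → S → ℝ}
    (hu : IsSol D r τ u) (hv : IsSol D r τ v)
    (hbu : ∀ T, 0 ≤ T → ∃ M, ∀ t ∈ Set.Icc 0 T, ∀ z ∈ D, |u t z| ≤ M)
    (hbv : ∀ T, 0 ≤ T → ∃ M, ∀ t ∈ Set.Icc 0 T, ∀ z ∈ D, |v t z| ≤ M)
    (h0 : ∀ z ∈ D, u 0 z = v 0 z)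
    (hout : ∀ t, 0 ≤ t → ∀ z ∈ D, ∀ a, r a z ≠ 0 → τ a z ∉ D → u t (τ a z) = v t (τ a z)) :
    ∀ t, 0 ≤ t → ∀ z ∈ D, u t z = v t z := by
  have hb : ∀ T, 0 ≤ T → ∃ M, ∀ t ∈ Set.Icc 0 T, ∀ z ∈ D, |u t z - v t z| ≤ M := by
    intro T hT
    obtain ⟨M, hM⟩ := hbu T hT
    obtain ⟨M', hM'⟩ := hbv T hT
    exact ⟨M + M', fun t ht z hz => (abs_sub _ _).trans (add_le_add (hM t ht z hz) (hM' t ht z hz))⟩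
  intro t ht z hz
  refine le_antisymm ?_ ?_
  · refine IsSol.le hr hD hu hv (fun T hT => ?_) (fun z hz => (h0 z hz).le)
      (fun t ht z hz a ha h => (hout t ht z hz a ha h).le) t ht z hz
    obtain ⟨M, hM⟩ := hb T hT
    exact ⟨M, fun t ht z hz => (le_abs_self _).trans (hM t ht z hz)⟩
  · refine IsSol.le hr hD hv hu (fun T hT => ?_) (fun z hz => (h0 z hz).ge)
      (fun t ht z hz a ha h => (hout t ht z hz a ha h).ge) t ht z hz
    obtain ⟨M, hM⟩ := hb T hT
    exact ⟨M, fun t ht z hz => by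
      rw [← neg_sub]; exact (neg_le_abs _).trans (hM t ht z hz)⟩

/-- Fundamental theorem of calculus on `[0, ∞)`, with the one-sided derivative at `0`. -/
lemma hasDerivWithinAt_of_eq_integral {f φ : ℝ → ℝ} (hφ : ContinuousOn φ (Set.Ici 0))
    (h : ∀ t, 0 ≤ t → f t = f 0 + ∫ s in (0 : ℝ)..t, φ s) (t : ℝ) (ht : 0 ≤ t) :
    HasDerivWithinAt f (φ t) (Set.Ici 0) t := by
  have hψ : Continuous fun s => φ (max s 0) :=
    hφ.comp_continuous (by fun_prop) fun s => Set.mem_Ici.2 (le_max_right _ _)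
  have h1 := (intervalIntegral.integral_hasDerivAt_right (hψ.intervalIntegrable 0 t)
    (hψ.stronglyMeasurableAtFilter _ _) hψ.continuousAt).const_add (f 0)
  have h2 : HasDerivWithinAt (fun u => f 0 + ∫ s in (0 : ℝ)..u, φ (max s 0)) (φ t)
      (Set.Ici 0) t := by
    have := h1.hasDerivWithinAt (s := Set.Ici 0)
    rwa [max_eq_left ht] at this
  have h3 : ∀ u ∈ Set.Ici (0 : ℝ), f u = f 0 + ∫ s in (0 : ℝ)..u, φ (max s 0) := by
    intro u hu
    rw [h u hu]
    congr 1
    refine intervalIntegral.integral_congr fun s hs => ?_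
    rw [Set.uIcc_of_le hu] at hs
    simp [hs.1]
  exact h2.congr h3 (h3 t ht)

lemma gen_continuousOn {u : ℝ → S → ℝ} {z : S} {s : Set ℝ} (h : ContinuousOn (fun t => u t z) s)
    (h' : ∀ a, r a z ≠ 0 → ContinuousOn (fun t => u t (τ a z)) s) :
    ContinuousOn (fun t => gen r τ (u t) z) s := by
  refine continuousOn_finsetSum _ fun a _ => ?_
  by_cases ha : r a z = 0
  · simpa [ha] using continuousOn_const
  · exact continuousOn_const.mul ((h' a ha).sub h)

lemma IsSol.integral_eq {u : ℝ → S → ℝ} (hu : IsSol D r τ u) {z : S} (hz : z ∈ D)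
    (h' : ∀ a, r a z ≠ 0 → ContinuousOn (fun t => u t (τ a z)) (Set.Ici 0)) {t : ℝ} (ht : 0 ≤ t) :
    u t z = u 0 z + ∫ s in (0 : ℝ)..t, gen r τ (u s) z := by
  have hsub : Set.Icc 0 t ⊆ Set.Ici 0 := fun s hs => hs.1
  rw [intervalIntegral.integral_eq_sub_of_hasDerivAt_of_le ht ((hu.continuousOn hz).mono hsub)
    (fun s hs => (hu z hz s hs.1.le).hasDerivAt (Ici_mem_nhds hs.1))]
  · ring
  · refine ContinuousOn.intervalIntegrable ?_
    rw [Set.uIcc_of_le ht]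
    exact (gen_continuousOn (hu.continuousOn hz) h').mono hsub

lemma abs_gen_le {f : S → ℝ} {z : S} {M : ℝ} (h : |f z| ≤ M)
    (h' : ∀ a, r a z ≠ 0 → |f (τ a z)| ≤ M) : |gen r τ f z| ≤ (∑ a, |r a z|) * (2 * M) := by
  rw [gen, Finset.sum_mul]
  refine (Finset.abs_sum_le_sum_abs _ _).trans (Finset.sum_le_sum fun a _ => ?_)
  by_cases ha : r a z = 0
  · simp [ha]
  · rw [abs_mul]
    refine mul_le_mul_of_nonneg_left ?_ (abs_nonneg _)
    have := abs_sub (f (τ a z)) (f z)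
    have := h' a ha
    linarith

/-- The pointwise limit of a uniformly bounded sequence (or net) of solutions of the backward
equation is a solution. The set `E` contains `D` and all states reachable from it in one step. -/
theorem IsSol.of_tendsto {ι : Type*} {l : Filter ι} [l.NeBot] [l.IsCountablyGenerated]
    {u : ι → ℝ → S → ℝ} {v : ℝ → S → ℝ} {E : Set S} (hDE : D ⊆ E)
    (hτ : ∀ z ∈ D, ∀ a, r a z ≠ 0 → τ a z ∈ E)
    (hu : ∀ i, IsSol D r τ (u i)) {M : ℝ} (hM : ∀ i, ∀ t, 0 ≤ t → ∀ z ∈ E, |u i t z| ≤ M)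
    (hlim : ∀ t, 0 ≤ t → ∀ z ∈ E, Filter.Tendsto (fun i => u i t z) l (nhds (v t z)))
    (hcu : ∀ i, ∀ z ∈ E, z ∉ D → ContinuousOn (fun t => u i t z) (Set.Ici 0))
    (hcv : ∀ z ∈ E, z ∉ D → ContinuousOn (fun t => v t z) (Set.Ici 0)) :
    IsSol D r τ v := by
  have hcu' : ∀ i, ∀ z ∈ E, ContinuousOn (fun t => u i t z) (Set.Ici 0) := by
    intro i z hz
    by_cases hzD : z ∈ D
    · exact (hu i).continuousOn hzD
    · exact hcu i z hz hzD
  have hMv : ∀ t, 0 ≤ t → ∀ z ∈ E, |v t z| ≤ M := fun t ht z hz =>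
    le_of_tendsto (hlim t ht z hz).abs (Filter.Eventually.of_forall fun i => hM i t ht z hz)
  have hint : ∀ z ∈ D, ∀ t, 0 ≤ t → v t z = v 0 z + ∫ s in (0 : ℝ)..t, gen r τ (v s) z := by
    intro z hz t ht
    have h1 : Filter.Tendsto (fun i => u i t z) l
        (nhds (v 0 z + ∫ s in (0 : ℝ)..t, gen r τ (v s) z)) := by
      have : (fun i => u i t z) = fun i => u i 0 z + ∫ s in (0 : ℝ)..t, gen r τ (u i s) z := by
        funext i
        exact (hu i).integral_eq hz (fun a ha => hcu' i _ (hτ z hz a ha)) ht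
      rw [this]
      refine (hlim 0 le_rfl z (hDE hz)).add ?_
      refine intervalIntegral.tendsto_integral_filter_of_dominated_convergence
        (fun _ => (∑ a, |r a z|) * (2 * M)) ?_ ?_ (by simp) ?_
      · refine Filter.Eventually.of_forall fun i => ?_
        refine ContinuousOn.aestronglyMeasurable ?_ measurableSet_uIoc
        rw [Set.uIoc_of_le ht]
        exact (gen_continuousOn ((hu i).continuousOn hz)
          fun a ha => hcu' i _ (hτ z hz a ha)).mono fun s hs => hs.1.le
      · refine Filter.Eventually.of_forall fun i => Filter.Eventually.of_forall fun s hs => ?_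
        rw [Set.uIoc_of_le ht] at hs
        exact abs_gen_le (hM i s hs.1.le z (hDE hz)) fun a ha => hM i s hs.1.le _ (hτ z hz a ha)
      · refine Filter.Eventually.of_forall fun s hs => ?_
        rw [Set.uIoc_of_le ht] at hs
        refine tendsto_finsetSum _ fun a _ => ?_
        by_cases ha : r a z = 0
        · simp [ha]
        · exact ((hlim s hs.1.le _ (hτ z hz a ha)).sub (hlim s hs.1.le z (hDE hz))).const_mul _
    exact tendsto_nhds_unique (hlim t ht z (hDE hz)) h1
  have hcv' : ∀ z ∈ E, ContinuousOn (fun t => v t z) (Set.Ici 0) := by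
    intro z hz
    by_cases hzD : z ∈ D
    swap
    · exact hcv z hz hzD
    have hLip : ∀ s ∈ Set.Ici (0 : ℝ), ∀ t ∈ Set.Ici (0 : ℝ),
        dist (v s z) (v t z) ≤ (∑ a, |r a z|) * (2 * M) * dist s t := by
      intro s hs t ht
      have hi : ∀ i, dist (u i s z) (u i t z) ≤ (∑ a, |r a z|) * (2 * M) * dist s t := by
        intro i
        have := Convex.norm_image_sub_le_of_norm_hasDerivWithin_le (𝕜 := ℝ)
          (f := fun t => u i t z) (f' := fun t => gen r τ (u i t) z) (s := Set.Ici 0)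
          (C := (∑ a, |r a z|) * (2 * M)) (fun t ht => hu i z hzD t ht)
          (fun t ht => abs_gen_le (hM i t ht z hz) fun a ha => hM i t ht _ (hτ z hzD a ha))
          (convex_Ici 0) ht hs
        simpa [Real.dist_eq] using this
      exact le_of_tendsto ((hlim s hs z hz).dist (hlim t ht z hz)) (Filter.Eventually.of_forall hi)
    have h0 : 0 ≤ (∑ a, |r a z|) * (2 * M) := (abs_nonneg _).trans
      (abs_gen_le (r := r) (τ := τ) (hMv 0 le_rfl z hz) fun a ha => hMv 0 le_rfl _ (hτ z hzD a ha))
    exact (LipschitzOnWith.of_dist_le_mul (K := ⟨_, h0⟩)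
      fun s hs t ht => hLip s hs t ht).continuousOn
  intro z hz t ht
  exact hasDerivWithinAt_of_eq_integral
    (gen_continuousOn (hcv' z (hDE hz)) fun a ha => hcv' _ (hτ z hz a ha)) (hint z hz) t ht

end MaxPrinciple

/-! ### The transition function of a birth and death chain -/

instance : DecidableEq Dir
  | .up, .up => isTrue rfl
  | .down, .down => isTrue rfl
  | .up, .down => isFalse Dir.noConfusion
  | .down, .up => isFalse Dir.noConfusion

instance : Fintype Dir := ⟨{.up, .down}, fun a => by cases a <;> simp⟩

/-- The rate of the moves in direction `a` of the chain with birth rates `b`, death rates `d`. -/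
def rate (b d : ℤ → ℝ) : Dir → ℤ → ℝ
  | .up => b
  | .down => d

/-- The state reached by a move in direction `a`. -/
def move (a : Dir) (x : ℤ) : ℤ := x + a.step

@[simp] lemma move_up (x : ℤ) : move .up x = x + 1 := rfl
@[simp] lemma move_down (x : ℤ) : move .down x = x - 1 := rfl

lemma sum_dir {M : Type*} [AddCommMonoid M] (f : Dir → M) : ∑ a, f a = f .up + f .down := by
  have : (Finset.univ : Finset Dir) = {.up, .down} := rfl
  rw [this, Finset.sum_pair (by simp)]

lemma gen_chain (b d : ℤ → ℝ) (f : ℤ → ℝ) (x : ℤ) :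
    gen (rate b d) move f x = b x * (f (x + 1) - f x) + d x * (f (x - 1) - f x) := by
  rw [gen, sum_dir]; rfl

/-- `b` and `d` are the birth and death rates of a chain which never leaves the set `J`. -/
structure IsChain (J : Set ℤ) (b d : ℤ → ℝ) : Prop where
  rate_nonneg : ∀ a, ∀ x ∈ J, 0 ≤ rate b d a x
  move_mem : ∀ x ∈ J, ∀ a, rate b d a x ≠ 0 → move a x ∈ J

lemma measurable_transitionAux (b d : ℤ → ℝ) (k : ℕ) (x y : ℤ) :
    Measurable fun t => transitionAux b d k t x y := by
  induction k generalizing x with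
  | zero =>
    simp only [transitionAux]
    split_ifs
    · fun_prop
    · fun_prop
  | succ k ih =>
    simp only [transitionAux]
    refine Measurable.add ?_ ?_
    · split_ifs
      · fun_prop
      · fun_prop
    · have h : ∀ t : ℝ, ∫⁻ s in Set.Icc 0 t, ENNReal.ofReal (Real.exp (-(b x + d x) * s)) *
          (ENNReal.ofReal (b x) * transitionAux b d k (t - s) (x + 1) y +
            ENNReal.ofReal (d x) * transitionAux b d k (t - s) (x - 1) y) =
          ∫⁻ s, {p : ℝ × ℝ | 0 ≤ p.2 ∧ p.2 ≤ p.1}.indicator (fun p : ℝ × ℝ =>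
            ENNReal.ofReal (Real.exp (-(b x + d x) * p.2)) *
          (ENNReal.ofReal (b x) * transitionAux b d k (p.1 - p.2) (x + 1) y +
            ENNReal.ofReal (d x) * transitionAux b d k (p.1 - p.2) (x - 1) y)) (t, s) := by
        intro t
        rw [← lintegral_indicator measurableSet_Icc]
        rfl
      simp_rw [h]
      refine Measurable.lintegral_prod_right' (f := {p : ℝ × ℝ | 0 ≤ p.2 ∧ p.2 ≤ p.1}.indicator
        (fun p : ℝ × ℝ => ENNReal.ofReal (Real.exp (-(b x + d x) * p.2)) *
          (ENNReal.ofReal (b x) * transitionAux b d k (p.1 - p.2) (x + 1) y +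
            ENNReal.ofReal (d x) * transitionAux b d k (p.1 - p.2) (x - 1) y))) ?_
      have i1 := ih (x + 1)
      have i2 := ih (x - 1)
      refine Measurable.indicator ?_ ?_
      · have := i1.comp (measurable_fst.sub measurable_snd : Measurable fun p : ℝ × ℝ => p.1 - p.2)
        have := i2.comp (measurable_fst.sub measurable_snd : Measurable fun p : ℝ × ℝ => p.1 - p.2)
        simp only [Function.comp_def] at *
        fun_prop
      · exact (measurableSet_le measurable_const measurable_snd).inter
          (measurableSet_le measurable_snd measurable_fst)

lemma transitionAux_mono (b d : ℤ → ℝ) (t : ℝ) (x y : ℤ) :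
    Monotone fun k => transitionAux b d k t x y := by
  refine monotone_nat_of_le_succ fun k => ?_
  induction k generalizing t x with
  | zero => simp only [transitionAux]; exact le_self_add
  | succ k ih =>
    rw [transitionAux]
    conv_rhs => rw [transitionAux]
    gcongr <;> apply ih

/-- The transition function as an extended nonnegative number. -/
def etransition (b d : ℤ → ℝ) (t : ℝ) (x y : ℤ) : ℝ≥0∞ := ⨆ k, transitionAux b d k t x y

lemma measurable_etransition (b d : ℤ → ℝ) (x y : ℤ) :
    Measurable fun t => etransition b d t x y :=
  Measurable.iSup fun k => measurable_transitionAux b d k x y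

/-- The first jump decomposition. -/
lemma etransition_eq (b d : ℤ → ℝ) (t : ℝ) (x y : ℤ) :
    etransition b d t x y = (if x = y then ENNReal.ofReal (Real.exp (-(b x + d x) * t)) else 0) +
      ∫⁻ s in Set.Icc 0 t, ENNReal.ofReal (Real.exp (-(b x + d x) * s)) *
        (ENNReal.ofReal (b x) * etransition b d (t - s) (x + 1) y +
          ENNReal.ofReal (d x) * etransition b d (t - s) (x - 1) y) := by
  have h1 : etransition b d t x y = ⨆ k, transitionAux b d (k + 1) t x y :=
    ((transitionAux_mono b d t x y).iSup_nat_add 1).symm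
  have hm : ∀ z, Monotone fun k => fun s => transitionAux b d k (t - s) z y :=
    fun z k l h s => transitionAux_mono b d (t - s) z y h
  rw [h1]
  simp only [transitionAux]
  rw [← ENNReal.add_iSup]
  congr 1
  rw [← lintegral_iSup]
  · congr 1
    funext s
    rw [← ENNReal.mul_iSup]
    congr 1
    simp only [etransition, ENNReal.mul_iSup]
    rw [ENNReal.iSup_add_iSup_of_monotone]
    · exact fun k l h => mul_le_mul_right (hm _ h s) _
    · exact fun k l h => mul_le_mul_right (hm _ h s) _
  · intro k
    have i1 := (measurable_transitionAux b d k (x + 1) y).comp (measurable_const.sub measurable_id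
      : Measurable fun s : ℝ => t - s)
    have i2 := (measurable_transitionAux b d k (x - 1) y).comp (measurable_const.sub measurable_id
      : Measurable fun s : ℝ => t - s)
    simp only [Function.comp_def] at i1 i2
    fun_prop
  · intro k l h s
    dsimp only
    gcongr
    · exact hm _ h s
    · exact hm _ h s

/-- The total rate `c = b + d` integrates against `exp (-c s)` to `1 - exp (-c t)`. -/
lemma exp_add_lintegral_exp {c t : ℝ} (hc : 0 ≤ c) (ht : 0 ≤ t) :
    ENNReal.ofReal (Real.exp (-c * t)) +
      ∫⁻ s in Set.Icc 0 t, ENNReal.ofReal (Real.exp (-c * s)) * ENNReal.ofReal c = 1 := by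
  have h1 : ∀ s : ℝ, ENNReal.ofReal (Real.exp (-c * s)) * ENNReal.ofReal c =
      ENNReal.ofReal (c * Real.exp (-c * s)) := by
    intro s
    rw [mul_comm, ENNReal.ofReal_mul hc]
  simp_rw [h1]
  rw [← ofReal_integral_eq_lintegral_ofReal, ← ENNReal.ofReal_add (by positivity)
    (integral_nonneg fun s => by positivity)]
  · rw [integral_Icc_eq_integral_Ioc, ← intervalIntegral.integral_of_le ht]
    have : ∀ s ∈ Set.uIcc 0 t, 
        HasDerivAt (fun s => -Real.exp (-c * s)) (c * Real.exp (-c * s)) s := by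
      intro s _
      have := (((hasDerivAt_id s).const_mul (-c)).exp).neg
      convert! this using 1
      simp; ring
    rw [intervalIntegral.integral_eq_sub_of_hasDerivAt this]
    · simp
    · exact Continuous.intervalIntegrable (by fun_prop) _ _
  · exact Continuous.integrableOn_Icc (by fun_prop)
  · exact Filter.Eventually.of_forall fun s => by positivity

variable {J : Set ℤ} {b d : ℤ → ℝ}

/-- By induction on the number of jumps: the first jump carries the mass `1 - exp (-(b x + d x) t)`,
the complement of the probability of no jump. -/
lemma tsum_transitionAux_le_one (hJ : IsChain J b d) (k : ℕ) {t : ℝ} (ht : 0 ≤ t) {x : ℤ}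
    (hx : x ∈ J) : ∑' y, transitionAux b d k t x y ≤ 1 := by
  have hb : 0 ≤ b x := hJ.rate_nonneg .up x hx
  have hd : 0 ≤ d x := hJ.rate_nonneg .down x hx
  induction k generalizing t x with
  | zero =>
    simp only [transitionAux]
    rw [tsum_ite_eq' x fun _ => ENNReal.ofReal (Real.exp (-(b x + d x) * t)), ENNReal.ofReal_le_one,
      Real.exp_le_one_iff]
    nlinarith [mul_nonneg (add_nonneg hb hd) ht]
  | succ k ih =>
    simp only [transitionAux]
    have hm : ∀ z y, Measurable fun s => transitionAux b d k (t - s) z y := fun z y =>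
      (measurable_transitionAux b d k z y).comp (measurable_const.sub measurable_id
        : Measurable fun s : ℝ => t - s)
    rw [ENNReal.tsum_add, tsum_ite_eq' x fun _ => ENNReal.ofReal (Real.exp (-(b x + d x) * t)),
      ← lintegral_tsum, ← exp_add_lintegral_exp (add_nonneg hb hd) ht]
    · refine add_le_add le_rfl (setLIntegral_mono ?_ fun s hs => ?_)
      · fun_prop
      · rw [ENNReal.tsum_mul_left]
        refine mul_le_mul_right ?_ _
        rw [ENNReal.tsum_add, ENNReal.tsum_mul_left, ENNReal.tsum_mul_left,
          ENNReal.ofReal_add hb hd]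
        refine add_le_add ?_ ?_
        · by_cases h : b x = 0
          · simp [h]
          · have hm := hJ.move_mem x hx .up h
            exact (mul_le_mul_right (ih (sub_nonneg.2 hs.2) hm
              (hJ.rate_nonneg .up _ hm) (hJ.rate_nonneg .down _ hm)) _).trans_eq (mul_one _)
        · by_cases h : d x = 0
          · simp [h]
          · have hm := hJ.move_mem x hx .down h
            exact (mul_le_mul_right (ih (sub_nonneg.2 hs.2) hm
              (hJ.rate_nonneg .up _ hm) (hJ.rate_nonneg .down _ hm)) _).trans_eq (mul_one _)
    · intro y
      have i1 := hm (x + 1) y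
      have i2 := hm (x - 1) y
      fun_prop

lemma tsum_etransition_le_one (hJ : IsChain J b d) {t : ℝ} (ht : 0 ≤ t) {x : ℤ}
    (hx : x ∈ J) : ∑' y, etransition b d t x y ≤ 1 := by
  rw [ENNReal.tsum_eq_iSup_sum]
  refine iSup_le fun s => ?_
  simp only [etransition]
  rw [ENNReal.finsetSum_iSup_of_monotone fun y => transitionAux_mono b d t x y]
  exact iSup_le fun k => (ENNReal.sum_le_tsum s).trans (tsum_transitionAux_le_one hJ k ht hx)

lemma etransition_le_one (hJ : IsChain J b d) {t : ℝ} (ht : 0 ≤ t) {x : ℤ} (hx : x ∈ J) (y : ℤ) :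
    etransition b d t x y ≤ 1 :=
  (ENNReal.le_tsum y).trans (tsum_etransition_le_one hJ ht hx)

lemma ofReal_transition (hJ : IsChain J b d) {t : ℝ} (ht : 0 ≤ t) {x : ℤ} (hx : x ∈ J) (y : ℤ) :
    ENNReal.ofReal (transition b d t x y) = etransition b d t x y :=
  ENNReal.ofReal_toReal (ne_top_of_le_ne_top ENNReal.one_ne_top (etransition_le_one hJ ht hx y))

lemma transition_nonneg (b d : ℤ → ℝ) (t : ℝ) (x y : ℤ) : 0 ≤ transition b d t x y :=
  ENNReal.toReal_nonneg

lemma transition_le_one (hJ : IsChain J b d) {t : ℝ} (ht : 0 ≤ t) {x : ℤ} (hx : x ∈ J) (y : ℤ) :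
    transition b d t x y ≤ 1 :=
  ENNReal.toReal_le_of_le_ofReal zero_le_one
    (ENNReal.ofReal_one.symm ▸ etransition_le_one hJ ht hx y)

lemma summable_transition (hJ : IsChain J b d) {t : ℝ} (ht : 0 ≤ t) {x : ℤ} (hx : x ∈ J) :
    Summable (transition b d t x) :=
  ENNReal.summable_toReal (ne_top_of_le_ne_top ENNReal.one_ne_top
    (tsum_etransition_le_one hJ ht hx))

lemma sum_transition_le_one (hJ : IsChain J b d) {t : ℝ} (ht : 0 ≤ t) {x : ℤ} (hx : x ∈ J)
    (s : Finset ℤ) : ∑ y ∈ s, transition b d t x y ≤ 1 := by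
  have h1 : ∑ y ∈ s, transition b d t x y = (∑ y ∈ s, etransition b d t x y).toReal :=
    (ENNReal.toReal_sum fun y _ => ne_top_of_le_ne_top ENNReal.one_ne_top
      (etransition_le_one hJ ht hx y)).symm
  rw [h1]
  exact ENNReal.toReal_le_of_le_ofReal zero_le_one (by
    simpa using (ENNReal.sum_le_tsum s).trans (tsum_etransition_le_one hJ ht hx))

lemma measurable_transition (b d : ℤ → ℝ) (x y : ℤ) : Measurable fun t => transition b d t x y :=
  (measurable_etransition b d x y).ennreal_toReal

/-- The first jump decomposition, in real numbers and with time reversed in the integral. -/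
lemma transition_eq (hJ : IsChain J b d) {t : ℝ} (ht : 0 ≤ t) {x : ℤ} (hx : x ∈ J) (y : ℤ) :
    transition b d t x y = Real.exp (-(b x + d x) * t) * ((if x = y then 1 else 0) +
      ∫ s in (0 : ℝ)..t, Real.exp ((b x + d x) * s) *
        (b x * transition b d s (x + 1) y + d x * transition b d s (x - 1) y)) := by
  have hb : 0 ≤ b x := hJ.rate_nonneg .up x hx
  have hd : 0 ≤ d x := hJ.rate_nonneg .down x hx
  set F : ℝ → ℝ := fun s => Real.exp ((b x + d x) * s) *
        (b x * transition b d s (x + 1) y + d x * transition b d s (x - 1) y) with hF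
  have hF0 : ∀ s, 0 ≤ F s := fun s => by
    have := transition_nonneg b d s (x + 1) y
    have := transition_nonneg b d s (x - 1) y
    positivity
  -- The integrand has real values: a neighbour outside `J`, where the transition function could be
  -- infinite, is reached with rate zero only.
  have key : ∀ s ∈ Set.Icc 0 t, ENNReal.ofReal (Real.exp (-(b x + d x) * s)) *
        (ENNReal.ofReal (b x) * etransition b d (t - s) (x + 1) y +
          ENNReal.ofReal (d x) * etransition b d (t - s) (x - 1) y) =
      ENNReal.ofReal (Real.exp (-(b x + d x) * t) * F (t - s)) := by
    intro s hs
    have h1 : ENNReal.ofReal (b x) * etransition b d (t - s) (x + 1) y =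
        ENNReal.ofReal (b x * transition b d (t - s) (x + 1) y) := by
      rw [ENNReal.ofReal_mul hb]
      by_cases h : b x = 0
      · simp [h]
      · rw [ofReal_transition hJ (sub_nonneg.2 hs.2) (x := x + 1) (hJ.move_mem x hx .up h)]
    have h2 : ENNReal.ofReal (d x) * etransition b d (t - s) (x - 1) y =
        ENNReal.ofReal (d x * transition b d (t - s) (x - 1) y) := by
      rw [ENNReal.ofReal_mul hd]
      by_cases h : d x = 0
      · simp [h]
      · rw [ofReal_transition hJ (sub_nonneg.2 hs.2) (x := x - 1) (hJ.move_mem x hx .down h)]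
    rw [h1, h2, ← ENNReal.ofReal_add (mul_nonneg hb (transition_nonneg _ _ _ _ _))
      (mul_nonneg hd (transition_nonneg _ _ _ _ _)), ← ENNReal.ofReal_mul (Real.exp_nonneg _),
      hF, ← mul_assoc, ← Real.exp_add]
    ring_nf
  have h2 := etransition_eq b d t x y
  rw [setLIntegral_congr_fun measurableSet_Icc key] at h2
  have hm : Measurable fun s => Real.exp (-(b x + d x) * t) * F (t - s) := by
    have i1 := (measurable_transition b d (x + 1) y).comp (measurable_const.sub measurable_id
      : Measurable fun s : ℝ => t - s)
    have i2 := (measurable_transition b d (x - 1) y).comp (measurable_const.sub measurable_id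
      : Measurable fun s : ℝ => t - s)
    simp only [hF, Function.comp_def] at i1 i2 ⊢
    fun_prop
  have h3 : (∫⁻ s in Set.Icc 0 t, ENNReal.ofReal (Real.exp (-(b x + d x) * t) * F (t - s))).toReal =
      Real.exp (-(b x + d x) * t) * ∫ s in (0 : ℝ)..t, F s := by
    rw [← integral_eq_lintegral_of_nonneg_ae (Filter.Eventually.of_forall fun s =>
      mul_nonneg (Real.exp_nonneg _) (hF0 _)) hm.aestronglyMeasurable,
      integral_Icc_eq_integral_Ioc, ← intervalIntegral.integral_of_le ht,
      intervalIntegral.integral_const_mul, intervalIntegral.integral_comp_sub_left]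
    simp
  have hfin : ∫⁻ s in Set.Icc 0 t, ENNReal.ofReal (Real.exp (-(b x + d x) * t) * F (t - s)) ≠ ⊤ :=
    ne_top_of_le_ne_top ENNReal.one_ne_top
      ((le_add_self.trans h2.symm.le).trans (etransition_le_one hJ ht hx y))
  have h4 : transition b d t x y = (etransition b d t x y).toReal := rfl
  rw [h4, h2, ENNReal.toReal_add (by split_ifs <;> simp) hfin, h3, mul_add]
  congr 1
  split_ifs
  · rw [ENNReal.toReal_ofReal (Real.exp_nonneg _), mul_one]
  · simp

lemma transition_zero (hJ : IsChain J b d) {x : ℤ} (hx : x ∈ J) (y : ℤ) :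
    transition b d 0 x y = if x = y then 1 else 0 := by
  simp [transition_eq hJ le_rfl hx]

lemma continuousOn_transition (hJ : IsChain J b d) {x : ℤ} (hx : x ∈ J) (y : ℤ) :
    ContinuousOn (fun t => transition b d t x y) (Set.Ici 0) := by
  have hb : 0 ≤ b x := hJ.rate_nonneg .up x hx
  have hd : 0 ≤ d x := hJ.rate_nonneg .down x hx
  set F : ℝ → ℝ := fun s => Real.exp ((b x + d x) * s) *
        (b x * transition b d s (x + 1) y + d x * transition b d s (x - 1) y) with hF
  have hFm : Measurable F := by
    have i1 := measurable_transition b d (x + 1) y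
    have i2 := measurable_transition b d (x - 1) y
    fun_prop
  have hint : ∀ u v : ℝ, IntervalIntegrable ((Set.Ici 0).indicator F) volume u v := by
    intro u v
    refine IntervalIntegrable.mono_fun' (g := fun s => Real.exp ((b x + d x) * s) * (b x + d x))
      (Continuous.intervalIntegrable (by fun_prop) _ _)
      (hFm.indicator measurableSet_Ici).aestronglyMeasurable
      (Filter.Eventually.of_forall fun s => ?_)
    dsimp only
    by_cases hs : s ∈ Set.Ici (0 : ℝ)
    · have h1 : b x * transition b d s (x + 1) y ≤ b x := by
        by_cases h : b x = 0
        · simp [h]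
        · exact mul_le_of_le_one_right hb (transition_le_one hJ hs (hJ.move_mem x hx .up h) y)
      have h2 : d x * transition b d s (x - 1) y ≤ d x := by
        by_cases h : d x = 0
        · simp [h]
        · exact mul_le_of_le_one_right hd (transition_le_one hJ hs (hJ.move_mem x hx .down h) y)
      have := transition_nonneg b d s (x + 1) y
      have := transition_nonneg b d s (x - 1) y
      rw [Set.indicator_of_mem hs, hF, Real.norm_of_nonneg (by positivity)]
      dsimp only
      gcongr
    · rw [Set.indicator_of_notMem hs]
      simp only [norm_zero]
      positivity
  have hcont := intervalIntegral.continuous_primitive hint 0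
  have : ContinuousOn (fun t => Real.exp (-(b x + d x) * t) * ((if x = y then 1 else 0) +
      ∫ s in (0 : ℝ)..t, (Set.Ici 0).indicator F s)) (Set.Ici 0) := by
    apply Continuous.continuousOn
    fun_prop
  refine this.congr fun t ht => ?_
  simp only []
  rw [transition_eq hJ ht hx]
  congr 2
  refine intervalIntegral.integral_congr fun s hs => ?_
  rw [Set.uIcc_of_le ht] at hs
  simp [hF, hs.1]

/-- The transition function solves the backward equation. -/
theorem isSol_transition (hJ : IsChain J b d) (y : ℤ) :
    IsSol J (rate b d) move fun t x => transition b d t x y := by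
  intro x hx t ht
  set F : ℝ → ℝ := fun s => Real.exp ((b x + d x) * s) *
        (b x * transition b d s (x + 1) y + d x * transition b d s (x - 1) y) with hF
  have hFc : ContinuousOn F (Set.Ici 0) := by
    refine ContinuousOn.mul (by fun_prop) (ContinuousOn.add ?_ ?_)
    · by_cases h : b x = 0
      · simpa [h] using continuousOn_const
      · exact continuousOn_const.mul (continuousOn_transition hJ (hJ.move_mem x hx .up h) y)
    · by_cases h : d x = 0
      · simpa [h] using continuousOn_const
      · exact continuousOn_const.mul (continuousOn_transition hJ (hJ.move_mem x hx .down h) y)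
  have h1 := hasDerivWithinAt_of_eq_integral (f := fun t => (if x = y then 1 else 0) +
      ∫ s in (0 : ℝ)..t, F s) hFc (fun t _ => by simp) t ht
  have h2 : HasDerivWithinAt (fun t => Real.exp (-(b x + d x) * t))
      (Real.exp (-(b x + d x) * t) * (-(b x + d x) * 1)) (Set.Ici 0) t :=
    (((hasDerivAt_id t).const_mul (-(b x + d x))).exp).hasDerivWithinAt
  have h3 := (h2.mul h1).congr (f₁ := fun t => transition b d t x y)
    (fun s hs => transition_eq hJ hs hx y) (transition_eq hJ ht hx y)
  convert! h3 using 1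
  have h4 := transition_eq hJ ht hx y
  have h5 : Real.exp (-(b x + d x) * t) * F t =
      b x * transition b d t (x + 1) y + d x * transition b d t (x - 1) y := by
    rw [hF, ← mul_assoc, ← Real.exp_add,
      show -(b x + d x) * t + (b x + d x) * t = 0 by ring, Real.exp_zero, one_mul]
  rw [h5, gen_chain]
  linear_combination (-(b x + d x)) * h4

/-! ### Consequences of uniqueness: commutation, Siegmund duality, reversibility -/

section Generic

variable {S A : Type*} [Fintype A] {D : Set S} {r : A → S → ℝ} {τ : A → S → S}

lemma Confined.mono {D' : Set S} (hD : Confined D r τ) (h : D' ⊆ D) : Confined D' r τ := by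
  obtain ⟨V, H, C, CH, hV, hH, hC, hCH, hfin⟩ := hD
  exact ⟨V, H, C, CH, hV, hH, fun z hz => hC z (h hz), fun K z hz => hCH K z (h hz),
    fun K m => (hfin K m).subset fun z hz => ⟨h hz.1, hz.2⟩⟩

lemma IsSol.mono {D' : Set S} {u : ℝ → S → ℝ} (hu : IsSol D r τ u) (h : D' ⊆ D) :
    IsSol D' r τ u := fun z hz => hu z (h hz)

lemma IsSol.zero : IsSol D r τ fun _ _ => 0 := fun z _ t _ => by
  simpa [gen] using hasDerivWithinAt_const t (Set.Ici 0) (0 : ℝ)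

lemma IsSol.const (c : ℝ) : IsSol D r τ fun _ _ => c := fun z _ t _ => by
  simpa [gen] using hasDerivWithinAt_const t (Set.Ici 0) c

lemma gen_add (f g : S → ℝ) (z : S) :
    gen r τ (fun z => f z + g z) z = gen r τ f z + gen r τ g z := by
  simp only [gen, ← Finset.sum_add_distrib]
  exact Finset.sum_congr rfl fun a _ => by ring

lemma gen_const_mul (c : ℝ) (f : S → ℝ) (z : S) :
    gen r τ (fun z => c * f z) z = c * gen r τ f z := by
  simp only [gen, Finset.mul_sum]
  exact Finset.sum_congr rfl fun a _ => by ring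

lemma IsSol.add {u v : ℝ → S → ℝ} (hu : IsSol D r τ u) (hv : IsSol D r τ v) :
    IsSol D r τ fun t z => u t z + v t z := fun z hz t ht => by
  rw [gen_add]; exact (hu z hz t ht).add (hv z hz t ht)

lemma IsSol.sub {u v : ℝ → S → ℝ} (hu : IsSol D r τ u) (hv : IsSol D r τ v) :
    IsSol D r τ fun t z => u t z - v t z := fun z hz t ht => by
  rw [gen_sub]; exact (hu z hz t ht).sub (hv z hz t ht)

lemma IsSol.const_mul {u : ℝ → S → ℝ} (hu : IsSol D r τ u) (c : ℝ) :
    IsSol D r τ fun t z => c * u t z := fun z hz t ht => by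
  rw [gen_const_mul]; exact (hu z hz t ht).const_mul c

lemma IsSol.sum {ι : Type*} (s : Finset ι) {u : ι → ℝ → S → ℝ} (hu : ∀ i, IsSol D r τ (u i)) :
    IsSol D r τ fun t z => ∑ i ∈ s, u i t z := by
  classical
  induction s using Finset.induction_on with
  | empty => simpa using IsSol.zero
  | insert i s hi ih =>
    simp only [Finset.sum_insert hi]
    exact (hu i).add ih

/-- The generator commutes with the semigroup: if `u` and `h` are the bounded solutions with
initial values `f` and `L f`, then `L (u t) = h t`. Indeed `f + ∫₀ᵗ h` is a bounded solution with
initial value `f`, and therefore equal to `u`. -/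
theorem gen_eq_of_initial (hr : ∀ a, ∀ z ∈ D, 0 ≤ r a z) (hD : Confined D r τ)
    (hτ : ∀ z ∈ D, ∀ a, r a z ≠ 0 → τ a z ∈ D) {u h : ℝ → S → ℝ} (hu : IsSol D r τ u)
    (hh : IsSol D r τ h) {M M' : ℝ} (hbu : ∀ t, 0 ≤ t → ∀ z ∈ D, |u t z| ≤ M)
    (hbh : ∀ t, 0 ≤ t → ∀ z ∈ D, |h t z| ≤ M') (h0 : ∀ z ∈ D, h 0 z = gen r τ (u 0) z) :
    ∀ t, 0 ≤ t → ∀ z ∈ D, gen r τ (u t) z = h t z := by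
  set v : ℝ → S → ℝ := fun t z => u 0 z + ∫ s in (0 : ℝ)..t, h s z with hv
  have hvd : ∀ z ∈ D, ∀ t, 0 ≤ t → HasDerivWithinAt (fun t => v t z) (h t z) (Set.Ici 0) t :=
    fun z hz t ht => hasDerivWithinAt_of_eq_integral (hh.continuousOn hz)
      (fun t _ => by simp [hv]) t ht
  have hii : ∀ z ∈ D, ∀ t, 0 ≤ t → IntervalIntegrable (fun s => h s z) volume 0 t := by
    intro z hz t ht
    refine ContinuousOn.intervalIntegrable ?_
    rw [Set.uIcc_of_le ht]
    exact (hh.continuousOn hz).mono fun s hs => hs.1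
  have hgv : ∀ z ∈ D, ∀ t, 0 ≤ t → gen r τ (v t) z = h t z := by
    intro z hz t ht
    have h1 := hh.integral_eq hz (fun a ha => hh.continuousOn (hτ z hz a ha)) ht
    rw [h1, h0 z hz, hv, gen_add]
    congr 1
    simp only [gen]
    rw [intervalIntegral.integral_finsetSum]
    · refine Finset.sum_congr rfl fun a _ => ?_
      by_cases ha : r a z = 0
      · simp [ha]
      · rw [intervalIntegral.integral_const_mul, intervalIntegral.integral_sub
          (hii _ (hτ z hz a ha) t ht) (hii z hz t ht)]
    · intro a _
      by_cases ha : r a z = 0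
      · simp [ha]
      · exact ((hii _ (hτ z hz a ha) t ht).sub (hii z hz t ht)).const_mul _
  have hvs : IsSol D r τ v := fun z hz t ht => by
    rw [hgv z hz t ht]; exact hvd z hz t ht
  have huv := IsSol.eq hr hD hu hvs (fun T _ => ⟨M, fun t ht z hz => hbu t ht.1 z hz⟩)
    (fun T hT => ⟨M + M' * T, fun t ht z hz => by
      refine (abs_add_le _ _).trans (add_le_add (hbu 0 le_rfl z hz) ?_)
      have := intervalIntegral.norm_integral_le_of_norm_le_const (a := 0) (b := t)
        (f := fun s => h s z) (C := M') (fun s hs => by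
          rw [Set.uIoc_of_le ht.1] at hs
          exact hbh s hs.1.le z hz)
      rw [sub_zero, abs_of_nonneg ht.1] at this
      exact this.trans (mul_le_mul_of_nonneg_left ht.2
        ((abs_nonneg _).trans (hbh 0 le_rfl z hz)))⟩)
    (fun z hz => by simp [hv]) (fun t ht z hz a ha h => (h (hτ z hz a ha)).elim)
  intro t ht z hz
  rw [← hgv z hz t ht]
  exact gen_congr (huv t ht z hz) fun a ha => huv t ht _ (hτ z hz a ha)

end Generic

variable {J : Set ℤ} {b d : ℤ → ℝ}

lemma indicatorProb_nonneg (b d : ℤ → ℝ) (t : ℝ) (S : Set ℤ) (x : ℤ) :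
    0 ≤ indicatorProb (transition b d) t S x :=
  tsum_nonneg fun z => Set.indicator_nonneg (fun z _ => transition_nonneg b d t x z) z

lemma indicatorProb_le_one (hJ : IsChain J b d) {t : ℝ} (ht : 0 ≤ t) (S : Set ℤ) {x : ℤ}
    (hx : x ∈ J) : indicatorProb (transition b d) t S x ≤ 1 :=
  ((summable_transition hJ ht hx).indicator S).tsum_le_of_sum_le fun s =>
    (Finset.sum_le_sum fun z _ => Set.indicator_le_self' (fun z _ => transition_nonneg b d t x z)
      z).trans (sum_transition_le_one hJ ht hx s)

lemma abs_indicatorProb_le_one (hJ : IsChain J b d) {t : ℝ} (ht : 0 ≤ t) (S : Set ℤ) {x : ℤ}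
    (hx : x ∈ J) : |indicatorProb (transition b d) t S x| ≤ 1 := by
  rw [abs_of_nonneg (indicatorProb_nonneg b d t S x)]
  exact indicatorProb_le_one hJ ht S hx

open Classical in
lemma indicatorProb_zero (hJ : IsChain J b d) (S : Set ℤ) {x : ℤ} (hx : x ∈ J) :
    indicatorProb (transition b d) 0 S x = if x ∈ S then 1 else 0 := by
  rw [indicatorProb, tsum_eq_single x]
  · simp [Set.indicator, transition_zero hJ hx]
  · intro z hz
    simp [Set.indicator, transition_zero hJ hx, hz.symm]

/-- The probability of finding the chain in a given set solves the backward equation. -/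
lemma isSol_indicatorProb (hJ : IsChain J b d) (S : Set ℤ) :
    IsSol J (rate b d) move fun t x => indicatorProb (transition b d) t S x := by
  classical
  refine IsSol.of_tendsto (l := Filter.atTop) (E := J) (M := 1)
    (u := fun (s : Finset ℤ) t x => ∑ z ∈ s, S.indicator (transition b d t x) z)
    subset_rfl hJ.move_mem ?_ ?_ ?_ (fun _ z hz h => (h hz).elim) (fun z hz h => (h hz).elim)
  · intro s
    refine IsSol.sum s fun z => ?_
    by_cases hz : z ∈ S
    · simpa [hz] using isSol_transition hJ z
    · simpa [hz] using IsSol.zero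
  · intro s t ht x hx
    rw [abs_of_nonneg (Finset.sum_nonneg fun z _ =>
      Set.indicator_nonneg (fun z _ => transition_nonneg b d t x z) z)]
    exact (Finset.sum_le_sum fun z _ => Set.indicator_le_self'
      (fun z _ => transition_nonneg b d t x z) z).trans (sum_transition_le_one hJ ht hx s)
  · intro t ht x hx
    exact ((summable_transition hJ ht hx).indicator S).hasSum

lemma indicatorProb_sub (hJ : IsChain J b d) {t : ℝ} (ht : 0 ≤ t) {S S' : Set ℤ} {x y : ℤ}
    (hx : x ∈ J) (hy : y ∈ S) (hS : S' = S \ {y}) :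
    transition b d t x y =
      indicatorProb (transition b d) t S x - indicatorProb (transition b d) t S' x := by
  have h := summable_transition hJ ht hx
  rw [indicatorProb, indicatorProb, ← (h.indicator S).tsum_sub (h.indicator S'), tsum_eq_single y]
  · simp [hS, hy]
  · intro z hz
    by_cases hzS : z ∈ S <;> simp [hS, Set.indicator, hz, hzS]

lemma abs_transition_le_one (hJ : IsChain J b d) {t : ℝ} (ht : 0 ≤ t) {x : ℤ} (hx : x ∈ J)
    (y : ℤ) : |transition b d t x y| ≤ 1 := by
  rw [abs_of_nonneg (transition_nonneg b d t x y)]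
  exact transition_le_one hJ ht hx y

/-- The forward equation. -/
theorem forward_equation (hJ : IsChain J b d) (hc : Confined J (rate b d) move) {t : ℝ}
    (ht : 0 ≤ t) {x : ℤ} (hx : x ∈ J) (y : ℤ) :
    HasDerivWithinAt (fun t => transition b d t x y)
      (b (y - 1) * transition b d t x (y - 1) + d (y + 1) * transition b d t x (y + 1) -
        (b y + d y) * transition b d t x y) (Set.Ici 0) t := by
  have h := gen_eq_of_initial hJ.rate_nonneg hc hJ.move_mem (isSol_transition hJ y)
    ((((isSol_transition hJ (y - 1)).const_mul (b (y - 1))).add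
      ((isSol_transition hJ (y + 1)).const_mul (d (y + 1)))).sub
      ((isSol_transition hJ y).const_mul (b y + d y)))
    (M := 1) (M' := |b (y - 1)| + |d (y + 1)| + |b y + d y|)
    (fun t ht z hz => abs_transition_le_one hJ ht hz y)
    (fun t ht z hz => by
      have h1 := abs_transition_le_one hJ ht hz y
      have h2 := abs_transition_le_one hJ ht hz (y - 1)
      have h3 := abs_transition_le_one hJ ht hz (y + 1)
      refine (abs_sub _ _).trans (add_le_add ((abs_add_le _ _).trans (add_le_add ?_ ?_)) ?_) <;>
      · rw [abs_mul]; exact mul_le_of_le_one_right (abs_nonneg _) (by assumption))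
    (fun z hz => by
      have hup : b z * transition b d 0 (z + 1) y = b z * if z + 1 = y then 1 else 0 := by
        by_cases h : b z = 0
        · simp [h]
        · rw [transition_zero hJ (x := z + 1) (hJ.move_mem z hz .up h)]
      have hdn : d z * transition b d 0 (z - 1) y = d z * if z - 1 = y then 1 else 0 := by
        by_cases h : d z = 0
        · simp [h]
        · rw [transition_zero hJ (x := z - 1) (hJ.move_mem z hz .down h)]
      rw [gen_chain, mul_sub, mul_sub, hup, hdn]
      simp only [transition_zero hJ hz]
      have e1 : (z = y - 1) ↔ z + 1 = y := by omega
      have e2 : (z = y + 1) ↔ z - 1 = y := by omega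
      simp only [e1, e2]
      split_ifs <;> first | omega | (subst_vars; simp; try ring))
    t ht x hx
  rw [← h]
  exact isSol_transition hJ y x hx t ht

/-- Siegmund duality: if two chains are dual to each other with respect to `1(x ≤ y)`, then the
probability that the first chain, started from `x`, is at most `y`, is the probability that
the second one, started from `y`, is at least `x`. -/
theorem siegmund_duality {J' : Set ℤ} {b' d' : ℤ → ℝ} (hJ : IsChain J b d)
    (hc : Confined J (rate b d) move) (hJ' : IsChain J' b' d') (hc' : Confined J' (rate b' d') move)
    (hbd : ∀ x ∈ J, ∀ y ∈ J', x = y + 1 → b' y = d x) (hdb : ∀ x ∈ J, x ∈ J' → d' x = b x)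
    {S S' : Set ℤ} (hS : J ⊆ S) (hS' : ∀ x ∈ J, ∀ y ∈ J', x ≤ y → y ∈ S') {t : ℝ} (ht : 0 ≤ t)
    {x y : ℤ} (hx : x ∈ J) (hy : y ∈ J') :
    indicatorProb (transition b d) t (S ∩ Set.Iic y) x =
      indicatorProb (transition b' d') t (S' ∩ Set.Ici x) y := by
  classical
  have hg0 : ∀ x ∈ J, ∀ y, indicatorProb (transition b d) 0 (S ∩ Set.Iic y) x =
      if x ≤ y then 1 else 0 := by
    intro x hx y
    rw [indicatorProb_zero hJ _ hx]
    simp [hS hx]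
  have hg : ∀ y, IsSol J (rate b d) move
      fun t x => indicatorProb (transition b d) t (S ∩ Set.Iic y) x :=
    fun y => isSol_indicatorProb hJ _
  -- As a function of `y`, the left-hand side solves the backward equation of the second chain: at
  -- time zero, the generator of the first chain in `x` and that of the second chain in `y` agree on
  -- `1(x ≤ y)`, and this persists because the generator commutes with the semigroup.
  have hsol : IsSol J' (rate b' d') move
      fun t y => indicatorProb (transition b d) t (S ∩ Set.Iic y) x := by
    intro y hy t ht
    rw [gen_chain]
    have := gen_eq_of_initial hJ.rate_nonneg hc hJ.move_mem (hg y)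
      ((((hg (y + 1)).sub (hg y)).const_mul (b' y)).add
        (((hg (y - 1)).sub (hg y)).const_mul (d' y))) (M := 1) (M' := |b' y| * 2 + |d' y| * 2)
      (fun t ht z hz => abs_indicatorProb_le_one hJ ht _ hz)
      (fun t ht z hz => by
        have h1 := abs_indicatorProb_le_one hJ ht (S ∩ Set.Iic y) hz
        have h2 := abs_indicatorProb_le_one hJ ht (S ∩ Set.Iic (y - 1)) hz
        have h3 := abs_indicatorProb_le_one hJ ht (S ∩ Set.Iic (y + 1)) hz
        refine (abs_add_le _ _).trans (add_le_add ?_ ?_) <;>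
        · rw [abs_mul]
          refine mul_le_mul_of_nonneg_left ((abs_sub _ _).trans ?_) (abs_nonneg _)
          linarith)
      (fun z hz => by
        have hup : b z * indicatorProb (transition b d) 0 (S ∩ Set.Iic y) (z + 1) =
            b z * if z + 1 ≤ y then 1 else 0 := by
          by_cases h : b z = 0
          · simp [h]
          · rw [hg0 (z + 1) (hJ.move_mem z hz .up h)]
        have hdn : d z * indicatorProb (transition b d) 0 (S ∩ Set.Iic y) (z - 1) =
            d z * if z - 1 ≤ y then 1 else 0 := by
          by_cases h : d z = 0
          · simp [h]
          · rw [hg0 (z - 1) (hJ.move_mem z hz .down h)]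
        rw [gen_chain, mul_sub (b z), mul_sub (d z), hup, hdn]
        simp only [hg0 z hz]
        rcases lt_trichotomy z y with h | h | h
        · have e1 : z ≤ y + 1 := by omega
          have e2 : z ≤ y - 1 := by omega
          have e3 : z + 1 ≤ y := by omega
          have e4 : z - 1 ≤ y := by omega
          simp [e1, e2, e3, e4, h.le]
        · subst h
          have e2 : ¬ z ≤ z - 1 := by omega
          have e3 : ¬ z + 1 ≤ z := by omega
          simp [hdb z hz hy]
        · have e2 : ¬ z ≤ y - 1 := by omega
          have e3 : ¬ z + 1 ≤ y := by omega
          have e5 : ¬ z ≤ y := by omega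
          by_cases h' : z = y + 1
          · have e1 : z ≤ y + 1 := by omega
            have e4 : z - 1 ≤ y := by omega
            simp [e1, e2, e3, e4, e5, hbd z hz y hy h']
          · have e1 : ¬ z ≤ y + 1 := by omega
            have e4 : ¬ z - 1 ≤ y := by omega
            simp [e1, e2, e3, e4, e5])
      t ht x hx
    have h2 := hg y x hx t ht
    rw [this] at h2
    exact h2
  refine IsSol.eq hJ'.rate_nonneg hc' hsol (isSol_indicatorProb hJ' (S' ∩ Set.Ici x))
    (fun T _ => ⟨1, fun t ht z _ => abs_indicatorProb_le_one hJ ht.1 _ hx⟩)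
    (fun T _ => ⟨1, fun t ht z hz => abs_indicatorProb_le_one hJ' ht.1 _ hz⟩) ?_
    (fun t ht z hz a ha h => (h (hJ'.move_mem z hz a ha)).elim) t ht y hy
  intro z hz
  rw [hg0 x hx, indicatorProb_zero hJ' _ hz]
  by_cases h : x ≤ z
  · simp [h, hS' x hx z hz h]
  · simp [h]

/-- The chain never leaves `J`: this holds for any number of jumps. -/
lemma transition_eq_zero (hJ : IsChain J b d) {t : ℝ} {x y : ℤ} (hx : x ∈ J) (hy : y ∉ J) :
    transition b d t x y = 0 := by
  have h : ∀ (k : ℕ) (t : ℝ) (x : ℤ), x ∈ J → transitionAux b d k t x y = 0 := by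
    intro k
    induction k with
    | zero =>
      intro t x hx
      rw [transitionAux, if_neg (ne_of_mem_of_not_mem hx hy)]
    | succ k ih =>
      intro t x hx
      have hu : ∀ s, ENNReal.ofReal (b x) * transitionAux b d k s (x + 1) y = 0 := by
        intro s
        by_cases h : b x = 0
        · simp [h]
        · rw [ih s (x + 1) (hJ.move_mem x hx .up h), mul_zero]
      have hd : ∀ s, ENNReal.ofReal (d x) * transitionAux b d k s (x - 1) y = 0 := by
        intro s
        by_cases h : d x = 0
        · simp [h]
        · rw [ih s (x - 1) (hJ.move_mem x hx .down h), mul_zero]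
      rw [transitionAux, if_neg (ne_of_mem_of_not_mem hx hy)]
      simp [hu, hd]
  simp [transition, h _ _ _ hx]

/-- One half of reversibility. The function `π(y) / π(x) p_t(y,x)` of `x` is, by the forward
equation and detailed balance, a nonnegative solution of the backward equation; `p_t(x,y)` is the
smallest one with the given initial value. -/
lemma transition_le_of_detailedBalance (hJ : IsChain J b d) (hc : Confined J (rate b d) move)
    {S : Set ℤ} (hSJ : S ⊆ J) {m : ℤ → ℝ} (hm : ∀ x ∈ S, 0 < m x)
    (hup : ∀ x ∈ S, x + 1 ∈ S → m x * b x = m (x + 1) * d (x + 1))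
    (hup' : ∀ x ∈ S, x + 1 ∉ S → d (x + 1) = 0)
    (hdn' : ∀ x ∈ S, x - 1 ∉ S → b (x - 1) = 0 ∨ x - 1 ∉ J)
    (hout : ∀ x ∈ J, x ∉ S → ∀ y ∈ S, ∀ t, 0 ≤ t → transition b d t x y = 0)
    {t : ℝ} (ht : 0 ≤ t) {x y : ℤ} (hx : x ∈ S) (hy : y ∈ S) :
    m x * transition b d t x y ≤ m y * transition b d t y x := by
  classical
  set v : ℝ → ℤ → ℝ := fun t x => if x ∈ S then m y / m x * transition b d t y x else 0 with hv
  have hvs : IsSol S (rate b d) move v := by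
    intro x hx t ht
    have hmx := (hm x hx).ne'
    have e : (fun s => v s x) = fun s => m y / m x * transition b d s y x := by
      funext s; simp [hv, hx]
    rw [e]
    convert! (forward_equation hJ hc ht (hSJ hy) x).const_mul (m y / m x) using 1
    have h1 : b x * v t (x + 1) = m y / m x * (d (x + 1) * transition b d t y (x + 1)) := by
      by_cases h : x + 1 ∈ S
      · have := hup x hx h
        have := (hm _ h).ne'
        simp only [hv, h, if_true]
        field_simp
        linear_combination (m y * transition b d t y (x + 1)) * hup x hx h
      · simp [hv, h, hup' x hx h]
    have h2 : d x * v t (x - 1) = m y / m x * (b (x - 1) * transition b d t y (x - 1)) := by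
      by_cases h : x - 1 ∈ S
      · have h3 := hup (x - 1) h (by simpa using hx)
        rw [sub_add_cancel] at h3
        have := (hm _ h).ne'
        simp only [hv, h, if_true]
        field_simp
        linear_combination -(m y * transition b d t y (x - 1)) * h3
      · rcases hdn' x hx h with h' | h'
        · simp [hv, h, h']
        · simp [hv, h, transition_eq_zero hJ (hSJ hy) h']
    rw [gen_chain, mul_sub, mul_sub (d x), h1, h2]
    simp only [hv, hx, if_true]
    ring
  have hv0 : ∀ t x, 0 ≤ v t x := by
    intro t x
    by_cases h : x ∈ S
    · simp only [hv, h, if_true]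
      exact mul_nonneg (div_nonneg (hm y hy).le (hm x h).le) (transition_nonneg _ _ _ _ _)
    · simp [hv, h]
  have := IsSol.le (fun a z hz => hJ.rate_nonneg a z (hSJ hz)) (hc.mono hSJ)
    ((isSol_transition hJ y).mono hSJ) hvs
    (fun T _ => ⟨1, fun t ht z hz => by
      have := transition_le_one hJ ht.1 (hSJ hz) y
      have := hv0 t z
      linarith⟩)
    (fun z hz => by
      simp only [hv, hz, if_true]
      rw [transition_zero hJ (hSJ hz), transition_zero hJ (hSJ hy)]
      by_cases h : z = y
      · subst h; simp [(hm z hz).ne']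
      · simp [h, Ne.symm h])
    (fun t ht z hz a ha h => by
      rw [hout _ (hJ.move_mem z (hSJ hz) a ha) h y hy t ht]
      exact hv0 _ _) t ht x hx
  simp only [hv, hx, if_true] at this
  have hmx := hm x hx
  rw [div_mul_eq_mul_div, le_div_iff₀ hmx] at this
  linarith

/-- Reversibility of a chain with respect to a measure on `S` with detailed balance. -/
theorem transition_reversible (hJ : IsChain J b d) (hc : Confined J (rate b d) move)
    {S : Set ℤ} (hSJ : S ⊆ J) {m : ℤ → ℝ} (hm : ∀ x ∈ S, 0 < m x)
    (hup : ∀ x ∈ S, x + 1 ∈ S → m x * b x = m (x + 1) * d (x + 1))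
    (hup' : ∀ x ∈ S, x + 1 ∉ S → d (x + 1) = 0)
    (hdn' : ∀ x ∈ S, x - 1 ∉ S → b (x - 1) = 0 ∨ x - 1 ∉ J)
    (hout : ∀ x ∈ J, x ∉ S → ∀ y ∈ S, ∀ t, 0 ≤ t → transition b d t x y = 0)
    {t : ℝ} (ht : 0 ≤ t) {x y : ℤ} (hx : x ∈ S) (hy : y ∈ S) :
    m x * transition b d t x y = m y * transition b d t y x :=
  le_antisymm (transition_le_of_detailedBalance hJ hc hSJ hm hup hup' hdn' hout ht hx hy)
    (transition_le_of_detailedBalance hJ hc hSJ hm hup hup' hdn' hout ht hy hx)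

/-! ### Natural boundaries and Lyapunov functions -/

/-- There is a nonnegative function with bounded drift and finite sublevel sets, so that the chain
with birth rates `b` and death rates `d` on `J` does not explode. -/
def HasLyapunov (J : Set ℤ) (b d : ℤ → ℝ) : Prop :=
  ∃ (V : ℤ → ℝ) (C : ℝ), (∀ x, 0 ≤ V x) ∧ (∀ x ∈ J, gen (rate b d) move V x ≤ C) ∧
    ∀ K, {x ∈ J | V x ≤ K}.Finite

lemma HasLyapunov.confined {J : Set ℤ} {b d : ℤ → ℝ} (h : HasLyapunov J b d) :
    Confined J (rate b d) move := by
  obtain ⟨V, C, h1, h2, h3⟩ := h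
  exact Confined.of_single V C h1 h2 h3

/-- The function `∑_{a ≤ j < x} s(j) ∑_{a ≤ i ≤ j} m(i)` of Feller's test for explosion. -/
def fellerFn (m s : ℤ → ℝ) (a x : ℤ) : ℝ := ∑ j ∈ Finset.Ico a x, s j * ∑ i ∈ Finset.Icc a j, m i

lemma fellerFn_succ (m s : ℤ → ℝ) {a x : ℤ} (h : a ≤ x) :
    fellerFn m s a (x + 1) = fellerFn m s a x + s x * ∑ i ∈ Finset.Icc a x, m i := by
  rw [fellerFn, ← Finset.insert_Ico_right_eq_Ico_add_one h, Finset.sum_insert (by simp), add_comm]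
  rfl

lemma fellerFn_eq_zero (m s : ℤ → ℝ) {a x : ℤ} (h : x ≤ a) : fellerFn m s a x = 0 := by
  simp [fellerFn, h]

section Feller

variable {m s : ℤ → ℝ} {a : ℤ} (hm : ∀ x, a ≤ x → 0 ≤ m x) (hs : ∀ x, a ≤ x → 0 ≤ s x)
include hm hs

lemma fellerFn_mono : Monotone (fellerFn m s a) := fun _ _ h =>
  Finset.sum_le_sum_of_subset_of_nonneg (Finset.Ico_subset_Ico_right h) fun j hj _ =>
    mul_nonneg (hs j (Finset.mem_Ico.1 hj).1)
      (Finset.sum_nonneg fun i hi => hm i (Finset.mem_Icc.1 hi).1)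

lemma fellerFn_nonneg (x : ℤ) : 0 ≤ fellerFn m s a x :=
  Finset.sum_nonneg fun j hj => mul_nonneg (hs j (Finset.mem_Ico.1 hj).1)
      (Finset.sum_nonneg fun i hi => hm i (Finset.mem_Icc.1 hi).1)

omit hm hs in
/-- If `m` is the speed and `s` the scale density of the chain, then the generator maps
`fellerFn m s a` to the indicator function of `[a, ∞)`. -/
lemma gen_fellerFn_le_one {b d : ℤ → ℝ} (h1 : ∀ x, a ≤ x → b x * s x * m x = 1)
    (h2 : ∀ x, a ≤ x → d (x + 1) * s x * m (x + 1) = 1) (x : ℤ) :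
    gen (rate b d) move (fellerFn m s a) x ≤ 1 := by
  rw [gen_chain]
  rcases lt_trichotomy x a with h | h | h
  · rw [fellerFn_eq_zero _ _ (by omega), fellerFn_eq_zero _ _ (by omega),
      fellerFn_eq_zero _ _ (by omega)]
    simp
  · subst h
    rw [fellerFn_succ _ _ le_rfl, fellerFn_eq_zero _ _ le_rfl,
      fellerFn_eq_zero (x := x - 1) _ _ (by omega)]
    simp only [Finset.Icc_self, Finset.sum_singleton]
    linarith [h1 x le_rfl]
  · obtain ⟨y, rfl⟩ : ∃ y, x = y + 1 := ⟨x - 1, by ring⟩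
    have hy : a ≤ y := by omega
    rw [fellerFn_succ _ _ h.le, add_sub_cancel_right, fellerFn_succ _ _ hy,
      ← Finset.insert_Icc_right_eq_Icc_add_one (by omega), Finset.sum_insert (by simp)]
    have e1 := h1 (y + 1) h.le
    have e2 := h2 y hy
    set M := ∑ i ∈ Finset.Icc a y, m i
    have e3 : b (y + 1) * s (y + 1) = d (y + 1) * s y := by
      have : m (y + 1) ≠ 0 := fun h => by simp [h] at e1
      exact mul_right_cancel₀ this (e1.trans e2.symm)
    apply le_of_eq
    linear_combination e1 + M * e3

/-- A divergent series makes `fellerFn` unbounded, so that its sublevel sets are finite to the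
right. -/
lemma exists_lt_fellerFn
    (h : ∑' j : ℤ, ENNReal.ofReal (s j) * ∑ i ∈ Finset.Icc a j, ENNReal.ofReal (m i) = ⊤) (K : ℝ) :
    ∃ N, K < fellerFn m s a N := by
  by_contra! hcon
  have hle : ∑' j : ℤ, ENNReal.ofReal (s j) * ∑ i ∈ Finset.Icc a j, ENNReal.ofReal (m i) ≤
      ENNReal.ofReal K := by
    rw [ENNReal.tsum_eq_iSup_sum]
    refine iSup_le fun F => ?_
    obtain ⟨N, hN⟩ : ∃ N, ∀ j ∈ F, j < N := by
      obtain ⟨N, hN⟩ := F.bddAbove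
      exact ⟨N + 1, fun j hj => Int.lt_add_one_of_le (hN hj)⟩
    refine le_trans ?_ (ENNReal.ofReal_le_ofReal (hcon N))
    rw [fellerFn, ENNReal.ofReal_sum_of_nonneg fun j hj => mul_nonneg (hs j (Finset.mem_Ico.1 hj).1)
      (Finset.sum_nonneg fun i hi => hm i (Finset.mem_Icc.1 hi).1)]
    calc ∑ j ∈ F, ENNReal.ofReal (s j) * ∑ i ∈ Finset.Icc a j, ENNReal.ofReal (m i)
        ≤ ∑ j ∈ Finset.Ico a N,
            ENNReal.ofReal (s j) * ∑ i ∈ Finset.Icc a j, ENNReal.ofReal (m i) := by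
          refine Finset.sum_le_sum_of_ne_zero fun j hj hne => ?_
          rw [Finset.mem_Ico]
          refine ⟨?_, hN j hj⟩
          by_contra! hlt
          exact hne (by simp [hlt])
      _ ≤ _ := Finset.sum_le_sum fun j hj => by
          rw [ENNReal.ofReal_mul (hs j (Finset.mem_Ico.1 hj).1),
            ENNReal.ofReal_sum_of_nonneg fun i hi => hm i (Finset.mem_Icc.1 hi).1]
  rw [h] at hle
  exact absurd hle (by simp)

end Feller

/-- Feller's criterion for a chain with one infinite end. -/
lemma hasLyapunov_of_Ici {b d m s : ℤ → ℝ} {a c : ℤ} (hm : ∀ x, a ≤ x → 0 ≤ m x)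
    (hs : ∀ x, a ≤ x → 0 ≤ s x) (h1 : ∀ x, a ≤ x → b x * s x * m x = 1)
    (h2 : ∀ x, a ≤ x → d (x + 1) * s x * m (x + 1) = 1)
    (h : ∑' j : ℤ, ENNReal.ofReal (s j) * ∑ i ∈ Finset.Icc a j, ENNReal.ofReal (m i) = ⊤) :
    HasLyapunov (Set.Ici c) b d := by
  refine ⟨fellerFn m s a, 1, fellerFn_nonneg hm hs, fun x _ => gen_fellerFn_le_one h1 h2 x,
    fun K => ?_⟩
  obtain ⟨N, hN⟩ := exists_lt_fellerFn hm hs h K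
  refine (Set.finite_Icc c N).subset fun x hx => ⟨hx.1, ?_⟩
  by_contra! hlt
  exact absurd ((fellerFn_mono hm hs hlt.le).trans hx.2) (not_le.2 hN)

/-- Feller's criterion for a chain on `ℤ`. -/
lemma hasLyapunov_univ {b d m s : ℤ → ℝ} (hm : ∀ x, 0 ≤ m x)
    (hs : ∀ x, 0 ≤ s x) (h1 : ∀ x, b x * s x * m x = 1) (h2 : ∀ x, d (x + 1) * s x * m (x + 1) = 1)
    (h : ∑' j : ℤ, ENNReal.ofReal (s j) * ∑ i ∈ Finset.Icc 1 j, ENNReal.ofReal (m i) = ⊤)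
    (h' : ∑' j : ℤ, ENNReal.ofReal (s (-j - 1)) *
      ∑ i ∈ Finset.Icc 1 j, ENNReal.ofReal (m (-i)) = ⊤) :
    HasLyapunov Set.univ b d := by
  set U := fellerFn m s 1
  set U' := fellerFn (fun x => m (-x)) (fun x => s (-x - 1)) 1
  have hU := fellerFn_nonneg (m := m) (s := s) (a := 1) (fun x _ => hm x) (fun x _ => hs x)
  have hU' := fellerFn_nonneg (m := fun x => m (-x)) (s := fun x => s (-x - 1)) (a := 1)
    (fun x _ => hm _) (fun x _ => hs _)
  refine ⟨fun x => U x + U' (-x), 2, fun x => add_nonneg (hU x) (hU' _), fun x _ => ?_,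
    fun K => ?_⟩
  · rw [gen_add]
    have e1 := gen_fellerFn_le_one (a := 1) (fun x _ => h1 x) (fun x _ => h2 x) x
    have e2 := gen_fellerFn_le_one (b := fun x => d (-x)) (d := fun x => b (-x))
      (m := fun x => m (-x)) (s := fun x => s (-x - 1)) (a := 1)
      (fun x _ => by have := h2 (-x - 1); rwa [sub_add_cancel] at this)
      (fun x _ => by have := h1 (-x - 1); rwa [show -(x + 1) = -x - 1 by ring]) (-x)
    have e3 : gen (rate b d) move (fun x => U' (-x)) x =
        gen (rate (fun x => d (-x)) fun x => b (-x)) move U' (-x) := by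
      rw [gen_chain, gen_chain, neg_neg, add_comm, show -(x + 1) = -x - 1 by ring,
        show -(x - 1) = -x + 1 by ring]
    rw [e3]
    linarith
  · obtain ⟨N, hN⟩ := exists_lt_fellerFn (fun x _ => hm x) (fun x _ => hs x) h K
    obtain ⟨N', hN'⟩ := exists_lt_fellerFn (m := fun x => m (-x)) (s := fun x => s (-x - 1))
      (fun x _ => hm _) (fun x _ => hs _) h' K
    refine (Set.finite_Icc (-N') N).subset fun x hx => ⟨?_, ?_⟩
    · by_contra! hlt
      have := fellerFn_mono (m := fun x => m (-x)) (s := fun x => s (-x - 1)) (a := 1)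
        (fun x _ => hm _) (fun x _ => hs _) (show N' ≤ -x by omega)
      have h3 := hx.2
      have h4 := hU x
      simp only [U, U'] at h3 h4
      linarith
    · by_contra! hlt
      have := fellerFn_mono (m := m) (s := s) (a := 1) (fun x _ => hm x) (fun x _ => hs x) hlt.le
      have h3 := hx.2
      have h4 := hU' (-x)
      simp only [U, U'] at h3 h4
      linarith

/-! ### The chain and its dual -/

lemma revMeasure_eq_neg (b d : ℤ → ℝ) {x : ℤ} (hx : x ≤ 0) :
    revMeasure b d x = ∏ k ∈ Finset.Icc (x + 1) 0, d k / b (k - 1) := by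
  rcases hx.lt_or_eq with h | rfl
  · rw [revMeasure, if_neg (by omega)]
    refine Finset.prod_nbij' (fun i => x + i) (fun k => k - x) ?_ ?_ ?_ ?_ ?_
    · intro i hi; rw [Finset.mem_Icc] at hi ⊢; omega
    · intro i hi; rw [Finset.mem_Icc] at hi ⊢; omega
    · intro i _; ring
    · intro i _; ring
    · intro i _; rfl
  · simp [revMeasure]

/-- Detailed balance. -/
lemma revMeasure_succ {b d : ℤ → ℝ} {x : ℤ} (hb : b x ≠ 0) (hd : d (x + 1) ≠ 0) :
    revMeasure b d x * b x = revMeasure b d (x + 1) * d (x + 1) := by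
  rcases le_or_gt 0 x with h | h
  · rw [revMeasure, if_pos h, revMeasure, if_pos (by omega),
      ← Finset.insert_Icc_right_eq_Icc_add_one (by omega), Finset.prod_insert (by simp)]
    rw [add_sub_cancel_right]
    field_simp
  · rw [revMeasure_eq_neg b d h.le, revMeasure_eq_neg b d (by omega),
      ← Finset.insert_Icc_add_one_left_eq_Icc (show x + 1 ≤ 0 by omega),
      Finset.prod_insert (by simp), add_sub_cancel_right]
    field_simp

lemma revMeasure_pos_of_nonneg {b d : ℤ → ℝ} (hb : ∀ x, 0 ≤ x → 0 < b x) (hd : ∀ x, 1 ≤ x → 0 < d x)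
    {x : ℤ} (hx : 0 ≤ x) : 0 < revMeasure b d x := by
  rw [revMeasure, if_pos hx]
  refine Finset.prod_pos fun i hi => ?_
  rw [Finset.mem_Icc] at hi
  exact div_pos (hb _ (by omega)) (hd _ hi.1)

lemma revMeasure_pos {b d : ℤ → ℝ} (hb : ∀ x, 0 < b x) (hd : ∀ x, 0 < d x)
    (x : ℤ) : 0 < revMeasure b d x := by
  rw [revMeasure]
  split_ifs
  · exact Finset.prod_pos fun i _ => div_pos (hb _) (hd _)
  · exact Finset.prod_pos fun i _ => div_pos (hd _) (hb _)

section Rates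

variable {I : Lattice} {lam mu : ℤ → ℝ} (hr : AdmissibleRates lam mu I)
include hr

lemma AdmissibleRates.lam_pos {x : ℤ} (hx : x ∈ I.sites) : 0 < lam x := by
  cases I
  · exact hr.1 x hx
  · exact (hr x).1

lemma AdmissibleRates.mu_succ_pos {x : ℤ} (hx : x ∈ I.sites) : 0 < mu (x + 1) := by
  cases I
  · exact hr.2.2 (x + 1) (by have : 0 ≤ x := hx; omega)
  · exact (hr _).2

lemma AdmissibleRates.mu_eq_zero {x : ℤ} (hx : x ∈ I.sites) (hx' : x - 1 ∉ I.sites) : mu x = 0 := by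
  cases I
  · have h1 : 0 ≤ x := hx
    have h2 : ¬ 0 ≤ x - 1 := hx'
    obtain rfl : x = 0 := by omega
    exact hr.2.1
  · exact (hx' trivial).elim

omit hr in
lemma succ_mem_sites {x : ℤ} (hx : x ∈ I.sites) : x + 1 ∈ I.sites := by
  cases I
  · have h1 : 0 ≤ x := hx
    exact (show 0 ≤ x + 1 by omega)
  · trivial

omit hr in
lemma mem_sites_of_le {x y : ℤ} (hx : x ∈ I.sites) (h : x ≤ y) : y ∈ I.sites := by
  cases I
  · exact le_trans (show (0 : ℤ) ≤ x from hx) h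
  · trivial

omit hr in
lemma sites_subset_dualSites : I.sites ⊆ I.dualSites := by
  cases I
  · exact Set.Ici_subset_Ici.2 (by norm_num)
  · exact subset_rfl

omit hr in
lemma mem_dualSites_iff {x : ℤ} : x ∈ I.dualSites ↔ x + 1 ∈ I.sites := by
  cases I
  · show -1 ≤ x ↔ 0 ≤ x + 1
    omega
  · exact Iff.rfl

lemma AdmissibleRates.mu_pos {x : ℤ} (hx' : x - 1 ∈ I.sites) : 0 < mu x := by
  have := hr.mu_succ_pos hx'
  rwa [sub_add_cancel] at this

lemma AdmissibleRates.mu_nonneg {x : ℤ} (hx : x ∈ I.sites) : 0 ≤ mu x := by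
  by_cases h : x - 1 ∈ I.sites
  · exact (hr.mu_pos h).le
  · exact (hr.mu_eq_zero hx h).ge

lemma isChain_pT : IsChain I.sites lam mu where
  rate_nonneg a x hx := by
    cases a
    · exact (hr.lam_pos hx).le
    · exact hr.mu_nonneg hx
  move_mem x hx a ha := by
    cases a
    · exact succ_mem_sites hx
    · by_contra h
      exact ha (hr.mu_eq_zero hx h)

lemma isChain_pHat : IsChain I.dualSites (dualBirth mu) (dualDeath I lam) where
  rate_nonneg a x hx := by
    cases a
    · exact hr.mu_nonneg (mem_dualSites_iff.1 hx)
    · show 0 ≤ dualDeath I lam x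
      rw [dualDeath]
      split_ifs with h
      · exact (hr.lam_pos h).le
      · exact le_rfl
  move_mem x hx a ha := by
    cases a
    · rw [move_up]
      refine sites_subset_dualSites (mem_dualSites_iff.1 hx)
    · rw [move_down, mem_dualSites_iff, sub_add_cancel]
      by_contra h
      exact ha (by simp [rate, dualDeath, h])

lemma revMeasure_pos_of_sites {x : ℤ} (hx : x ∈ I.sites) : 0 < revMeasure lam mu x := by
  cases I
  · exact revMeasure_pos_of_nonneg hr.1 hr.2.2 hx
  · exact revMeasure_pos (fun x => (hr x).1) (fun x => (hr x).2) x

omit hr in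
lemma dualDeath_of_mem {x : ℤ} (hx : x ∈ I.sites) : dualDeath I lam x = lam x := if_pos hx

lemma revMeasureHat_pos {x : ℤ} (hx : x ∈ I.sites) : 0 < revMeasureHat I lam mu x := by
  cases I
  · refine revMeasure_pos_of_nonneg (fun x hx => hr.mu_succ_pos (x := x) hx) (fun x hx => ?_) hx
    have hx' : x ∈ Lattice.nat.sites := show 0 ≤ x by omega
    rw [dualDeath, if_pos hx']
    exact hr.lam_pos hx'
  · refine revMeasure_pos (fun x => (hr _).2) (fun x => ?_) x
    rw [dualDeath_of_mem (show x ∈ Lattice.int.sites from trivial)]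
    exact (hr x).1

lemma detailedBalance {x : ℤ} (hx : x ∈ I.sites) :
    revMeasure lam mu x * lam x = revMeasure lam mu (x + 1) * mu (x + 1) :=
  revMeasure_succ (hr.lam_pos hx).ne' (hr.mu_succ_pos hx).ne'

lemma detailedBalanceHat {x : ℤ} (hx : x ∈ I.sites) :
    revMeasureHat I lam mu x * mu (x + 1) = revMeasureHat I lam mu (x + 1) * lam (x + 1) := by
  have h := succ_mem_sites hx
  have h2 := revMeasure_succ (b := dualBirth mu) (d := dualDeath I lam) (x := x)
    (hr.mu_succ_pos hx).ne' (by rw [dualDeath, if_pos h]; exact (hr.lam_pos h).ne')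
  rwa [dualDeath, if_pos h] at h2

/-- The scale density. -/
lemma scale_rel {x : ℤ} (hx : x ∈ I.sites) :
    lam x * (1 / (lam x * revMeasure lam mu x)) * revMeasure lam mu x = 1 := by
  have := (hr.lam_pos hx).ne'
  have := (revMeasure_pos_of_sites hr hx).ne'
  field_simp

lemma scale_rel' {x : ℤ} (hx : x ∈ I.sites) :
    mu (x + 1) * (1 / (lam x * revMeasure lam mu x)) * revMeasure lam mu (x + 1) = 1 := by
  have := (hr.lam_pos hx).ne'
  have := (revMeasure_pos_of_sites hr hx).ne'
  field_simp
  linarith [detailedBalance hr hx]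

lemma scale_nonneg {x : ℤ} (hx : x ∈ I.sites) : 0 ≤ 1 / (lam x * revMeasure lam mu x) := by
  have := (hr.lam_pos hx)
  have := (revMeasure_pos_of_sites hr hx)
  positivity

end Rates

lemma tsum_reindex {f : ℤ → ℝ≥0∞} {g : ℤ → ℝ≥0∞} {S : Set ℤ} (e : ℤ ≃ ℤ)
    (hf : ∀ j ∉ S, f j = 0) (h : ∑' j : S, f j = ⊤) (hg : ∀ k, g k = f (e k)) :
    ∑' k, g k = ⊤ := by
  rw [tsum_subtype_eq_of_support_subset fun j hj => by_contra fun h => hj (hf j h)] at h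
  rw [← h, ← e.tsum_eq f]
  exact tsum_congr hg

/-- The chain does not explode, as the infinite ends are not exit boundaries. -/
lemma hasLyapunov_pT {I : Lattice} {lam mu : ℤ → ℝ} (hr : AdmissibleRates lam mu I)
    (hn : NaturalBoundaries lam mu I) : HasLyapunov I.sites lam mu := by
  cases I with
  | nat =>
    refine hasLyapunov_of_Ici (a := 0) (m := revMeasure lam mu)
      (s := fun x => 1 / (lam x * revMeasure lam mu x))
      (fun x hx => (revMeasure_pos_of_sites hr hx).le) (fun x hx => scale_nonneg hr hx)
      (fun x hx => scale_rel hr hx) (fun x hx => scale_rel' hr hx) ?_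
    refine tsum_reindex (f := fun j => scale lam mu j * ∑ i ∈ Finset.Icc 0 j, mass lam mu i)
      (Equiv.refl ℤ) (fun j hj => ?_) hn.1 fun k => rfl
    rw [Set.mem_Ici, not_le] at hj
    simp [Finset.Icc_eq_empty_of_lt hj]
  | int =>
    refine hasLyapunov_univ (m := revMeasure lam mu)
      (s := fun x => 1 / (lam x * revMeasure lam mu x))
      (fun x => (revMeasure_pos_of_sites hr (x := x) trivial).le)
      (fun x => scale_nonneg hr (x := x) trivial)
      (fun x => scale_rel hr (x := x) trivial) (fun x => scale_rel' hr (x := x) trivial) ?_ ?_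
    · refine tsum_reindex (f := fun j => scale lam mu j * ∑ i ∈ Finset.Icc 1 j, mass lam mu i)
        (Equiv.refl ℤ) (fun j hj => ?_) hn.1 fun k => rfl
      rw [Set.mem_Ici, not_le] at hj
      simp [Finset.Icc_eq_empty_of_lt hj]
    · refine tsum_reindex
        (f := fun j => scale lam mu j * ∑ i ∈ Finset.Icc (j + 1) (-1), mass lam mu i)
        (Equiv.subLeft (-1)) (fun j hj => ?_) hn.2.2.1 fun k => ?_
      · rw [Set.mem_Iic, not_le] at hj
        rw [Finset.Icc_eq_empty_of_lt (by omega)]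
        simp
      · rw [Equiv.subLeft_apply, show -1 - k = -k - 1 by ring]
        congr 1
        refine Finset.sum_nbij' (fun i => -i) (fun i => -i) ?_ ?_ ?_ ?_ ?_
        · intro i hi; rw [Finset.mem_Icc] at hi ⊢; omega
        · intro i hi; rw [Finset.mem_Icc] at hi ⊢; omega
        · intro i _; ring
        · intro i _; ring
        · intro i _; rfl

/-- The dual chain does not explode, as the infinite ends are not entrance boundaries of the
original chain: speed and scale densities swap their roles under duality. -/
lemma hasLyapunov_pHat {I : Lattice} {lam mu : ℤ → ℝ} (hr : AdmissibleRates lam mu I)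
    (hn : NaturalBoundaries lam mu I) :
    HasLyapunov I.dualSites (dualBirth mu) (dualDeath I lam) := by
  cases I with
  | nat =>
    refine hasLyapunov_of_Ici (a := 0) (s := fun x => revMeasure lam mu (x + 1))
      (m := fun x => 1 / (lam x * revMeasure lam mu x))
      (fun x hx => scale_nonneg hr hx)
      (fun x hx => (revMeasure_pos_of_sites hr (succ_mem_sites (I := .nat) hx)).le)
      (fun x hx => by
        have := scale_rel' hr (x := x) hx
        simp only [dualBirth]; linarith)
      (fun x hx => by
        have hx1 : x + 1 ∈ Lattice.nat.sites := succ_mem_sites (I := .nat) hx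
        have := scale_rel hr hx1
        rw [dualDeath, if_pos hx1]; linarith) ?_
    have h := hn.2
    have e : ∑' j : Set.Ici (0 : ℤ), scale lam mu j * ∑' i : Set.Ici ((j : ℤ) + 1), mass lam mu i =
        ∑' k : ℤ, mass lam mu (k + 1) * ∑ i ∈ Finset.Icc 0 k, scale lam mu i := by
      calc _ = ∑' j : ℤ, ∑' i : ℤ,
            if 0 ≤ j ∧ j + 1 ≤ i then scale lam mu j * mass lam mu i else 0 := by
            rw [tsum_subtype (Set.Ici (0 : ℤ))
              fun j => scale lam mu j * ∑' i : Set.Ici (j + 1), mass lam mu i]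
            refine tsum_congr fun j => ?_
            by_cases hj : 0 ≤ j
            · rw [Set.indicator_of_mem (Set.mem_Ici.2 hj), tsum_subtype (Set.Ici (j + 1)),
                ← ENNReal.tsum_mul_left]
              refine tsum_congr fun i => ?_
              by_cases hi : j + 1 ≤ i <;> simp [Set.indicator, hi, hj]
            · rw [Set.indicator_of_notMem (by simpa using hj)]
              simp [hj]
        _ = ∑' i : ℤ, ∑' j : ℤ, if 0 ≤ j ∧ j + 1 ≤ i then scale lam mu j * mass lam mu i else 0 :=
            ENNReal.tsum_comm
        _ = ∑' k : ℤ, ∑' j : ℤ, if 0 ≤ j ∧ j + 1 ≤ k + 1 then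
              scale lam mu j * mass lam mu (k + 1) else 0 :=
            ((Equiv.addRight (1 : ℤ)).tsum_eq fun i => ∑' j : ℤ,
              if 0 ≤ j ∧ j + 1 ≤ i then scale lam mu j * mass lam mu i else 0).symm
        _ = _ := by
            refine tsum_congr fun k => ?_
            rw [tsum_eq_sum (s := Finset.Icc 0 k), Finset.mul_sum]
            · refine Finset.sum_congr rfl fun j hj => ?_
              rw [Finset.mem_Icc] at hj
              rw [if_pos (by omega), mul_comm]
            · intro j hj
              rw [Finset.mem_Icc] at hj
              rw [if_neg (by omega)]
    rw [e] at h
    exact h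
  | int =>
    refine hasLyapunov_univ (s := fun x => revMeasure lam mu (x + 1))
      (m := fun x => 1 / (lam x * revMeasure lam mu x))
      (fun x => scale_nonneg hr (x := x) trivial)
      (fun x => (revMeasure_pos_of_sites hr (x := x + 1) trivial).le)
      (fun x => by
        have := scale_rel' hr (x := x) trivial
        simp only [dualBirth]; linarith)
      (fun x => by
        have := scale_rel hr (x := x + 1) trivial
        rw [dualDeath_of_mem (show x + 1 ∈ Lattice.int.sites from trivial)]; linarith) ?_ ?_
    · refine tsum_reindex
        (f := fun j => mass lam mu j * ∑ i ∈ Finset.Icc 1 (j - 1), scale lam mu i)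
        (Equiv.addRight 1) (fun j hj => ?_) hn.2.1 fun k => ?_
      · rw [Set.mem_Ici, not_le] at hj
        rw [Finset.Icc_eq_empty_of_lt (by omega)]
        simp
      · rw [Equiv.coe_addRight, add_sub_cancel_right]
        rfl
    · refine tsum_reindex
        (f := fun j => mass lam mu j * ∑ i ∈ Finset.Icc j (-1), scale lam mu i)
        (Equiv.neg ℤ) (fun j hj => ?_) hn.2.2.2 fun k => ?_
      · rw [Set.mem_Iic, not_le] at hj
        rw [Finset.Icc_eq_empty_of_lt (by omega)]
        simp
      · rw [Equiv.neg_apply, sub_add_cancel]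
        congr 1
        refine Finset.sum_nbij' (fun i => -i) (fun i => -i) ?_ ?_ ?_ ?_ ?_
        · intro i hi; rw [Finset.mem_Icc] at hi ⊢; omega
        · intro i hi; rw [Finset.mem_Icc] at hi ⊢; omega
        · intro i _; ring
        · intro i _; ring
        · intro i _; rfl

/-! ### Determinants whose rows solve backward equations -/

lemma det_eq_sum_rows {ι : Type*} [Fintype ι] [DecidableEq ι] (M : Matrix ι ι ℝ) :
    M.det = ∑ σ : Equiv.Perm ι, ((Equiv.Perm.sign σ : ℤ) : ℝ) * ∏ i, M i (σ i) := by
  rw [← Matrix.det_transpose, Matrix.det_apply']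
  rfl

/-- The derivative of a determinant is the sum over its rows of the determinants in which one row is
differentiated. -/
lemma hasDerivWithinAt_det {ι : Type*} [Fintype ι] [DecidableEq ι] {M : ℝ → Matrix ι ι ℝ}
    {M' : Matrix ι ι ℝ} {s : Set ℝ} {t : ℝ}
    (h : ∀ i j, HasDerivWithinAt (fun t => M t i j) (M' i j) s t) :
    HasDerivWithinAt (fun t => (M t).det) (∑ i, ((M t).updateRow i (M' i)).det) s t := by
  have h1 : (fun t => (M t).det) = fun t => ∑ σ : Equiv.Perm ι,
      ((Equiv.Perm.sign σ : ℤ) : ℝ) * ∏ i, M t i (σ i) := funext fun t => det_eq_sum_rows _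
  rw [h1]
  have h2 := HasDerivWithinAt.fun_sum (u := Finset.univ) fun (σ : Equiv.Perm ι) _ =>
    (HasDerivWithinAt.fun_finsetProd (u := Finset.univ) fun i _ => h i (σ i)).const_mul
      ((Equiv.Perm.sign σ : ℤ) : ℝ)
  convert! h2 using 1
  simp only [det_eq_sum_rows, Finset.mul_sum]
  rw [Finset.sum_comm]
  refine Finset.sum_congr rfl fun σ _ => Finset.sum_congr rfl fun i _ => ?_
  rw [← Finset.mul_prod_erase Finset.univ _ (Finset.mem_univ i), Matrix.updateRow_self,
    smul_eq_mul, mul_comm (M' i (σ i))]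
  congr 2
  refine Finset.prod_congr rfl fun j hj => ?_
  rw [Matrix.updateRow_ne (Finset.ne_of_mem_erase hj)]

section MultiChain

variable {ι : Type*} [DecidableEq ι]

/-- The rates of a family of independent chains indexed by `ι`. -/
def multiRate (b d : ι → ℤ → ℝ) (a : ι × Dir) (z : ι → ℤ) : ℝ :=
  rate (b a.1) (d a.1) a.2 (z a.1)

/-- The moves of a family of independent chains indexed by `ι`. -/
def multiMove (a : ι × Dir) (z : ι → ℤ) : ι → ℤ := Function.update z a.1 (move a.2 (z a.1))

/-- The determinant with rows `ρᵢ(zᵢ)`. -/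
def rowDet [Fintype ι] (ρ : ι → ℤ → ι → ℝ) (z : ι → ℤ) : ℝ :=
  (Matrix.of fun i c => ρ i (z i) c).det

variable [Fintype ι]

lemma gen_multi (b d : ι → ℤ → ℝ) (f : (ι → ℤ) → ℝ) (z : ι → ℤ) :
    gen (multiRate b d) multiMove f z = ∑ i, ∑ a, rate (b i) (d i) a (z i) *
      (f (Function.update z i (move a (z i))) - f z) := by
  rw [gen, Fintype.sum_prod_type]
  rfl

/-- The drift of a sum of functions of the single chains. -/
lemma gen_multi_sum (b d : ι → ℤ → ℝ) (V : ι → ℤ → ℝ) (z : ι → ℤ) :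
    gen (multiRate b d) multiMove (fun z => ∑ i, V i (z i)) z =
      ∑ i, gen (rate (b i) (d i)) move (V i) (z i) := by
  rw [gen_multi]
  refine Finset.sum_congr rfl fun i _ => Finset.sum_congr rfl fun a _ => ?_
  congr 1
  rw [← Finset.sum_sub_distrib, Finset.sum_eq_single i]
  · simp
  · intro j _ hj
    simp [hj]
  · simp

/-- A determinant whose rows solve backward equations solves the backward equation of the family of
independent chains, by multilinearity. -/
lemma hasDerivWithinAt_rowDet {b d : ι → ℤ → ℝ} {ρ : ℝ → ι → ℤ → ι → ℝ} {t : ℝ} {z : ι → ℤ}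
    (h : ∀ i c, HasDerivWithinAt (fun t => ρ t i (z i) c)
      (gen (rate (b i) (d i)) move (fun x => ρ t i x c) (z i)) (Set.Ici 0) t) :
    HasDerivWithinAt (fun t => rowDet (ρ t) z)
      (gen (multiRate b d) multiMove (rowDet (ρ t)) z) (Set.Ici 0) t := by
  have h1 := hasDerivWithinAt_det (M := fun t => Matrix.of fun i c => ρ t i (z i) c)
    (M' := Matrix.of fun i c => gen (rate (b i) (d i)) move (fun x => ρ t i x c) (z i)) h
  convert! h1 using 1
  rw [gen_multi]
  refine Finset.sum_congr rfl fun i _ => ?_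
  set M : Matrix ι ι ℝ := Matrix.of fun i c => ρ t i (z i) c
  have hrow : (Matrix.of fun i c => gen (rate (b i) (d i)) move (fun x => ρ t i x c) (z i)) i =
      ∑ a, rate (b i) (d i) a (z i) • (ρ t i (move a (z i)) - M i) := by
    funext c
    simp [gen, M]
  have hup : ∀ x, (M.updateRow i (ρ t i x)).det = rowDet (ρ t) (Function.update z i x) := by
    intro x
    rw [rowDet]
    congr 1
    ext j c
    by_cases hj : j = i
    · subst hj; simp
    · simp [hj, M]
  have hself : (M.updateRow i (M i)).det = rowDet (ρ t) z := by
    rw [Matrix.updateRow_eq_self]; rfl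
  rw [hrow]
  have hmap : ∀ v, (M.updateRow i v).det =
      (Matrix.detRowAlternating (n := ι) (R := ℝ)).toMultilinearMap.toLinearMap M i v :=
    fun v => rfl
  rw [hmap, map_sum]
  refine Finset.sum_congr rfl fun a _ => ?_
  rw [map_smul, map_sub, ← hmap, ← hmap, hup, hself, smul_eq_mul]

end MultiChain

/-- The determinant `det (g(zᵢ, z'ⱼ) - 1(i < j))`. -/
def cdfDet (g : ℤ → ℤ → ℝ) {k : ℕ} (z z' : Fin k → ℤ) : ℝ :=
  (Matrix.of fun i j : Fin k => g (z i) (z' j) - if i < j then 1 else 0).det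

/-- For an indicator kernel and increasing arguments the matrix is unitriangular, or has a block of
zeros which is too large for a nonzero determinant. -/
lemma cdfDet_indicator {g : ℤ → ℤ → ℝ} {k : ℕ} {z z' : Fin k → ℤ} (hz : Monotone z)
    (hz' : Monotone z') (hg : ∀ i j, g (z i) (z' j) = if z i ≤ z' j then 1 else 0) :
    cdfDet g z z' = if ∀ i, z i ≤ z' i then 1 else 0 := by
  split_ifs with h
  · rw [cdfDet, Matrix.det_of_isLowerTriangular]
    · refine Finset.prod_eq_one fun i _ => ?_
      simp [hg, h i]
    · intro i j hij
      have hij' : i < j := hij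
      simp [hg, hij', (h i).trans (hz' hij'.le)]
  · push Not at h
    obtain ⟨p, hp⟩ := h
    rw [cdfDet, det_eq_sum_rows]
    refine Finset.sum_eq_zero fun σ _ => ?_
    suffices ∃ i, p ≤ i ∧ σ i ≤ p by
      obtain ⟨i, hi, hi'⟩ := this
      rw [Finset.prod_eq_zero (Finset.mem_univ i), mul_zero]
      have h1 : ¬ i < σ i := not_lt.2 (hi'.trans hi)
      have h2 : ¬ z i ≤ z' (σ i) := not_le.2 (((hz' hi').trans_lt hp).trans_le (hz hi))
      simp [hg, h1, h2]
    by_contra! hcon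
    have h1 : (Finset.Ici p).image σ ⊆ Finset.Ioi p := by
      intro j hj
      obtain ⟨i, hi, rfl⟩ := Finset.mem_image.1 hj
      exact Finset.mem_Ioi.2 (hcon i (Finset.mem_Ici.1 hi))
    have h2 := Finset.card_le_card h1
    rw [Finset.card_image_of_injective _ σ.injective, Fin.card_Ici, Fin.card_Ioi] at h2
    have := p.2
    omega

/-- When two consecutive points coincide, their rows differ by a unit vector only, and the
determinant reduces to one with a point and a threshold less. -/
lemma cdfDet_of_eq {g : ℤ → ℤ → ℝ} {k : ℕ} {z z' : Fin (k + 1) → ℤ} {i : Fin k}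
    (h : z i.castSucc = z i.succ) :
    cdfDet g z z' = cdfDet g (z ∘ i.succ.succAbove) (z' ∘ i.succ.succAbove) := by
  set M : Matrix (Fin (k + 1)) (Fin (k + 1)) ℝ :=
    Matrix.of fun i j => g (z i) (z' j) - if i < j then 1 else 0 with hM
  have hne : i.castSucc ≠ i.succ := (Fin.castSucc_lt_succ).ne
  have h1 : (M.updateRow i.castSucc (M i.castSucc + (-1 : ℝ) • M i.succ)).det = M.det :=
    Matrix.det_updateRow_add_smul_self M hne (-1)
  have hrow : M i.castSucc + (-1 : ℝ) • M i.succ = fun j => if j = i.succ then -1 else 0 := by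
    funext j
    simp only [hM, Pi.add_apply, Pi.smul_apply, Matrix.of_apply, h, smul_eq_mul]
    rcases lt_trichotomy j i.succ with hj | hj | hj
    · have e1 : ¬ i.castSucc < j := by rw [Fin.lt_def] at *; simp at *; omega
      have e2 : ¬ i.succ < j := hj.not_gt
      simp [e1, e2, hj.ne]
    · subst hj
      simp
      ring
    · have e1 : i.castSucc < j := Fin.castSucc_lt_succ.trans hj
      simp [e1, hj, hj.ne']
  have h0 : cdfDet g z z' = M.det := rfl
  rw [h0, ← h1, hrow, Matrix.det_succ_row _ i.castSucc, Finset.sum_eq_single i.succ]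
  · rw [Matrix.updateRow_self, if_pos rfl]
    have hs : ((-1 : ℝ) ^ ((i.castSucc : ℕ) + (i.succ : ℕ)) * -1) = 1 := by
      rw [Fin.val_castSucc, Fin.val_succ, show (i : ℕ) + (i + 1) = 2 * i + 1 by ring, pow_succ,
        pow_mul]
      simp
    rw [hs, one_mul, cdfDet]
    congr 1
    ext p q
    rw [Matrix.submatrix_apply, Matrix.updateRow_ne (Fin.succAbove_ne _ _)]
    simp only [hM, Matrix.of_apply, Function.comp]
    have hzp : z (i.castSucc.succAbove p) = z (i.succ.succAbove p) := by
      by_cases hp : p = i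
      · subst hp
        rw [Fin.succAbove_castSucc_self, Fin.succAbove_succ_self, h]
      · congr 1
        rcases lt_or_gt_of_ne hp with hp | hp
        · rw [Fin.succAbove_of_castSucc_lt _ _ (Fin.castSucc_lt_castSucc_iff.2 hp),
            Fin.succAbove_of_castSucc_lt _ _ ((Fin.castSucc_lt_castSucc_iff.2 hp).trans
              Fin.castSucc_lt_succ)]
        · rw [Fin.succAbove_of_le_castSucc _ _ (Fin.castSucc_le_castSucc_iff.2 hp.le),
            Fin.succAbove_of_le_castSucc _ _ (Fin.succ_le_castSucc_iff.2 hp)]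
    rw [hzp]
    congr 1
    have : i.castSucc.succAbove p < i.succ.succAbove q ↔ p < q := by
      simp only [Fin.succAbove, Fin.lt_def, Fin.val_castSucc, Fin.val_succ]
      split_ifs <;> simp <;> omega
    simp only [this]
  · intro j _ hj
    rw [Matrix.updateRow_self, if_neg hj]
    simp
  · simp

/-- The bound on a determinant with bounded entries. -/
lemma abs_det_le_of_entries {ι : Type*} [Fintype ι] [DecidableEq ι] {M : Matrix ι ι ℝ} {x : ℝ}
    (h : ∀ i j, |M i j| ≤ x) : |M.det| ≤ (Fintype.card ι).factorial • x ^ Fintype.card ι :=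
  Matrix.det_le (abv := AbsoluteValue.abs) h

/-- The determinantal formula for coalescing chains: a family of functions `U k t z z'` of `k`
starting points `z` and thresholds `z'`, which solves the backward equation of independent chains at
pairwise distinct starting points, and which forgets one of two coinciding starting points
together with the larger threshold, is given by determinants. -/
theorem eq_cdfDet_of_coalescing {J : Set ℤ} {b d : ℤ → ℝ} (hJ : IsChain J b d)
    (hL : HasLyapunov J b d) {g : ℝ → ℤ → ℤ → ℝ}
    (hg : ∀ y, IsSol J (rate b d) move fun t x => g t x y)
    (hg1 : ∀ t, 0 ≤ t → ∀ x ∈ J, ∀ y, |g t x y| ≤ 1)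
    (hg0 : ∀ x ∈ J, ∀ y, g 0 x y = if x ≤ y then 1 else 0)
    {U : ∀ k : ℕ, ℝ → (Fin k → ℤ) → (Fin k → ℤ) → ℝ}
    (hU0 : ∀ t z z', 0 ≤ t → U 0 t z z' = 1)
    (hUb : ∀ k t z z', 0 ≤ t → |U k t z z'| ≤ 1)
    (hU : ∀ k (z' : Fin k → ℤ), ∀ T, 0 ≤ T → ∀ z : Fin k → ℤ, (∀ i, z i ∈ J) → StrictMono z →
      ContinuousOn (fun t => U k t z z') (Set.Icc 0 T) ∧ ∀ t ∈ Set.Ico 0 T,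
        HasDerivWithinAt (fun t => U k t z z')
          (gen (multiRate (fun _ => b) fun _ => d) multiMove (fun z => U k t z z') z) (Set.Ici t) t)
    (hUi : ∀ k (z z' : Fin k → ℤ), (∀ i, z i ∈ J) →
      U k 0 z z' = if ∀ i, z i ≤ z' i then 1 else 0)
    (hUc : ∀ k (z z' : Fin (k + 1) → ℤ) (i : Fin k) t, 0 ≤ t → (∀ i, z i ∈ J) → Monotone z' →
      z i.castSucc = z i.succ →
      U (k + 1) t z z' = U k t (z ∘ i.succ.succAbove) (z' ∘ i.succ.succAbove))
    (k : ℕ) (z z' : Fin k → ℤ) (hz : ∀ i, z i ∈ J) (hzm : Monotone z) (hzm' : Monotone z')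
    (t : ℝ) (ht : 0 ≤ t) : U k t z z' = cdfDet (g t) z z' := by
  classical
  induction k generalizing t with
  | zero => rw [hU0 t z z' ht, cdfDet, Matrix.det_isEmpty]
  | succ k ih =>
    set D : Set (Fin (k + 1) → ℤ) := {z | (∀ i, z i ∈ J) ∧ StrictMono z} with hD
    -- At coinciding starting points both sides reduce to `k` points.
    have htie : ∀ z : Fin (k + 1) → ℤ, (∀ i, z i ∈ J) → Monotone z → ¬ StrictMono z →
        ∀ t, 0 ≤ t → U (k + 1) t z z' = cdfDet (g t) z z' := by
      intro z hz hm hs t ht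
      rw [Fin.strictMono_iff_lt_succ] at hs
      push Not at hs
      obtain ⟨i, hi⟩ := hs
      have hi' : z i.castSucc = z i.succ := le_antisymm (hm Fin.castSucc_lt_succ.le) hi
      rw [hUc k z z' i t ht hz hzm' hi', cdfDet_of_eq hi']
      exact ih _ _ (fun _ => hz _) (hm.comp (Fin.strictMono_succAbove _).monotone)
        (hzm'.comp (Fin.strictMono_succAbove _).monotone) t ht
    have hr : ∀ a, ∀ z ∈ D, 0 ≤ multiRate (fun _ => b) (fun _ => d) a z :=
      fun a z hz => hJ.rate_nonneg _ _ (hz.1 _)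
    have hconf : Confined D (multiRate (fun _ => b) fun _ => d) multiMove := by
      obtain ⟨V, C, hV, hC, hf⟩ := hL
      refine Confined.of_single (fun z => ∑ i, V (z i)) (∑ _i : Fin (k + 1), C)
        (fun z => Finset.sum_nonneg fun i _ => hV _) (fun z hz => ?_) (fun K => ?_)
      · rw [gen_multi_sum (fun _ => b) (fun _ => d) (fun _ => V)]
        exact Finset.sum_le_sum fun i _ => hC _ (hz.1 i)
      · refine (Set.Finite.pi fun _ : Fin (k + 1) => hf K).subset fun z hz i _ => ⟨hz.1.1 i, ?_⟩
        exact (Finset.single_le_sum (f := fun i => V (z i)) (fun i _ => hV _)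
          (Finset.mem_univ i)).trans hz.2
    -- One move from distinct starting points leads at worst to coinciding ones, so that the
    -- difference of both sides vanishes off `D` at all states which can be reached from `D`.
    have hmoveJ : ∀ z ∈ D, ∀ a, multiRate (fun _ => b) (fun _ => d) a z ≠ 0 →
        (∀ i, multiMove a z i ∈ J) ∧ Monotone (multiMove a z) := by
      rintro z hz ⟨i, a⟩ ha
      refine ⟨fun j => ?_, Fin.monotone_iff_le_succ.2 fun j => ?_⟩
      · by_cases hj : j = i
        · subst hj
          simpa [multiMove] using hJ.move_mem _ (hz.1 j) a ha
        · simpa [multiMove, hj] using hz.1 j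
      · have h1 := hz.2 (Fin.castSucc_lt_succ (i := j))
        have hne : j.castSucc ≠ j.succ := Fin.castSucc_lt_succ.ne
        have hmv : z i - 1 ≤ move a (z i) ∧ move a (z i) ≤ z i + 1 := by
          cases a
          · simp only [move_up]; omega
          · simp only [move_down]; omega
        simp only [multiMove, Function.update_apply]
        split_ifs with h2 h3 h3
        · exact le_rfl
        · rw [h2] at h1; omega
        · rw [h3] at h1; omega
        · exact h1.le
    have hdet : IsSol D (multiRate (fun _ => b) fun _ => d) multiMove
        fun t z => cdfDet (g t) z z' := by
      intro z hz t ht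
      refine hasDerivWithinAt_rowDet (b := fun _ => b) (d := fun _ => d)
        (ρ := fun t i x c => g t x (z' c) - if i < c then 1 else 0) fun i c => ?_
      exact ((hg (z' c)).sub (IsSol.const _)) (z i) (hz.1 i) t ht
    have hdetb : ∀ t, 0 ≤ t → ∀ z ∈ D, |cdfDet (g t) z z'| ≤
        (Fintype.card (Fin (k + 1))).factorial • (2 : ℝ) ^ Fintype.card (Fin (k + 1)) := by
      intro t ht z hz
      refine abs_det_le_of_entries fun i j => ?_
      have h1 := hg1 t ht (z i) (hz.1 i) (z' j)
      have h2 : |if i < j then (1 : ℝ) else 0| ≤ 1 := by split_ifs <;> simp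
      exact (abs_sub _ _).trans (by linarith)
    have hinit : ∀ z ∈ D, U (k + 1) 0 z z' = cdfDet (g 0) z z' := by
      intro z hz
      rw [hUi _ z z' hz.1, cdfDet_indicator hz.2.monotone hzm' fun i j => hg0 _ (hz.1 i) _]
    -- The maximum principle, applied to both signs of the difference.
    have main : ∀ (c : ℝ), (c = 1 ∨ c = -1) → ∀ z ∈ D,
        c * (U (k + 1) t z z' - cdfDet (g t) z z') ≤ 0 := by
      intro c hc z hz
      set w : ℝ → (Fin (k + 1) → ℤ) → ℝ := fun t z =>
        if z ∈ D then c * (U (k + 1) t z z' - cdfDet (g t) z z') else 0 with hw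
      have hwD : ∀ z ∈ D, (fun t => w t z) =
          fun t => c * (U (k + 1) t z z' - cdfDet (g t) z z') := by
        intro z hz; funext t; simp [hw, hz]
      have hcabs : |c| = 1 := by rcases hc with rfl | rfl <;> simp
      have := max_principle (T := t) (M := 1 + (Fintype.card (Fin (k + 1))).factorial •
          (2 : ℝ) ^ Fintype.card (Fin (k + 1))) (w := w)
        (w' := fun t z => gen (multiRate (fun _ => b) fun _ => d) multiMove
          (fun z => c * (U (k + 1) t z z' - cdfDet (g t) z z')) z) hr hconf
        (fun s hs z hz => by
          simp only [hw, hz, if_true]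
          refine (le_abs_self _).trans ?_
          rw [abs_mul, hcabs, one_mul]
          exact (abs_sub _ _).trans (add_le_add (hUb _ _ _ _ hs.1) (hdetb s hs.1 z hz)))
        (fun z hz => by
          rw [hwD z hz]
          exact continuousOn_const.mul ((hU (k + 1) z' t ht z hz.1 hz.2).1.sub
            ((hdet.continuousOn hz).mono fun s hs => hs.1)))
        (fun z hz s hs => by
          rw [hwD z hz, gen_const_mul, gen_sub]
          exact (((hU (k + 1) z' t ht z hz.1 hz.2).2 s hs).sub
            ((hdet z hz s hs.1).mono (Set.Ici_subset_Ici.2 hs.1))).const_mul c)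
        (fun z hz s hs => by
          refine (gen_congr (by simp [hw, hz]) fun a ha => ?_).le
          by_cases hD' : multiMove a z ∈ D
          · simp [hw, hD']
          · have h2 := hmoveJ z hz a ha
            have h3 : ¬ StrictMono (multiMove a z) := fun h => hD' ⟨h2.1, h⟩
            simp [hw, hD', htie _ h2.1 h2.2 h3 s hs.1])
        (fun z => by
          by_cases hz : z ∈ D
          · simp [hw, hz, hinit z hz]
          · simp [hw, hz])
        (fun s _ z hz => by simp [hw, hz]) t ⟨ht, le_rfl⟩ z
      simpa [hw, hz] using this
    by_cases hs : StrictMono z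
    · have h1 := main 1 (Or.inl rfl) z ⟨hz, hs⟩
      have h2 := main (-1) (Or.inr rfl) z ⟨hz, hs⟩
      linarith
    · exact htie z hz hzm hs t ht

/-! ### Iterated differences -/

/-- The iterated difference operator with step `ε` in the variables of the list `l`. -/
def diffList {m : ℕ} (ε : ℤ) (l : List (Fin m)) (F : (Fin m → ℤ) → ℝ) : (Fin m → ℤ) → ℝ :=
  l.foldr (fun i G v => G (Function.update v i (v i + ε)) - G v) F

lemma fwdAll_eq {m : ℕ} (F : (Fin m → ℤ) → ℝ) : fwdAll F = diffList 1 (List.finRange m) F := by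
  simp only [fwdAll, fwd, diffList, Function.update_eq_self]

lemma bwdAll_eq {m : ℕ} (F : (Fin m → ℤ) → ℝ) : bwdAll F = diffList (-1) (List.finRange m) F := by
  simp only [bwdAll, bwd, diffList, Function.update_eq_self, sub_eq_add_neg]

section diffList

variable {m : ℕ} {ε : ℤ} {l : List (Fin m)}

lemma diffList_cons (i : Fin m) (F : (Fin m → ℤ) → ℝ) (v : Fin m → ℤ) :
    diffList ε (i :: l) F v =
      diffList ε l F (Function.update v i (v i + ε)) - diffList ε l F v := rfl

lemma diffList_congr (hl : l.Nodup) {F G : (Fin m → ℤ) → ℝ} {v : Fin m → ℤ}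
    (h : ∀ v', (∀ j, v' j = v j ∨ (j ∈ l ∧ v' j = v j + ε)) → F v' = G v') :
    diffList ε l F v = diffList ε l G v := by
  induction l generalizing v with
  | nil => exact h v fun j => Or.inl rfl
  | cons i l ih =>
    rw [List.nodup_cons] at hl
    rw [diffList_cons, diffList_cons]
    congr 1
    · refine ih hl.2 fun v' hv' => h v' fun j => ?_
      by_cases hj : j = i
      · subst hj
        rcases hv' j with h1 | h1
        · right; simpa using h1
        · exact (hl.1 h1.1).elim
      · rcases hv' j with h1 | h1
        · left; simpa [hj] using h1
        · right; simpa [hj] using h1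
    · refine ih hl.2 fun v' hv' => h v' fun j => ?_
      rcases hv' j with h1 | h1
      · exact Or.inl h1
      · exact Or.inr ⟨List.mem_cons_of_mem _ h1.1, h1.2⟩

lemma diffList_const_mul (c : ℝ) (F : (Fin m → ℤ) → ℝ) (v : Fin m → ℤ) :
    diffList ε l (fun v => c * F v) v = c * diffList ε l F v := by
  induction l generalizing v with
  | nil => rfl
  | cons i l ih => rw [diffList_cons, diffList_cons, ih, ih, mul_sub]

/-- Iterated differences of a multilinear function of single-variable functions. -/
lemma diffList_multilinear {E : Type*} [AddCommGroup E] [Module ℝ E] (hl : l.Nodup)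
    (M : MultilinearMap ℝ (fun _ : Fin m => E) ℝ) (φ : Fin m → ℤ → E) (v : Fin m → ℤ) :
    diffList ε l (fun v => M fun j => φ j (v j)) v =
      M fun j => if j ∈ l then φ j (v j + ε) - φ j (v j) else φ j (v j) := by
  induction l generalizing v with
  | nil => simp [diffList]
  | cons i l ih =>
    rw [List.nodup_cons] at hl
    rw [diffList_cons, ih hl.2, ih hl.2]
    set N : Fin m → E := fun j => if j ∈ l then φ j (v j + ε) - φ j (v j) else φ j (v j) with hN
    have h1 : (fun j => if j ∈ l then φ j (Function.update v i (v i + ε) j + ε) -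
        φ j (Function.update v i (v i + ε) j) else φ j (Function.update v i (v i + ε) j)) =
        Function.update N i (φ i (v i + ε)) := by
      funext j
      by_cases hj : j = i
      · subst hj; simp [hl.1]
      · simp [hj, hN]
    have h2 : N = Function.update N i (φ i (v i)) := by
      funext j
      by_cases hj : j = i
      · subst hj; simp [hl.1, hN]
      · simp [hj]
    rw [h1]
    conv_lhs => rw [h2, Function.update_idem]
    rw [← M.map_update_sub]
    congr 1
    funext j
    by_cases hj : j = i
    · subst hj; simp
    · simp [hj, hN]

lemma diffList_integral {Ω : Type*} [MeasurableSpace Ω] {P : Measure Ω}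
    {f : (Fin m → ℤ) → Ω → ℝ} (hf : ∀ v, Integrable (f v) P) (v : Fin m → ℤ) :
    Integrable (fun ω => diffList ε l (fun v => f v ω) v) P ∧
    diffList ε l (fun v => ∫ ω, f v ω ∂P) v = ∫ ω, diffList ε l (fun v => f v ω) v ∂P := by
  induction l generalizing v with
  | nil => exact ⟨hf v, rfl⟩
  | cons i l ih =>
    simp only [diffList_cons]
    refine ⟨(ih _).1.sub (ih _).1, ?_⟩
    rw [integral_sub (ih _).1 (ih _).1, (ih _).2, (ih _).2]

end diffList

/-- Iterated differences of the probability of an intersection of events which depend on one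
variable each. -/
lemma diffList_measure_inter {Ω : Type*} [MeasurableSpace Ω] {P : Measure Ω} [IsFiniteMeasure P]
    {m n : ℕ} {ε ε' : ℤ} {A : Fin m → ℤ → Set Ω} {B : Fin n → ℤ → Set Ω} {A' : Fin m → Set Ω}
    {B' : Fin n → Set Ω} (hA : ∀ i w, NullMeasurableSet (A i w) P)
    (hB : ∀ i w, NullMeasurableSet (B i w) P) {x : Fin m → ℤ} {y : Fin n → ℤ}
    (hA' : ∀ i, ∀ᵐ ω ∂P, (A i (x i + ε)).indicator 1 ω - (A i (x i)).indicator 1 ω =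
      (-(A' i).indicator 1 ω : ℝ))
    (hB' : ∀ i, ∀ᵐ ω ∂P, (B i (y i + ε')).indicator 1 ω - (B i (y i)).indicator 1 ω =
      (-(B' i).indicator 1 ω : ℝ))
    (hm : NullMeasurableSet {ω | (∀ i, ω ∈ A' i) ∧ ∀ j, ω ∈ B' j} P) :
    diffList ε' (List.finRange n) (fun y => diffList ε (List.finRange m) (fun x =>
      P.real {ω | (∀ i, ω ∈ A i (x i)) ∧ ∀ j, ω ∈ B j (y j)}) x) y =
      (-1) ^ m * (-1) ^ n * P.real {ω | (∀ i, ω ∈ A' i) ∧ ∀ j, ω ∈ B' j} := by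
  classical
  have hind : ∀ (s : Fin m → Set Ω) (t : Fin n → Set Ω) ω,
      ({ω | (∀ i, ω ∈ s i) ∧ ∀ j, ω ∈ t j}.indicator 1 ω : ℝ) =
        (∏ i, (s i).indicator 1 ω) * ∏ j, (t j).indicator 1 ω := by
    intro s t ω
    by_cases h : ω ∈ {ω | (∀ i, ω ∈ s i) ∧ ∀ j, ω ∈ t j}
    · rw [Set.indicator_of_mem h, Finset.prod_eq_one fun i _ => Set.indicator_of_mem (h.1 i) 1,
        Finset.prod_eq_one fun i _ => Set.indicator_of_mem (h.2 i) 1]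
      simp
    · rw [Set.indicator_of_notMem h]
      have : (∃ i, ω ∉ s i) ∨ ∃ j, ω ∉ t j := by
        by_contra! hcon
        exact h hcon
      rcases this with ⟨i, hi⟩ | ⟨i, hi⟩
      · rw [Finset.prod_eq_zero (Finset.mem_univ i) (Set.indicator_of_notMem hi 1), zero_mul]
      · rw [Finset.prod_eq_zero (i := i) (f := fun j => (t j).indicator (1 : Ω → ℝ) ω)
          (Finset.mem_univ i) (Set.indicator_of_notMem hi 1), mul_zero]
  have hnm : ∀ (x : Fin m → ℤ) (y : Fin n → ℤ),
      NullMeasurableSet {ω | (∀ i, ω ∈ A i (x i)) ∧ ∀ j, ω ∈ B j (y j)} P := by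
    intro x y
    have : {ω | (∀ i, ω ∈ A i (x i)) ∧ ∀ j, ω ∈ B j (y j)} =
        (⋂ i, A i (x i)) ∩ ⋂ j, B j (y j) := by ext; simp
    rw [this]
    exact (NullMeasurableSet.iInter fun i => hA _ _).inter
      (NullMeasurableSet.iInter fun j => hB _ _)
  have hreal : ∀ s : Set Ω, NullMeasurableSet s P → P.real s = ∫ ω, s.indicator 1 ω ∂P := by
    intro s hs
    rw [integral_indicator₀ hs]
    simp
  have hint : ∀ s : Set Ω, NullMeasurableSet s P →
      Integrable (fun ω => s.indicator (1 : Ω → ℝ) ω) P :=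
    fun s hs => (integrable_const (1 : ℝ)).indicator₀ hs
  have e1 : ∀ y : Fin n → ℤ,
      (fun x : Fin m → ℤ => P.real {ω | (∀ i, ω ∈ A i (x i)) ∧ ∀ j, ω ∈ B j (y j)}) =
      fun x => ∫ ω, {ω | (∀ i, ω ∈ A i (x i)) ∧ ∀ j, ω ∈ B j (y j)}.indicator 1 ω ∂P :=
    fun y => funext fun x => hreal _ (hnm x y)
  simp only [e1]
  have e2 := fun y : Fin n → ℤ => diffList_integral (ε := ε) (l := List.finRange m) (P := P)
    (f := fun x ω => {ω | (∀ i, ω ∈ A i (x i)) ∧ ∀ j, ω ∈ B j (y j)}.indicator 1 ω)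
    (fun x => hint _ (hnm x y)) x
  simp only [(e2 _).2]
  rw [(diffList_integral (fun y => (e2 y).1) y).2, hreal _ hm, ← integral_const_mul]
  refine integral_congr_ae ?_
  filter_upwards [ae_all_iff.2 hA', ae_all_iff.2 hB'] with ω hω hω'
  simp only [hind]
  have e3 : ∀ y : Fin n → ℤ, diffList ε (List.finRange m) (fun x : Fin m → ℤ =>
      (∏ i, (A i (x i)).indicator (1 : Ω → ℝ) ω) * ∏ j, (B j (y j)).indicator (1 : Ω → ℝ) ω) x =
      ((-1) ^ m * ∏ i, (A' i).indicator (1 : Ω → ℝ) ω) * ∏ j, (B j (y j)).indicator 1 ω := by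
    intro y
    have h := diffList_const_mul (ε := ε) (l := List.finRange m)
      (∏ j, (B j (y j)).indicator (1 : Ω → ℝ) ω)
      (fun x : Fin m → ℤ => ∏ i, (A i (x i)).indicator (1 : Ω → ℝ) ω) x
    have h' := diffList_multilinear (ε := ε) (List.nodup_finRange m)
      (MultilinearMap.mkPiAlgebra ℝ (Fin m) ℝ) (fun i w => (A i w).indicator (1 : Ω → ℝ) ω) x
    simp only [MultilinearMap.mkPiAlgebra_apply, List.mem_finRange, if_true, hω] at h'
    rw [h', Finset.prod_neg, Finset.card_univ, Fintype.card_fin] at h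
    rw [mul_comm, ← h]
    congr 1
    funext x
    exact mul_comm _ _
  simp only [e3]
  have h := diffList_const_mul (ε := ε') (l := List.finRange n)
      ((-1) ^ m * ∏ i, (A' i).indicator (1 : Ω → ℝ) ω)
      (fun y : Fin n → ℤ => ∏ i, (B i (y i)).indicator (1 : Ω → ℝ) ω) y
  have h' := diffList_multilinear (ε := ε') (List.nodup_finRange n)
      (MultilinearMap.mkPiAlgebra ℝ (Fin n) ℝ) (fun i w => (B i w).indicator (1 : Ω → ℝ) ω) y
  simp only [MultilinearMap.mkPiAlgebra_apply, List.mem_finRange, if_true, hω'] at h'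
  rw [h', Finset.prod_neg, Finset.card_univ, Fintype.card_fin] at h
  rw [h]
  ring

/-! ### Interlacing sequences and block determinants -/

/-- The weak interlacing `x₁ ≤ y₁ ≤ x₂ ≤ y₂ ≤ ⋯`. -/
def WeakInterlaced {m n : ℕ} (x : Fin m → ℤ) (y : Fin n → ℤ) : Prop :=
  ∀ (i : Fin m) (j : Fin n), ((i : ℕ) ≤ j → x i ≤ y j) ∧ ((j : ℕ) < i → y j ≤ x i)

/-- The interlacing `x₁ ≤ y₁ < x₂ ≤ y₂ < ⋯`. -/
def Interlaced {m n : ℕ} (x : Fin m → ℤ) (y : Fin n → ℤ) : Prop :=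
  ∀ (i : Fin m) (j : Fin n), ((i : ℕ) ≤ j → x i ≤ y j) ∧ ((j : ℕ) < i → y j < x i)

/-- The position of a particle in the order `x₁, y₁, x₂, y₂, …`. -/
def interPos {m n : ℕ} : Fin m ⊕ Fin n → ℕ := Sum.elim (fun i => 2 * i) fun j => 2 * j + 1

/-- The enumeration of the particles in the order `x₁, y₁, x₂, y₂, …`. -/
def interEquiv {m n : ℕ} (h : n ≤ m) (h' : m ≤ n + 1) : Fin m ⊕ Fin n ≃ Fin (m + n) :=
  Equiv.ofBijective
    (fun s => ⟨interPos s, by rcases s with i | j <;> simp [interPos] <;> omega⟩) (by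
    rw [Fintype.bijective_iff_injective_and_card]
    refine ⟨fun s s' hs => ?_, by simp⟩
    have := Fin.mk.inj_iff.1 hs
    rcases s with i | i <;> rcases s' with j | j <;> simp [interPos] at this ⊢ <;> omega)

lemma interEquiv_lt {m n : ℕ} (h : n ≤ m) (h' : m ≤ n + 1) (s s' : Fin m ⊕ Fin n) :
    interEquiv h h' s < interEquiv h h' s' ↔ interPos s < interPos s' := Iff.rfl

/-- The interlaced sequence `x₁, y₁, x₂, y₂, …`. -/
def interSeq {m n : ℕ} (h : n ≤ m) (h' : m ≤ n + 1) (x : Fin m → ℤ) (y : Fin n → ℤ) :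
    Fin (m + n) → ℤ := Sum.elim x y ∘ (interEquiv h h').symm

lemma interSeq_monotone {m n : ℕ} (h : n ≤ m) (h' : m ≤ n + 1) {x : Fin m → ℤ} {y : Fin n → ℤ}
    (hxy : WeakInterlaced x y) : Monotone (interSeq h h' x y) := by
  intro p q hpq
  obtain ⟨s, rfl⟩ := (interEquiv h h').surjective p
  obtain ⟨s', rfl⟩ := (interEquiv h h').surjective q
  simp only [interSeq, Function.comp, Equiv.symm_apply_apply]
  have hpos : interPos s ≤ interPos s' := hpq
  rcases s with i | i <;> rcases s' with j | j <;>
    simp only [interPos, Sum.elim_inl, Sum.elim_inr] at hpos ⊢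
  · rcases (show (i : ℕ) ≤ j by omega).lt_or_eq with hij | hij
    · have := (hxy i ⟨i, by omega⟩).1 le_rfl
      exact this.trans ((hxy j ⟨i, by omega⟩).2 hij)
    · rw [Fin.ext hij]
  · exact (hxy i j).1 (by omega)
  · exact (hxy j i).2 (by omega)
  · rcases (show (i : ℕ) ≤ j by omega).lt_or_eq with hij | hij
    · have := (hxy ⟨j, by omega⟩ j).1 le_rfl
      exact ((hxy ⟨j, by omega⟩ i).2 hij).trans this
    · rw [Fin.ext hij]

/-- The matrix of `cdfDet` for interlaced sequences, in block form. -/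
def interMatrix (g : ℤ → ℤ → ℝ) {m n : ℕ} (x : Fin m → ℤ) (y : Fin n → ℤ) (x' : Fin m → ℤ)
    (y' : Fin n → ℤ) : Matrix (Fin m ⊕ Fin n) (Fin m ⊕ Fin n) ℝ :=
  Matrix.of fun s s' => g (Sum.elim x y s) (Sum.elim x' y' s') -
    if interPos s < interPos s' then 1 else 0

lemma cdfDet_interSeq (g : ℤ → ℤ → ℝ) {m n : ℕ} (h : n ≤ m) (h' : m ≤ n + 1) (x : Fin m → ℤ)
    (y : Fin n → ℤ) (x' : Fin m → ℤ) (y' : Fin n → ℤ) :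
    cdfDet g (interSeq h h' x y) (interSeq h h' x' y') = (interMatrix g x y x' y').det := by
  rw [cdfDet, ← Matrix.det_submatrix_equiv_self (interEquiv h h')]
  congr 1
  ext s s'
  simp [interMatrix, interSeq, interEquiv_lt]

/-- The matrix obtained from `interMatrix` by taking forward differences in the variables `y` and
backward differences in the variables `x'`. -/
def diffMatrix (g : ℤ → ℤ → ℝ) {m n : ℕ} (x : Fin m → ℤ) (y : Fin n → ℤ) (x' : Fin m → ℤ)
    (y' : Fin n → ℤ) : Matrix (Fin m ⊕ Fin n) (Fin m ⊕ Fin n) ℝ :=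
  Matrix.fromBlocks
    (Matrix.of fun i j => g (x i) (x' j - 1) - g (x i) (x' j))
    (Matrix.of fun (i : Fin m) (j : Fin n) => g (x i) (y' j) - if (i : ℕ) ≤ j then 1 else 0)
    (Matrix.of fun i j => (g (y i + 1) (x' j - 1) - g (y i + 1) (x' j)) -
      (g (y i) (x' j - 1) - g (y i) (x' j)))
    (Matrix.of fun i j => g (y i + 1) (y' j) - g (y i) (y' j))

/-- The determinant is linear in the columns indexed by `x'` and in the rows indexed by `y`, and
each of these columns and rows depends on a single variable. The indicators do not depend on these
variables, so they disappear from the differenced rows and columns. -/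
lemma diffList_interMatrix (g : ℤ → ℤ → ℝ) {m n : ℕ} (x : Fin m → ℤ) (y : Fin n → ℤ)
    (x' : Fin m → ℤ) (y' : Fin n → ℤ) :
    diffList 1 (List.finRange n) (fun y => diffList (-1) (List.finRange m)
      (fun x' => (interMatrix g x y x' y').det) x') y = (diffMatrix g x y x' y').det := by
  set Dt : MultilinearMap ℝ (fun _ : Fin m ⊕ Fin n => Fin m ⊕ Fin n → ℝ) ℝ :=
    (Matrix.detRowAlternating (n := Fin m ⊕ Fin n) (R := ℝ)).toMultilinearMap
  have hDt : ∀ M : Matrix (Fin m ⊕ Fin n) (Fin m ⊕ Fin n) ℝ, Dt M = M.det := fun _ => rfl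
  -- differences in the columns
  set Mc : (Fin n → ℤ) → Matrix (Fin m ⊕ Fin n) (Fin m ⊕ Fin n) ℝ := fun y =>
    Matrix.of fun s s' => Sum.elim
      (fun j => g (Sum.elim x y s) (x' j - 1) - g (Sum.elim x y s) (x' j))
      (fun j => g (Sum.elim x y s) (y' j) - if interPos s < 2 * (j : ℕ) + 1 then 1 else 0) s'
  have hcol : ∀ y, diffList (-1) (List.finRange m)
      (fun x' => (interMatrix g x y x' y').det) x' = (Mc y).det := by
    intro y
    set colR : Fin n → Fin m ⊕ Fin n → ℝ := fun j s => g (Sum.elim x y s) (y' j) -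
      if interPos s < 2 * (j : ℕ) + 1 then 1 else 0
    set colL : Fin m → ℤ → Fin m ⊕ Fin n → ℝ := fun j w s => g (Sum.elim x y s) w -
      if interPos s < 2 * (j : ℕ) then 1 else 0
    have h1 : ∀ x', (interMatrix g x y x' y').det =
        (Dt.domDomCongr (Equiv.sumComm _ _)).currySum colR fun j => colL j (x' j) := by
      intro x'
      rw [← Matrix.det_transpose, ← hDt]
      simp only [MultilinearMap.currySum_apply, MultilinearMap.domDomCongr_apply]
      congr 1
      funext s s'
      rcases s with j | j <;> rfl
    simp only [h1]
    rw [diffList_multilinear (List.nodup_finRange m)]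
    rw [← Matrix.det_transpose, ← hDt]
    simp only [MultilinearMap.currySum_apply, MultilinearMap.domDomCongr_apply, List.mem_finRange,
      if_true]
    congr 1
    funext s s'
    rcases s with j | j
    · simp [colL, Mc, sub_eq_add_neg]
    · rfl
  simp only [hcol]
  -- differences in the rows
  set rowL : Fin m → Fin m ⊕ Fin n → ℝ := fun i => Sum.elim
      (fun j => g (x i) (x' j - 1) - g (x i) (x' j))
      (fun j => g (x i) (y' j) - if (i : ℕ) ≤ j then 1 else 0)
  set rowR : Fin n → ℤ → Fin m ⊕ Fin n → ℝ := fun i w => Sum.elim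
      (fun j => g w (x' j - 1) - g w (x' j))
      (fun j => g w (y' j) - if (i : ℕ) < j then 1 else 0)
  have h2 : ∀ y, (Mc y).det = Dt.currySum rowL fun j => rowR j (y j) := by
    intro y
    rw [← hDt]
    simp only [MultilinearMap.currySum_apply]
    congr 1
    funext s s'
    rcases s with i | i <;> rcases s' with j | j
    · rfl
    · simp [Mc, rowL, interPos]
    · rfl
    · simp [Mc, rowR, interPos]
  simp only [h2]
  rw [diffList_multilinear (List.nodup_finRange n), ← hDt]
  simp only [MultilinearMap.currySum_apply, List.mem_finRange, if_true]
  congr 1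
  funext s s'
  rcases s with i | i <;> rcases s' with j | j
  · rfl
  · rfl
  · rfl
  · simp [rowR, diffMatrix]

/-- If a function agrees with `cdfDet` at weakly interlaced arguments, then its iterated differences
at interlaced arguments form the block determinant of differences. -/
lemma diffList_eq_det_diffMatrix {g : ℤ → ℤ → ℝ} {m n : ℕ} {F : (Fin n → ℤ) → (Fin m → ℤ) → ℝ}
    {x x' : Fin m → ℤ} {y y' : Fin n → ℤ} (hxy : Interlaced x y) (hxy' : Interlaced x' y')
    (hF : ∀ v w, WeakInterlaced x v → WeakInterlaced w y' → (∀ j, v j = y j ∨ v j = y j + 1) →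
      F v w = (interMatrix g x v w y').det) :
    diffList 1 (List.finRange n) (fun v => diffList (-1) (List.finRange m) (F v) x') y =
      (diffMatrix g x y x' y').det := by
  rw [← diffList_interMatrix]
  refine diffList_congr (List.nodup_finRange n) fun v hv => ?_
  refine diffList_congr (List.nodup_finRange m) fun w hw => ?_
  refine hF v w (fun i j => ?_) (fun i j => ?_) fun j => (hv j).imp_right And.right
  · have := hxy i j
    rcases hv j with h | ⟨-, h⟩ <;> rw [h] <;> exact ⟨fun hij => by have := this.1 hij; omega,
      fun hij => by have := this.2 hij; omega⟩
  · have := hxy' i j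
    rcases hw i with h | ⟨-, h⟩ <;> rw [h] <;> exact ⟨fun hij => by have := this.1 hij; omega,
      fun hij => by have := this.2 hij; omega⟩

/-! ### Sub-Markov kernels from bounded solutions of backward equations -/

/-- A transition function of a Markov process with possibly finite lifetime on a discrete space. -/
structure IsSubMarkovKernel {X : Type*} (q : ℝ → X → X → ℝ) : Prop where
  nonneg : ∀ t, 0 ≤ t → ∀ x y, 0 ≤ q t x y
  sum_le : ∀ t, 0 ≤ t → ∀ x (F : Finset X), ∑ y ∈ F, q t x y ≤ 1
  zero_self : ∀ x, q 0 x x = 1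
  zero_ne : ∀ x y, x ≠ y → q 0 x y = 0
  hasSum : ∀ s t, 0 ≤ s → 0 ≤ t → ∀ x z, HasSum (fun y => q t x y * q s y z) (q (t + s) x z)
  tendsto : ∀ x, Filter.Tendsto (fun t => q t x x) (nhdsWithin 0 (Set.Ioi 0)) (nhds 1)

namespace IsSubMarkovKernel

variable {X : Type*} {q : ℝ → X → X → ℝ}

lemma summable (hq : IsSubMarkovKernel q) {t : ℝ} (ht : 0 ≤ t) (x : X) : Summable (q t x) :=
  summable_of_sum_le (hq.nonneg t ht x) (hq.sum_le t ht x)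

lemma tsum_le_one (hq : IsSubMarkovKernel q) {t : ℝ} (ht : 0 ≤ t) (x : X) : ∑' y, q t x y ≤ 1 :=
  (hq.summable ht x).tsum_le_of_sum_le (hq.sum_le t ht x)

lemma summable_mul (hq : IsSubMarkovKernel q) {t : ℝ} (ht : 0 ≤ t) (x : X) {f : X → ℝ}
    (hf : IsBoundedFn f) : Summable fun y => q t x y * f y := by
  obtain ⟨C, hC⟩ := hf
  refine Summable.of_norm_bounded ((hq.summable ht x).mul_right C) fun y => ?_
  rw [norm_mul, Real.norm_of_nonneg (hq.nonneg t ht x y)]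
  exact mul_le_mul_of_nonneg_left (hC y) (hq.nonneg t ht x y)

lemma abs_kernelOp_le (hq : IsSubMarkovKernel q) {t : ℝ} (ht : 0 ≤ t) (x : X) {f : X → ℝ} {C : ℝ}
    (hC : ∀ y, |f y| ≤ C) : |kernelOp (q t) f x| ≤ C := by
  have hC0 : 0 ≤ C := (abs_nonneg _).trans (hC x)
  have h1 : ∀ y, ‖q t x y * f y‖ ≤ q t x y * C := fun y => by
    rw [norm_mul, Real.norm_of_nonneg (hq.nonneg t ht x y)]
    exact mul_le_mul_of_nonneg_left (hC y) (hq.nonneg t ht x y)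
  refine (tsum_of_norm_bounded ((hq.summable ht x).mul_right C).hasSum h1).trans ?_
  rw [tsum_mul_right]
  exact mul_le_of_le_one_left hC0 (hq.tsum_le_one ht x)

theorem isSubMarkovSemigroup (hq : IsSubMarkovKernel q) :
    IsSubMarkovSemigroup fun t => kernelOp (q t) where
  bounded := fun t ht f ⟨C, hC⟩ => ⟨C, fun z => hq.abs_kernelOp_le ht z hC⟩
  zero := fun f _ => by
    funext x
    rw [kernelOp, tsum_eq_single x fun y hy => by rw [hq.zero_ne x y hy.symm, zero_mul],
      hq.zero_self, one_mul]
  le_one := fun t ht z => by simpa [kernelOp] using hq.tsum_le_one ht z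
  nonneg := fun t ht f _ hf z => tsum_nonneg fun y => mul_nonneg (hq.nonneg t ht z y) (hf y)
  add := fun s t hs ht f hf => by
    obtain ⟨C, hC⟩ := hf
    funext x
    have hsum : Summable fun p : X × X => q t x p.1 * q s p.1 p.2 * f p.2 := by
      have hbase : Summable fun p : X × X => q t x p.1 * q s p.1 p.2 := by
        have hn : ∀ p : X × X, 0 ≤ q t x p.1 * q s p.1 p.2 := fun p =>
          mul_nonneg (hq.nonneg t ht x p.1) (hq.nonneg s hs p.1 p.2)
        refine (summable_prod_of_nonneg hn).2 ⟨fun y => (hq.summable hs y).mul_left (q t x y), ?_⟩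
        simp only [tsum_mul_left]
        refine hq.summable_mul ht x ⟨1, fun y => ?_⟩
        rw [abs_of_nonneg (tsum_nonneg (hq.nonneg s hs y))]
        exact hq.tsum_le_one hs y
      refine Summable.of_norm_bounded (hbase.mul_right C) fun p => ?_
      have h0 := mul_nonneg (hq.nonneg t ht x p.1) (hq.nonneg s hs p.1 p.2)
      rw [norm_mul, Real.norm_of_nonneg h0]
      exact mul_le_mul_of_nonneg_left (hC p.2) h0
    calc kernelOp (q (t + s)) f x = ∑' z, ∑' y, q t x y * q s y z * f z := by
          refine tsum_congr fun z => ?_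
          rw [tsum_mul_right, (hq.hasSum s t hs ht x z).tsum_eq]
      _ = ∑' y, ∑' z, q t x y * q s y z * f z := by
          exact Summable.tsum_comm (f := fun y z => q t x y * q s y z * f z) hsum
      _ = kernelOp (q t) (kernelOp (q s) f) x := by
          refine tsum_congr fun y => ?_
          simp only [mul_assoc, tsum_mul_left, kernelOp]

end IsSubMarkovKernel

/-- If, for every target `z'`, the functions `q t · z'` form a bounded solution of the backward
equation of a confined process killed on leaving `D`, started from the indicator of `z'`, then `q`
is a sub-Markov kernel. Positivity, the mass bound and the Chapman-Kolmogorov equations all follow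
from the comparison principle. -/
theorem isSubMarkovKernel_of_isSol {S A X : Type*} [Fintype A] [Countable X] {D : Set S}
    {r : A → S → ℝ} {τ : A → S → S} (hr : ∀ a, ∀ z ∈ D, 0 ≤ r a z) (hD : Confined D r τ)
    (e : X → S) (hrange : Set.range e = D) {q : ℝ → S → X → ℝ}
    (hq : ∀ x, IsSol D r τ fun t z => q t z x)
    (hb : ∀ x, ∃ M, ∀ t, 0 ≤ t → ∀ z ∈ D, |q t z x| ≤ M)
    (h0 : ∀ x, q 0 (e x) x = 1) (h0' : ∀ x y, x ≠ y → q 0 (e x) y = 0)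
    (hout : ∀ t, 0 ≤ t → ∀ z, z ∉ D → ∀ x, q t z x = 0) :
    IsSubMarkovKernel fun t x y => q t (e x) y := by
  classical
  have hmem : ∀ x, e x ∈ D := fun x => hrange ▸ Set.mem_range_self x
  have h0'' : ∀ z ∈ D, ∀ y, 0 ≤ q 0 z y := by
    intro z hz y
    rw [← hrange] at hz
    obtain ⟨x, rfl⟩ := hz
    by_cases hxy : x = y
    · rw [hxy, h0]; exact zero_le_one
    · rw [h0' x y hxy]
  -- Positivity: comparison with the solution `0`.
  have hnn : ∀ t, 0 ≤ t → ∀ z ∈ D, ∀ y, 0 ≤ q t z y := by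
    intro t ht z hz y
    obtain ⟨M, hM⟩ := hb y
    refine IsSol.le hr hD IsSol.zero (hq y) (fun T hT => ⟨M, fun s hs z hz => ?_⟩)
      (fun z hz => h0'' z hz y) (fun s hs z hz a _ ha => (hout s hs _ ha y).ge) t ht z hz
    have := neg_le_abs (q s z y)
    linarith [hM s hs.1 z hz]
  -- Mass at most one: comparison with the solution `1`.
  have hsum : ∀ t, 0 ≤ t → ∀ z ∈ D, ∀ F : Finset X, ∑ y ∈ F, q t z y ≤ 1 := by
    intro t ht z hz F
    choose M hM using hb
    have hM0 : ∀ y, 0 ≤ M y := fun y => (abs_nonneg _).trans (hM y t ht z hz)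
    refine IsSol.le hr hD (IsSol.sum (u := fun y t z => q t z y) F fun y => hq y)
      (IsSol.const 1)
      (fun T hT => ⟨∑ y ∈ F, M y, fun s hs z hz => ?_⟩) (fun z hz => ?_)
      (fun s hs z hz a _ ha => ?_) t ht z hz
    · have : ∑ y ∈ F, q s z y ≤ ∑ y ∈ F, M y :=
        Finset.sum_le_sum fun y _ => (le_abs_self _).trans (hM y s hs.1 z hz)
      linarith
    · rw [← hrange] at hz
      obtain ⟨x, rfl⟩ := hz
      by_cases hx : x ∈ F
      · rw [Finset.sum_eq_single x (fun y _ hy => h0' x y hy.symm) (fun h => (h hx).elim), h0]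
      · rw [Finset.sum_eq_zero fun y hy => h0' x y fun h => hx (h ▸ hy)]
        exact zero_le_one
    · simp [hout s hs _ ha]
  have hle1 : ∀ t, 0 ≤ t → ∀ z ∈ D, ∀ y, q t z y ≤ 1 := fun t ht z hz y => by
    simpa using hsum t ht z hz {y}
  have hsummable : ∀ t, 0 ≤ t → ∀ z ∈ D, Summable (q t z) := fun t ht z hz =>
    summable_of_sum_le (hnn t ht z hz) (hsum t ht z hz)
  have habs : ∀ s t, 0 ≤ s → 0 ≤ t → ∀ z ∈ D, ∀ w (F : Finset X),
      0 ≤ ∑ y ∈ F, q t z y * q s (e y) w ∧ ∑ y ∈ F, q t z y * q s (e y) w ≤ 1 := by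
    intro s t hs ht z hz w F
    refine ⟨Finset.sum_nonneg fun y _ => mul_nonneg (hnn t ht z hz y) (hnn s hs _ (hmem y) w),
      (Finset.sum_le_sum fun y _ => ?_).trans (hsum t ht z hz F)⟩
    exact mul_le_of_le_one_right (hnn t ht z hz y) (hle1 s hs _ (hmem y) w)
  have hsummable' : ∀ s t, 0 ≤ s → 0 ≤ t → ∀ z ∈ D, ∀ w,
      Summable fun y => q t z y * q s (e y) w := fun s t hs ht z hz w =>
    summable_of_sum_le (fun y => mul_nonneg (hnn t ht z hz y) (hnn s hs _ (hmem y) w))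
      fun F => (habs s t hs ht z hz w F).2
  refine ⟨fun t ht x y => hnn t ht _ (hmem x) y, fun t ht x F => hsum t ht _ (hmem x) F, h0, h0',
    fun s t hs ht x w => ?_, fun x => ?_⟩
  · have hval : (∑' y, q t (e x) y * q s (e y) w) = q (t + s) (e x) w := by
      -- Both sides of the Chapman-Kolmogorov equation are bounded solutions in `t` with the initial
      -- value `q s · w`.
      refine IsSol.eq hr hD (u := fun t z => ∑' y, q t z y * q s (e y) w)
        (v := fun t z => q (t + s) z w) ?_ ?_ (fun T _ => ⟨1, fun t ht z hz => ?_⟩)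
        (fun T _ => ⟨1, fun t ht z hz => ?_⟩) (fun z hz => ?_)
        (fun t ht z hz a _ ha => ?_) t ht _ (hmem x)
      · refine IsSol.of_tendsto (l := Filter.atTop) (E := Set.univ) (M := 1)
          (u := fun (F : Finset X) t z => ∑ y ∈ F, q t z y * q s (e y) w) (Set.subset_univ _)
          (fun _ _ _ _ => Set.mem_univ _) (fun F => ?_) (fun F t ht z _ => ?_)
          (fun t ht z _ => ?_) (fun F z _ hz => ?_) (fun z _ hz => ?_)
        · refine IsSol.sum (u := fun y t z => q t z y * q s (e y) w) F fun y => ?_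
          simp only [mul_comm _ (q s (e y) w)]
          exact (hq y).const_mul _
        · by_cases hz : z ∈ D
          · rw [abs_of_nonneg (habs s t hs ht z hz w F).1]
            exact (habs s t hs ht z hz w F).2
          · simp [hout t ht z hz]
        · by_cases hz : z ∈ D
          · exact (hsummable' s t hs ht z hz w).hasSum
          · simp [hout t ht z hz]
        · refine (continuousOn_const (c := (0 : ℝ))).congr fun t ht => ?_
          simp [hout t ht z hz]
        · refine (continuousOn_const (c := (0 : ℝ))).congr fun t ht => ?_
          simp [hout t ht z hz]
      · intro z hz t ht
        have h1 := hq w z hz (t + s) (add_nonneg ht hs)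
        have h2 := h1.scomp (h := fun t => t + s) (s := Set.Ici 0) t
          ((hasDerivWithinAt_id t (Set.Ici 0)).add_const s)
          (fun u hu => add_nonneg (Set.mem_Ici.1 hu) hs)
        simpa [Function.comp_def] using h2
      · rw [abs_of_nonneg (tsum_nonneg fun y =>
          mul_nonneg (hnn t ht.1 z hz y) (hnn s hs _ (hmem y) w))]
        exact (hsummable' s t hs ht.1 z hz w).tsum_le_of_sum_le
          fun F => (habs s t hs ht.1 z hz w F).2
      · rw [abs_of_nonneg (hnn _ (add_nonneg ht.1 hs) z hz w)]
        exact hle1 _ (add_nonneg ht.1 hs) z hz w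
      · rw [← hrange] at hz
        obtain ⟨x, rfl⟩ := hz
        rw [tsum_eq_single x fun y hy => by rw [h0' x y hy.symm, zero_mul], h0, one_mul, zero_add]
      · simp [hout t ht _ ha, hout (t + s) (add_nonneg ht hs) _ ha]
    rw [← hval]
    exact (hsummable' s t hs ht _ (hmem x) w).hasSum
  · have h1 : ContinuousWithinAt (fun t => q t (e x) x) (Set.Ici 0) 0 :=
      (hq x).continuousOn (hmem x) 0 (Set.mem_Ici.2 le_rfl)
    have h2 := h1.mono Set.Ioi_subset_Ici_self
    rw [ContinuousWithinAt, h0] at h2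
    exact h2

/-! ### The dynamics on the interlacing space -/

section Interlacing

variable {m n : ℕ} {S : Set ℤ} {bX dX bY dY : ℤ → ℝ}

/-- The interlacing configurations with particles in `S`, indexed by the disjoint union of the
indices of the `x`-particles and of the `y`-particles. -/
def interSet (m n : ℕ) (S : Set ℤ) : Set (Fin m ⊕ Fin n → ℤ) :=
  {z | (∀ s, z s ∈ S) ∧ Interlaced (fun i => z (.inl i)) fun j => z (.inr j)}

/-- The rates of the moves: the `x`-particles have rates `(bX, dX)`, the `y`-particles have rates
`(bY, dY)`. -/
def interRate (bX dX bY dY : ℤ → ℝ) :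
    (Fin m ⊕ Fin n) × Dir → (Fin m ⊕ Fin n → ℤ) → ℝ :=
  multiRate (Sum.elim (fun _ => bX) fun _ => bY) (Sum.elim (fun _ => dX) fun _ => dY)

open Classical in
/-- The moves of the interacting particles: a `y`-particle moves freely and pushes the
`x`-particles which are in its way, whereas a move of an `x`-particle which violates the interlacing
is suppressed. -/
def interMove (S : Set ℤ) (a : (Fin m ⊕ Fin n) × Dir) (z : Fin m ⊕ Fin n → ℤ) :
    Fin m ⊕ Fin n → ℤ :=
  match a.1 with
  | .inl _ => if multiMove a z ∈ interSet m n S then multiMove a z else z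
  | .inr j => Sum.elim
      (fun i => if (i : ℕ) ≤ j then min (z (.inl i)) (multiMove a z (.inr j))
        else max (z (.inl i)) (multiMove a z (.inr j) + 1))
      fun j' => multiMove a z (.inr j')

/-- Properties of the rows `ρ s x` of a determinant which make it compatible with the interaction:
moving an `x`-particle across a `y`-particle changes its row by a multiple of the row of the
`y`-particle, the rows of all `y`-particles are given by the same function, and the row of a
`y`-particle vanishes on exit from `S`. -/
structure IsInterRow (S : Set ℤ) (bY dY : ℤ → ℝ) (ρ : Fin m ⊕ Fin n → ℤ → Fin m ⊕ Fin n → ℝ) :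
    Prop where
  cross : ∃ κ : ℤ → ℝ, ∀ i j, ∀ y ∈ S, ∀ c,
    ρ (.inl i) (y + 1) c = ρ (.inl i) y c + κ y * ρ (.inr j) y c
  same : ∀ j j', ρ (.inr j) = ρ (.inr j')
  exit : ∀ j a, ∀ y ∈ S, rate bY dY a y ≠ 0 → move a y ∉ S → ∀ c, ρ (.inr j) (move a y) c = 0

lemma Interlaced.strictMono {x : Fin m → ℤ} {y : Fin n → ℤ} (h : Interlaced x y) (hnm : n ≤ m) :
    StrictMono y := by
  intro j j' hjj
  have h1 := (h ⟨j', by omega⟩ j').1 le_rfl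
  have h2 := (h ⟨j', by omega⟩ j).2 hjj
  omega

/-- If `z` and `z'` differ only in `x`-particles which are at the two sides of the same
`y`-particle, then the rows differ by multiples of the row of this `y`-particle, and the
determinants agree. -/
lemma rowDet_eq_of_cross {ρ : Fin m ⊕ Fin n → ℤ → Fin m ⊕ Fin n → ℝ} (hρ : IsInterRow S bY dY ρ)
    {z z' : Fin m ⊕ Fin n → ℤ} (j : Fin n) (hj : z (.inr j) ∈ S)
    (hy : ∀ j', z (.inr j') = z' (.inr j'))
    (hx : ∀ i, z (.inl i) = z' (.inl i) ∨
      (z (.inl i) = z (.inr j) + 1 ∧ z' (.inl i) = z (.inr j)) ∨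
      (z (.inl i) = z (.inr j) ∧ z' (.inl i) = z (.inr j) + 1)) :
    rowDet ρ z = rowDet ρ z' := by
  obtain ⟨κ, hκ⟩ := hρ.cross
  refine Matrix.det_eq_of_forall_row_eq_smul_add_const
    (Sum.elim (fun i => if z (.inl i) = z' (.inl i) then 0 else
      if z (.inl i) = z (.inr j) then -κ (z (.inr j)) else κ (z (.inr j))) fun _ => 0)
    (.inr j) rfl fun s c => ?_
  rcases s with i | j'
  · simp only [Matrix.of_apply, Sum.elim_inl, ← hy]
    rcases hx i with h | ⟨h1, h2⟩ | ⟨h1, h2⟩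
    · simp [h]
    · rw [h1, h2, hκ i j _ hj]
      simp
    · rw [h1, h2, hκ i j _ hj]
      simp
  · simp [hy]

lemma multiMove_inl (s : Fin m) (a : Dir) (z : Fin m ⊕ Fin n → ℤ) (i : Fin m) :
    multiMove (Sum.inl s, a) z (.inl i) = if i = s then move a (z (.inl s)) else z (.inl i) := by
  by_cases hi : i = s
  · subst hi; simp [multiMove]
  · simp [multiMove, hi]

/-- If a move of an `x`-particle is suppressed, then a `y`-particle is next to it. -/
lemma exists_blocking (hS : S.OrdConnected) (hdown : ∀ x ∈ S, dX x ≠ 0 → x - 1 ∈ S)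
    (hup : m ≤ n ∨ ∀ x ∈ S, x + 1 ∈ S) {z : Fin m ⊕ Fin n → ℤ} (hz : z ∈ interSet m n S)
    {s : Fin m} {a : Dir} (ha : interRate bX dX bY dY (Sum.inl s, a) z ≠ 0)
    (hW : multiMove (Sum.inl s, a) z ∉ interSet m n S) :
    ∃ j, (z (.inl s) = z (.inr j) ∧ move a (z (.inl s)) = z (.inr j) + 1) ∨
      (z (.inl s) = z (.inr j) + 1 ∧ move a (z (.inl s)) = z (.inr j)) := by
  have hz2 : ∀ (i : Fin m) (j : Fin n), ((i : ℕ) ≤ j → z (.inl i) ≤ z (.inr j)) ∧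
      ((j : ℕ) < i → z (.inr j) < z (.inl i)) := hz.2
  have hmv := multiMove_inl s a z
  have hmvy : ∀ j, multiMove (Sum.inl s, a) z (.inr j) = z (.inr j) := by
    intro j; simp [multiMove]
  by_contra! hcon
  have hin : ∀ j : Fin n, ((s : ℕ) ≤ j → move a (z (.inl s)) ≤ z (.inr j)) ∧
      ((j : ℕ) < s → z (.inr j) < move a (z (.inl s))) := by
    intro j
    have h1 := hz2 s j
    have h2 := hcon j
    cases a
    · simp only [move_up] at h2 ⊢
      exact ⟨fun h => by have := h1.1 h; omega, fun h => by have := h1.2 h; omega⟩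
    · simp only [move_down] at h2 ⊢
      exact ⟨fun h => by have := h1.1 h; omega, fun h => by have := h1.2 h; omega⟩
  have hmS : move a (z (.inl s)) ∈ S := by
    cases a
    · by_cases hsn : (s : ℕ) < n
      · exact hS.out (hz.1 (.inl s)) (hz.1 (.inr ⟨s, hsn⟩))
          ⟨by simp, (hin ⟨s, hsn⟩).1 le_rfl⟩
      · rcases hup with h | h
        · exact absurd s.2 (by omega)
        · exact h _ (hz.1 _)
    · exact hdown _ (hz.1 _) ha
  refine hW ⟨fun s' => ?_, fun i j => ?_⟩
  · rcases s' with i | j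
    · rw [hmv]
      split_ifs
      · exact hmS
      · exact hz.1 _
    · rw [hmvy]; exact hz.1 _
  · simp only [hmv, hmvy]
    split_ifs with hi
    · subst hi; exact hin j
    · exact hz2 i j

/-- The interaction is invisible to the determinant: a suppressed move and a move which pushes other
particles lead to the same value as the free move, whereas the value at the free move vanishes if a
`y`-particle leaves `S` or collides with another one, when the interacting process is killed. -/
lemma rowDet_interMove {ρ : Fin m ⊕ Fin n → ℤ → Fin m ⊕ Fin n → ℝ} (hρ : IsInterRow S bY dY ρ)
    (hnm : n ≤ m) (hS : S.OrdConnected) (hdown : ∀ x ∈ S, dX x ≠ 0 → x - 1 ∈ S)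
    (hup : m ≤ n ∨ ∀ x ∈ S, x + 1 ∈ S) {z : Fin m ⊕ Fin n → ℤ} (hz : z ∈ interSet m n S)
    (a : (Fin m ⊕ Fin n) × Dir) (ha : interRate bX dX bY dY a z ≠ 0) :
    (interSet m n S).indicator (rowDet ρ) (interMove S a z) = rowDet ρ (multiMove a z) := by
  classical
  have hz2 : ∀ (i : Fin m) (j : Fin n), ((i : ℕ) ≤ j → z (.inl i) ≤ z (.inr j)) ∧
      ((j : ℕ) < i → z (.inr j) < z (.inl i)) := hz.2
  obtain ⟨s | j, a⟩ := a
  · -- moves of an `x`-particle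
    by_cases hW : multiMove (Sum.inl s, a) z ∈ interSet m n S
    · simp [interMove, hW]
    · simp only [interMove, hW, if_false]
      rw [Set.indicator_of_mem hz]
      have hmv := multiMove_inl s a z
      have hmvy : ∀ j, multiMove (Sum.inl s, a) z (.inr j) = z (.inr j) := by
        intro j; simp [multiMove]
      suffices ∃ j, (z (.inl s) = z (.inr j) ∧ move a (z (.inl s)) = z (.inr j) + 1) ∨
          (z (.inl s) = z (.inr j) + 1 ∧ move a (z (.inl s)) = z (.inr j)) by
        obtain ⟨j, hj⟩ := this
        refine rowDet_eq_of_cross hρ j (hz.1 _) (fun j' => (hmvy j').symm) fun i => ?_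
        rw [hmv]
        split_ifs with hi
        · subst hi
          rcases hj with hj | hj
          · exact Or.inr (Or.inr hj)
          · exact Or.inr (Or.inl hj)
        · exact Or.inl rfl
      exact exists_blocking hS hdown hup hz ha hW
  · -- moves of a `y`-particle
    set y' := move a (z (.inr j)) with hy'
    have hmv : ∀ j', multiMove (Sum.inr j, a) z (.inr j') =
        if j' = j then y' else z (.inr j') := by
      intro i
      by_cases hi : i = j
      · subst hi; simp [multiMove, hy']
      · simp [multiMove, hi]
    have hmvx : ∀ i, multiMove (Sum.inr j, a) z (.inl i) = z (.inl i) := by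
      intro j; simp [multiMove]
    have hclx : ∀ i, interMove S (Sum.inr j, a) z (.inl i) =
        if (i : ℕ) ≤ j then min (z (.inl i)) y' else max (z (.inl i)) (y' + 1) := by
      intro i
      simp only [interMove, Sum.elim_inl, hmv, if_true]
    have hcly : ∀ j', interMove S (Sum.inr j, a) z (.inr j') =
        if j' = j then y' else z (.inr j') := by
      intro i
      simp only [interMove, Sum.elim_inr, hmv]
    have hmono := hz.2.strictMono hnm
    -- On exit from `S` the row of the `y`-particle vanishes.
    by_cases hyS : y' ∈ S
    swap
    · rw [Set.indicator_of_notMem]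
      · refine (Matrix.det_eq_zero_of_row_eq_zero (.inr j) fun c => ?_).symm
        simp only [Matrix.of_apply, hmv, if_true]
        exact hρ.exit j a _ (hz.1 _) ha hyS c
      · intro h
        have := h.1 (.inr j)
        rw [hcly, if_pos rfl] at this
        exact hyS this
    -- After a collision of `y`-particles two rows coincide.
    by_cases hcol : ∃ j', j' ≠ j ∧ z (.inr j') = y'
    · obtain ⟨j', hj', hj'y⟩ := hcol
      rw [Set.indicator_of_notMem]
      · refine (Matrix.det_zero_of_row_eq (i := .inr j') (j := .inr j) (by simpa using hj') ?_).symm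
        funext c
        simp only [Matrix.of_apply, hmv, if_true, hj', if_false, hj'y, hρ.same j' j]
      · intro h
        refine hj' ((h.2.strictMono hnm).injective ?_)
        simp only [hcly, if_true, hj', if_false, hj'y]
    push Not at hcol
    have hya : y' = z (.inr j) + 1 ∨ y' = z (.inr j) - 1 := by
      cases a
      · exact Or.inl rfl
      · exact Or.inr rfl
    -- Otherwise pushing restores the interlacing, and the pushed `x`-particles cross the
    -- `y`-particle.
    have hcl : interMove S (Sum.inr j, a) z ∈ interSet m n S := by
      refine ⟨fun s => ?_, fun i j' => ?_⟩
      · rcases s with i | j'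
        · rw [hclx]
          split_ifs with hi
          · rcases min_choice (z (.inl i)) y' with h | h <;> rw [h]
            · exact hz.1 _
            · exact hyS
          · rcases max_choice (z (.inl i)) (y' + 1) with h | h
            · rw [h]; exact hz.1 _
            · rw [h]
              have hle := max_eq_right_iff.1 h
              by_cases hin : (i : ℕ) < n
              · refine hS.out (hz.1 (.inl i)) (hz.1 (.inr ⟨i, hin⟩)) ⟨hle, ?_⟩
                have h1 := (hz2 i ⟨i, hin⟩).1 le_rfl
                have h2 := (hz2 i j).2 (by omega)
                have h3 := hcol ⟨i, hin⟩ (by intro h; apply hi; rw [← h])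
                omega
              · rcases hup with h | h
                · exact absurd i.2 (by omega)
                · exact h _ hyS
        · rw [hcly]
          split_ifs
          · exact hyS
          · exact hz.1 _
      · simp only [hclx, hcly]
        have h1 := hz2 i j'
        have h2 := hz2 i j
        by_cases hjj : j' = j
        · subst hjj
          simp only [if_true]
          refine ⟨fun h => ?_, fun h => ?_⟩
          · rw [if_pos h]; exact min_le_right _ _
          · rw [if_neg (by omega)]; exact lt_of_lt_of_le (by omega) (le_max_right _ _)
        · simp only [hjj, if_false]
          have h3 := hcol j' hjj
          refine ⟨fun h => ?_, fun h => ?_⟩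
          · have h4 := h1.1 h
            split_ifs with hi
            · exact (min_le_left _ _).trans h4
            · have h5 : z (.inr j) < z (.inr j') := hmono (by rw [Fin.lt_def]; omega)
              refine max_le h4 (by omega)
          · have h4 := h1.2 h
            split_ifs with hi
            · have h5 : z (.inr j') < z (.inr j) := hmono (by rw [Fin.lt_def]; omega)
              exact lt_min h4 (by omega)
            · exact lt_of_lt_of_le h4 (le_max_left _ _)
    rw [Set.indicator_of_mem hcl]
    have hzj : interMove S (Sum.inr j, a) z (.inr j) = y' := by rw [hcly, if_pos rfl]
    refine rowDet_eq_of_cross hρ j (by rw [hzj]; exact hyS)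
      (fun j' => by rw [hmv, hcly]) fun i => ?_
    rw [hzj, hmvx, hclx]
    have h2 := hz2 i j
    split_ifs with hi
    · have h3 := h2.1 hi
      rcases le_or_gt (z (.inl i)) y' with h | h
      · left; exact min_eq_left h
      · right; right
        exact ⟨min_eq_right h.le, by omega⟩
    · have h3 := h2.2 (by omega)
      rcases le_or_gt (y' + 1) (z (.inl i)) with h | h
      · left; exact max_eq_left h
      · right; left
        exact ⟨max_eq_right h.le, by omega⟩

lemma interRate_nonneg (hX : ∀ a, ∀ x ∈ S, 0 ≤ rate bX dX a x)
    (hY : ∀ a, ∀ x ∈ S, 0 ≤ rate bY dY a x) (a : (Fin m ⊕ Fin n) × Dir) (z : Fin m ⊕ Fin n → ℤ)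
    (hz : z ∈ interSet m n S) : 0 ≤ interRate bX dX bY dY a z := by
  obtain ⟨s | j, a⟩ := a
  · exact hX _ _ (hz.1 _)
  · exact hY _ _ (hz.1 _)

/-- The interacting particles do not explode. The `y`-particles are autonomous, and as long as they
stay in a finite set, their interaction with the `x`-particles takes place in a finite set. -/
lemma confined_inter (hS : S.OrdConnected) (hdown : ∀ x ∈ S, dX x ≠ 0 → x - 1 ∈ S)
    (hup : m ≤ n ∨ ∀ x ∈ S, x + 1 ∈ S) (hX : ∀ a, ∀ x ∈ S, 0 ≤ rate bX dX a x)
    (hY : ∀ a, ∀ x ∈ S, 0 ≤ rate bY dY a x) (hLX : HasLyapunov S bX dX)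
    (hLY : HasLyapunov S bY dY) :
    Confined (interSet m n S) (interRate bX dX bY dY) (interMove S) := by
  classical
  obtain ⟨VX, CX, hVX, hCX, hfX⟩ := hLX
  obtain ⟨VY, CY, hVY, hCY, hfY⟩ := hLY
  -- `V` controls the `y`-particles and `H` the `x`-particles. The term `Ψ` bounds the contributions
  -- of the suppressed moves of `x`-particles (next to `y`) and of the pushed ones (which land at `y
  -- - 1` or `y + 2`).
  set V : (Fin m ⊕ Fin n → ℤ) → ℝ := fun z =>
    ∑ s, (Sum.elim (fun _ _ => 0) fun _ => VY : Fin m ⊕ Fin n → ℤ → ℝ) s (z s) with hV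
  set H : (Fin m ⊕ Fin n → ℤ) → ℝ := fun z =>
    ∑ s, (Sum.elim (fun _ => VX) fun _ _ => 0 : Fin m ⊕ Fin n → ℤ → ℝ) s (z s) with hH
  have hVeq : ∀ z, V z = ∑ j, VY (z (.inr j)) := fun z => by simp [hV]
  have hHeq : ∀ z, H z = ∑ i, VX (z (.inl i)) := fun z => by simp [hH]
  set Ψ : ℤ → ℝ := fun y => (∑ a, |rate bX dX a y|) * VX y +
    (∑ a, |rate bX dX a (y + 1)|) * VX (y + 1) +
    (∑ a, |rate bY dY a y|) * (m * (VX (y - 1) + VX (y + 2))) with hΨ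
  have hsum0 : ∀ (b d : ℤ → ℝ) y, 0 ≤ ∑ a, |rate b d a y| :=
    fun b d y => Finset.sum_nonneg fun a _ => abs_nonneg _
  have hle0 : ∀ (b d : ℤ → ℝ) a y, rate b d a y ≤ ∑ a, |rate b d a y| := fun b d a y =>
    (le_abs_self _).trans (Finset.single_le_sum (f := fun a => |rate b d a y|)
      (fun a _ => abs_nonneg _) (Finset.mem_univ a))
  have hΨ1 : ∀ y, 0 ≤ (∑ a, |rate bX dX a y|) * VX y := fun y => mul_nonneg (hsum0 _ _ _) (hVX _)
  have hΨ2 : ∀ y, 0 ≤ (∑ a, |rate bY dY a y|) * (m * (VX (y - 1) + VX (y + 2))) := fun y =>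
    mul_nonneg (hsum0 _ _ _) (mul_nonneg (Nat.cast_nonneg _) (add_nonneg (hVX _) (hVX _)))
  have hΨ0 : ∀ y, 0 ≤ Ψ y := fun y => add_nonneg (add_nonneg (hΨ1 _) (hΨ1 _)) (hΨ2 _)
  -- the effect of the interaction on `H`
  have hterm : ∀ z ∈ interSet m n S, ∀ a,
      interRate bX dX bY dY a z * (H (interMove S a z) - H z) ≤
        interRate bX dX bY dY a z * (H (multiMove a z) - H z) + ∑ j, Ψ (z (.inr j)) := by
    intro z hz a
    have hr := interRate_nonneg hX hY a z hz
    have hz2 : ∀ (i : Fin m) (j : Fin n), ((i : ℕ) ≤ j → z (.inl i) ≤ z (.inr j)) ∧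
      ((j : ℕ) < i → z (.inr j) < z (.inl i)) := hz.2
    have hS0 : 0 ≤ ∑ j, Ψ (z (.inr j)) := Finset.sum_nonneg fun j _ => hΨ0 _
    have hS1 : ∀ j, Ψ (z (.inr j)) ≤ ∑ j, Ψ (z (.inr j)) := fun j =>
      Finset.single_le_sum (f := fun j => Ψ (z (.inr j))) (fun j _ => hΨ0 _) (Finset.mem_univ j)
    by_cases ha : interRate bX dX bY dY a z = 0
    · rw [ha]; simpa using hS0
    obtain ⟨s | j, a⟩ := a
    · by_cases hW : multiMove (Sum.inl s, a) z ∈ interSet m n S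
      · simp only [interMove, hW, if_true]
        linarith
      · simp only [interMove, hW, if_false, sub_self, mul_zero]
        have hdiff : -VX (z (.inl s)) ≤ H (multiMove (Sum.inl s, a) z) - H z := by
          rw [hHeq, hHeq, ← Finset.sum_sub_distrib, Finset.sum_eq_single s]
          · rw [multiMove_inl, if_pos rfl]
            linarith [hVX (move a (z (.inl s)))]
          · intro i _ hi
            rw [multiMove_inl, if_neg hi, sub_self]
          · simp
        have h1 : interRate bX dX bY dY (Sum.inl s, a) z * -VX (z (.inl s)) ≤
            interRate bX dX bY dY (Sum.inl s, a) z * (H (multiMove (Sum.inl s, a) z) - H z) :=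
          mul_le_mul_of_nonneg_left hdiff hr
        have h2 : interRate bX dX bY dY (Sum.inl s, a) z * VX (z (.inl s)) ≤
            (∑ a, |rate bX dX a (z (.inl s))|) * VX (z (.inl s)) :=
          mul_le_mul_of_nonneg_right (hle0 _ _ a _) (hVX _)
        have h3 : ∃ j, (∑ a, |rate bX dX a (z (.inl s))|) * VX (z (.inl s)) ≤ Ψ (z (.inr j)) := by
          obtain ⟨j, hj⟩ := exists_blocking hS hdown hup hz ha hW
          refine ⟨j, ?_⟩
          have e1 := hΨ1 (z (.inr j))
          have e2 := hΨ1 (z (.inr j) + 1)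
          have e3 := hΨ2 (z (.inr j))
          rcases hj with ⟨hj, -⟩ | ⟨hj, -⟩ <;> rw [hj] <;> simp only [hΨ] <;> linarith
        obtain ⟨j, h3⟩ := h3
        have h4 := hS1 j
        linarith
    · have hm0 : H (multiMove (Sum.inr j, a) z) = H z := by
        rw [hHeq, hHeq]
        refine Finset.sum_congr rfl fun i _ => ?_
        simp [multiMove]
      rw [hm0, sub_self, mul_zero, zero_add]
      set y := z (.inr j) with hy
      have hmvj : multiMove (Sum.inr j, a) z (.inr j) = move a y := by simp [multiMove, hy]
      have hdiff : H (interMove S (Sum.inr j, a) z) - H z ≤ m * (VX (y - 1) + VX (y + 2)) := by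
        rw [hHeq, hHeq, ← Finset.sum_sub_distrib]
        have : ∀ i ∈ (Finset.univ : Finset (Fin m)),
            VX (interMove S (Sum.inr j, a) z (.inl i)) - VX (z (.inl i)) ≤
              VX (y - 1) + VX (y + 2) := by
          intro i _
          have e0 := hVX (z (.inl i))
          have e1 := hVX (y - 1)
          have e2 := hVX (y + 2)
          have h2 := hz2 i j
          rw [← hy] at h2
          simp only [interMove, Sum.elim_inl, hmvj]
          split_ifs with hi
          · have h3 := h2.1 hi
            rcases le_or_gt (z (.inl i)) (move a y) with h | h
            · rw [min_eq_left h]; linarith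
            · rw [min_eq_right h.le]
              cases a
              · simp only [move_up] at h; omega
              · simp only [move_down]; linarith
          · have h3 := h2.2 (by omega)
            rcases le_or_gt (move a y + 1) (z (.inl i)) with h | h
            · rw [max_eq_left h]; linarith
            · rw [max_eq_right h.le]
              cases a
              · simp only [move_up, add_assoc]; norm_num; linarith
              · simp only [move_down] at h; omega
        refine (Finset.sum_le_sum this).trans ?_
        rw [Finset.sum_const, Finset.card_univ, Fintype.card_fin, nsmul_eq_mul]
      have h1 := mul_le_mul_of_nonneg_left hdiff hr
      have h2 : interRate bX dX bY dY (Sum.inr j, a) z * (m * (VX (y - 1) + VX (y + 2))) ≤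
          (∑ a, |rate bY dY a y|) * (m * (VX (y - 1) + VX (y + 2))) :=
        mul_le_mul_of_nonneg_right (hle0 _ _ a _)
          (mul_nonneg (Nat.cast_nonneg _) (add_nonneg (hVX _) (hVX _)))
      have h3 : (∑ a, |rate bY dY a y|) * (m * (VX (y - 1) + VX (y + 2))) ≤ Ψ y := by
        have e1 := hΨ1 y
        have e2 := hΨ1 (y + 1)
        simp only [hΨ]
        linarith
      exact h1.trans (h2.trans (h3.trans (hS1 j)))
  -- On `{V ≤ K}` the `y`-particles are in a finite set, so that `Ψ` is bounded there.
  refine ⟨V, H, ∑ _j : Fin n, CY, fun K => (∑ _i : Fin m, CX) +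
    Fintype.card ((Fin m ⊕ Fin n) × Dir) * ∑ _j : Fin n, ∑ y ∈ (hfY K).toFinset, Ψ y,
    fun z => ?_, fun z => ?_, fun z hz => ?_, fun K z hz hK => ?_, fun K M => ?_⟩
  · rw [hVeq]; exact Finset.sum_nonneg fun j _ => hVY _
  · rw [hHeq]; exact Finset.sum_nonneg fun j _ => hVX _
  · have h1 : gen (interRate bX dX bY dY) (interMove S) V z =
        gen (interRate bX dX bY dY) multiMove V z := by
      refine Finset.sum_congr rfl fun a _ => ?_
      congr 2
      rw [hVeq, hVeq]
      obtain ⟨s | j, a⟩ := a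
      · refine Finset.sum_congr rfl fun j _ => ?_
        by_cases hW : multiMove (Sum.inl s, a) z ∈ interSet m n S
        · simp only [interMove, hW, if_true]
        · simp only [interMove, hW, if_false]
          simp [multiMove]
      · rfl
    rw [h1, interRate, gen_multi_sum, Fintype.sum_sum_type]
    have h2 : ∀ i : Fin m, gen (rate bX dX) move (fun _ => 0) (z (.inl i)) = 0 := fun i => by
      simp [gen]
    simp only [Sum.elim_inl, Sum.elim_inr, h2, Finset.sum_const_zero, zero_add]
    exact Finset.sum_le_sum fun j _ => hCY _ (hz.1 _)
  · have h1 : gen (interRate bX dX bY dY) (interMove S) H z ≤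
        gen (interRate bX dX bY dY) multiMove H z +
          Fintype.card ((Fin m ⊕ Fin n) × Dir) * ∑ j, Ψ (z (.inr j)) := by
      refine (Finset.sum_le_sum fun a _ => hterm z hz a).trans ?_
      rw [Finset.sum_add_distrib, Finset.sum_const, Finset.card_univ, nsmul_eq_mul]
      exact le_rfl
    have h2 : gen (interRate bX dX bY dY) multiMove H z ≤ ∑ _i : Fin m, CX := by
      rw [interRate, gen_multi_sum, Fintype.sum_sum_type]
      have h2 : ∀ i : Fin n, gen (rate bY dY) move (fun _ => 0) (z (.inr i)) = 0 := fun i => by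
        simp [gen]
      simp only [Sum.elim_inl, Sum.elim_inr, h2, Finset.sum_const_zero, add_zero]
      exact Finset.sum_le_sum fun j _ => hCX _ (hz.1 _)
    refine h1.trans (add_le_add h2 (mul_le_mul_of_nonneg_left (Finset.sum_le_sum fun j _ => ?_)
      (Nat.cast_nonneg _)))
    refine Finset.single_le_sum (f := Ψ) (fun y _ => hΨ0 y) ((hfY K).mem_toFinset.2 ⟨hz.1 _, ?_⟩)
    rw [hVeq] at hK
    exact (Finset.single_le_sum (f := fun j => VY (z (.inr j))) (fun j _ => hVY _)
      (Finset.mem_univ j)).trans hK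
  · refine (Set.Finite.pi fun s : Fin m ⊕ Fin n => (hfX M).union (hfY K)).subset
      fun z hz s _ => ?_
    obtain ⟨hz, hzV, hzH⟩ := hz
    rw [hVeq] at hzV
    rw [hHeq] at hzH
    rcases s with i | j
    · exact Or.inl ⟨hz.1 _, (Finset.single_le_sum (f := fun i => VX (z (.inl i)))
        (fun i _ => hVX _) (Finset.mem_univ i)).trans hzH⟩
    · exact Or.inr ⟨hz.1 _, (Finset.single_le_sum (f := fun j => VY (z (.inr j)))
        (fun j _ => hVY _) (Finset.mem_univ j)).trans hzV⟩

/-- Determinants of compatible rows solve the backward equation of the interacting particles, killed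
on leaving the interlacing space. -/
lemma isSol_interDet (hnm : n ≤ m) (hS : S.OrdConnected)
    (hdown : ∀ x ∈ S, dX x ≠ 0 → x - 1 ∈ S) (hup : m ≤ n ∨ ∀ x ∈ S, x + 1 ∈ S)
    {ρ : ℝ → Fin m ⊕ Fin n → ℤ → Fin m ⊕ Fin n → ℝ}
    (hρ : ∀ t, 0 ≤ t → IsInterRow S bY dY (ρ t))
    (hsX : ∀ i c, IsSol S (rate bX dX) move fun t x => ρ t (.inl i) x c)
    (hsY : ∀ j c, IsSol S (rate bY dY) move fun t x => ρ t (.inr j) x c) :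
    IsSol (interSet m n S) (interRate bX dX bY dY) (interMove S)
      fun t => (interSet m n S).indicator (rowDet (ρ t)) := by
  intro z hz t ht
  have h1 : HasDerivWithinAt (fun t => rowDet (ρ t) z)
      (gen (interRate bX dX bY dY) multiMove (rowDet (ρ t)) z) (Set.Ici 0) t := by
    refine hasDerivWithinAt_rowDet fun s c => ?_
    rcases s with i | j
    · exact hsX i c _ (hz.1 _) t ht
    · exact hsY j c _ (hz.1 _) t ht
  have h2 : gen (interRate bX dX bY dY) (interMove S) ((interSet m n S).indicator (rowDet (ρ t))) z
      = gen (interRate bX dX bY dY) multiMove (rowDet (ρ t)) z := by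
    refine Finset.sum_congr rfl fun a _ => ?_
    by_cases ha : interRate bX dX bY dY a z = 0
    · simp [ha]
    · rw [rowDet_interMove (hρ t ht) hnm hS hdown hup hz a ha, Set.indicator_of_mem hz]
  rw [h2]
  exact h1.congr (fun s _ => Set.indicator_of_mem hz _) (Set.indicator_of_mem hz _)

end Interlacing

/-! ### The determinantal kernels on the interlacing space -/

/-- The analytic input for the determinantal kernels: `g t x y` is the probability that a chain
started from `x` is at time `t` in a state at most `y`, and `h t y y'` is the density, with respect
to the symmetrizing measure `w`, of the transition function of the Siegmund dual chain killed
outside `S`. -/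
structure IsInterPair (S : Set ℤ) (bX dX bY dY : ℤ → ℝ) (w : ℤ → ℝ) (g h : ℝ → ℤ → ℤ → ℝ) :
    Prop where
  ordConnected : S.OrdConnected
  rate_nonneg : ∀ a, ∀ x ∈ S, 0 ≤ rate bX dX a x
  rate_nonneg' : ∀ a, ∀ x ∈ S, 0 ≤ rate bY dY a x
  down_mem : ∀ x ∈ S, dX x ≠ 0 → x - 1 ∈ S
  lyapunov : HasLyapunov S bX dX
  lyapunov' : HasLyapunov S bY dY
  pos : ∀ x ∈ S, 0 < w x
  sol : ∀ y, IsSol S (rate bX dX) move fun t x => g t x y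
  sol' : ∀ y, IsSol S (rate bY dY) move fun t x => h t x y
  bounded : ∀ t, 0 ≤ t → ∀ x ∈ S, ∀ y, |g t x y| ≤ 1
  bounded' : ∀ y, ∃ M, ∀ t, 0 ≤ t → ∀ x ∈ S, |h t x y| ≤ M
  zero : ∀ x, (x ∈ S ∨ x - 1 ∈ S) → ∀ y, g 0 x y = if x ≤ y then 1 else 0
  cross : ∀ t, 0 ≤ t → ∀ y ∈ S, ∀ y', (y' ∈ S ∨ y' + 1 ∈ S) →
    g t (y + 1) y' = g t y y' - w y * h t y y'
  exit : ∀ t, 0 ≤ t → ∀ a, ∀ y ∈ S, rate bY dY a y ≠ 0 → move a y ∉ S → ∀ y', h t (move a y) y' = 0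

section InterPair

variable {m n : ℕ} {S : Set ℤ} {bX dX bY dY w : ℤ → ℝ} {g h : ℝ → ℤ → ℤ → ℝ}

/-- The rows of the determinants: those of the `x`-particles and of the `y`-particles, for given
targets. -/
def interRow (g h : ℤ → ℤ → ℝ) (z' : Fin m ⊕ Fin n → ℤ) :
    Fin m ⊕ Fin n → ℤ → Fin m ⊕ Fin n → ℝ :=
  Sum.elim
    (fun i x => Sum.elim (fun c => g x (z' (.inl c) - 1) - g x (z' (.inl c)))
      fun c => g x (z' (.inr c)) - if (i : ℕ) ≤ c then 1 else 0)
    fun _ y => Sum.elim (fun c => h y (z' (.inl c) - 1) - h y (z' (.inl c)))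
      fun c => h y (z' (.inr c))

/-- The kernel on the interlacing space as a block determinant. -/
def interKernel (w : ℤ → ℝ) (g : ℤ → ℤ → ℝ) (z z' : Fin m ⊕ Fin n → ℤ) : ℝ :=
  (∏ j, w (z' (.inr j))) / (∏ j, w (z (.inr j))) *
    ((-1) ^ n * (-1) ^ m * (diffMatrix g (fun i => z (.inl i)) (fun j => z (.inr j))
      (fun i => z' (.inl i)) fun j => z' (.inr j)).det)

lemma IsInterPair.isInterRow (hp : IsInterPair S bX dX bY dY w g h) {z' : Fin m ⊕ Fin n → ℤ}
    (hz' : ∀ s, z' s ∈ S) {t : ℝ} (ht : 0 ≤ t) :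
    IsInterRow S bY dY (interRow (g t) (h t) z') where
  cross := by
    refine ⟨fun y => -w y, fun i j y hy c => ?_⟩
    rcases c with c | c
    · simp only [interRow, Sum.elim_inl, Sum.elim_inr]
      rw [hp.cross t ht y hy _ (Or.inl (hz' _)),
        hp.cross t ht y hy _ (Or.inr (by simpa using hz' _))]
      ring
    · simp only [interRow, Sum.elim_inl, Sum.elim_inr]
      rw [hp.cross t ht y hy _ (Or.inl (hz' _))]
      ring
  same := fun j j' => rfl
  exit := fun j a y hy hr hS c => by
    rcases c with c | c <;> simp [interRow, hp.exit t ht a y hy hr hS]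

/-- Up to constants and the factors `w (y j)`, which are taken out of the rows of the `y`-particles,
the determinant of the rows is the block determinant of differences. -/
lemma IsInterPair.rowDet_eq (hp : IsInterPair S bX dX bY dY w g h) {z z' : Fin m ⊕ Fin n → ℤ}
    (hz : ∀ s, z s ∈ S) (hz' : ∀ s, z' s ∈ S) {t : ℝ} (ht : 0 ≤ t) :
    (∏ j, w (z' (.inr j))) * (-1) ^ m * rowDet (interRow (g t) (h t) z') z =
      interKernel w (g t) z z' := by
  have h1 : rowDet (interRow (g t) (h t) z') z = (∏ j : Fin n, -(w (z (.inr j)))⁻¹) *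
      (diffMatrix (g t) (fun i => z (.inl i)) (fun j => z (.inr j))
      (fun i => z' (.inl i)) fun j => z' (.inr j)).det := by
    have h2 := Matrix.det_mul_column (Sum.elim (fun _ : Fin m => (1 : ℝ))
      fun j : Fin n => -(w (z (.inr j)))⁻¹) (diffMatrix (g t) (fun i => z (.inl i))
        (fun j => z (.inr j)) (fun i => z' (.inl i)) fun j => z' (.inr j))
    rw [Fintype.prod_sum_type] at h2
    simp only [Sum.elim_inl, Sum.elim_inr, Finset.prod_const_one, one_mul] at h2
    rw [← h2, rowDet]
    congr 1
    ext s c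
    rcases s with i | j
    · rcases c with c | c <;> simp [interRow, diffMatrix]
    · have hw := (hp.pos _ (hz (.inr j))).ne'
      have c1 := fun c => hp.cross t ht _ (hz (.inr j)) _ (Or.inl (hz' c))
      have c2 := fun c => hp.cross t ht _ (hz (.inr j)) (z' c - 1) (Or.inr (by simpa using hz' c))
      rcases c with c | c
      · simp only [interRow, diffMatrix, Matrix.of_apply, Sum.elim_inl, Sum.elim_inr,
          Matrix.fromBlocks_apply₂₁, c1, c2]
        field_simp
        ring
      · simp only [interRow, diffMatrix, Matrix.of_apply, Sum.elim_inr,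
          Matrix.fromBlocks_apply₂₂, c1]
        field_simp
        ring
  rw [h1, interKernel, Finset.prod_neg, Finset.prod_inv_distrib, Finset.card_univ,
    Fintype.card_fin]
  ring

/-- At time zero the kernel is the identity: the determinant is an iterated difference of the
indicator function of componentwise domination. -/
lemma IsInterPair.interKernel_zero (hp : IsInterPair S bX dX bY dY w g h) (hnm : n ≤ m)
    (hmn : m ≤ n + 1) {z z' : Fin m ⊕ Fin n → ℤ} (hz : z ∈ interSet m n S)
    (hz' : z' ∈ interSet m n S) : interKernel w (g 0) z z' = if z = z' then 1 else 0 := by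
  classical
  set P : Measure Unit := Measure.dirac ()
  have hmeas : ∀ s : Set Unit, NullMeasurableSet s P := fun s =>
    (MeasurableSpace.measurableSet_top (s := s)).nullMeasurableSet
  have hdiff := diffList_measure_inter (P := P) (ε := -1) (ε' := 1)
    (A := fun i v => {_ω : Unit | z (.inl i) ≤ v}) (B := fun j v => {_ω : Unit | v ≤ z' (.inr j)})
    (A' := fun i => {_ω : Unit | z (.inl i) = z' (.inl i)})
    (B' := fun j => {_ω : Unit | z (.inr j) = z' (.inr j)})
    (fun i v => hmeas _) (fun j v => hmeas _)
    (x := fun i => z' (.inl i)) (y := fun j => z (.inr j))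
    (fun i => Filter.Eventually.of_forall fun ω => by
      simp only [Set.indicator_apply, Set.mem_ofPred_eq, Pi.one_apply]
      split_ifs <;> first | omega | norm_num)
    (fun i => Filter.Eventually.of_forall fun ω => by
      simp only [Set.indicator_apply, Set.mem_ofPred_eq, Pi.one_apply]
      split_ifs <;> first | omega | norm_num)
    (hmeas _)
  have hreal : ∀ (p : Prop) [Decidable p], P.real {_ω : Unit | p} = if p then 1 else 0 := by
    intro p _
    split_ifs with h
    · simp [P, h]
    · simp [P, h]
  have hdet := diffList_eq_det_diffMatrix (g := g 0) (F := fun v u =>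
      P.real {_ω : Unit | (∀ i, z (.inl i) ≤ u i) ∧ ∀ j, v j ≤ z' (.inr j)}) hz.2 hz'.2
    (fun v u hv hu hvy => by
      rw [hreal, ← cdfDet_interSeq _ hnm hmn, cdfDet_indicator (interSeq_monotone _ _ hv)
        (interSeq_monotone _ _ hu)]
      · refine if_congr ?_ rfl rfl
        rw [← (interEquiv hnm hmn).forall_congr_right]
        simp [interSeq]
      · intro p q
        obtain ⟨s, rfl⟩ := (interEquiv hnm hmn).surjective p
        refine hp.zero _ ?_ _
        rcases s with i | j
        · left; simpa [interSeq] using hz.1 _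
        · simp only [interSeq, Function.comp, Equiv.symm_apply_apply, Sum.elim_inr]
          rcases hvy j with h | h
          · left; rw [h]; exact hz.1 _
          · right; rw [h, add_sub_cancel_right]; exact hz.1 _)
  have hdet' := hdet.symm.trans hdiff
  simp only [Set.mem_ofPred_eq, hreal] at hdet'
  rw [interKernel, hdet']
  have hiff : ((∀ i, z (.inl i) = z' (.inl i)) ∧ ∀ j, z (.inr j) = z' (.inr j)) ↔ z = z' := by
    rw [funext_iff, Sum.forall]
  simp only [hiff]
  split_ifs with h
  · subst h
    rw [div_self (Finset.prod_ne_zero_iff.2 fun j _ => (hp.pos _ (hz.1 _)).ne')]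
    have h1 : ((-1 : ℝ) ^ n) * (-1) ^ n = 1 := by rw [← mul_pow]; simp
    have h2 : ((-1 : ℝ) ^ m) * (-1) ^ m = 1 := by rw [← mul_pow]; simp
    linear_combination (-1 : ℝ) ^ n * (-1) ^ n * h2 + h1
  · simp

/-- The block determinants form a sub-Markov kernel on the interlacing space. -/
theorem IsInterPair.isSubMarkovKernel (hp : IsInterPair S bX dX bY dY w g h) (hnm : n ≤ m)
    (hmn : m ≤ n + 1) (hup : m ≤ n ∨ ∀ x ∈ S, x + 1 ∈ S) {X : Type*} [Countable X]
    {e : X → Fin m ⊕ Fin n → ℤ} (he : Function.Injective e)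
    (hrange : Set.range e = interSet m n S) :
    IsSubMarkovKernel fun t x y => interKernel w (g t) (e x) (e y) := by
  have hmem : ∀ x, e x ∈ interSet m n S := fun x => hrange ▸ Set.mem_range_self x
  set q : ℝ → (Fin m ⊕ Fin n → ℤ) → X → ℝ := fun t z x =>
    ((∏ j, w (e x (.inr j))) * (-1) ^ m) *
      (interSet m n S).indicator (rowDet (interRow (g t) (h t) (e x))) z with hq
  have hqe : ∀ t, 0 ≤ t → ∀ x y, q t (e x) y = interKernel w (g t) (e x) (e y) := by
    intro t ht x y
    rw [← hp.rowDet_eq (hmem x).1 (hmem y).1 ht, hq]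
    simp only [Set.indicator_of_mem (hmem x)]
  have hk := isSubMarkovKernel_of_isSol (X := X) (D := interSet m n S) (q := q)
    (r := interRate bX dX bY dY) (τ := interMove S)
    (interRate_nonneg hp.rate_nonneg hp.rate_nonneg')
    (confined_inter hp.ordConnected hp.down_mem hup hp.rate_nonneg hp.rate_nonneg' hp.lyapunov
      hp.lyapunov') e hrange
    (fun x => ?_) (fun x => ?_) (fun x => ?_) (fun x y hxy => ?_) (fun t _ z hz x => ?_)
  · refine ⟨fun t ht x y => ?_, fun t ht x F => ?_, fun x => ?_, fun x y hxy => ?_,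
      fun s t hs ht x z => ?_, fun x => ?_⟩
    · rw [← hqe t ht]; exact hk.nonneg t ht x y
    · simp only [← hqe t ht]; exact hk.sum_le t ht x F
    · rw [← hqe 0 le_rfl]; exact hk.zero_self x
    · rw [← hqe 0 le_rfl]; exact hk.zero_ne x y hxy
    · simp only [← hqe t ht, ← hqe s hs, ← hqe (t + s) (add_nonneg ht hs)]
      exact hk.hasSum s t hs ht x z
    · refine (hk.tendsto x).congr' ?_
      filter_upwards [self_mem_nhdsWithin] with t ht
      exact hqe t (le_of_lt ht) x x
  · refine IsSol.const_mul (isSol_interDet hnm hp.ordConnected hp.down_mem hup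
      (ρ := fun t => interRow (g t) (h t) (e x)) (fun t ht => hp.isInterRow (hmem x).1 ht)
      (fun i c => ?_) fun j c => ?_) _
    · rcases c with c | c
      · exact (hp.sol _).sub (hp.sol _)
      · exact (hp.sol _).sub (IsSol.const _)
    · rcases c with c | c
      · exact (hp.sol' _).sub (hp.sol' _)
      · exact hp.sol' _
  · choose M hM using hp.bounded'
    have hM0 : ∀ y, 0 ≤ |M y| := fun y => abs_nonneg _
    set B : ℝ := 2 + ∑ c, (|M (e x c)| + |M (e x c - 1)|) with hB
    refine ⟨|(∏ j, w (e x (.inr j))) * (-1) ^ m| *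
      ((Fintype.card (Fin m ⊕ Fin n)).factorial • B ^ Fintype.card (Fin m ⊕ Fin n)),
      fun t ht z hz => ?_⟩
    simp only [hq]
    rw [abs_mul, Set.indicator_of_mem hz]
    refine mul_le_mul_of_nonneg_left ?_ (abs_nonneg _)
    refine abs_det_le_of_entries fun s c => ?_
    have hS0 : 0 ≤ ∑ c, (|M (e x c)| + |M (e x c - 1)|) :=
      Finset.sum_nonneg fun c _ => add_nonneg (hM0 _) (hM0 _)
    have hS1 : ∀ c, |M (e x c)| + |M (e x c - 1)| ≤ ∑ c, (|M (e x c)| + |M (e x c - 1)|) :=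
      fun c => Finset.single_le_sum (f := fun c => |M (e x c)| + |M (e x c - 1)|)
        (fun c _ => add_nonneg (hM0 _) (hM0 _)) (Finset.mem_univ c)
    have hh : ∀ j y, |h t (z (.inr j)) y| ≤ |M y| := fun j y =>
      (hM y t ht _ (hz.1 _)).trans (le_abs_self _)
    rcases s with i | j
    · have hg := hp.bounded t ht _ (hz.1 (.inl i))
      rcases c with c | c
      · refine (abs_sub _ _).trans ?_
        have := hg (e x (.inl c) - 1)
        have := hg (e x (.inl c))
        linarith
      · refine (abs_sub _ _).trans ?_
        have := hg (e x (.inr c))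
        have h2 : |if (i : ℕ) ≤ c then (1 : ℝ) else 0| ≤ 1 := by split_ifs <;> simp
        linarith
    · rcases c with c | c
      · refine (abs_sub _ _).trans ?_
        have := hh j (e x (.inl c) - 1)
        have := hh j (e x (.inl c))
        have := hS1 (.inl c)
        linarith
      · have := hh j (e x (.inr c))
        have := hS1 (.inr c)
        have := hM0 (e x (.inr c) - 1)
        change |h t (z (.inr j)) (e x (.inr c))| ≤ B
        linarith
  · rw [hqe 0 le_rfl, hp.interKernel_zero hnm hmn (hmem x) (hmem x), if_pos rfl]
  · rw [hqe 0 le_rfl, hp.interKernel_zero hnm hmn (hmem x) (hmem y), if_neg (he.ne hxy)]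
  · simp [hq, Set.indicator_of_notMem hz]

end InterPair

/-! ### Kolmogorov's extension theorem for countable state spaces -/

/-- A set is exhausted in measure by its finite subsets. -/
lemma exists_finset_measure_sdiff_le {F : Type*} [MeasurableSpace F] [Countable F]
    [MeasurableSingletonClass F] (μ : Measure F) [IsFiniteMeasure μ] (A : Set F) {δ : ℝ≥0∞}
    (hδ : δ ≠ 0) : ∃ K : Finset F, ↑K ⊆ A ∧ μ (A \ K) ≤ δ := by
  classical
  have hA : MeasurableSet A := A.to_countable.measurableSet
  by_cases h0 : μ A = 0
  · exact ⟨∅, by simp, by simp [h0]⟩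
  have h1 : ∑' x, A.indicator (fun x => μ {x}) x = μ A :=
    Measure.tsum_indicator_apply_singleton μ A hA
  have h2 : μ A - δ < ∑' x, A.indicator (fun x => μ {x}) x := by
    rw [h1]; exact ENNReal.sub_lt_self (measure_ne_top _ _) h0 hδ
  obtain ⟨K, hK⟩ := ((ENNReal.summable.hasSum).eventually (lt_mem_nhds h2)).exists
  refine ⟨K.filter (· ∈ A), by intro x; simp, ?_⟩
  have h3 : μ (K.filter (· ∈ A) : Finset F) = ∑ x ∈ K, A.indicator (fun x => μ {x}) x := by
    rw [← sum_measure_singleton, Finset.sum_filter]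
    exact Finset.sum_congr rfl fun x _ => by simp [Set.indicator_apply]
  rw [measure_sdiff (by intro x; simp) (Finset.measurableSet _).nullMeasurableSet
    (measure_ne_top _ _), h3, tsub_le_iff_right, add_comm]
  exact tsub_le_iff_right.1 hK.le

/-- Every projective family of probability measures on a countable space has a projective limit.
Continuity at the empty set of the content on cylinders follows by inner approximation
by finite sets and Tychonoff's theorem. -/
theorem exists_isProjectiveLimit {ι E : Type*} [Countable E] [MeasurableSpace E]
    [MeasurableSingletonClass E] (P : ∀ I : Finset ι, Measure (∀ _ : I, E))
    [∀ I, IsProbabilityMeasure (P I)] (hP : IsProjectiveMeasureFamily (α := fun _ : ι => E) P) :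
    ∃ μ : Measure (ι → E), IsProjectiveLimit (α := fun _ : ι => E) μ P := by
  classical
  let _ : TopologicalSpace E := ⊥
  have : DiscreteTopology E := ⟨rfl⟩
  have hms : ∀ (I : Finset ι) (T : Set (∀ _ : I, E)), MeasurableSet T :=
    fun I T => T.to_countable.measurableSet
  have hzero : ∀ ⦃A : ℕ → Set (ι → E)⦄, (∀ n, A n ∈ measurableCylinders fun _ : ι => E) →
      Antitone A → ⋂ n, A n = ∅ →
      Filter.Tendsto (fun n => projectiveFamilyContent hP (A n)) Filter.atTop (nhds 0) := by
    intro A hA hanti hinter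
    have hmono : Antitone fun n => projectiveFamilyContent hP (A n) := fun i j hij =>
      projectiveFamilyContent_mono hP (hA j) (hA i) (hanti hij)
    have hlim := tendsto_atTop_iInf hmono
    set ε := ⨅ n, projectiveFamilyContent hP (A n) with hε
    by_contra hne
    have hε0 : ε ≠ 0 := fun h => hne (by rwa [h] at hlim)
    have hle : ∀ n, ε ≤ projectiveFamilyContent hP (A n) := fun n => iInf_le _ n
    choose s T hT hAs using fun n => (mem_measurableCylinders _).1 (hA n)
    obtain ⟨δ, hδ0, hδ⟩ := ENNReal.exists_pos_sum_of_countable' hε0 ℕ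
    -- Decreasing cylinders of content at least `ε` are approximated from inside by cylinders over
    -- finite sets, with a total error of less than `ε`.
    choose K hKT hK using fun n =>
      exists_finset_measure_sdiff_le (P (s n)) (T n) (hδ0 n).ne'
    set C : ℕ → Set (ι → E) := fun n => cylinder (s n) (K n : Set (∀ _ : s n, E)) with hC
    have hCm : ∀ n, C n ∈ measurableCylinders fun _ : ι => E := fun n =>
      cylinder_mem_measurableCylinders _ _ (hms _ _)
    have hring : IsSetRing (measurableCylinders fun _ : ι => E) := isSetRing_measurableCylinders
    have hdiffm : ∀ n, A n \ C n ∈ measurableCylinders fun _ : ι => E := fun n =>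
      hring.sdiff_mem (hA n) (hCm n)
    have hdiff : ∀ n, projectiveFamilyContent hP (A n \ C n) ≤ δ n := by
      intro n
      have : A n \ C n = cylinder (s n) (T n \ K n) := by
        rw [hAs n, hC]; rfl
      rw [this, projectiveFamilyContent_cylinder hP (hms _ _)]
      exact hK n
    -- finitely many of the approximating sets intersect
    have hfin : ∀ n, ∃ f : ι → E, ∀ k ≤ n, f ∈ C k := by
      intro n
      by_contra! hcon
      have hsub : A n ⊆ ⋃ k ≤ n, A k \ C k := by
        intro f hf
        obtain ⟨k, hk, hfk⟩ := hcon f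
        exact Set.mem_biUnion (x := k) hk ⟨hanti hk hf, hfk⟩
      have h1 : projectiveFamilyContent hP (A n) ≤ ∑ k ∈ Finset.range (n + 1), δ k := by
        refine (projectiveFamilyContent_mono hP (hA n) ?_ hsub).trans
          ((projectiveFamilyContent_iUnion_le hP hdiffm n).trans
            (Finset.sum_le_sum fun k _ => hdiff k))
        have : (⋃ k ≤ n, A k \ C k) = ⋃ k ∈ Finset.range (n + 1), A k \ C k := by
          simp only [Finset.mem_range_succ_iff]
        rw [this]
        exact hring.biUnion_mem _ fun k _ => hdiffm k
      exact absurd ((hle n).trans (h1.trans (ENNReal.sum_le_tsum _))) (not_le.2 hδ)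
    -- a compact box which meets all these intersections
    obtain ⟨f0, -⟩ := hfin 0
    set m : ι → ℕ := fun i => if h : ∃ n, i ∈ s n then Nat.find h else 0 with hm
    set box : ι → Set E := fun i =>
      if h : ∃ n, i ∈ s n then (fun f : ∀ _ : s (Nat.find h), E => f ⟨i, Nat.find_spec h⟩) ''
        (K (Nat.find h)) else {f0 i} with hbox
    have hboxfin : ∀ i, (box i).Finite := by
      intro i
      simp only [hbox]
      split_ifs with h
      · exact (Finset.finite_toSet _).image _
      · exact Set.finite_singleton _
    have hboxne : ∀ i, (box i).Nonempty := by
      intro i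
      simp only [hbox]
      split_ifs with h
      · obtain ⟨f, hf⟩ := hfin (Nat.find h)
        exact ⟨_, Set.mem_image_of_mem _ (hf _ le_rfl)⟩
      · exact Set.singleton_nonempty _
    have hcl : ∀ n, IsClosed (C n) := fun n => by
      have : Continuous fun f : ι → E => (s n).restrict f := by fun_prop
      exact (isClosed_discrete (K n : Set (∀ _ : s n, E))).preimage this
    obtain ⟨f, hf⟩ := IsCompact.nonempty_iInter_of_sequence_nonempty_isCompact_isClosed
      (fun n => Set.univ.pi box ∩ ⋂ k ≤ n, C k)
      (fun n => Set.inter_subset_inter_right _ fun f hf => by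
        simp only [Set.mem_iInter] at hf ⊢
        exact fun k hk => hf k (by omega))
      (fun n => by
        obtain ⟨f, hf⟩ := hfin n
        choose d hd using hboxne
        refine ⟨fun i => if ∃ k ≤ n, i ∈ s k then f i else d i, fun i _ => ?_, ?_⟩
        · dsimp only
          split_ifs with h
          · obtain ⟨k, hk, hik⟩ := h
            have hex : ∃ n, i ∈ s n := ⟨k, hik⟩
            simp only [hbox, hex, dif_pos]
            exact ⟨_, hf _ ((Nat.find_min' hex hik).trans hk), rfl⟩
          · exact hd i
        · simp only [Set.mem_iInter]
          intro k hk
          have := hf k hk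
          simp only [hC, mem_cylinder] at this ⊢
          convert this using 1
          funext i
          have h : ∃ k ≤ n, (i : ι) ∈ s k := ⟨k, hk, i.2⟩
          simp [Finset.restrict, h])
      ((isCompact_univ_pi fun i => (hboxfin i).isCompact).inter_right
        (isClosed_biInter fun k _ => hcl k))
      (fun n => (isClosed_set_pi fun i _ => isClosed_discrete _).inter
        (isClosed_biInter fun k _ => hcl k))
    have : f ∈ ⋂ n, A n := by
      simp only [Set.mem_iInter, Set.mem_inter_iff] at hf ⊢
      intro n
      have h1 := (hf n).2 n le_rfl
      rw [hAs n]
      exact hKT n h1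
    rw [hinter] at this
    exact this
  have hsub : (projectiveFamilyContent hP).IsSigmaSubadditive := by
    refine isSigmaSubadditive_of_addContent_iUnion_eq_tsum isSetRing_measurableCylinders
      fun f hf hfU hf' => ?_
    exact addContent_iUnion_eq_sum_of_tendsto_zero isSetRing_measurableCylinders
      (projectiveFamilyContent hP) (fun s _ => projectiveFamilyContent_ne_top hP) hzero hf hfU hf'
  refine ⟨(projectiveFamilyContent hP).measure isSetSemiring_measurableCylinders
    generateFrom_measurableCylinders.ge hsub, fun I => ?_⟩
  ext T hT
  rw [Measure.map_apply (by fun_prop) hT, AddContent.measure_eq]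
  · exact projectiveFamilyContent_cylinder hP hT
  · exact generateFrom_measurableCylinders.symm
  · exact cylinder_mem_measurableCylinders _ _ hT

/-! ### Finite-dimensional distributions of a Markov chain in continuous time -/

/-- A conservative transition function in terms of probability mass functions. -/
structure IsTransitionPMF {E : Type*} (p : ℝ≥0 → E → PMF E) : Prop where
  zero : ∀ x, p 0 x = PMF.pure x
  bind : ∀ s t x, (p s x).bind (p t) = p (s + t) x

section ChainLaw

variable {E : Type*} {p : ℝ≥0 → E → PMF E}

/-- The law of a path which is `x` at time `t₀`, evolves according to the transition function `p`,
and is recorded at the times of the list; at all other times it is given by `f`. -/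
def chainLaw (p : ℝ≥0 → E → PMF E) : ℝ≥0 → E → List ℝ≥0 → (ℝ≥0 → E) → PMF (ℝ≥0 → E)
  | _, _, [], f => PMF.pure f
  | t₀, x, t :: l, f => (p (t - t₀) x).bind fun y => chainLaw p t y l (Function.update f t y)

lemma chainLaw_eq_of_notMem {t₀ : ℝ≥0} {x : E} {l : List ℝ≥0} {f : ℝ≥0 → E} {u : ℝ≥0}
    (hu : u ∉ l) : ∀ g ∈ (chainLaw p t₀ x l f).support, g u = f u := by
  induction l generalizing t₀ x f with
  | nil => intro g hg; rw [chainLaw, PMF.mem_support_pure_iff] at hg; rw [hg]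
  | cons t l ih =>
    intro g hg
    rw [List.mem_cons, not_or] at hu
    rw [chainLaw, PMF.mem_support_bind_iff] at hg
    obtain ⟨y, -, hy⟩ := hg
    rw [ih hu.2 g hy, Function.update_of_ne hu.1]

/-- The recorded path does not depend on the default values at recorded times. -/
lemma chainLaw_map_congr (J : Set ℝ≥0) {t₀ : ℝ≥0} {x : E} {l : List ℝ≥0} {f f' : ℝ≥0 → E}
    (h : ∀ u ∈ J, f u = f' u) :
    (chainLaw p t₀ x l f).map J.domRestrict = (chainLaw p t₀ x l f').map J.domRestrict := by
  induction l generalizing t₀ x f f' with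
  | nil =>
    rw [chainLaw, chainLaw, PMF.pure_map, PMF.pure_map]
    congr 1
    funext u
    exact h u u.2
  | cons t l ih =>
    rw [chainLaw, chainLaw, PMF.map_bind, PMF.map_bind]
    congr 1
    funext y
    refine ih fun u hu => ?_
    by_cases hut : u = t
    · subst hut; simp
    · simp [hut, h u hu]

/-- Times at which the path is not inspected may be omitted, by the Chapman-Kolmogorov equations. -/
lemma chainLaw_map_filter (hp : IsTransitionPMF p) (J : Set ℝ≥0) [DecidablePred (· ∈ J)]
    {t₀ : ℝ≥0} {x : E} {l : List ℝ≥0} (hl : (t₀ :: l).Pairwise (· ≤ ·)) {f : ℝ≥0 → E} :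
    (chainLaw p t₀ x l f).map J.domRestrict =
      (chainLaw p t₀ x (l.filter (· ∈ J)) f).map J.domRestrict := by
  induction l generalizing t₀ x f with
  | nil => rfl
  | cons t l ih =>
    have hl' := List.Pairwise.of_cons hl
    by_cases ht : t ∈ J
    · rw [List.filter_cons_of_pos (by simpa using ht), chainLaw, chainLaw, PMF.map_bind,
        PMF.map_bind]
      congr 1
      funext y
      exact ih hl'
    · rw [List.filter_cons_of_neg (by simpa using ht), chainLaw, PMF.map_bind]
      have h1 : ∀ y, (chainLaw p t y l (Function.update f t y)).map J.domRestrict =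
          (chainLaw p t y (l.filter (· ∈ J)) f).map J.domRestrict := fun y => by
        rw [ih hl']
        refine chainLaw_map_congr J fun u hu => ?_
        rw [Function.update_of_ne]
        rintro rfl
        exact ht hu
      simp only [h1]
      have hmem : ∀ u ∈ l.filter (· ∈ J), t ≤ u := fun u hu =>
        List.rel_of_pairwise_cons hl' (List.mem_of_mem_filter hu)
      rcases hcase : l.filter (· ∈ J) with _ | ⟨t', l'⟩
      · simp only [chainLaw]
        rw [PMF.bind_const]
      · have h2 : t ≤ t' := hmem t' (by rw [hcase]; exact List.mem_cons_self)
        have h3 : t₀ ≤ t := List.rel_of_pairwise_cons hl List.mem_cons_self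
        simp only [chainLaw, PMF.map_bind]
        rw [← PMF.bind_bind, hp.bind, add_comm, tsub_add_tsub_cancel h2 h3]

/-- Repeated times may be omitted. -/
lemma chainLaw_dedup (hp : IsTransitionPMF p) {t₀ : ℝ≥0} {x : E}
    {l : List ℝ≥0} (hl : l.Pairwise (· ≤ ·)) {f : ℝ≥0 → E} :
    chainLaw p t₀ x l f = chainLaw p t₀ x l.dedup f := by
  induction l generalizing t₀ x f with
  | nil => rfl
  | cons t l ih =>
    have hl' := List.Pairwise.of_cons hl
    by_cases ht : t ∈ l
    · rw [List.dedup_cons_of_mem ht, ← ih hl']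
      rcases l with _ | ⟨t', l⟩
      · simp at ht
      · have h1 : t ≤ t' := List.rel_of_pairwise_cons hl List.mem_cons_self
        have h2 : t' ≤ t := by
          rcases List.mem_cons.1 ht with h | h
          · exact h.ge
          · exact List.rel_of_pairwise_cons hl' h
        obtain rfl := le_antisymm h1 h2
        simp only [chainLaw, tsub_self, hp.zero, PMF.pure_bind, Function.update_idem]
    · rw [List.dedup_cons_of_notMem ht, chainLaw, chainLaw]
      congr 1
      funext y
      exact ih hl'

/-- The state at the initial time is certain, even if this time is recorded once more. -/
lemma chainLaw_eq_self (hp : IsTransitionPMF p) {t₀ : ℝ≥0} {x : E} {l : List ℝ≥0}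
    (hl : (t₀ :: l).Pairwise (· ≤ ·)) {f : ℝ≥0 → E} (hf : f t₀ = x) :
    ∀ g ∈ (chainLaw p t₀ x l f).support, g t₀ = x := by
  induction l generalizing f with
  | nil => intro g hg; rw [chainLaw, PMF.mem_support_pure_iff] at hg; rw [hg, hf]
  | cons t l ih =>
    intro g hg
    have h1 : t₀ ≤ t := List.rel_of_pairwise_cons hl List.mem_cons_self
    rcases h1.eq_or_lt with rfl | h1
    · rw [chainLaw, tsub_self, hp.zero, PMF.pure_bind] at hg
      exact ih (List.Pairwise.of_cons hl) (by simp) g hg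
    · rw [chainLaw_eq_of_notMem _ g hg, hf]
      intro hmem
      rcases List.mem_cons.1 hmem with h | h
      · exact h1.ne h
      · exact absurd (List.rel_of_pairwise_cons (List.Pairwise.of_cons hl) h) (not_le.2 h1)

/-- The product of transition probabilities along a list of times and states. -/
def pathProd (p : ℝ≥0 → E → PMF E) : ℝ≥0 → E → List (ℝ≥0 × E) → ℝ≥0∞
  | _, _, [] => 1
  | t₀, x, a :: L => p (a.1 - t₀) x a.2 * pathProd p a.1 a.2 L

lemma chainLaw_apply (hp : IsTransitionPMF p) {t₀ : ℝ≥0} {x : E} {L : List (ℝ≥0 × E)}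
    (hL : (L.map Prod.fst).Pairwise (· ≤ ·)) {f : ℝ≥0 → E} :
    (chainLaw p t₀ x (L.map Prod.fst) f).toOuterMeasure {g | ∀ a ∈ L, g a.1 = a.2} =
      pathProd p t₀ x L := by
  classical
  induction L generalizing t₀ x f with
  | nil => simp [chainLaw, pathProd]
  | cons a L ih =>
    simp only [List.map_cons] at hL ⊢
    rw [chainLaw, PMF.toOuterMeasure_bind_apply, tsum_eq_single a.2, pathProd]
    · congr 1
      rw [← ih (List.Pairwise.of_cons hL)]
      refine PMF.toOuterMeasure_apply_eq_of_inter_support_eq _ ?_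
      ext g
      simp only [Set.mem_inter_iff, Set.mem_ofPred_eq, List.forall_mem_cons]
      refine ⟨fun h => ⟨h.1.2, h.2⟩, fun h => ⟨⟨?_, h.1⟩, h.2⟩⟩
      exact chainLaw_eq_self hp hL (by simp) g h.2
    · intro y hy
      refine mul_eq_zero_of_right _ ?_
      rw [PMF.toOuterMeasure_apply_eq_zero_iff, Set.disjoint_left]
      intro g hg hg'
      have h1 := chainLaw_eq_self hp hL (by simp) g hg
      exact hy (h1.symm.trans (hg' a List.mem_cons_self))

lemma chainLaw_toFinset (hp : IsTransitionPMF p) {x : E} {l : List ℝ≥0}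
    (hl : l.Pairwise (· ≤ ·)) :
    chainLaw p 0 x (l.toFinset.sort (· ≤ ·)) (fun _ => x) = chainLaw p 0 x l fun _ => x := by
  rw [chainLaw_dedup hp hl]
  congr 1
  refine List.Perm.eq_of_pairwise (le := (· ≤ ·)) (fun a b _ _ => le_antisymm)
    (Finset.pairwise_sort _ _) (hl.sublist (List.dedup_sublist l)) ?_
  rw [List.perm_ext_iff_of_nodup (Finset.sort_nodup _ _) (List.nodup_dedup l)]
  simp

variable [MeasurableSpace E]

/-- The law at finitely many times of the chain started from `x`. -/
def fidiLaw (p : ℝ≥0 → E → PMF E) (x : E) (I : Finset ℝ≥0) : Measure (∀ _ : I, E) :=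
  ((chainLaw p 0 x (I.sort (· ≤ ·)) fun _ => x).map fun f (i : I) => f i).toMeasure

instance (x : E) (I : Finset ℝ≥0) : IsProbabilityMeasure (fidiLaw p x I) :=
  PMF.toMeasure.isProbabilityMeasure _

/-- Consistency: the law at fewer times is the image of the law at more times. -/
lemma fidiLaw_map (hp : IsTransitionPMF p) (x : E) {I J : Finset ℝ≥0} (hJI : J ⊆ I) :
    (fidiLaw p x I).map (fun (f : I → E) (j : J) => f ⟨j, hJI j.2⟩) = fidiLaw p x J := by
  classical
  have hm : Measurable fun (f : I → E) (j : J) => f ⟨j, hJI j.2⟩ := by fun_prop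
  have h1 := chainLaw_map_filter hp (J : Set ℝ≥0) (t₀ := 0) (x := x) (f := fun _ => x)
    (l := I.sort (· ≤ ·))
    (List.pairwise_cons.2 ⟨fun _ _ => zero_le, Finset.pairwise_sort _ _⟩)
  have h2 := chainLaw_toFinset hp (x := x) (l := (I.sort (· ≤ ·)).filter (· ∈ (J : Set ℝ≥0)))
    ((Finset.pairwise_sort I (· ≤ ·)).filter _)
  have h3 : ((I.sort (· ≤ ·)).filter (· ∈ (J : Set ℝ≥0))).toFinset = J := by
    ext u
    simp only [List.mem_toFinset, List.mem_filter, Finset.mem_sort, decide_eq_true_eq,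
      Finset.mem_coe]
    exact ⟨fun h => h.2, fun h => ⟨hJI h, h⟩⟩
  rw [h3] at h2
  rw [← h2] at h1
  have h4 : (chainLaw p 0 x (I.sort (· ≤ ·)) fun _ => x).map (fun f (j : J) => f j) =
      (chainLaw p 0 x (J.sort (· ≤ ·)) fun _ => x).map fun f (j : J) => f j := h1
  rw [fidiLaw, PMF.toMeasure_map (hf := hm), PMF.map_comp, fidiLaw, ← h4]
  rfl

lemma isProjectiveMeasureFamily_fidiLaw (hp : IsTransitionPMF p) (x : E) :
    IsProjectiveMeasureFamily (α := fun _ : ℝ≥0 => E) (fidiLaw p x) :=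
  fun _ _ hJI => (fidiLaw_map hp x hJI).symm

/-- For every transition function there is a process with this transition function. -/
theorem exists_measure_pathProd [MeasurableSingletonClass E] [Countable E]
    (hp : IsTransitionPMF p) (x : E) :
    ∃ μ : Measure (ℝ≥0 → E), IsProbabilityMeasure μ ∧ ∀ L : List (ℝ≥0 × E),
      (L.map Prod.fst).Pairwise (· ≤ ·) → μ {f | ∀ a ∈ L, f a.1 = a.2} = pathProd p 0 x L := by
  classical
  obtain ⟨μ, hμ⟩ := exists_isProjectiveLimit (fidiLaw p x) (isProjectiveMeasureFamily_fidiLaw hp x)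
  refine ⟨μ, hμ.isProbabilityMeasure, fun L hL => ?_⟩
  set I := (L.map Prod.fst).toFinset with hI
  have hmem : ∀ a ∈ L, a.1 ∈ I := fun a ha => List.mem_toFinset.2 (List.mem_map_of_mem ha)
  set T : Set (∀ _ : I, E) := {f | ∀ a (ha : a ∈ L), f ⟨a.1, hmem a ha⟩ = a.2} with hT
  have h1 : {f : ℝ≥0 → E | ∀ a ∈ L, f a.1 = a.2} = cylinder I T := rfl
  have hTm : MeasurableSet T := T.to_countable.measurableSet
  rw [h1, hμ.measure_cylinder I hTm, fidiLaw, PMF.toMeasure_apply_eq_toOuterMeasure_apply _ hTm,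
    PMF.toOuterMeasure_map_apply, chainLaw_toFinset hp hL, ← chainLaw_apply hp hL]
  rfl

end ChainLaw

/-! ### The Markov process of a sub-Markov kernel -/

lemma tsum_option_ennreal {X : Type*} (f : Option X → ℝ≥0∞) :
    ∑' o, f o = f none + ∑' x, f (some x) := by
  classical
  rw [ENNReal.tsum_eq_add_tsum_ite none]
  congr 1
  rw [← (Option.some_injective X).tsum_eq]
  · simp
  · intro o ho
    rcases o with _ | x
    · simp at ho
    · exact ⟨x, rfl⟩

/-- The mass at `none` is determined by the masses at the other points. -/
lemma pmf_option_ext {X : Type*} {p p' : PMF (Option X)} (h : ∀ x, p (some x) = p' (some x)) :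
    p = p' := by
  refine PMF.ext fun o => ?_
  rcases o with _ | x
  · have h1 := p.tsum_coe
    have h2 := p'.tsum_coe
    rw [tsum_option_ennreal] at h1 h2
    simp only [h] at h1
    have hne : ∑' x, p' (some x) ≠ ⊤ := fun hT => by simp [hT] at h2
    exact (ENNReal.add_left_inj hne).1 (h1.trans h2.symm)
  · exact h x

namespace IsSubMarkovKernel

variable {X : Type*} {q : ℝ → X → X → ℝ}

lemma tsum_ofReal_le_one (hq : IsSubMarkovKernel q) {t : ℝ} (ht : 0 ≤ t) (x : X) :
    ∑' y, ENNReal.ofReal (q t x y) ≤ 1 := by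
  rw [← ENNReal.ofReal_tsum_of_nonneg (hq.nonneg t ht x) (hq.summable ht x)]
  exact ENNReal.ofReal_le_one.2 (hq.tsum_le_one ht x)

/-- The conservative transition function on the state space with a cemetery `none` added. -/
def ext (hq : IsSubMarkovKernel q) (t : ℝ≥0) : Option X → PMF (Option X)
  | none => PMF.pure none
  | some x => ⟨fun o => o.elim (1 - ∑' y, ENNReal.ofReal (q t x y))
      fun y => ENNReal.ofReal (q t x y), by
        rw [ENNReal.summable.hasSum_iff, tsum_option_ennreal]
        exact tsub_add_cancel_of_le (hq.tsum_ofReal_le_one t.2 x)⟩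

lemma ext_some_some (hq : IsSubMarkovKernel q) (t : ℝ≥0) (x y : X) :
    hq.ext t (some x) (some y) = ENNReal.ofReal (q t x y) := rfl

lemma ext_some_none (hq : IsSubMarkovKernel q) (t : ℝ≥0) (x : X) :
    hq.ext t (some x) none = 1 - ∑' y, ENNReal.ofReal (q t x y) := rfl

lemma ext_none_some (hq : IsSubMarkovKernel q) (t : ℝ≥0) (y : X) :
    hq.ext t none (some y) = 0 := by simp [ext]

lemma isTransitionPMF_ext (hq : IsSubMarkovKernel q) : IsTransitionPMF hq.ext where
  zero := fun o => by
    classical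
    rcases o with _ | x
    · rfl
    · refine pmf_option_ext fun y => ?_
      rw [ext_some_some, PMF.pure_apply]
      by_cases hxy : y = x
      · subst hxy; simp [hq.zero_self]
      · simp [hxy, hq.zero_ne x y (Ne.symm hxy)]
  bind := fun s t o => by
    rcases o with _ | x
    · exact PMF.pure_bind _ _
    · refine pmf_option_ext fun z => ?_
      rw [PMF.bind_apply, tsum_option_ennreal, ext_none_some, mul_zero, zero_add]
      simp only [ext_some_some, NNReal.coe_add]
      rw [← (hq.hasSum t s t.2 s.2 x z).tsum_eq, ENNReal.ofReal_tsum_of_nonneg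
        (fun y => mul_nonneg (hq.nonneg s s.2 x y) (hq.nonneg t t.2 y z))
        (hq.hasSum t s t.2 s.2 x z).summable]
      exact tsum_congr fun y => (ENNReal.ofReal_mul (hq.nonneg s s.2 x y)).symm

/-- A path which avoids the cemetery has the probability given by the kernel itself. -/
lemma pathProd_ext (hq : IsSubMarkovKernel q) {k : ℕ} (τ : Fin (k + 1) → ℝ≥0) (hτ : Monotone τ)
    (c : Fin (k + 1) → X) :
    pathProd hq.ext (τ 0) (some (c 0)) (List.ofFn fun i : Fin k => (τ i.succ, some (c i.succ))) =
      ENNReal.ofReal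
        (∏ i : Fin k, q ((τ i.succ : ℝ) - τ i.castSucc) (c i.castSucc) (c i.succ)) := by
  induction k with
  | zero => simp [pathProd]
  | succ k ih =>
    have hle : τ 0 ≤ τ (Fin.succ 0) := hτ (Fin.zero_le _)
    have h0 : (0 : ℝ) ≤ (τ (Fin.succ 0) : ℝ) - τ 0 := sub_nonneg.2 (NNReal.coe_le_coe.2 hle)
    rw [List.ofFn_succ, pathProd, Fin.prod_univ_succ, Fin.castSucc_zero,
      ENNReal.ofReal_mul (hq.nonneg _ h0 _ _), ext_some_some, NNReal.coe_sub hle]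
    congr 1
    exact ih (fun i => τ i.succ) (fun i j hij => hτ (Fin.succ_le_succ_iff.2 hij))
      fun i => c i.succ

/-- Every sub-Markov kernel on a countable space is the transition function of a Markov process.
The process is obtained from the projective limit of the finite-dimensional distributions on
the space with a cemetery; its lifetime is the infimum of the rational times at
which the path is in the cemetery, which at every fixed time agrees almost surely with the path. -/
theorem exists_markov_realization {X : Type} [Countable X] {q : ℝ → X → X → ℝ}
    (hq : IsSubMarkovKernel q) : HasMarkovProcess q := by
  classical
  let _ : MeasurableSpace (Option X) := ⊤
  rcases isEmpty_or_nonempty X with hX | ⟨⟨d⟩⟩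
  · refine ⟨Unit, inferInstance, fun x => (hX.false x).elim, fun _ _ => none, fun _ => 0,
      fun x => (hX.false x).elim, fun _ x => (hX.false x).elim, fun _ _ => by simp,
      fun _ _ c => (hX.false (c 0)).elim⟩
  choose P hP hPL using fun x : X => exists_measure_pathProd hq.isTransitionPMF_ext (some x)
  set rt : ℚ → ℝ≥0 := fun r => Real.toNNReal r with hrt
  set ζ : (ℝ≥0 → Option X) → ℝ≥0∞ := fun ω =>
    ⨅ r : ℚ, if ω (rt r) = none then (rt r : ℝ≥0∞) else ⊤ with hζ
  set Z : ℝ≥0 → (ℝ≥0 → Option X) → Option X := fun t ω =>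
    if ζ ω ≤ t then none else some ((ω t).getD d) with hZ
  have hms : ∀ (t : ℝ≥0) (T : Set (Option X)), MeasurableSet {ω : ℝ≥0 → Option X | ω t ∈ T} :=
    fun t T => measurable_pi_apply t (MeasurableSpace.measurableSet_top (s := T))
  have hζm : Measurable ζ := Measurable.iInf fun r =>
    Measurable.ite (hms (rt r) {none}) measurable_const measurable_const
  -- two-dimensional distributions
  have htwo : ∀ x s t a b, s ≤ t → P x {ω | ω s = a ∧ ω t = b} =
      hq.ext s (some x) a * hq.ext (t - s) a b := by
    intro x s t a b hst
    have := hPL x [(s, a), (t, b)] (by simpa using hst)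
    simpa [pathProd] using this
  -- The cemetery is absorbing.
  have hA : ∀ x s t, s ≤ t → ∀ᵐ ω ∂P x, ω s = none → ω t = none := by
    intro x s t hst
    have : ∀ᵐ ω ∂P x, ∀ y : X, ¬ (ω s = none ∧ ω t = some y) := by
      refine ae_all_iff.2 fun y => ?_
      rw [ae_iff]
      simp only [not_not]
      rw [htwo x s t none (some y) hst, ext_none_some, mul_zero]
    filter_upwards [this] with ω hω hs
    rcases ht : ω t with _ | y
    · rfl
    · exact (hω y ⟨hs, ht⟩).elim
  -- A path is not in a state of `X` at a fixed time `t` if it is in the cemetery at all later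
  -- rational times, because `q u y y` tends to `1` as `u` tends to `0`.
  have hB : ∀ x t, ∀ᵐ ω ∂P x, (∀ r, t < rt r → ω (rt r) = none) → ω t = none := by
    intro x t
    have : ∀ᵐ ω ∂P x, ∀ y : X, ¬ (ω t = some y ∧ ∀ r, t < rt r → ω (rt r) = none) := by
      refine ae_all_iff.2 fun y => ?_
      rw [ae_iff]
      simp only [not_not]
      refine le_antisymm (ENNReal.le_of_forall_pos_le_add fun ε hε _ => ?_) bot_le
      rw [zero_add]
      have h1 : ∀ᶠ u in nhdsWithin (0 : ℝ) (Set.Ioi 0), 1 - (ε : ℝ) < q u y y :=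
        (hq.tendsto y).eventually (lt_mem_nhds (by simpa using hε))
      obtain ⟨δ, hδ, hδ'⟩ := mem_nhdsGT_iff_exists_Ioo_subset.1 h1
      have hδ0 : (0 : ℝ) < δ := hδ
      obtain ⟨r, -, hr1, hr2⟩ := (NNReal.lt_iff_exists_rat_btwn t (t + ⟨δ, hδ0.le⟩)).1
        (lt_add_of_pos_right t (by exact hδ0))
      have hr2' : (rt r : ℝ) < t + δ := NNReal.coe_lt_coe.2 hr2
      have hr1' : (t : ℝ) < rt r := NNReal.coe_lt_coe.2 hr1
      have h2 : 1 - (ε : ℝ) < q (rt r - t) y y := hδ' ⟨by linarith, by linarith⟩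
      calc P x {ω | ω t = some y ∧ ∀ r, t < rt r → ω (rt r) = none}
          ≤ P x {ω | ω t = some y ∧ ω (rt r) = none} :=
            measure_mono fun ω hω => ⟨hω.1, hω.2 r hr1⟩
        _ ≤ hq.ext (rt r - t) (some y) none := by
            rw [htwo x t (rt r) _ _ hr1.le]
            exact mul_le_of_le_one_left bot_le (PMF.coe_le_one _ _)
        _ ≤ ε := by
            rw [ext_some_none, tsub_le_iff_right, NNReal.coe_sub hr1.le]
            have h3 : ENNReal.ofReal (q (rt r - t) y y) ≤
                ∑' z, ENNReal.ofReal (q (rt r - t) y z) := ENNReal.le_tsum y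
            refine le_trans ?_ (add_le_add_right h3 _)
            rw [← ENNReal.ofReal_coe_nnreal, ← ENNReal.ofReal_add ε.coe_nonneg
              (hq.nonneg (rt r - t) (by linarith) y y), ENNReal.one_le_ofReal]
            linarith
    filter_upwards [this] with ω hω hr
    rcases ht : ω t with _ | y
    · rfl
    · exact (hω y ⟨ht, hr⟩).elim
  -- Hence the process defined through the lifetime is a modification of the coordinate process.
  have hae : ∀ x t, ∀ᵐ ω ∂P x, Z t ω = ω t := by
    intro x t
    have h1 : ∀ᵐ ω ∂P x, ∀ r r' : ℚ, rt r ≤ rt r' → ω (rt r) = none → ω (rt r') = none :=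
      ae_all_iff.2 fun r => ae_all_iff.2 fun r' => by
        by_cases h : rt r ≤ rt r'
        · filter_upwards [hA x _ _ h] with ω hω _ using hω
        · exact Filter.Eventually.of_forall fun ω h' => (h h').elim
    have h2 : ∀ᵐ ω ∂P x, ∀ r : ℚ, t < rt r → ω t = none → ω (rt r) = none :=
      ae_all_iff.2 fun r => by
        by_cases h : t < rt r
        · filter_upwards [hA x _ _ h.le] with ω hω _ using hω
        · exact Filter.Eventually.of_forall fun ω h' => (h h').elim
    filter_upwards [h1, h2, hB x t] with ω h1 h2 h3
    by_cases hle : ζ ω ≤ t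
    · simp only [hZ, hle, if_true]
      refine (h3 fun r hr => ?_).symm
      have h4 : ζ ω < rt r := hle.trans_lt (by exact_mod_cast hr)
      obtain ⟨r', hr'⟩ := iInf_lt_iff.1 h4
      split_ifs at hr' with h5
      · exact h1 r' r (by exact_mod_cast hr'.le) h5
      · exact absurd hr' (by simp)
    · simp only [hZ, hle, if_false]
      rcases ht : ω t with _ | y
      · refine absurd (le_of_forall_gt_imp_ge_of_dense fun b hb => ?_) hle
        obtain ⟨b', hb1, hb2⟩ := ENNReal.lt_iff_exists_nnreal_btwn.1 hb
        obtain ⟨r, -, hr1, hr2⟩ := (NNReal.lt_iff_exists_rat_btwn t b').1 (by exact_mod_cast hb1)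
        refine (iInf_le _ r).trans ?_
        rw [if_pos (h2 r hr1 ht)]
        exact le_trans (by exact_mod_cast hr2.le) hb2.le
      · rfl
  refine ⟨ℝ≥0 → Option X, inferInstance, P, Z, ζ, hP, fun t x => ?_, fun t ω => ?_,
    fun k τ c h0 hτ => ?_⟩
  · have : {ω | Z t ω = some x} = {ω | ζ ω ≤ t}ᶜ ∩ {ω | ω t ∈ {o | o.getD d = x}} := by
      ext ω
      rcases le_or_gt (ζ ω) t with h | h <;> simp [hZ, h]
    rw [this]
    exact (measurableSet_le hζm measurable_const).compl.inter (hms t _)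
  · by_cases h : ζ ω ≤ t <;> simp [hZ, h]
  · have h1 : (P (c 0)) {ω | ∀ i, Z (τ i) ω = some (c i)} =
        (P (c 0)) {ω | ∀ a ∈ List.ofFn fun i => (τ i, some (c i)), ω a.1 = a.2} := by
      refine measure_congr ?_
      filter_upwards [ae_all_iff.2 fun i => hae (c 0) (τ i)] with ω hω
      refine propext ?_
      change (∀ i, Z (τ i) ω = some (c i)) ↔
        ∀ a ∈ List.ofFn fun i => (τ i, some (c i)), ω a.1 = a.2
      simp only [hω, List.forall_mem_ofFn_iff]
    have h2 : (P (c 0)) {ω | ∀ i, Z (τ i) ω = some (c i)} = ENNReal.ofReal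
        (∏ i : Fin k, q ((τ i.succ : ℝ) - τ i.castSucc) (c i.castSucc) (c i.succ)) := by
      rw [h1, hPL, List.ofFn_succ, pathProd, ← hq.pathProd_ext τ hτ c]
      · simp only [h0, tsub_self, hq.isTransitionPMF_ext.zero]
        rw [PMF.pure_apply, if_pos rfl, one_mul]
      · rw [List.map_ofFn, List.pairwise_ofFn]
        exact fun i j hij => hτ hij.le
    rw [measureReal_def, h2, ENNReal.toReal_ofReal]
    refine Finset.prod_nonneg fun i _ => hq.nonneg _ ?_ _ _
    exact sub_nonneg.2 (NNReal.coe_le_coe.2 (hτ (Fin.castSucc_le_succ i)))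

end IsSubMarkovKernel

/-! ### Following arrows -/

section Follows

variable {A : ℤ → Dir → Set ℝ}

/-- Arrow sets which are locally finite at each site and contain no simultaneous arrows. -/
structure IsGoodArrows (A : ℤ → Dir → Set ℝ) : Prop where
  finite : ∀ x a p q, (A x a ∩ Set.Ioc p q).Finite
  eq_of_mem : ∀ x a x' a' t, t ∈ A x a → t ∈ A x' a' → x = x' ∧ a = a'

lemma Follows.le {s t : ℝ} {x y : ℤ} (h : Follows A s t x y) : s ≤ t := by
  induction h with
  | stay hst _ => exact hst
  | jump hsu hut _ _ _ _ => exact hsu.le.trans hut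

lemma follows_self_iff {t : ℝ} {x y : ℤ} : Follows A t t x y ↔ y = x := by
  refine ⟨fun h => ?_, ?_⟩
  · cases h with
    | stay _ _ => rfl
    | jump hsu hut _ _ _ => exact absurd (hsu.trans_le hut) (lt_irrefl _)
  · rintro rfl
    exact .stay le_rfl fun v hv => absurd (hv.1.trans_le hv.2) (lt_irrefl _)

lemma Follows.trans {s u t : ℝ} {x y z : ℤ} (h : Follows A s u x y) (h' : Follows A u t y z) :
    Follows A s t x z := by
  induction h with
  | stay hsu hx =>
    cases h' with
    | stay hut hx' =>
      refine .stay (hsu.trans hut) fun v hv a => ?_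
      rcases le_or_gt v _ with h | h
      · exact hx v ⟨hv.1, h⟩ a
      · exact hx' v ⟨h, hv.2⟩ a
    | jump huv hvt hv hx' hrest =>
      refine .jump (hsu.trans_lt huv) hvt hv (fun w hw a => ?_) hrest
      rcases le_or_gt w _ with h | h
      · exact hx w ⟨hw.1, h⟩ a
      · exact hx' w ⟨h, hw.2⟩ a
  | jump hsv hvu hv hx _ ih => exact .jump hsv (hvu.trans h'.le) hv hx (ih h')

lemma Follows.split {s u t : ℝ} {x z : ℤ} (h : Follows A s t x z) (hsu : s ≤ u) (hut : u ≤ t) :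
    ∃ y, Follows A s u x y ∧ Follows A u t y z := by
  induction h with
  | stay hst hx =>
    exact ⟨_, .stay hsu fun v hv => hx v ⟨hv.1, hv.2.trans hut⟩,
      .stay hut fun v hv => hx v ⟨hsu.trans_lt hv.1, hv.2⟩⟩
  | @jump s v t x y a hsv hvt hv hx hrest ih =>
    rcases lt_or_ge u v with h | h
    · exact ⟨x, .stay hsu fun w hw => hx w ⟨hw.1, hw.2.trans_lt h⟩,
        .jump h hvt hv (fun w hw => hx w ⟨hsu.trans_lt hw.1, hw.2⟩) hrest⟩
    · obtain ⟨w, hw, hw'⟩ := ih h hut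
      exact ⟨w, .jump hsv h hv hx hw, hw'⟩

lemma Follows.unique (hA : IsGoodArrows A) {s t : ℝ} {x y y' : ℤ} (h : Follows A s t x y)
    (h' : Follows A s t x y') : y = y' := by
  induction h with
  | stay hst hx =>
    cases h' with
    | stay _ _ => rfl
    | jump hsu hut hu _ _ => exact absurd hu (hx _ ⟨hsu, hut⟩ _)
  | @jump s u t x y a hsu hut hu hx _ ih =>
    cases h' with
    | stay _ hx' => exact absurd hu (hx' _ ⟨hsu, hut⟩ _)
    | @jump _ v _ _ _ b hsv hvt hv hx' hrest =>
      rcases lt_trichotomy u v with h | h | h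
      · exact absurd hu (hx' _ ⟨hsu, h⟩ _)
      · subst h
        obtain ⟨-, rfl⟩ := hA.eq_of_mem _ _ _ _ _ hu hv
        exact ih hrest
      · exact absurd hv (hx _ ⟨hsv, h⟩ _)

/-- Once the position at an intermediate time is known, the past does not matter. -/
lemma Follows.iff_of_follows (hA : IsGoodArrows A) {s u t : ℝ} {x y z : ℤ} (h : Follows A s u x y)
    (hut : u ≤ t) : Follows A s t x z ↔ Follows A u t y z := by
  refine ⟨fun h' => ?_, h.trans⟩
  obtain ⟨y', h1, h2⟩ := h'.split h.le hut
  rwa [h.unique hA h1]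

/-- A path visits finitely many sites. -/
lemma Follows.exists_finset (hA : IsGoodArrows A) {s t : ℝ} {x y : ℤ} (h : Follows A s t x y) :
    ∃ V : Finset ℤ, ∀ u w, u ≤ t → Follows A s u x w → w ∈ V := by
  classical
  induction h with
  | @stay s t x hst hx =>
    refine ⟨{x}, fun u w hu hw => Finset.mem_singleton.2 (hw.unique hA (.stay hw.le ?_))⟩
    exact fun v hv => hx v ⟨hv.1, hv.2.trans hu⟩
  | @jump s v t x y a hsv hvt hv hx hrest ih =>
    obtain ⟨V, hV⟩ := ih
    refine ⟨insert x V, fun u w hu hw => Finset.mem_insert.2 ?_⟩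
    rcases lt_or_ge u v with h | h
    · exact Or.inl (hw.unique hA (.stay hw.le fun r hr => hx r ⟨hr.1, hr.2.trans_lt h⟩))
    · right
      refine hV u w hu (((Follows.jump hsv le_rfl hv hx
        (follows_self_iff.2 rfl)).iff_of_follows hA h).1 hw)

/-! ### Discretization of the time interval -/

/-- The transition from `x` to `y` can be read off from the knowledge of which kinds of arrows
(`c x a`) are present during a short time interval: there is no arrow at `x`, or there are only
arrows of one direction, which lead to `y`, and no arrows at `y`. -/
def CellStep (c : ℤ → Dir → Prop) (x y : ℤ) : Prop :=
  (y = x ∧ ∀ a, ¬ c x a) ∨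
    ∃ a, y = move a x ∧ c x a ∧ (∀ a', a' ≠ a → ¬ c x a') ∧ ∀ a', ¬ c y a'

/-- The composition of the first steps of a sequence. -/
def GridPath (c : ℕ → ℤ → Dir → Prop) : ℕ → ℤ → ℤ → Prop
  | 0, x, y => y = x
  | j + 1, x, y => ∃ w, GridPath c j x w ∧ CellStep (c j) w y

/-- Paths cannot cross: neighbouring particles cannot exchange their places in one step, because the
target of a moving particle has no arrows in this step. -/
lemma CellStep.mono {c : ℤ → Dir → Prop} {x y x' y' : ℤ} (h : CellStep c x y)
    (h' : CellStep c x' y') (hx : x ≤ x') : y ≤ y' := by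
  rcases h with ⟨rfl, h⟩ | ⟨a, rfl, ha, ha', hy⟩ <;>
    rcases h' with ⟨rfl, h'⟩ | ⟨b, rfl, hb, hb', hy'⟩
  · exact hx
  · rcases hx.eq_or_lt with rfl | hx
    · exact absurd hb (h b)
    · cases b
      · simp only [move_up]; omega
      · simp only [move_down]; omega
  · rcases hx.eq_or_lt with rfl | hx
    · exact absurd ha (h' a)
    · cases a
      · simp only [move_up]; omega
      · simp only [move_down]; omega
  · rcases hx.eq_or_lt with rfl | hx
    · by_cases hab : b = a
      · rw [hab]
      · exact absurd hb (ha' b hab)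
    · cases a <;> cases b
      · simp only [move_up]; omega
      · simp only [move_up, move_down] at *
        have : x' ≠ x + 1 := fun h => hy .down (h ▸ hb)
        omega
      · simp only [move_up, move_down]; omega
      · simp only [move_down]; omega

lemma GridPath.mono {c : ℕ → ℤ → Dir → Prop} {j : ℕ} {x y x' y' : ℤ} (h : GridPath c j x y)
    (h' : GridPath c j x' y') (hx : x ≤ x') : y ≤ y' := by
  induction j generalizing y y' with
  | zero => rw [GridPath] at h h'; omega
  | succ j ih =>
    obtain ⟨w, hw, hy⟩ := h
    obtain ⟨w', hw', hy'⟩ := h'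
    exact hy.mono hy' (ih hw hw')

/-- There are arrows of the kind `(x, a)` during `(p, q]`. -/
def HasArrow (A : ℤ → Dir → Set ℝ) (p q : ℝ) (x : ℤ) (a : Dir) : Prop :=
  (A x a ∩ Set.Ioc p q).Nonempty

lemma follows_of_cellStep (hA : IsGoodArrows A) {p q : ℝ} (hpq : p ≤ q) {x y : ℤ}
    (h : CellStep (HasArrow A p q) x y) : Follows A p q x y := by
  rcases h with ⟨rfl, h⟩ | ⟨a, rfl, ha, ha', hy⟩
  · exact .stay hpq fun v hv a hva => h a ⟨v, hva, hv⟩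
  · obtain ⟨u, hu, hmin⟩ := Set.exists_min_image _ id (hA.finite x a p q) ha
    refine .jump hu.2.1 hu.2.2 hu.1 (fun v hv a' hva => ?_) (.stay hu.2.2 fun v hv a' hva => ?_)
    · by_cases haa : a' = a
      · subst haa
        exact absurd (hmin v ⟨hva, hv.1, hv.2.le.trans hu.2.2⟩) (not_le.2 hv.2)
      · exact ha' a' haa ⟨v, hva, hv.1, hv.2.le.trans hu.2.2⟩
    · exact hy a' ⟨v, hva, hu.2.1.trans hv.1, hv.2⟩

lemma follows_of_gridPath (hA : IsGoodArrows A) {t : ℕ → ℝ} (ht : Monotone t) {j : ℕ} {x y : ℤ}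
    (h : GridPath (fun i => HasArrow A (t i) (t (i + 1))) j x y) : Follows A (t 0) (t j) x y := by
  induction j generalizing y with
  | zero => exact follows_self_iff.2 h
  | succ j ih =>
    obtain ⟨w, hw, hy⟩ := h
    exact (ih hw).trans (follows_of_cellStep hA (ht (Nat.le_succ j)) hy)

/-- The points of a finite set are separated by a positive distance. -/
lemma exists_gap {F : Set ℝ} (hF : F.Finite) : ∃ δ > 0, ∀ u ∈ F, ∀ v ∈ F, |u - v| < δ → u = v := by
  classical
  rcases (hF.toFinset.offDiag).eq_empty_or_nonempty with h | h
  · refine ⟨1, one_pos, fun u hu v hv _ => ?_⟩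
    by_contra hne
    have : (u, v) ∈ hF.toFinset.offDiag := by simp [hu, hv, hne]
    rw [h] at this
    simp at this
  · obtain ⟨⟨u0, v0⟩, h0, hmin⟩ := Finset.exists_min_image _ (fun p : ℝ × ℝ => |p.1 - p.2|) h
    refine ⟨|u0 - v0|, ?_, fun u hu v hv huv => ?_⟩
    · simp only [Finset.mem_offDiag] at h0
      exact abs_pos.2 (sub_ne_zero.2 h0.2.2)
    · by_contra hne
      exact absurd (hmin (u, v) (by simp [hu, hv, hne])) (not_le.2 huv)

/-- A path is recovered from all sufficiently fine discretizations. -/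
lemma Follows.exists_gridPath (hA : IsGoodArrows A) {s T : ℝ} {x y : ℤ} (h : Follows A s T x y) :
    ∃ δ > 0, ∀ (t : ℕ → ℝ) (M : ℕ), Monotone t → t 0 = s → t M = T →
      (∀ j, t (j + 1) - t j < δ) → GridPath (fun i => HasArrow A (t i) (t (i + 1))) M x y := by
  classical
  obtain ⟨V, hV⟩ := h.exists_finset hA
  -- The times of all arrows at the finitely many visited sites and their neighbours. If the mesh is
  -- smaller than their minimal distance, then each cell contains at most one of these arrows.
  set F : Set ℝ := ⋃ w ∈ V, ⋃ a, ((A w a ∩ Set.Ioc s T) ∪ ⋃ b, (A (move b w) a ∩ Set.Ioc s T))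
    with hF
  have hfin : F.Finite := by
    refine Set.Finite.biUnion (Finset.finite_toSet V) fun w _ => Set.finite_iUnion fun a => ?_
    exact (hA.finite _ _ _ _).union (Set.finite_iUnion fun b => hA.finite _ _ _ _)
  obtain ⟨δ, hδ, hgap⟩ := exists_gap hfin
  refine ⟨δ, hδ, fun t M ht h0 hM hmesh => ?_⟩
  have key : ∀ j ≤ M, ∀ w, Follows A s (t j) x w →
      GridPath (fun i => HasArrow A (t i) (t (i + 1))) j x w := by
    intro j
    induction j with
    | zero =>
      intro _ w hw
      rw [h0, follows_self_iff] at hw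
      exact hw
    | succ j ih =>
      intro hj w hw
      have hs : s ≤ t j := h0 ▸ ht (Nat.zero_le j)
      have hjT : t (j + 1) ≤ T := hM ▸ ht hj
      have hlt := ht (Nat.le_succ j)
      obtain ⟨v, hv, hvw⟩ := hw.split hs hlt
      refine ⟨v, ih (by omega) v hv, ?_⟩
      have hvV : v ∈ V := hV (t j) v (hlt.trans hjT) hv
      have hmemF : ∀ a r, r ∈ A v a → r ∈ Set.Ioc (t j) (t (j + 1)) → r ∈ F := fun a r hr hr' =>
        Set.mem_biUnion hvV (Set.mem_iUnion.2 ⟨a, Or.inl ⟨hr, hs.trans_lt hr'.1, hr'.2.trans hjT⟩⟩)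
      have hmemF' : ∀ a b r, r ∈ A (move b v) a → r ∈ Set.Ioc (t j) (t (j + 1)) → r ∈ F :=
        fun a b r hr hr' => Set.mem_biUnion hvV (Set.mem_iUnion.2
          ⟨a, Or.inr (Set.mem_iUnion.2 ⟨b, hr, hs.trans_lt hr'.1, hr'.2.trans hjT⟩)⟩)
      have honly : ∀ r r', r ∈ F → r' ∈ F → r ∈ Set.Ioc (t j) (t (j + 1)) →
          r' ∈ Set.Ioc (t j) (t (j + 1)) → r = r' := fun r r' hr hr' h1 h2 =>
        hgap r hr r' hr' (lt_of_le_of_lt (abs_sub_le_iff.2 ⟨by linarith [h1.2, h2.1],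
          by linarith [h2.2, h1.1]⟩) (hmesh j))
      cases hvw with
      | stay _ hx => exact Or.inl ⟨rfl, fun a ⟨r, hr, hr'⟩ => hx r hr' a hr⟩
      | @jump _ u _ _ _ a hu1 hu2 hu hx hrest =>
        have huI : u ∈ Set.Ioc (t j) (t (j + 1)) := ⟨hu1, hu2⟩
        have hno : ∀ a', ¬ HasArrow A (t j) (t (j + 1)) (move a v) a' := by
          rintro a' ⟨r, hr, hr'⟩
          have := honly r u (hmemF' _ _ r hr hr') (hmemF _ u hu huI) hr' huI
          subst this
          have := (hA.eq_of_mem _ _ _ _ _ hr hu).1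
          cases a
          · simp only [move_up] at this; omega
          · simp only [move_down] at this; omega
        have hw' : w = move a v := hrest.unique hA
          (.stay hu2 fun r hr a' hra => hno a' ⟨r, hra, hu1.trans hr.1, hr.2⟩)
        refine Or.inr ⟨a, hw', ⟨u, hu, huI⟩, fun a' haa ⟨r, hr, hr'⟩ => ?_, fun a' => ?_⟩
        · have := honly r u (hmemF _ r hr hr') (hmemF _ u hu huI) hr' huI
          subst this
          exact haa (hA.eq_of_mem _ _ _ _ _ hr hu).2
        · rw [hw']; exact hno a'
  exact key M le_rfl y (hM.symm ▸ h)

/-- The standard partition of `[s, T]` into `m + 1` intervals, continued beyond `T`. -/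
def gridTime (s T : ℝ) (m j : ℕ) : ℝ := s + j * ((T - s) / (m + 1))

lemma gridTime_zero (s T : ℝ) (m : ℕ) : gridTime s T m 0 = s := by simp [gridTime]

lemma gridTime_last (s T : ℝ) (m : ℕ) : gridTime s T m (m + 1) = T := by
  have : (m : ℝ) + 1 ≠ 0 := by positivity
  simp only [gridTime, Nat.cast_add, Nat.cast_one]
  field_simp
  ring

lemma gridTime_succ_sub (s T : ℝ) (m j : ℕ) :
    gridTime s T m (j + 1) - gridTime s T m j = (T - s) / (m + 1) := by
  simp only [gridTime, Nat.cast_add, Nat.cast_one]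
  ring

lemma gridTime_monotone {s T : ℝ} (h : s ≤ T) (m : ℕ) : Monotone (gridTime s T m) :=
  monotone_nat_of_le_succ fun j => by
    have := gridTime_succ_sub s T m j
    have : 0 ≤ (T - s) / (m + 1) := div_nonneg (sub_nonneg.2 h) (by positivity)
    linarith

lemma Follows.eventually_gridPath (hA : IsGoodArrows A) {s T : ℝ} {x y : ℤ}
    (h : Follows A s T x y) : ∀ᶠ m in Filter.atTop, GridPath
      (fun i => HasArrow A (gridTime s T m i) (gridTime s T m (i + 1))) (m + 1) x y := by
  obtain ⟨δ, hδ, h1⟩ := h.exists_gridPath hA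
  have h2 : Filter.Tendsto (fun m : ℕ => (T - s) / ((m : ℝ) + 1)) Filter.atTop (nhds 0) :=
    tendsto_const_nhds.div_atTop
      (Filter.tendsto_atTop_add_const_right _ _ tendsto_natCast_atTop_atTop)
  filter_upwards [h2.eventually (gt_mem_nhds hδ)] with m hm
  exact h1 _ _ (gridTime_monotone h.le m) (gridTime_zero _ _ _) (gridTime_last _ _ _)
    fun j => by rwa [gridTime_succ_sub]

lemma exists_follows_iff_eventually (hA : IsGoodArrows A) {s T : ℝ} (hsT : s ≤ T) {x : ℤ}
    {B : Set ℤ} : ((∃ y ∈ B, Follows A s T x y) → ∀ᶠ m in Filter.atTop, ∃ y ∈ B, GridPath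
      (fun i => HasArrow A (gridTime s T m i) (gridTime s T m (i + 1))) (m + 1) x y) ∧
    ∀ m, (∃ y ∈ B, GridPath
      (fun i => HasArrow A (gridTime s T m i) (gridTime s T m (i + 1))) (m + 1) x y) →
      ∃ y ∈ B, Follows A s T x y := by
  refine ⟨fun ⟨y, hy, h⟩ => ?_, fun m ⟨y, hy, h⟩ => ⟨y, hy, ?_⟩⟩
  · filter_upwards [h.eventually_gridPath hA] with m hm using ⟨y, hy, hm⟩
  · have := follows_of_gridPath hA (gridTime_monotone hsT m) h
    rwa [gridTime_zero, gridTime_last] at this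

lemma Follows.mono (hA : IsGoodArrows A) {s T : ℝ} {x y x' y' : ℤ} (h : Follows A s T x y)
    (h' : Follows A s T x' y') (hx : x ≤ x') : y ≤ y' := by
  obtain ⟨m, hm, hm'⟩ := ((h.eventually_gridPath hA).and (h'.eventually_gridPath hA)).exists
  exact hm.mono hm' hx

end Follows

/-! ### Poisson arrows -/

section Step

variable {f : ℝ → ℤ}

lemma continuousAt_of_eq_of_mem_Ioc (hf : Monotone f)
    (hr : ∀ t, ContinuousWithinAt f (Set.Ici t) t) {p q u : ℝ} (hpq : f p = f q)
    (hu : u ∈ Set.Ioc p q) : ContinuousAt f u := by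
  refine continuousAt_iff_continuous_left_right.2 ⟨?_, hr u⟩
  have : ∀ v ∈ Set.Icc p q, f v = f p := fun v hv =>
    le_antisymm ((hf hv.2).trans hpq.ge) (hf hv.1)
  refine (continuousWithinAt_const (b := f p)).congr_of_eventuallyEq ?_
    (this u ⟨hu.1.le, hu.2⟩)
  filter_upwards [self_mem_nhdsWithin, mem_nhdsWithin_of_mem_nhds (Ioi_mem_nhds hu.1)] with v h1 h2
  exact this v ⟨le_of_lt h2, le_trans h1 hu.2⟩

lemma eq_of_continuousAt (hr : ∀ t, ContinuousWithinAt f (Set.Ici t) t) {p q : ℝ} (hpq : p ≤ q)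
    (h : ∀ u ∈ Set.Ioc p q, ContinuousAt f u) : f p = f q := by
  refine isPreconnected_Icc.constant (s := Set.Icc p q) (fun u hu => ?_) (Set.left_mem_Icc.2 hpq)
    (Set.right_mem_Icc.2 hpq)
  rcases hu.1.eq_or_lt with rfl | h'
  · exact (hr _).mono Set.Icc_subset_Ici_self
  · exact (h u ⟨h', hu.2⟩).continuousWithinAt

lemma finite_not_continuousAt (hf : Monotone f)
    (hr : ∀ t, ContinuousWithinAt f (Set.Ici t) t) (p q : ℝ) :
    ({u | ¬ ContinuousAt f u} ∩ Set.Ioc p q).Finite := by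
  have key : ∀ u v, u < v → ¬ ContinuousAt f v → f u ≠ f v := fun u v huv hv h =>
    hv (continuousAt_of_eq_of_mem_Ioc hf hr h ⟨huv, le_rfl⟩)
  refine Set.Finite.of_injOn (f := f) (t := Set.Icc (f p) (f q))
    (fun u hu => ⟨hf hu.2.1.le, hf hu.2.2⟩) (fun u hu v hv h => ?_) (Set.finite_Icc _ _)
  rcases lt_trichotomy u v with h' | h' | h'
  · exact absurd h (key u v h' hv.1)
  · exact h'
  · exact absurd h.symm (key v u h' hu.1)

end Step

section ArrowField

variable {Ω : Type*} [MeasurableSpace Ω] {P : Measure Ω} {J : Set ℤ} {b d : ℤ → ℝ}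
  {N : J × Dir → ℝ → Ω → ℤ}

lemma IsArrowField.poisson (hN : IsArrowField P J b d N) (k : J × Dir) :
    IsPoissonProcess P (N k) (rate b d k.2 k.1) := by
  obtain ⟨x, a⟩ := k
  cases a
  · exact hN.up x
  · exact hN.down x

/-- The counting process of the arrows from `x` in direction `a` increases during `(p, q]`. -/
def Jumps (N : J × Dir → ℝ → Ω → ℤ) (ω : Ω) (p q : ℝ) (x : ℤ) (a : Dir) : Prop :=
  ∃ h : x ∈ J, N (⟨x, h⟩, a) q ω - N (⟨x, h⟩, a) p ω ≠ 0

/-- Almost surely, arrows during `(p, q]` are detected by the increment of the counting process. -/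
lemma IsArrowField.ae_hasArrow_iff (hN : IsArrowField P J b d N) :
    ∀ᵐ ω ∂P, ∀ p q, p ≤ q → ∀ x a,
      HasArrow (arrowTimes N ω) p q x a ↔ Jumps N ω p q x a := by
  have h1 : ∀ᵐ ω ∂P, ∀ k, Monotone fun t => N k t ω := ae_all_iff.2 fun k => (hN.poisson k).mono
  have h2 := ae_all_iff.2 fun k => (hN.poisson k).rightCont
  filter_upwards [h1, h2] with ω h1 h2 p q hpq x a
  constructor
  · rintro ⟨u, ⟨hx, hu⟩, hu'⟩
    exact ⟨hx, fun h => hu (continuousAt_of_eq_of_mem_Ioc (h1 _) (h2 _)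
      (sub_eq_zero.1 h).symm hu')⟩
  · rintro ⟨hx, h⟩
    by_contra hno
    refine h (sub_eq_zero.2 (eq_of_continuousAt (h2 (⟨x, hx⟩, a)) hpq fun u hu => ?_).symm)
    by_contra hc
    exact hno ⟨u, ⟨hx, hc⟩, hu⟩

lemma IsArrowField.ae_finite (hN : IsArrowField P J b d N) :
    ∀ᵐ ω ∂P, ∀ x a p q, (arrowTimes N ω x a ∩ Set.Ioc p q).Finite := by
  have h1 : ∀ᵐ ω ∂P, ∀ k, Monotone fun t => N k t ω := ae_all_iff.2 fun k => (hN.poisson k).mono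
  have h2 := ae_all_iff.2 fun k => (hN.poisson k).rightCont
  filter_upwards [h1, h2] with ω h1 h2 x a p q
  by_cases hx : x ∈ J
  · refine (finite_not_continuousAt (h1 (⟨x, hx⟩, a)) (h2 _) p q).subset ?_
    exact Set.inter_subset_inter_left _ fun u hu => hu.2
  · refine Set.finite_empty.subset ?_
    rintro u ⟨⟨h, -⟩, -⟩
    exact hx h

lemma IsArrowField.measurableSet_jumps (hN : IsArrowField P J b d N) (p q : ℝ) (x : ℤ) (a : Dir) :
    MeasurableSet {ω | Jumps N ω p q x a} := by
  by_cases hx : x ∈ J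
  · have : {ω | Jumps N ω p q x a} =
        (fun ω => N (⟨x, hx⟩, a) q ω - N (⟨x, hx⟩, a) p ω) ⁻¹' {0}ᶜ := by
      ext ω; simp [Jumps, hx]
    rw [this]
    have h := hN.poisson (⟨x, hx⟩, a)
    exact ((h.measurable q).sub (h.measurable p)) (MeasurableSet.of_discrete)
  · have : {ω | Jumps N ω p q x a} = ∅ := by ext ω; simp [Jumps, hx]
    rw [this]; exact .empty

lemma IsArrowField.indep_jumps (hN : IsArrowField P J b d N) (p q : ℝ) {x x' : ℤ} {a a' : Dir}
    (h : (x, a) ≠ (x', a')) :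
    P.real ({ω | Jumps N ω p q x a} ∩ {ω | Jumps N ω p q x' a'}) =
      P.real {ω | Jumps N ω p q x a} * P.real {ω | Jumps N ω p q x' a'} := by
  by_cases hx : x ∈ J
  swap
  · have : {ω | Jumps N ω p q x a} = ∅ := by ext ω; simp [Jumps, hx]
    simp [this]
  by_cases hx' : x' ∈ J
  swap
  · have : {ω | Jumps N ω p q x' a'} = ∅ := by ext ω; simp [Jumps, hx']
    simp [this]
  have hne : ((⟨x, hx⟩, a) : J × Dir) ≠ (⟨x', hx'⟩, a') := by
    intro h'
    simp only [Prod.mk.injEq, Subtype.mk.injEq] at h'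
    exact h (Prod.ext h'.1 h'.2)
  have h1 := (hN.indep.indepFun hne).comp (φ := fun g : ℝ → ℤ => g q - g p)
    (ψ := fun g : ℝ → ℤ => g q - g p) (by fun_prop) (by fun_prop)
  have h2 := h1.measure_inter_preimage_eq_mul {0}ᶜ {0}ᶜ (MeasurableSet.of_discrete)
    (MeasurableSet.of_discrete)
  have e : {ω | Jumps N ω p q x a} =
      ((fun g : ℝ → ℤ => g q - g p) ∘ fun ω t => N (⟨x, hx⟩, a) t ω) ⁻¹' {0}ᶜ := by
    ext ω; simp [Jumps, hx]
  have e' : {ω | Jumps N ω p q x' a'} =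
      ((fun g : ℝ → ℤ => g q - g p) ∘ fun ω t => N (⟨x', hx'⟩, a') t ω) ⁻¹' {0}ᶜ := by
    ext ω; simp [Jumps, hx']
  rw [e, e', Measure.real, h2, ENNReal.toReal_mul]
  rfl

variable [IsProbabilityMeasure P]

/-- The probability that a Poisson variable does not vanish. -/
lemma IsArrowField.measureReal_jumps (hN : IsArrowField P J b d N) {p q : ℝ} (hpq : p ≤ q) {x : ℤ}
    {a : Dir} (hx : x ∈ J) (hr : 0 ≤ rate b d a x) :
    P.real {ω | Jumps N ω p q x a} = 1 - Real.exp (-(rate b d a x * (q - p))) := by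
  have h := hN.poisson (⟨x, hx⟩, a)
  have hm : Measurable fun ω => N (⟨x, hx⟩, a) q ω - N (⟨x, hx⟩, a) p ω :=
    (h.measurable q).sub (h.measurable p)
  have h0 : {ω | Jumps N ω p q x a}ᶜ =
      (fun ω => N (⟨x, hx⟩, a) q ω - N (⟨x, hx⟩, a) p ω) ⁻¹' {0} := by
    ext ω; simp [Jumps, hx]
  have h1 := h.law p q hpq
  have h2 : P.real {ω | Jumps N ω p q x a}ᶜ = Real.exp (-(rate b d a x * (q - p))) := by
    rw [h0, ← map_measureReal_apply hm (MeasurableSet.of_discrete), h1,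
      map_measureReal_apply (by fun_prop) (MeasurableSet.of_discrete)]
    have : (fun m : ℕ => (m : ℤ)) ⁻¹' {0} = {0} := by ext; simp
    rw [this, poissonMeasure_real_singleton,
      Real.coe_toNNReal _ (mul_nonneg hr (sub_nonneg.2 hpq))]
    simp
  rw [probReal_compl_eq_one_sub (hN.measurableSet_jumps p q x a)] at h2
  linarith

lemma IsArrowField.measureReal_jumps_le (hN : IsArrowField P J b d N) (hJ : IsChain J b d)
    {p q : ℝ} (hpq : p ≤ q) (x : ℤ) (a : Dir) :
    P.real {ω | Jumps N ω p q x a} ≤ |rate b d a x| * (q - p) := by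
  by_cases hx : x ∈ J
  · have hr := hJ.rate_nonneg a x hx
    rw [hN.measureReal_jumps hpq hx hr, abs_of_nonneg hr]
    linarith [Real.add_one_le_exp (-(rate b d a x * (q - p)))]
  · have : {ω | Jumps N ω p q x a} = ∅ := by ext ω; simp [Jumps, hx]
    rw [this, measureReal_empty]
    exact mul_nonneg (abs_nonneg _) (sub_nonneg.2 hpq)

lemma IsArrowField.measureReal_jumps_inter_le (hN : IsArrowField P J b d N) (hJ : IsChain J b d)
    {p q : ℝ} (hpq : p ≤ q) {x x' : ℤ} {a a' : Dir} (h : (x, a) ≠ (x', a')) :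
    P.real ({ω | Jumps N ω p q x a} ∩ {ω | Jumps N ω p q x' a'}) ≤
      |rate b d a x| * |rate b d a' x'| * (q - p) ^ 2 := by
  rw [hN.indep_jumps p q h]
  calc _ ≤ (|rate b d a x| * (q - p)) * (|rate b d a' x'| * (q - p)) :=
        mul_le_mul (hN.measureReal_jumps_le hJ hpq _ _) (hN.measureReal_jumps_le hJ hpq _ _)
          measureReal_nonneg (mul_nonneg (abs_nonneg _) (sub_nonneg.2 hpq))
    _ = _ := by ring

lemma IsArrowField.abs_measureReal_jumps_sub_le (hN : IsArrowField P J b d N)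
    (hJ : IsChain J b d) {p q : ℝ} (hpq : p ≤ q) {x : ℤ} {a : Dir} (hx : x ∈ J) :
    |P.real {ω | Jumps N ω p q x a} - rate b d a x * (q - p)| ≤
      (rate b d a x) ^ 2 * (q - p) ^ 2 := by
  have hr := hJ.rate_nonneg a x hx
  rw [hN.measureReal_jumps hpq hx hr, ← mul_pow]
  set v := rate b d a x * (q - p)
  have hv : 0 ≤ v := mul_nonneg hr (sub_nonneg.2 hpq)
  have h1 := Real.add_one_le_exp (-v)
  have h2 : Real.exp (-v) ≤ 1 - v + v ^ 2 := by
    rw [Real.exp_neg, inv_le_iff_one_le_mul₀ (Real.exp_pos _)]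
    nlinarith [Real.add_one_le_exp v, pow_nonneg hv 3, sq_nonneg (v - 1), sq_nonneg v]
  exact abs_sub_le_iff.2 ⟨by nlinarith, by linarith⟩

/-- Almost surely there are no two simultaneous arrows: dividing `(-M, M]` into cells of length `h`,
the expected number of cells which contain arrows of two given kinds is `O(h)`. -/
lemma IsArrowField.ae_not_simultaneous (hN : IsArrowField P J b d N) (hJ : IsChain J b d)
    {x x' : ℤ} {a a' : Dir} (h : (x, a) ≠ (x', a')) :
    ∀ᵐ ω ∂P, ∀ u, u ∈ arrowTimes N ω x a → u ∉ arrowTimes N ω x' a' := by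
  set R := |rate b d a x| * |rate b d a' x'| with hR
  have hR0 : 0 ≤ R := mul_nonneg (abs_nonneg _) (abs_nonneg _)
  have key : ∀ M : ℕ, P.real {ω | ∀ m : ℕ, ∃ j < m + 1,
      Jumps N ω (gridTime (-M) M m j) (gridTime (-M) M m (j + 1)) x a ∧
      Jumps N ω (gridTime (-M) M m j) (gridTime (-M) M m (j + 1)) x' a'} = 0 := by
    intro M
    refine le_antisymm ?_ measureReal_nonneg
    have hlim : Filter.Tendsto (fun m : ℕ => R * (2 * M) ^ 2 / ((m : ℝ) + 1)) Filter.atTop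
        (nhds 0) := tendsto_const_nhds.div_atTop
      (Filter.tendsto_atTop_add_const_right _ _ tendsto_natCast_atTop_atTop)
    refine ge_of_tendsto' hlim fun m => ?_
    have hM : (-M : ℝ) ≤ M := by linarith [(Nat.cast_nonneg M : (0 : ℝ) ≤ M)]
    have hm : (0 : ℝ) < (m : ℝ) + 1 := by positivity
    calc _ ≤ P.real (⋃ j ∈ Finset.range (m + 1),
            ({ω | Jumps N ω (gridTime (-M) M m j) (gridTime (-M) M m (j + 1)) x a} ∩
            {ω | Jumps N ω (gridTime (-M) M m j) (gridTime (-M) M m (j + 1)) x' a'})) := by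
          refine measureReal_mono (fun ω hω => ?_) (measure_ne_top _ _)
          obtain ⟨j, hj, h1⟩ := hω m
          exact Set.mem_biUnion (Finset.mem_coe.2 (Finset.mem_range.2 hj)) h1
      _ ≤ ∑ j ∈ Finset.range (m + 1), R * ((M - -M) / (m + 1)) ^ 2 := by
          refine (measureReal_biUnion_finset_le _ _).trans (Finset.sum_le_sum fun j _ => ?_)
          have := hN.measureReal_jumps_inter_le hJ
            (gridTime_monotone hM m (Nat.le_succ j)) h
          rwa [gridTime_succ_sub] at this
      _ = _ := by
          rw [Finset.sum_const, Finset.card_range, nsmul_eq_mul]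
          push_cast
          field_simp
          ring
  have key' : ∀ᵐ ω ∂P, ∀ M : ℕ, ¬ ∀ m : ℕ, ∃ j < m + 1,
      Jumps N ω (gridTime (-M) M m j) (gridTime (-M) M m (j + 1)) x a ∧
      Jumps N ω (gridTime (-M) M m j) (gridTime (-M) M m (j + 1)) x' a' := by
    refine ae_all_iff.2 fun M => ?_
    rw [ae_iff]
    simp only [not_not]
    exact (measureReal_eq_zero_iff).1 (key M)
  filter_upwards [key', hN.ae_hasArrow_iff] with ω hω hA u hu hu'
  obtain ⟨M, hM⟩ := exists_nat_gt |u|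
  have hM' := abs_lt.1 hM
  refine hω M fun m => ?_
  have hle : (-M : ℝ) ≤ M := by linarith
  have hmono := gridTime_monotone hle m
  have hmem : u ∈ Set.Ioc (gridTime (-M) M m 0) (gridTime (-M) M m (m + 1)) := by
    rw [gridTime_zero, gridTime_last]; exact ⟨hM'.1, hM'.2.le⟩
  rw [← hmono.biUnion_Ico_Ioc_map_succ] at hmem
  simp only [Set.mem_iUnion] at hmem
  obtain ⟨j, hj, hu1⟩ := hmem
  exact ⟨j, hj.2, (hA _ _ (hmono (Nat.le_succ j)) _ _).1 ⟨u, hu, hu1⟩,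
    (hA _ _ (hmono (Nat.le_succ j)) _ _).1 ⟨u, hu', hu1⟩⟩

lemma IsArrowField.ae_isGoodArrows (hN : IsArrowField P J b d N) (hJ : IsChain J b d) :
    ∀ᵐ ω ∂P, IsGoodArrows (arrowTimes N ω) := by
  have h : ∀ᵐ ω ∂P, ∀ x a x' a', (x, a) ≠ (x', a') →
      ∀ u, u ∈ arrowTimes N ω x a → u ∉ arrowTimes N ω x' a' := by
    refine ae_all_iff.2 fun x => ae_all_iff.2 fun a => ae_all_iff.2 fun x' => ae_all_iff.2 fun a' =>
      ae_all_iff.2 fun hne => hN.ae_not_simultaneous hJ hne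
  filter_upwards [hN.ae_finite, h] with ω h1 h2
  refine ⟨h1, fun x a x' a' t ht ht' => ?_⟩
  by_contra hne
  exact h2 x a x' a' (fun h => hne (Prod.ext_iff.1 h)) t ht ht'

end ArrowField

/-! ### Independence of the past and the future of the flow -/

lemma measurableSet_cellStep {Ω : Type*} {m : MeasurableSpace Ω} {c : Ω → ℤ → Dir → Prop}
    (hc : ∀ x a, MeasurableSet {ω | c ω x a}) (x y : ℤ) :
    MeasurableSet {ω | CellStep (c ω) x y} := by
  have h : ∀ x a, Measurable fun ω => c ω x a := fun x a => measurableSet_setOfPred.1 (hc x a)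
  refine measurableSet_setOfPred.2 ?_
  unfold CellStep
  refine Measurable.or (measurable_const.and (Measurable.forall fun a => (h x a).not)) ?_
  refine Measurable.exists fun a => measurable_const.and ((h x a).and (Measurable.and ?_ ?_))
  · exact Measurable.forall fun a' => measurable_const.imp (h x a').not
  · exact Measurable.forall fun a' => (h y a').not

lemma measurableSet_gridPath {Ω : Type*} {m : MeasurableSpace Ω} {c : ℕ → Ω → ℤ → Dir → Prop}
    (hc : ∀ j x a, MeasurableSet {ω | c j ω x a}) (j : ℕ) (x y : ℤ) :
    MeasurableSet {ω | GridPath (fun i => c i ω) j x y} := by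
  induction j generalizing y with
  | zero => simp only [GridPath]; exact .const _
  | succ j ih =>
    refine measurableSet_setOfPred.2 ?_
    simp only [GridPath]
    exact Measurable.exists fun w => (measurableSet_setOfPred.1 (ih w)).and
      (measurableSet_setOfPred.1 (measurableSet_cellStep (hc j) w y))

/-- Dominated convergence for a null measurable limit event. -/
lemma tendsto_measureReal_of_ae_tendsto {Ω : Type*} [MeasurableSpace Ω] {P : Measure Ω}
    [IsFiniteMeasure P] {A : Set Ω} {As : ℕ → Set Ω} (hA : NullMeasurableSet A P)
    (hAs : ∀ m, MeasurableSet (As m))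
    (h : ∀ᵐ ω ∂P, ∀ᶠ m in Filter.atTop, (ω ∈ As m ↔ ω ∈ A)) :
    Filter.Tendsto (fun m => P.real (As m)) Filter.atTop (nhds (P.real A)) := by
  have e := hA.toMeasurable_ae_eq
  rw [← measureReal_congr e]
  refine (ENNReal.tendsto_toReal (measure_ne_top _ _)).comp
    (tendsto_measure_of_ae_tendsto_indicator_of_isFiniteMeasure Filter.atTop
      (measurableSet_toMeasurable _ _) hAs ?_)
  filter_upwards [h, e.mem_iff] with ω h he
  filter_upwards [h] with m h
  exact h.trans he.symm

section Future

variable {Ω : Type*} {J : Set ℤ} {N : J × Dir → ℝ → Ω → ℤ}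

/-- The information contained in the increments over `(p, q]`. -/
@[reducible] def incrementSpace (N : J × Dir → ℝ → Ω → ℤ) (p q : ℝ) : MeasurableSpace Ω :=
  ⨆ k, MeasurableSpace.comap (fun ω => N k q ω - N k p ω) ⊤

lemma measurableSet_incrementSpace_jumps (p q : ℝ) (x : ℤ) (a : Dir) :
    MeasurableSet[incrementSpace N p q] {ω | Jumps N ω p q x a} := by
  by_cases hx : x ∈ J
  · have : {ω | Jumps N ω p q x a} =
        (fun ω => N (⟨x, hx⟩, a) q ω - N (⟨x, hx⟩, a) p ω) ⁻¹' {0}ᶜ := by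
      ext ω; simp [Jumps, hx]
    rw [this]
    exact le_iSup (fun k => MeasurableSpace.comap (fun ω => N k q ω - N k p ω) ⊤) (⟨x, hx⟩, a) _
      ⟨_, trivial, rfl⟩
  · have : {ω | Jumps N ω p q x a} = ∅ := by ext ω; simp [Jumps, hx]
    rw [this]; exact @MeasurableSet.empty _ (incrementSpace N p q)

/-- The event that the particles starting from `z i` at time `s` are in `B i` at time `T`. -/
def reachEvent (N : J × Dir → ℝ → Ω → ℤ) {ι : Type*} (s T : ℝ) (z : ι → ℤ) (B : ι → Set ℤ) :
    Set Ω :=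
  {ω | ∀ i, ∃ y ∈ B i, Follows (arrowTimes N ω) s T (z i) y}

variable {ι : Type*} [Finite ι]

/-- The event that the particles starting from `z i` at time `s` are seen to be in `B i` at time `T`
on the partition of `[s, T]` into `m + 1` intervals. -/
def gridEvent (N : J × Dir → ℝ → Ω → ℤ) (s T : ℝ) (m : ℕ) (z : ι → ℤ) (B : ι → Set ℤ) : Set Ω :=
  {ω | ∀ i, ∃ y ∈ B i, GridPath
    (fun j => Jumps N ω (gridTime s T m j) (gridTime s T m (j + 1))) (m + 1) (z i) y}

lemma measurableSet_gridEvent {mΩ : MeasurableSpace Ω} {s T : ℝ} {m : ℕ}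
    (h : ∀ j x a,
      MeasurableSet[mΩ] {ω | Jumps N ω (gridTime s T m j) (gridTime s T m (j + 1)) x a})
    (z : ι → ℤ) (B : ι → Set ℤ) : MeasurableSet[mΩ] (gridEvent N s T m z B) := by
  refine measurableSet_setOfPred.2 (Measurable.forall fun i => Measurable.exists fun y =>
    measurable_const.and (measurableSet_setOfPred.1 (measurableSet_gridPath
      (c := fun j ω => Jumps N ω (gridTime s T m j) (gridTime s T m (j + 1))) h _ _ _)))

variable [MeasurableSpace Ω] {P : Measure Ω} {b d : ℤ → ℝ}

omit [Finite ι] in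
/-- The increments over the successive intervals of a partition, at all sites, are independent. -/
lemma IsArrowField.iIndepFun_increments (hN : IsArrowField P J b d N) {t : ℕ → ℝ}
    (ht : Monotone t) :
    iIndepFun (fun (p : (J × Dir) × ℕ) ω => N p.1 (t (p.2 + 1)) ω - N p.1 (t p.2) ω) P := by
  refine iIndepFun_uncurry' (X := fun k j ω => N k (t (j + 1)) ω - N k (t j) ω)
    (fun k j => ((hN.poisson k).measurable _).sub ((hN.poisson k).measurable _)) ?_
    fun k => (hN.poisson k).indep.nat ht
  exact hN.indep.comp (fun k g j => g (t (j + 1)) - g (t j)) fun k => by fun_prop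

variable [IsProbabilityMeasure P]

/-- The discretized events converge almost surely. -/
lemma IsArrowField.ae_tendsto_gridEvent (hN : IsArrowField P J b d N) (hJ : IsChain J b d)
    {s T : ℝ} (hsT : s ≤ T) (z : ι → ℤ) (B : ι → Set ℤ) :
    ∀ᵐ ω ∂P, ∀ᶠ m in Filter.atTop, (ω ∈ gridEvent N s T m z B ↔ ω ∈ reachEvent N s T z B) := by
  filter_upwards [hN.ae_isGoodArrows hJ, hN.ae_hasArrow_iff] with ω hA hω
  have e : ∀ m, (fun j => Jumps N ω (gridTime s T m j) (gridTime s T m (j + 1))) =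
      fun j => HasArrow (arrowTimes N ω) (gridTime s T m j) (gridTime s T m (j + 1)) := by
    intro m
    funext j x a
    exact propext (hω _ _ (gridTime_monotone hsT m (Nat.le_succ j)) x a).symm
  simp only [gridEvent, Set.mem_ofPred_eq, e]
  by_cases h : ω ∈ reachEvent N s T z B
  · have : ∀ᶠ m in Filter.atTop, ∀ i, _ := Filter.eventually_all.2 fun i =>
      (exists_follows_iff_eventually hA hsT).1 (h i)
    filter_upwards [this] with m hm
    exact ⟨fun _ => h, fun _ => hm⟩
  · refine Filter.Eventually.of_forall fun m => ⟨fun hm => ?_, fun h' => absurd h' h⟩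
    exact fun i => (exists_follows_iff_eventually hA hsT).2 m (hm i)

lemma IsArrowField.nullMeasurableSet_reachEvent (hN : IsArrowField P J b d N)
    (hJ : IsChain J b d) {s T : ℝ} (hsT : s ≤ T) (z : ι → ℤ) (B : ι → Set ℤ) :
    NullMeasurableSet (reachEvent N s T z B) P := by
  have hm : ∀ m, MeasurableSet (gridEvent N s T m z B) := fun m =>
    measurableSet_gridEvent (fun j x a => hN.measurableSet_jumps _ _ _ _) z B
  refine nullMeasurableSet_of_tendsto_indicator Filter.atTop
    (fun m => (hm m).nullMeasurableSet) ?_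
  filter_upwards [hN.ae_tendsto_gridEvent hJ hsT z B] with ω hω
  exact hω

/-- The Markov property: the motion of the particles after time `s` is independent of the
arrows before time `s`. -/
lemma IsArrowField.indep_reachEvent (hN : IsArrowField P J b d N) (hJ : IsChain J b d)
    {r s T : ℝ} (hrs : r ≤ s) (hsT : s ≤ T) (z : ι → ℤ) (B : ι → Set ℤ) {E : Set Ω}
    (hE : MeasurableSet[incrementSpace N r s] E) :
    P.real (E ∩ reachEvent N s T z B) = P.real E * P.real (reachEvent N s T z B) := by
  have hEm : MeasurableSet E := by
    refine (iSup_le fun k => ?_ : incrementSpace N r s ≤ _) _ hE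
    exact (((hN.poisson k).measurable s).sub ((hN.poisson k).measurable r)).comap_le
  have hm : ∀ m, MeasurableSet (gridEvent N s T m z B) := fun m =>
    measurableSet_gridEvent (fun j x a => hN.measurableSet_jumps _ _ _ _) z B
  have hgrid : ∀ m, P.real (E ∩ gridEvent N s T m z B) =
      P.real E * P.real (gridEvent N s T m z B) := by
    intro m
    -- Prefix the partition of `[s, T]` by the interval `[r, s]`: its increments are independent of
    -- those over the other intervals, which determine the discretized event.
    set t : ℕ → ℝ := fun j => j.casesOn r (gridTime s T m) with ht
    have htm : Monotone t := by
      refine monotone_nat_of_le_succ fun j => ?_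
      cases j with
      | zero => simpa [ht, gridTime_zero] using hrs
      | succ j => exact gridTime_monotone hsT m (Nat.le_succ j)
    have h1 := hN.iIndepFun_increments htm
    have h2 := indep_iSup_of_disjoint (m := fun p : (J × Dir) × ℕ =>
        MeasurableSpace.comap (fun ω => N p.1 (t (p.2 + 1)) ω - N p.1 (t p.2) ω) ⊤)
      (fun p => (((hN.poisson p.1).measurable (t (p.2 + 1))).sub
        ((hN.poisson p.1).measurable (t p.2))).comap_le)
      h1 (S := {p | p.2 = 0}) (T := {p | p.2 ≠ 0})
      (Set.disjoint_left.2 fun p hp hp' => hp' hp)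
    rw [Indep_iff] at h2
    have h3 := h2 E (gridEvent N s T m z B) ?_ ?_
    · simp only [Measure.real, h3, ENNReal.toReal_mul]
    · refine (iSup_le fun k => ?_ : incrementSpace N r s ≤ _) _ hE
      refine le_trans (le_of_eq ?_)
        (le_iSup₂ (f := fun (p : (J × Dir) × ℕ) (_ : p ∈ {p | p.2 = 0}) =>
        MeasurableSpace.comap (fun ω => N p.1 (t (p.2 + 1)) ω - N p.1 (t p.2) ω) ⊤) (k, 0) rfl)
      simp [ht, gridTime_zero]
    · refine measurableSet_gridEvent (fun j x a => ?_) z B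
      refine (iSup_le fun k => ?_ :
        incrementSpace N (gridTime s T m j) (gridTime s T m (j + 1)) ≤ _)
        _ (measurableSet_incrementSpace_jumps _ _ x a)
      exact le_iSup₂ (f := fun (p : (J × Dir) × ℕ) (_ : p ∈ {p | p.2 ≠ 0}) =>
        MeasurableSpace.comap (fun ω => N p.1 (t (p.2 + 1)) ω - N p.1 (t p.2) ω) ⊤) (k, j + 1)
        (Nat.succ_ne_zero j)
  -- Let the mesh tend to zero.
  have hω := hN.ae_tendsto_gridEvent hJ hsT z B
  have l1 : Filter.Tendsto (fun m => P.real (E ∩ gridEvent N s T m z B)) Filter.atTop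
      (nhds (P.real (E ∩ reachEvent N s T z B))) := by
    refine tendsto_measureReal_of_ae_tendsto
      (hEm.nullMeasurableSet.inter (hN.nullMeasurableSet_reachEvent hJ hsT z B))
      (fun m => hEm.inter (hm m)) ?_
    filter_upwards [hω] with ω h
    filter_upwards [h] with m h
    exact and_congr_right fun _ => h
  have l2 : Filter.Tendsto (fun m => P.real (gridEvent N s T m z B)) Filter.atTop
      (nhds (P.real (reachEvent N s T z B))) :=
    tendsto_measureReal_of_ae_tendsto (hN.nullMeasurableSet_reachEvent hJ hsT z B) hm hω
  exact tendsto_nhds_unique (l1.congr hgrid) (l2.const_mul _)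

end Future

/-! ### The backward equation of the flow -/

/-- First order expansion of the probability of `A`, when a small time interval contains either
nothing (outside all `F κ`), or only the single event `E κ`, up to second order errors. -/
lemma abs_measureReal_expansion_le {Ω κ : Type*} [MeasurableSpace Ω] {P : Measure Ω}
    [IsProbabilityMeasure P] [Fintype κ] {E F : κ → Set Ω} {A : Set Ω}
    (hE : ∀ k, MeasurableSet (E k)) (hF : ∀ k, MeasurableSet (F k)) (hEF : ∀ k, E k ⊆ F k)
    (hdisj : Pairwise (Function.onFun Disjoint E)) (hA : NullMeasurableSet A P) {w : κ → ℝ}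
    {w₀ : ℝ}
    (hw : ∀ k, w k ∈ Set.Icc (0 : ℝ) 1) (hw₀ : w₀ ∈ Set.Icc (0 : ℝ) 1)
    (hEA : ∀ k, P.real (E k ∩ A) = P.real (E k) * w k)
    (hFA : P.real ((⋃ k, F k)ᶜ ∩ A) = P.real (⋃ k, F k)ᶜ * w₀) {r c : κ → ℝ}
    (hEr : ∀ k, |P.real (E k) - r k| ≤ c k) (hFr : ∀ k, |P.real (F k) - r k| ≤ c k) :
    |P.real A - w₀ - ∑ k, r k * (w k - w₀)| ≤ 6 * ∑ k, c k := by
  set G := ⋃ k, F k with hG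
  set D := ⋃ k, E k with hD
  have hDG : D ⊆ G := Set.iUnion_mono hEF
  have hGm : MeasurableSet G := .iUnion hF
  have hDm : MeasurableSet D := .iUnion hE
  have h1 : P.real A = P.real (G ∩ A) + P.real (Gᶜ ∩ A) := by
    rw [← measureReal_inter_add_sdiff (s := A) hGm, Set.inter_comm, Set.sdiff_eq, Set.inter_comm A]
  have h2 : P.real (G ∩ A) = P.real (D ∩ A) + P.real ((G \ D) ∩ A) := by
    rw [← measureReal_inter_add_sdiff (s := G ∩ A) hDm]
    congr 2
    · ext ω; simp only [Set.mem_inter_iff]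
      exact ⟨fun h => ⟨h.2, h.1.2⟩, fun h => ⟨⟨hDG h.1, h.2⟩, h.1⟩⟩
    · ext ω; simp only [Set.mem_inter_iff, Set.mem_sdiff]; tauto
  have h3 : P.real (D ∩ A) = ∑ k, P.real (E k) * w k := by
    rw [hD, Set.iUnion_inter, ← Set.biUnion_univ, ← Finset.coe_univ]
    simp only [Finset.mem_coe]
    rw [measureReal_biUnion_finset₀ (fun i _ j _ hij =>
      ((hdisj hij).mono Set.inter_subset_left Set.inter_subset_left).aedisjoint)
      fun k _ => (hE k).nullMeasurableSet.inter hA]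
    exact Finset.sum_congr rfl fun k _ => hEA k
  have h4 : P.real D = ∑ k, P.real (E k) := by
    rw [hD, measureReal_iUnion_fintype hdisj hE]
  have h5 : P.real G ≤ ∑ k, P.real (F k) := measureReal_iUnion_fintype_le _
  have h6 : P.real ((G \ D) ∩ A) ≤ P.real G - P.real D := by
    rw [← measureReal_sdiff hDG hDm]
    exact measureReal_mono Set.inter_subset_left (measure_ne_top _ _)
  have h7 : P.real Gᶜ = 1 - P.real G := probReal_compl_eq_one_sub hGm
  have h8 : 0 ≤ P.real ((G \ D) ∩ A) := measureReal_nonneg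
  set e := ∑ k, P.real (E k)
  have hfe : ∑ k, P.real (F k) - e ≤ 2 * ∑ k, c k := by
    rw [← Finset.sum_sub_distrib, Finset.mul_sum]
    refine Finset.sum_le_sum fun k _ => ?_
    have := abs_le.1 (hEr k)
    have := abs_le.1 (hFr k)
    linarith
  have hS1 : |∑ k, (P.real (E k) - r k) * w k| ≤ ∑ k, c k := by
    refine (Finset.abs_sum_le_sum_abs _ _).trans (Finset.sum_le_sum fun k _ => ?_)
    rw [abs_mul, abs_of_nonneg (hw k).1]
    exact (mul_le_of_le_one_right (abs_nonneg _) (hw k).2).trans (hEr k)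
  have hS2 : |∑ k, (P.real (E k) - r k) * w₀| ≤ ∑ k, c k := by
    refine (Finset.abs_sum_le_sum_abs _ _).trans (Finset.sum_le_sum fun k _ => ?_)
    rw [abs_mul, abs_of_nonneg hw₀.1]
    exact (mul_le_of_le_one_right (abs_nonneg _) hw₀.2).trans (hEr k)
  have key : P.real A - w₀ - ∑ k, r k * (w k - w₀) = ∑ k, (P.real (E k) - r k) * w k -
      ∑ k, (P.real (E k) - r k) * w₀ + (e - P.real G) * w₀ + P.real ((G \ D) ∩ A) := by
    have e1 : ∑ k, r k * (w k - w₀) = ∑ k, P.real (E k) * w k - e * w₀ -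
        ∑ k, (P.real (E k) - r k) * w k + ∑ k, (P.real (E k) - r k) * w₀ := by
      rw [Finset.sum_mul, ← Finset.sum_sub_distrib, ← Finset.sum_sub_distrib,
        ← Finset.sum_add_distrib]
      exact Finset.sum_congr rfl fun k _ => by ring
    rw [e1, h1, h2, h3, hFA, h7]
    ring
  have h9 : |(e - P.real G) * w₀| ≤ 2 * ∑ k, c k := by
    rw [abs_mul, abs_of_nonneg hw₀.1]
    refine (mul_le_of_le_one_right (abs_nonneg _) hw₀.2).trans ?_
    rw [abs_sub_comm, abs_of_nonneg (by linarith)]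
    linarith
  rw [key]
  have a1 := abs_le.1 hS1
  have a2 := abs_le.1 hS2
  have a3 := abs_le.1 h9
  exact abs_le.2 ⟨by linarith, by linarith⟩

/-- A second order error bound implies right differentiability. -/
lemma hasDerivWithinAt_of_abs_sub_le {f : ℝ → ℝ} {f' t C : ℝ}
    (h : ∀ u, t ≤ u → |f u - f t - (u - t) * f'| ≤ C * (u - t) ^ 2) :
    HasDerivWithinAt f f' (Set.Ici t) t := by
  rw [hasDerivWithinAt_iff_isLittleO]
  have h1 : (fun u => f u - f t - (u - t) • f') =O[nhdsWithin t (Set.Ici t)]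
      fun u => (u - t) ^ 2 := by
    refine Asymptotics.IsBigO.of_bound C ?_
    filter_upwards [self_mem_nhdsWithin] with u hu
    rw [Real.norm_eq_abs, Real.norm_eq_abs, abs_of_nonneg (sq_nonneg (u - t)), smul_eq_mul]
    exact h u hu
  refine h1.trans_isLittleO ?_
  have h2 : (fun v : ℝ => v ^ 2) =o[nhds 0] fun v => v := by
    simpa using Asymptotics.isLittleO_pow_id (𝕜 := ℝ) (n := 2) one_lt_two
  have h3 : Filter.Tendsto (fun u => u - t) (nhdsWithin t (Set.Ici t)) (nhds 0) := by
    refine tendsto_nhdsWithin_of_tendsto_nhds ?_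
    have h : Continuous fun u : ℝ => u - t := by fun_prop
    simpa using h.tendsto t
  exact h2.comp_tendsto h3

section Backward

variable {Ω : Type*} {J : Set ℤ} {N : J × Dir → ℝ → Ω → ℤ} {ι : Type*}

/-- Once the positions at time `s` are known, the event depends on the arrows after time `s` only.
-/
lemma mem_reachEvent_iff {ω : Ω} (hA : IsGoodArrows (arrowTimes N ω)) {r s T : ℝ} (hsT : s ≤ T)
    {z w : ι → ℤ} {B : ι → Set ℤ} (h : ∀ i, Follows (arrowTimes N ω) r s (z i) (w i)) :
    ω ∈ reachEvent N r T z B ↔ ω ∈ reachEvent N s T w B :=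
  forall_congr' fun i => exists_congr fun _ => and_congr_right fun _ =>
    (h i).iff_of_follows hA hsT

variable [MeasurableSpace Ω] {P : Measure Ω} [IsProbabilityMeasure P] {b d : ℤ → ℝ}
  [Fintype ι] [DecidableEq ι]

/-- Second order error bound for the backward equation of the flow. -/
lemma IsArrowField.exists_expansion (hN : IsArrowField P J b d N) (hJ : IsChain J b d)
    {z : ι → ℤ} (hz : Function.Injective z) (hzJ : ∀ i, z i ∈ J) :
    ∃ C, 0 ≤ C ∧ ∀ (B : ι → Set ℤ) (r s T : ℝ), r ≤ s → s ≤ T →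
      |P.real (reachEvent N r T z B) - P.real (reachEvent N s T z B) -
        (s - r) * gen (multiRate (fun _ => b) fun _ => d) multiMove
          (fun z => P.real (reachEvent N s T z B)) z| ≤ C * (s - r) ^ 2 := by
  classical
  -- the kinds of arrows which may interfere with an arrow of the kind `k`
  set K : ι × Dir → Finset (ℤ × Dir) := fun k =>
    ((Finset.univ.image fun j : ι × Dir => (z j.1, j.2)) ∪
      (Finset.univ.image fun a => (move k.2 (z k.1), a))).erase (z k.1, k.2) with hK
  set c : ι × Dir → ℝ := fun k => rate b d k.2 (z k.1) ^ 2 +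
    ∑ l ∈ K k, |rate b d k.2 (z k.1)| * |rate b d l.2 l.1| with hc
  have hc0 : ∀ k, 0 ≤ c k := fun k => add_nonneg (sq_nonneg _) (Finset.sum_nonneg fun l _ =>
    mul_nonneg (abs_nonneg _) (abs_nonneg _))
  refine ⟨6 * ∑ k, c k, mul_nonneg (by norm_num) (Finset.sum_nonneg fun k _ => hc0 k),
    fun B r s T hrs hsT => ?_⟩
  set F : ι × Dir → Set Ω := fun k => {ω | Jumps N ω r s (z k.1) k.2} with hF
  set E : ι × Dir → Set Ω := fun k => F k \ ⋃ l ∈ K k, {ω | Jumps N ω r s l.1 l.2} with hE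
  have hFm' : ∀ k, MeasurableSet[incrementSpace N r s] (F k) := fun k =>
    measurableSet_incrementSpace_jumps _ _ _ _
  have hEm' : ∀ k, MeasurableSet[incrementSpace N r s] (E k) := fun k =>
    (hFm' k).diff (Finset.measurableSet_biUnion _ fun l _ =>
      measurableSet_incrementSpace_jumps _ _ _ _)
  have hFm : ∀ k, MeasurableSet (F k) := fun k => hN.measurableSet_jumps _ _ _ _
  have hEm : ∀ k, MeasurableSet (E k) := fun k =>
    (hFm k).diff (Finset.measurableSet_biUnion _ fun l _ => hN.measurableSet_jumps _ _ _ _)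
  have hw : ∀ z' : ι → ℤ, P.real (reachEvent N s T z' B) ∈ Set.Icc (0 : ℝ) 1 := fun z' =>
    ⟨measureReal_nonneg, measureReal_le_one⟩
  have hFr : ∀ k, |P.real (F k) - rate b d k.2 (z k.1) * (s - r)| ≤
      rate b d k.2 (z k.1) ^ 2 * (s - r) ^ 2 := fun k =>
    hN.abs_measureReal_jumps_sub_le hJ hrs (hzJ k.1)
  have hEF : ∀ k, P.real (F k) - P.real (E k) ≤
      (∑ l ∈ K k, |rate b d k.2 (z k.1)| * |rate b d l.2 l.1|) * (s - r) ^ 2 := by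
    intro k
    have h1 := measureReal_inter_add_sdiff (μ := P) (s := F k) (t := ⋃ l ∈ K k,
      {ω | Jumps N ω r s l.1 l.2})
      (Finset.measurableSet_biUnion _ fun l _ => hN.measurableSet_jumps _ _ _ _)
    have h2 : P.real (F k ∩ ⋃ l ∈ K k, {ω | Jumps N ω r s l.1 l.2}) ≤
        ∑ l ∈ K k, |rate b d k.2 (z k.1)| * |rate b d l.2 l.1| * (s - r) ^ 2 := by
      rw [Set.inter_iUnion₂]
      refine (measureReal_biUnion_finset_le _ _).trans (Finset.sum_le_sum fun l hl => ?_)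
      exact hN.measureReal_jumps_inter_le hJ hrs (Finset.ne_of_mem_erase hl).symm
    rw [Finset.sum_mul]
    change P.real (_ ∩ _) + P.real (E k) = _ at h1
    linarith
  have hE_le : ∀ k, P.real (E k) ≤ P.real (F k) := fun k =>
    measureReal_mono Set.sdiff_subset (measure_ne_top _ _)
  -- If there is no arrow at the sites `z i`, nothing moves until time `s`; if the arrow `k` is the
  -- only one, and there is none at its target, exactly this move takes place.
  have hstay : ∀ᵐ ω ∂P, (ω ∈ (⋃ k, F k)ᶜ →
        (ω ∈ reachEvent N r T z B ↔ ω ∈ reachEvent N s T z B)) ∧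
      ∀ k, ω ∈ E k → (ω ∈ reachEvent N r T z B ↔ ω ∈ reachEvent N s T (multiMove k z) B) := by
    filter_upwards [hN.ae_isGoodArrows hJ, hN.ae_hasArrow_iff] with ω hA hω
    refine ⟨fun h => mem_reachEvent_iff hA hsT fun i => follows_of_cellStep hA hrs
      (Or.inl ⟨rfl, fun a ha => h (Set.mem_iUnion.2 ⟨(i, a), (hω _ _ hrs _ _).1 ha⟩)⟩),
      fun k hk => mem_reachEvent_iff hA hsT fun i => follows_of_cellStep hA hrs ?_⟩
    have hno : ∀ l ∈ K k, ¬ HasArrow (arrowTimes N ω) r s l.1 l.2 := fun l hl h =>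
      hk.2 (Set.mem_biUnion (Finset.mem_coe.2 hl) ((hω _ _ hrs _ _).1 h))
    have hmem : ∀ i a, (z i, a) ≠ (z k.1, k.2) → (z i, a) ∈ K k := fun i a hne =>
      Finset.mem_erase.2 ⟨hne, Finset.mem_union_left _
        (Finset.mem_image.2 ⟨(i, a), Finset.mem_univ _, rfl⟩)⟩
    by_cases hi : i = k.1
    · subst hi
      rw [multiMove, Function.update_self]
      refine Or.inr ⟨k.2, rfl, (hω _ _ hrs _ _).2 hk.1, fun a ha => hno _ (hmem _ _ ?_),
        fun a => hno (_, a) ?_⟩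
      · exact fun h => ha (Prod.ext_iff.1 h).2
      · refine Finset.mem_erase.2 ⟨fun h => ?_, Finset.mem_union_right _
          (Finset.mem_image.2 ⟨a, Finset.mem_univ _, rfl⟩)⟩
        have := (Prod.ext_iff.1 h).1
        cases hk2 : k.2 <;> simp [hk2, Dir.step] at this
    · rw [multiMove, Function.update_of_ne hi]
      exact Or.inl ⟨rfl, fun a => hno _ (hmem _ _ fun h => hi (hz (Prod.ext_iff.1 h).1))⟩
  have hgen : (s - r) * gen (multiRate (fun _ => b) fun _ => d) multiMove
      (fun z => P.real (reachEvent N s T z B)) z =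
      ∑ k : ι × Dir, rate b d k.2 (z k.1) * (s - r) *
        (P.real (reachEvent N s T (multiMove k z) B) - P.real (reachEvent N s T z B)) := by
    rw [gen, Finset.mul_sum]
    exact Finset.sum_congr rfl fun k _ => by rw [multiRate]; ring
  rw [hgen]
  have hcsum : 6 * ∑ k, c k * (s - r) ^ 2 = 6 * (∑ k, c k) * (s - r) ^ 2 := by
    rw [← Finset.sum_mul]; ring
  rw [← hcsum]
  refine abs_measureReal_expansion_le hEm hFm (fun k => Set.sdiff_subset) ?_
    (hN.nullMeasurableSet_reachEvent hJ (hrs.trans hsT) z B) (fun k => hw _) (hw _) (fun k => ?_)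
    ?_ (fun k => ?_) (fun k => (hFr k).trans ?_)
  · intro k l hkl
    refine Set.disjoint_left.2 fun ω hk hl => hk.2 ?_
    refine Set.mem_biUnion (x := (z l.1, l.2)) (Finset.mem_coe.2 (Finset.mem_erase.2 ⟨fun h => ?_,
      Finset.mem_union_left _ (Finset.mem_image.2 ⟨l, Finset.mem_univ _, rfl⟩)⟩)) hl.1
    have h' := Prod.ext_iff.1 h
    exact hkl (Prod.ext (hz h'.1) h'.2).symm
  · rw [← hN.indep_reachEvent hJ hrs hsT _ _ (hEm' k)]
    refine measureReal_congr ?_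
    filter_upwards [hstay] with ω hω
    exact propext (and_congr_right fun h => hω.2 k h)
  · rw [← hN.indep_reachEvent hJ hrs hsT _ _
      (MeasurableSet.compl (MeasurableSet.iUnion hFm'))]
    refine measureReal_congr ?_
    filter_upwards [hstay] with ω hω
    exact propext (and_congr_right fun h => hω.1 h)
  · have h1 := abs_le.1 (hFr k)
    have h2 := hEF k
    have h3 := hE_le k
    have h4 : 0 ≤ (∑ l ∈ K k, |rate b d k.2 (z k.1)| * |rate b d l.2 l.1|) * (s - r) ^ 2 :=
      (sub_nonneg.2 h3).trans h2
    simp only [hc, add_mul]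
    exact abs_le.2 ⟨by linarith, by linarith⟩
  · exact mul_le_mul_of_nonneg_right (le_add_of_nonneg_right (Finset.sum_nonneg fun l _ =>
      mul_nonneg (abs_nonneg _) (abs_nonneg _))) (sq_nonneg _)

/-- As a function of the length of the time interval, the probabilities of motions to given sets
satisfy the backward equation of independent chains, as long as the particles start from distinct
sites. -/
lemma IsArrowField.backward_equation (hN : IsArrowField P J b d N) (hJ : IsChain J b d)
    {z : ι → ℤ} (hz : Function.Injective z) (hzJ : ∀ i, z i ∈ J) (B : ι → Set ℤ) (T : ℝ) :
    (∀ S, ContinuousOn (fun t => P.real (reachEvent N (T - t) T z B)) (Set.Icc 0 S)) ∧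
      ∀ t, 0 ≤ t → HasDerivWithinAt (fun t => P.real (reachEvent N (T - t) T z B))
        (gen (multiRate (fun _ => b) fun _ => d) multiMove
          (fun z => P.real (reachEvent N (T - t) T z B)) z) (Set.Ici t) t := by
  obtain ⟨C, hC, h⟩ := hN.exists_expansion hJ hz hzJ
  have h' : ∀ t u : ℝ, 0 ≤ t → t ≤ u → _ := fun t u ht htu =>
    h B (T - u) (T - t) T (by linarith) (by linarith)
  simp only [sub_sub_sub_cancel_left] at h'
  refine ⟨fun S => ?_, fun t ht => hasDerivWithinAt_of_abs_sub_le fun u hu => h' t u ht hu⟩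
  set R : ℝ := ∑ k : ι × Dir, |multiRate (fun _ => b) (fun _ => d) k z| with hR
  have hR0 : 0 ≤ R := Finset.sum_nonneg fun k _ => abs_nonneg _
  have hgen : ∀ t, |gen (multiRate (fun _ => b) fun _ => d) multiMove
      (fun z => P.real (reachEvent N (T - t) T z B)) z| ≤ R := by
    intro t
    refine (Finset.abs_sum_le_sum_abs _ _).trans (Finset.sum_le_sum fun k _ => ?_)
    rw [abs_mul]
    refine mul_le_of_le_one_right (abs_nonneg _) ?_
    have : ∀ z' : ι → ℤ, P.real (reachEvent N (T - t) T z' B) ∈ Set.Icc (0 : ℝ) 1 := fun z' =>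
      ⟨measureReal_nonneg, measureReal_le_one⟩
    exact abs_le.2 ⟨by linarith [(this (multiMove k z)).1, (this z).2],
      by linarith [(this (multiMove k z)).2, (this z).1]⟩
  have key : ∀ t ∈ Set.Icc 0 S, ∀ u ∈ Set.Icc 0 S, t ≤ u →
      |P.real (reachEvent N (T - u) T z B) - P.real (reachEvent N (T - t) T z B)| ≤
        (C * S + R) * (u - t) := by
    intro t ht u hu htu
    have h1 := abs_le.1 (h' t u ht.1 htu)
    have h2 : |(u - t) * gen (multiRate (fun _ => b) fun _ => d) multiMove
        (fun z => P.real (reachEvent N (T - t) T z B)) z| ≤ (u - t) * R := by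
      rw [abs_mul, abs_of_nonneg (sub_nonneg.2 htu)]
      exact mul_le_mul_of_nonneg_left (hgen t) (sub_nonneg.2 htu)
    have h3 := abs_le.1 h2
    have h4 : C * (u - t) ^ 2 ≤ C * S * (u - t) := by
      rw [pow_two, mul_assoc]
      exact mul_le_mul_of_nonneg_left (mul_le_mul_of_nonneg_right (by linarith [ht.1, hu.2])
        (sub_nonneg.2 htu)) hC
    exact abs_le.2 ⟨by linarith, by linarith⟩
  refine (LipschitzOnWith.of_dist_le_mul (K := (C * S + R).toNNReal)
    fun t ht u hu => ?_).continuousOn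
  rw [Real.dist_eq, Real.dist_eq, Real.coe_toNNReal _
    (add_nonneg (mul_nonneg hC (ht.1.trans ht.2)) hR0)]
  rcases le_total t u with htu | htu
  · rw [abs_sub_comm, abs_sub_comm t, abs_of_nonneg (sub_nonneg.2 htu)]
    exact key t ht u hu htu
  · rw [abs_of_nonneg (sub_nonneg.2 htu)]
    exact key u hu t ht htu

end Backward

/-! ### Distribution of the flow -/

section Flow

variable {Ω : Type*} {J : Set ℤ} {N : J × Dir → ℝ → Ω → ℤ}

lemma follows_of_notMem {ω : Ω} {s T : ℝ} (hsT : s ≤ T) {x : ℤ} (hx : x ∉ J) :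
    Follows (arrowTimes N ω) s T x x :=
  .stay hsT fun _ _ _ h => hx h.1

lemma reachEvent_self {ι : Type*} (T : ℝ) (z : ι → ℤ) (B : ι → Set ℤ) :
    reachEvent N T T z B = {_ω : Ω | ∀ i, z i ∈ B i} := by
  ext ω
  simp only [reachEvent, Set.mem_ofPred_eq, follows_self_iff, exists_eq_right]

/-- The default value in the definition of the flow is not used if there is a path. -/
lemma flow_eq_of_follows {ω : Ω} (hA : IsGoodArrows (arrowTimes N ω)) {s t : ℝ} {x y : ℤ}
    (h : Follows (arrowTimes N ω) s t x y) : flow N ω s t x = y := by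
  have h' : ∃ y, Follows (arrowTimes N ω) s t x y := ⟨y, h⟩
  rw [flow, dif_pos h']
  exact h'.choose_spec.unique hA h

variable [MeasurableSpace Ω] {P : Measure Ω} [IsProbabilityMeasure P] {b d : ℤ → ℝ}

/-- Almost surely, only finitely many arrows are followed during a bounded time interval. -/
lemma IsArrowField.ae_exists_follows (hN : IsArrowField P J b d N) (hJ : IsChain J b d)
    (hL : HasLyapunov J b d) {s T : ℝ} (hsT : s ≤ T) :
    ∀ᵐ ω ∂P, ∀ x, ∃ y, Follows (arrowTimes N ω) s T x y := by
  set E : ℝ → ℤ → Set Ω := fun t x =>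
    reachEvent N (T - t) T (fun _ : Unit => x) fun _ => Set.univ with hE
  have hEx : ∀ t x, E t x = {ω | ∃ y, Follows (arrowTimes N ω) (T - t) T x y} := by
    intro t x; ext ω; simp [hE, reachEvent]
  have hback := fun (x : ℤ) (hx : x ∈ J) => hN.backward_equation hJ (z := fun _ : Unit => x)
    (fun _ _ _ => rfl) (fun _ => hx) (fun _ => Set.univ) T
  have hgen : ∀ t x, gen (multiRate (fun _ : Unit => b) fun _ => d) multiMove
      (fun z => P.real (reachEvent N (T - t) T z fun _ => Set.univ)) (fun _ => x) =
      gen (rate b d) move (fun x => P.real (E t x)) x := by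
    intro t x
    rw [gen_multi, gen]
    simp only [Finset.univ_unique, Finset.sum_singleton]
    refine Finset.sum_congr rfl fun a _ => ?_
    congr 4
  -- The probability `1 - P(E t x)` that the path does not survive solves the backward equation and
  -- vanishes at time zero, hence it vanishes by the maximum principle.
  have key := max_principle (T := T - s) (M := 1) (w := fun t x => 1 - P.real (E t x))
    (w' := fun t x => -gen (rate b d) move (fun x => P.real (E t x)) x) hJ.rate_nonneg hL.confined
    (fun t _ x _ => sub_le_self _ measureReal_nonneg)
    (fun x hx => continuousOn_const.sub ((hback x hx).1 _))
    (fun x hx t ht => ?_) ?_ ?_ ?_ (T - s) ⟨sub_nonneg.2 hsT, le_rfl⟩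
  · have h1 : ∀ x, P.real (E (T - s) x)ᶜ = 0 := by
      intro x
      have := hN.nullMeasurableSet_reachEvent hJ (s := T - (T - s)) (T := T) (by linarith)
        (fun _ : Unit => x) fun _ => Set.univ
      rw [probReal_compl_eq_one_sub₀ this]
      exact le_antisymm (key x) (sub_nonneg.2 measureReal_le_one)
    refine ae_all_iff.2 fun x => ?_
    have h2 := (measureReal_eq_zero_iff).1 (h1 x)
    rw [hEx, sub_sub_cancel] at h2
    exact h2
  · have h := (hback x hx).2 t ht.1
    rw [hgen] at h
    exact h.const_sub 1
  · intro t _ x _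
    rw [gen, gen, ← Finset.sum_neg_distrib]
    exact (Finset.sum_congr rfl fun a _ => by ring).le
  · intro x
    have : E 0 x = Set.univ := by
      rw [hE]; simp only [sub_zero, reachEvent_self]; simp
    simp [this]
  · intro t ht x hx
    have : E t x = Set.univ := by
      rw [hEx]
      exact Set.eq_univ_of_forall fun ω => ⟨x, follows_of_notMem (by linarith [ht.1]) hx⟩
    simp [this]

lemma IsArrowField.ae_follows_flow (hN : IsArrowField P J b d N) (hJ : IsChain J b d)
    (hL : HasLyapunov J b d) {s T : ℝ} (hsT : s ≤ T) :
    ∀ᵐ ω ∂P, IsGoodArrows (arrowTimes N ω) ∧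
      ∀ x, Follows (arrowTimes N ω) s T x (flow N ω s T x) := by
  filter_upwards [hN.ae_isGoodArrows hJ, hN.ae_exists_follows hJ hL hsT] with ω hA h
  refine ⟨hA, fun x => ?_⟩
  obtain ⟨y, hy⟩ := h x
  rwa [flow_eq_of_follows hA hy]

lemma IsArrowField.ae_monotone_flow (hN : IsArrowField P J b d N) (hJ : IsChain J b d)
    (hL : HasLyapunov J b d) {s T : ℝ} (hsT : s ≤ T) : ∀ᵐ ω ∂P, Monotone (flow N ω s T) := by
  filter_upwards [hN.ae_follows_flow hJ hL hsT] with ω h x y hxy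
  exact (h.2 x).mono h.1 (h.2 y) hxy

lemma IsArrowField.ae_mem_reachEvent_iff (hN : IsArrowField P J b d N) (hJ : IsChain J b d)
    (hL : HasLyapunov J b d) {ι : Type*} {s T : ℝ} (hsT : s ≤ T) (z : ι → ℤ) (B : ι → Set ℤ) :
    ∀ᵐ ω ∂P, (ω ∈ reachEvent N s T z B ↔ ∀ i, flow N ω s T (z i) ∈ B i) := by
  filter_upwards [hN.ae_follows_flow hJ hL hsT] with ω h
  refine forall_congr' fun i => ⟨fun ⟨y, hy, hf⟩ => ?_, fun hi => ⟨_, hi, h.2 _⟩⟩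
  rwa [flow_eq_of_follows h.1 hf]

lemma IsArrowField.nullMeasurableSet_flow (hN : IsArrowField P J b d N) (hJ : IsChain J b d)
    (hL : HasLyapunov J b d) {s T : ℝ} (hsT : s ≤ T) (x : ℤ) (B : Set ℤ) :
    NullMeasurableSet {ω | flow N ω s T x ∈ B} P := by
  refine (hN.nullMeasurableSet_reachEvent hJ hsT (fun _ : Unit => x) fun _ => B).congr ?_
  filter_upwards [hN.ae_mem_reachEvent_iff hJ hL hsT (fun _ : Unit => x) fun _ => B] with ω h
  exact propext (h.trans ⟨fun h => h (), fun h _ => h⟩)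

/-- The joint distribution function of the positions of finitely many coalescing particles. -/
theorem IsArrowField.measureReal_flow_le (hN : IsArrowField P J b d N) (hJ : IsChain J b d)
    (hL : HasLyapunov J b d) {g : ℝ → ℤ → ℤ → ℝ}
    (hg : ∀ y, IsSol J (rate b d) move fun t x => g t x y)
    (hg1 : ∀ t, 0 ≤ t → ∀ x ∈ J, ∀ y, |g t x y| ≤ 1)
    (hg0 : ∀ x ∈ J, ∀ y, g 0 x y = if x ≤ y then 1 else 0)
    {k : ℕ} {z z' : Fin k → ℤ} (hz : ∀ i, z i ∈ J) (hzm : Monotone z) (hzm' : Monotone z')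
    {t : ℝ} (ht : 0 ≤ t) :
    P.real {ω | ∀ i, flow N ω 0 t (z i) ≤ z' i} = cdfDet (g t) z z' := by
  rw [← eq_cdfDet_of_coalescing hJ hL hg hg1 hg0 (U := fun k u z z' =>
    P.real (reachEvent N (t - u) t z fun i : Fin k => Set.Iic (z' i))) ?_ ?_ ?_ ?_ ?_ k z z' hz hzm
    hzm' t ht]
  · refine measureReal_congr ?_
    rw [sub_self]
    filter_upwards [hN.ae_mem_reachEvent_iff hJ hL ht z fun i => Set.Iic (z' i)] with ω h
    exact propext h.symm
  · intro u z z' _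
    have : reachEvent N (t - u) t z (fun i : Fin 0 => Set.Iic (z' i)) = Set.univ :=
      Set.eq_univ_of_forall fun ω i => i.elim0
    simp [this]
  · intro k u z z' _
    rw [abs_of_nonneg measureReal_nonneg]
    exact measureReal_le_one
  · intro k z' T _ z hz hzm
    have h := hN.backward_equation hJ hzm.injective hz (fun i => Set.Iic (z' i)) t
    exact ⟨h.1 T, fun u hu => h.2 u hu.1⟩
  · intro k z z' _
    simp only [sub_zero, reachEvent_self, Set.mem_Iic]
    split_ifs with h <;> simp [h]
  · intro k z z' i u _ _ hz' hi
    congr 1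
    ext ω
    simp only [reachEvent, Set.mem_ofPred_eq, Function.comp, Set.mem_Iic]
    refine ⟨fun h j => h _, fun h j => ?_⟩
    by_cases hj : j = i.succ
    · subst hj
      obtain ⟨y, hy, hf⟩ := h i
      rw [Fin.succAbove_of_castSucc_lt _ _ Fin.castSucc_lt_succ] at hy hf
      exact ⟨y, hy.trans (hz' (Fin.castSucc_le_succ i)), hi ▸ hf⟩
    · obtain ⟨l, rfl⟩ := Fin.exists_succAbove_eq hj
      exact h l

end Flow

/-! ### The flow and its dual -/

section Dual

variable {Ω : Type*} {J : Set ℤ} {N : J × Dir → ℝ → Ω → ℤ}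

/-- For a monotone flow, the supremum is attained at `y` exactly if `y` stays below `y'` while `y +
1` gets above it. -/
lemma dualFlowSup_eq_iff {ω : Ω} {t : ℝ} (h : Monotone (flow N ω 0 t)) {y y' : ℤ} (hy : y ∈ J)
    (hy1 : y + 1 ∈ J) : dualFlowSup N ω (-t) 0 y' = (((y : ℤ) : WithBot ℤ) : WithTop (WithBot ℤ)) ↔
      flow N ω 0 t y ≤ y' ∧ y' < flow N ω 0 t (y + 1) := by
  rw [dualFlowSup, neg_zero, neg_neg]
  constructor
  · intro hs
    constructor
    · by_contra! hlt
      have hub : sSup ((fun w : ℤ => ((w : WithBot ℤ) : WithTop (WithBot ℤ))) ''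
          {w | w ∈ J ∧ flow N ω 0 t w ≤ y'}) ≤
            (((y - 1 : ℤ) : WithBot ℤ) : WithTop (WithBot ℤ)) := by
        refine sSup_le ?_
        rintro _ ⟨w, ⟨-, hw⟩, rfl⟩
        have : w < y := by
          by_contra! hyw
          exact absurd (hlt.trans_le (h hyw)) (not_lt.2 hw)
        exact WithTop.coe_le_coe.2 (WithBot.coe_le_coe.2 (by omega))
      rw [hs] at hub
      have := WithBot.coe_le_coe.1 (WithTop.coe_le_coe.1 hub)
      omega
    · by_contra! hle
      have hub : (((y + 1 : ℤ) : WithBot ℤ) : WithTop (WithBot ℤ)) ≤ sSup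
          ((fun w : ℤ => ((w : WithBot ℤ) : WithTop (WithBot ℤ))) ''
            {w | w ∈ J ∧ flow N ω 0 t w ≤ y'}) := le_sSup ⟨y + 1, ⟨hy1, hle⟩, rfl⟩
      rw [hs] at hub
      have := WithBot.coe_le_coe.1 (WithTop.coe_le_coe.1 hub)
      omega
  · rintro ⟨h1, h2⟩
    refine IsGreatest.csSup_eq ⟨⟨y, ⟨hy, h1⟩, rfl⟩, ?_⟩
    rintro _ ⟨w, ⟨-, hw⟩, rfl⟩
    have : w < y + 1 := by
      by_contra! hyw
      exact absurd (h2.trans_le (h hyw)) (not_lt.2 hw)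
    exact WithTop.coe_le_coe.2 (WithBot.coe_le_coe.2 (by omega))

/-- For a monotone flow, the infimum is attained at `y` exactly if `y` stays above `y'` while `y -
1` gets below it. -/
lemma dualFlowInf_eq_iff {ω : Ω} {t : ℝ} (h : Monotone (flow N ω 0 t)) {y y' : ℤ} (hy : y ∈ J)
    (hy1 : y - 1 ∈ J) : dualFlowInf N ω (-t) 0 y' = (((y : ℤ) : WithBot ℤ) : WithTop (WithBot ℤ)) ↔
      y' ≤ flow N ω 0 t y ∧ flow N ω 0 t (y - 1) < y' := by
  rw [dualFlowInf, neg_zero, neg_neg]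
  constructor
  · intro hs
    constructor
    · by_contra! hlt
      have hub : (((y + 1 : ℤ) : WithBot ℤ) : WithTop (WithBot ℤ)) ≤
          sInf ((fun w : ℤ => ((w : WithBot ℤ) : WithTop (WithBot ℤ))) ''
          {w | w ∈ J ∧ y' ≤ flow N ω 0 t w}) := by
        refine le_sInf ?_
        rintro _ ⟨w, ⟨-, hw⟩, rfl⟩
        have : y < w := by
          by_contra! hyw
          exact absurd ((h hyw).trans_lt hlt) (not_lt.2 hw)
        exact WithTop.coe_le_coe.2 (WithBot.coe_le_coe.2 (by omega))
      rw [hs] at hub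
      have := WithBot.coe_le_coe.1 (WithTop.coe_le_coe.1 hub)
      omega
    · by_contra! hle
      have hub : sInf ((fun w : ℤ => ((w : WithBot ℤ) : WithTop (WithBot ℤ))) ''
            {w | w ∈ J ∧ y' ≤ flow N ω 0 t w}) ≤
          (((y - 1 : ℤ) : WithBot ℤ) : WithTop (WithBot ℤ)) := sInf_le ⟨y - 1, ⟨hy1, hle⟩, rfl⟩
      rw [hs] at hub
      have := WithBot.coe_le_coe.1 (WithTop.coe_le_coe.1 hub)
      omega
  · rintro ⟨h1, h2⟩
    refine IsLeast.csInf_eq ⟨⟨y, ⟨hy, h1⟩, rfl⟩, ?_⟩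
    rintro _ ⟨w, ⟨-, hw⟩, rfl⟩
    have : y - 1 < w := by
      by_contra! hyw
      exact absurd ((h hyw).trans_lt h2) (not_lt.2 hw)
    exact WithTop.coe_le_coe.2 (WithBot.coe_le_coe.2 (by omega))

variable [MeasurableSpace Ω] {P : Measure Ω} [IsProbabilityMeasure P] {b d : ℤ → ℝ} {m n : ℕ}
  {x x' : Fin m → ℤ} {y y' : Fin n → ℤ} {t : ℝ}

lemma IsArrowField.ae_mem_eventSup_iff (hN : IsArrowField P J b d N) (hJ : IsChain J b d)
    (hL : HasLyapunov J b d) (ht : 0 ≤ t) (hy : ∀ j, y j ∈ J) (hy1 : ∀ j, y j + 1 ∈ J) :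
    ∀ᵐ ω ∂P, (ω ∈ eventSup N t x y x' y' ↔ (∀ i, flow N ω 0 t (x i) = x' i) ∧
      ∀ j, flow N ω 0 t (y j) ≤ y' j ∧ y' j < flow N ω 0 t (y j + 1)) := by
  filter_upwards [hN.ae_monotone_flow hJ hL ht] with ω h
  exact and_congr_right fun _ => forall_congr' fun j => dualFlowSup_eq_iff h (hy j) (hy1 j)

lemma IsArrowField.ae_mem_eventInf_iff (hN : IsArrowField P J b d N) (hJ : IsChain J b d)
    (hL : HasLyapunov J b d) (ht : 0 ≤ t) (hy : ∀ j, y j ∈ J) (hy1 : ∀ j, y j - 1 ∈ J) :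
    ∀ᵐ ω ∂P, (ω ∈ eventInf N t x y x' y' ↔ (∀ i, flow N ω 0 t (x i) = x' i) ∧
      ∀ j, y' j ≤ flow N ω 0 t (y j) ∧ flow N ω 0 t (y j - 1) < y' j) := by
  filter_upwards [hN.ae_monotone_flow hJ hL ht] with ω h
  exact and_congr_right fun _ => forall_congr' fun j => dualFlowInf_eq_iff h (hy j) (hy1 j)

/-- The probability of a motion of the flow and its dual is obtained from the joint distribution
function of the flow by taking differences in the initial points of the dual particles and in the
final points of the other ones. -/
theorem IsArrowField.diffList_lowerCdf (hN : IsArrowField P J b d N) (hJ : IsChain J b d)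
    (hL : HasLyapunov J b d) (ht : 0 ≤ t) (hy : ∀ j, y j ∈ J) (hy1 : ∀ j, y j + 1 ∈ J) :
    NullMeasurableSet (eventSup N t x y x' y') P ∧
      diffList 1 (List.finRange n) (fun v => diffList (-1) (List.finRange m)
        (fun w => lowerCdf P N t x v w y') x') y =
        (-1) ^ m * (-1) ^ n * P.real (eventSup N t x y x' y') := by
  have hm := fun x B => hN.nullMeasurableSet_flow hJ hL ht x B
  have hEv : eventSup N t x y x' y' =ᵐ[P] {ω | (∀ i, ω ∈ {ω | flow N ω 0 t (x i) = x' i}) ∧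
      ∀ j, ω ∈ {ω | flow N ω 0 t (y j) ≤ y' j ∧ y' j < flow N ω 0 t (y j + 1)}} := by
    filter_upwards [hN.ae_mem_eventSup_iff hJ hL ht hy hy1] with ω h
    exact propext h
  have hnull : NullMeasurableSet {ω | (∀ i, ω ∈ {ω | flow N ω 0 t (x i) = x' i}) ∧
      ∀ j, ω ∈ {ω | flow N ω 0 t (y j) ≤ y' j ∧ y' j < flow N ω 0 t (y j + 1)}} P := by
    simp only [Set.ofPred_and, Set.ofPred_forall, Set.mem_ofPred_eq]
    refine (NullMeasurableSet.iInter fun i => hm (x i) {x' i}).inter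
      (NullMeasurableSet.iInter fun j => ?_)
    exact (hm (y j) (Set.Iic (y' j))).inter (hm (y j + 1) (Set.Ioi (y' j)))
  refine ⟨hnull.congr hEv.symm, ?_⟩
  rw [measureReal_congr hEv]
  refine diffList_measure_inter (A := fun i w => {ω | flow N ω 0 t (x i) ≤ w})
    (B := fun j v => {ω | flow N ω 0 t v ≤ y' j}) (fun i w => hm (x i) (Set.Iic w))
    (fun j v => hm v (Set.Iic (y' j))) (fun i => ?_) (fun j => ?_) hnull
  · refine .of_forall fun ω => ?_
    simp only [Set.indicator_apply, Set.mem_ofPred_eq, Pi.one_apply]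
    split_ifs <;> first | omega | norm_num
  · filter_upwards [hN.ae_monotone_flow hJ hL ht] with ω h
    have := h (show y j ≤ y j + 1 by omega)
    simp only [Set.indicator_apply, Set.mem_ofPred_eq, Pi.one_apply]
    split_ifs <;> first | omega | norm_num

/-- The analogue of `IsArrowField.diffList_lowerCdf` for upper tails, with the directions of the
differences exchanged. -/
theorem IsArrowField.diffList_upperCdf (hN : IsArrowField P J b d N) (hJ : IsChain J b d)
    (hL : HasLyapunov J b d) (ht : 0 ≤ t) (hy : ∀ j, y j ∈ J) (hy1 : ∀ j, y j - 1 ∈ J) :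
    NullMeasurableSet (eventInf N t x y x' y') P ∧
      diffList (-1) (List.finRange n) (fun v => diffList 1 (List.finRange m)
        (fun w => upperCdf P N t x v w y') x') y =
        (-1) ^ m * (-1) ^ n * P.real (eventInf N t x y x' y') := by
  have hm := fun x B => hN.nullMeasurableSet_flow hJ hL ht x B
  have hEv : eventInf N t x y x' y' =ᵐ[P] {ω | (∀ i, ω ∈ {ω | flow N ω 0 t (x i) = x' i}) ∧
      ∀ j, ω ∈ {ω | y' j ≤ flow N ω 0 t (y j) ∧ flow N ω 0 t (y j - 1) < y' j}} := by
    filter_upwards [hN.ae_mem_eventInf_iff hJ hL ht hy hy1] with ω h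
    exact propext h
  have hnull : NullMeasurableSet {ω | (∀ i, ω ∈ {ω | flow N ω 0 t (x i) = x' i}) ∧
      ∀ j, ω ∈ {ω | y' j ≤ flow N ω 0 t (y j) ∧ flow N ω 0 t (y j - 1) < y' j}} P := by
    simp only [Set.ofPred_and, Set.ofPred_forall, Set.mem_ofPred_eq]
    refine (NullMeasurableSet.iInter fun i => hm (x i) {x' i}).inter
      (NullMeasurableSet.iInter fun j => ?_)
    exact (hm (y j) (Set.Ici (y' j))).inter (hm (y j - 1) (Set.Iio (y' j)))
  refine ⟨hnull.congr hEv.symm, ?_⟩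
  rw [measureReal_congr hEv]
  refine diffList_measure_inter (A := fun i w => {ω | w ≤ flow N ω 0 t (x i)})
    (B := fun j v => {ω | y' j ≤ flow N ω 0 t v}) (fun i w => hm (x i) (Set.Ici w))
    (fun j v => hm v (Set.Ici (y' j))) (fun i => ?_) (fun j => ?_) hnull
  · refine .of_forall fun ω => ?_
    simp only [Set.indicator_apply, Set.mem_ofPred_eq, Pi.one_apply]
    split_ifs <;> first | omega | norm_num
  · filter_upwards [hN.ae_monotone_flow hJ hL ht] with ω h
    have := h (show y j - 1 ≤ y j by omega)
    rw [sub_eq_add_neg] at this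
    simp only [Set.indicator_apply, Set.mem_ofPred_eq, Pi.one_apply, sub_eq_add_neg]
    split_ifs <;> first | omega | norm_num

/-- Determinantal formula for the joint motion of the flow and its dual. -/
theorem IsArrowField.measureReal_eventSup (hN : IsArrowField P J b d N) (hJ : IsChain J b d)
    (hL : HasLyapunov J b d) {g : ℝ → ℤ → ℤ → ℝ}
    (hg : ∀ y, IsSol J (rate b d) move fun t x => g t x y)
    (hg1 : ∀ t, 0 ≤ t → ∀ x ∈ J, ∀ y, |g t x y| ≤ 1)
    (hg0 : ∀ x ∈ J, ∀ y, g 0 x y = if x ≤ y then 1 else 0) (hnm : n ≤ m) (hmn : m ≤ n + 1)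
    (hxy : Interlaced x y) (hxy' : Interlaced x' y') (hx : ∀ i, x i ∈ J) (hy : ∀ j, y j ∈ J)
    (hy1 : ∀ j, y j + 1 ∈ J) (ht : 0 ≤ t) :
    P.real (eventSup N t x y x' y') =
      (-1) ^ n * (-1) ^ m * (diffMatrix (g t) x y x' y').det := by
  have h1 := (hN.diffList_lowerCdf hJ hL (x := x) (x' := x') (y' := y') ht hy hy1).2
  rw [diffList_eq_det_diffMatrix (g := g t) hxy hxy'] at h1
  · rw [h1]
    have e1 : ((-1 : ℝ) ^ n) * (-1) ^ n = 1 := by rw [← mul_pow]; simp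
    have e2 : ((-1 : ℝ) ^ m) * (-1) ^ m = 1 := by rw [← mul_pow]; simp
    linear_combination (-P.real (eventSup N t x y x' y')) * (e1 * (-1 : ℝ) ^ m * (-1 : ℝ) ^ m + e2)
  · intro v w hv hw hvy
    rw [← cdfDet_interSeq (g t) hnm hmn, ← hN.measureReal_flow_le hJ hL hg hg1 hg0 ?_
      (interSeq_monotone hnm hmn hv) (interSeq_monotone hnm hmn hw) ht, lowerCdf]
    · congr 1
      ext ω
      simp only [Set.mem_ofPred_eq]
      rw [← (interEquiv hnm hmn).forall_congr_right, Sum.forall]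
      simp [interSeq]
    · rw [← (interEquiv hnm hmn).forall_congr_right, Sum.forall]
      simp only [interSeq, Function.comp, Equiv.symm_apply_apply, Sum.elim_inl, Sum.elim_inr]
      refine ⟨hx, fun j => ?_⟩
      rcases hvy j with h | h
      · rw [h]; exact hy j
      · rw [h]; exact hy1 j

end Dual

/-! ### Reflection -/

section Reflection

/-- The opposite direction. -/
def Dir.flip : Dir → Dir
  | .up => .down
  | .down => .up

@[simp] lemma Dir.flip_flip (a : Dir) : a.flip.flip = a := by cases a <;> rfl

@[simp] lemma Dir.step_flip (a : Dir) : a.flip.step = -a.step := by cases a <;> rfl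

lemma rate_reflect (b d : ℤ → ℝ) (a : Dir) (x : ℤ) :
    rate (fun x => d (-x)) (fun x => b (-x)) a x = rate b d a.flip (-x) := by cases a <;> rfl

lemma neg_move (a : Dir) (x : ℤ) : -move a x = move a.flip (-x) := by
  simp only [move, Dir.step_flip]; ring

lemma IsChain.reflect {J : Set ℤ} {b d : ℤ → ℝ} (hJ : IsChain J b d) :
    IsChain (Neg.neg ⁻¹' J) (fun x => d (-x)) fun x => b (-x) where
  rate_nonneg a x hx := by rw [rate_reflect]; exact hJ.rate_nonneg _ _ hx
  move_mem x hx a h := by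
    rw [rate_reflect] at h
    rw [Set.mem_preimage, neg_move]
    exact hJ.move_mem _ hx _ h

lemma gen_reflect (b d : ℤ → ℝ) (f : ℤ → ℝ) (x : ℤ) :
    gen (rate (fun x => d (-x)) fun x => b (-x)) move (fun x => f (-x)) x =
      gen (rate b d) move f (-x) := by
  rw [gen_chain, gen_chain, neg_add, neg_sub]
  rw [show (-x + -1 : ℤ) = -x - 1 by ring, show (1 - x : ℤ) = -x + 1 by ring]
  ring

lemma HasLyapunov.reflect {J : Set ℤ} {b d : ℤ → ℝ} (h : HasLyapunov J b d) :
    HasLyapunov (Neg.neg ⁻¹' J) (fun x => d (-x)) fun x => b (-x) := by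
  obtain ⟨V, C, h1, h2, h3⟩ := h
  refine ⟨fun x => V (-x), C, fun x => h1 _, fun x hx => ?_, fun K => ?_⟩
  · rw [gen_reflect]; exact h2 _ hx
  · exact (h3 K).preimage neg_injective.injOn

lemma IsSol.reflect {J : Set ℤ} {b d : ℤ → ℝ} {u : ℝ → ℤ → ℝ} (h : IsSol J (rate b d) move u) :
    IsSol (Neg.neg ⁻¹' J) (rate (fun x => d (-x)) fun x => b (-x)) move fun t x => u t (-x) := by
  intro x hx t ht
  have := h (-x) hx t ht
  rwa [← gen_reflect] at this

variable {Ω : Type*} {J : Set ℤ} {N : J × Dir → ℝ → Ω → ℤ}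

/-- The arrows reflected at the origin. -/
def reflectField (N : J × Dir → ℝ → Ω → ℤ) : ↥(Neg.neg ⁻¹' J : Set ℤ) × Dir → ℝ → Ω → ℤ :=
  fun k => N (⟨-k.1, k.1.2⟩, k.2.flip)

lemma Follows.reflect {A : ℤ → Dir → Set ℝ} {s t : ℝ} {x y : ℤ} (h : Follows A s t x y) :
    Follows (fun x a => A (-x) a.flip) s t (-x) (-y) := by
  induction h with
  | stay hst h => exact .stay hst fun v hv a => by simpa using h v hv a.flip
  | @jump s u t x y a hsu hut hu h _ ih =>
    refine .jump (a := a.flip) hsu hut (by simpa using hu)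
      (fun v hv a' => by simpa using h v hv a'.flip) ?_
    rwa [Dir.step_flip, ← neg_add]

lemma IsGoodArrows.reflect {ω : Ω} (h : IsGoodArrows (arrowTimes N ω)) :
    IsGoodArrows (arrowTimes (reflectField N) ω) where
  finite x a p q := h.finite (-x) a.flip p q
  eq_of_mem x a x' a' t ht ht' := by
    obtain ⟨h1, h2⟩ := h.eq_of_mem (-x) a.flip (-x') a'.flip t ht ht'
    refine ⟨neg_injective h1, ?_⟩
    rw [← Dir.flip_flip a, h2, Dir.flip_flip]

variable [MeasurableSpace Ω] {P : Measure Ω} {b d : ℤ → ℝ}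

lemma IsArrowField.reflect (hN : IsArrowField P J b d N) :
    IsArrowField P (Neg.neg ⁻¹' J) (fun x => d (-x)) (fun x => b (-x)) (reflectField N) where
  up x := hN.down ⟨-x, x.2⟩
  down x := hN.up ⟨-x, x.2⟩
  indep := by
    refine hN.indep.precomp (g := fun k : ↥(Neg.neg ⁻¹' J : Set ℤ) × Dir =>
      ((⟨-k.1, k.1.2⟩ : J), k.2.flip)) fun k l h => ?_
    obtain ⟨⟨x, hx⟩, a⟩ := k
    obtain ⟨⟨x', hx'⟩, a'⟩ := l
    simp only [Prod.mk.injEq, Subtype.mk.injEq, neg_inj] at h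
    obtain ⟨rfl, h2⟩ := h
    rw [← Dir.flip_flip a, h2, Dir.flip_flip]

variable [IsProbabilityMeasure P]

lemma IsArrowField.ae_flow_reflect (hN : IsArrowField P J b d N) (hJ : IsChain J b d)
    (hL : HasLyapunov J b d) {s t : ℝ} (hst : s ≤ t) :
    ∀ᵐ ω ∂P, ∀ x, flow (reflectField N) ω s t x = -flow N ω s t (-x) := by
  filter_upwards [hN.ae_follows_flow hJ hL hst] with ω h x
  have := (h.2 (-x)).reflect
  rw [neg_neg] at this
  exact flow_eq_of_follows h.1.reflect this

/-- The events defined through the infimum are the reflections of the events defined through the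
supremum. -/
lemma IsArrowField.measureReal_eventInf (hN : IsArrowField P J b d N) (hJ : IsChain J b d)
    (hL : HasLyapunov J b d) {m n : ℕ} {x x' : Fin m → ℤ} {y y' : Fin n → ℤ} {t : ℝ} (ht : 0 ≤ t)
    (hy : ∀ j, y j ∈ J) (hy1 : ∀ j, y j - 1 ∈ J) :
    P.real (eventInf N t x y x' y') = P.real (eventSup (reflectField N) t
      (fun i => -x i.rev) (fun j => -y j.rev) (fun i => -x' i.rev) fun j => -y' j.rev) := by
  refine measureReal_congr ?_
  have hy' : ∀ j : Fin n, -y j.rev ∈ (Neg.neg ⁻¹' J : Set ℤ) := fun j => by simpa using hy j.rev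
  have hy1' : ∀ j : Fin n, -y j.rev + 1 ∈ (Neg.neg ⁻¹' J : Set ℤ) := fun j => by
    have := hy1 j.rev
    rw [Set.mem_preimage]
    convert this using 1
    ring
  filter_upwards [hN.ae_mem_eventInf_iff hJ hL (x := x) (x' := x') (y' := y') ht hy hy1,
    hN.reflect.ae_mem_eventSup_iff hJ.reflect hL.reflect (x := fun i => -x i.rev)
      (x' := fun i => -x' i.rev) (y' := fun j => -y' j.rev) ht hy' hy1',
    hN.ae_flow_reflect hJ hL ht] with ω h1 h2 h3
  refine propext (h1.trans (Iff.trans ?_ h2.symm))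
  simp only [h3, neg_neg, neg_inj, neg_le_neg_iff]
  refine and_congr Fin.rev_surjective.forall (Fin.rev_surjective.forall.trans
    (forall_congr' fun j => and_congr_right fun _ => ?_))
  rw [neg_add, neg_neg, neg_lt_neg_iff, sub_eq_add_neg]

end Reflection

/-! ### Duality and reversibility of the two chains -/

lemma HasLyapunov.mono {J J' : Set ℤ} {b d : ℤ → ℝ} (h : HasLyapunov J b d) (hJ : J' ⊆ J) :
    HasLyapunov J' b d := by
  obtain ⟨V, C, h1, h2, h3⟩ := h
  exact ⟨V, C, h1, fun x hx => h2 x (hJ hx), fun K => (h3 K).subset fun x hx => ⟨hJ hx.1, hx.2⟩⟩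

section Duality

variable {I : Lattice} {lam mu : ℤ → ℝ}

/-- `P̂_t 1_{[y,∞)}(x)`, where for `I = ℕ` the absorbing state `-1` is a possible target. -/
def upperProbDual (I : Lattice) (lam mu : ℤ → ℝ) (t : ℝ) (y x : ℤ) : ℝ :=
  indicatorProb (pHat I lam mu) t (I.dualSites ∩ Set.Ici y) x

lemma upperProbDual_eq {y : ℤ} (hy : y ∈ I.sites) (t : ℝ) (x : ℤ) :
    upperProbDual I lam mu t y x = upperProbHat I lam mu t y x := by
  rw [upperProbDual, upperProbHat]
  congr 1
  ext z
  exact ⟨fun h => ⟨mem_sites_of_le hy h.2, h.2⟩, fun h => ⟨sites_subset_dualSites h.1, h.2⟩⟩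

lemma lowerProb_eq_zero {y : ℤ} (hy : y ∉ I.sites) (t : ℝ) (x : ℤ) :
    lowerProb I lam mu t y x = 0 := by
  have : I.sites ∩ Set.Iic y = ∅ :=
    Set.eq_empty_of_forall_notMem fun z hz => hy (mem_sites_of_le hz.1 hz.2)
  simp [lowerProb, indicatorProb, this]

variable (hr : AdmissibleRates lam mu I)
include hr

/-- From the absorbing state `-1` of the dual chain for `I = ℕ` no site is reached. -/
lemma pHat_eq_zero_of_absorbed {x y : ℤ} (hx : x ∉ I.sites) (hx' : x ∈ I.dualSites)
    (hy : y ∈ I.sites) (t : ℝ) : pHat I lam mu t x y = 0 := by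
  have h0 : ∀ a, rate (dualBirth mu) (dualDeath I lam) a x = 0 := by
    intro a
    cases a
    · exact hr.mu_eq_zero (mem_dualSites_iff.1 hx') (by simpa using hx)
    · exact if_neg hx
  refine transition_eq_zero (J := {x}) ⟨fun a z hz => ?_, fun z hz a h => ?_⟩ rfl fun h => hx ?_
  · rw [Set.mem_singleton_iff.1 hz, h0]
  · rw [Set.mem_singleton_iff.1 hz] at h
    exact absurd (h0 a) h
  · rwa [← Set.mem_singleton_iff.1 h]

variable (hn : NaturalBoundaries lam mu I)
include hn

/-- Duality of the chain and its dual. The state `-1` counts as a threshold for the chain and as a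
starting point for the dual chain. -/
lemma siegmund {t : ℝ} (ht : 0 ≤ t) {x y : ℤ} (hx : x ∈ I.sites) (hy : y ∈ I.dualSites) :
    lowerProb I lam mu t y x = upperProbDual I lam mu t x y :=
  siegmund_duality (isChain_pT hr) (hasLyapunov_pT hr hn).confined (isChain_pHat hr)
    (hasLyapunov_pHat hr hn).confined (fun _ _ y _ h => by subst h; rfl)
    (fun _ hx _ => dualDeath_of_mem hx) subset_rfl (fun _ _ _ hy _ => hy) ht hx hy

lemma pT_reversible {t : ℝ} (ht : 0 ≤ t) {x y : ℤ} (hx : x ∈ I.sites) (hy : y ∈ I.sites) :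
    revMeasure lam mu x * pT lam mu t x y = revMeasure lam mu y * pT lam mu t y x :=
  transition_reversible (isChain_pT hr) (hasLyapunov_pT hr hn).confined subset_rfl
    (fun _ => revMeasure_pos_of_sites hr) (fun _ hx _ => detailedBalance hr hx)
    (fun _ hx h => absurd (succ_mem_sites hx) h) (fun _ _ h => Or.inr h)
    (fun _ hx h => absurd hx h) ht hx hy

lemma pHat_reversible {t : ℝ} (ht : 0 ≤ t) {x y : ℤ} (hx : x ∈ I.sites) (hy : y ∈ I.sites) :
    revMeasureHat I lam mu x * pHat I lam mu t x y =
      revMeasureHat I lam mu y * pHat I lam mu t y x :=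
  transition_reversible (isChain_pHat hr) (hasLyapunov_pHat hr hn).confined
    sites_subset_dualSites (fun _ => revMeasureHat_pos hr)
    (fun x hx h => by rw [dualDeath_of_mem h]; exact detailedBalanceHat hr hx)
    (fun _ hx h => absurd (succ_mem_sites hx) h)
    (fun x hx h => Or.inl (by rw [dualBirth, sub_add_cancel]; exact hr.mu_eq_zero hx h))
    (fun _ hx hx' _ hy t _ => pHat_eq_zero_of_absorbed hr hx' hx hy t) ht hx hy

/-- The dual transition function is a difference of values of the distribution function of the
chain. -/
lemma pHat_eq_lowerProb_sub {t : ℝ} (ht : 0 ≤ t) {x y : ℤ} (hx : x ∈ I.sites)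
    (hy : y ∈ I.sites) : pHat I lam mu t y x =
      lowerProb I lam mu t y x - lowerProb I lam mu t y (x + 1) := by
  have hy' := sites_subset_dualSites hy
  rw [siegmund hr hn ht hx hy', siegmund hr hn ht (succ_mem_sites hx) hy']
  refine indicatorProb_sub (isChain_pHat hr) ht hy' ⟨sites_subset_dualSites hx, Set.self_mem_Ici⟩ ?_
  ext z
  simp only [Set.mem_inter_iff, Set.mem_Ici, Set.mem_sdiff, Set.mem_singleton_iff]
  constructor
  · rintro ⟨h1, h2⟩; exact ⟨⟨h1, by omega⟩, by omega⟩
  · rintro ⟨⟨h1, h2⟩, h3⟩; exact ⟨h1, by omega⟩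

/-- The transition function is a difference of values of the distribution function of the
dual chain. -/
lemma pT_eq_upperProbDual_sub {t : ℝ} (ht : 0 ≤ t) {x y : ℤ} (hx : x ∈ I.sites)
    (hy : y ∈ I.sites) : pT lam mu t y x =
      upperProbDual I lam mu t y x - upperProbDual I lam mu t y (x - 1) := by
  rw [← siegmund hr hn ht hy (sites_subset_dualSites hx),
    ← siegmund hr hn ht hy (mem_dualSites_iff.2 (by simpa using hx))]
  refine indicatorProb_sub (isChain_pT hr) ht hy ⟨hx, Set.self_mem_Iic⟩ ?_
  ext z
  simp only [Set.mem_inter_iff, Set.mem_Iic, Set.mem_sdiff, Set.mem_singleton_iff]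
  constructor
  · rintro ⟨h1, h2⟩; exact ⟨⟨h1, by omega⟩, by omega⟩
  · rintro ⟨⟨h1, h2⟩, h3⟩; exact ⟨h1, by omega⟩

open Classical in
/-- The chain together with dual particles. -/
lemma isInterPair_lower : IsInterPair I.sites lam mu (dualBirth mu) (dualDeath I lam)
    (revMeasureHat I lam mu) (fun t x y => lowerProb I lam mu t y x)
    (fun t y y' => if y' ∈ I.sites then (revMeasureHat I lam mu y')⁻¹ * pHat I lam mu t y y'
      else 0) where
  ordConnected := ⟨fun x hx _ _ _ hz => mem_sites_of_le hx hz.1⟩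
  rate_nonneg := (isChain_pT hr).rate_nonneg
  rate_nonneg' a x hx := (isChain_pHat hr).rate_nonneg a x (sites_subset_dualSites hx)
  down_mem x hx h := by
    by_contra h'
    exact h (hr.mu_eq_zero hx h')
  lyapunov := hasLyapunov_pT hr hn
  lyapunov' := (hasLyapunov_pHat hr hn).mono sites_subset_dualSites
  pos _ hx := revMeasureHat_pos hr hx
  sol y := isSol_indicatorProb (isChain_pT hr) _
  sol' y' := by
    by_cases hy' : y' ∈ I.sites
    · simp only [hy', if_true]
      exact ((isSol_transition (isChain_pHat hr) y').mono sites_subset_dualSites).const_mul _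
    · simp only [hy', if_false]
      exact IsSol.zero
  bounded t ht x hx y := abs_indicatorProb_le_one (isChain_pT hr) ht _ hx
  bounded' y' := by
    refine ⟨|(revMeasureHat I lam mu y')⁻¹|, fun t ht x hx => ?_⟩
    split_ifs
    · rw [abs_mul]
      refine mul_le_of_le_one_right (abs_nonneg _) ?_
      rw [pHat, abs_of_nonneg (transition_nonneg _ _ _ _ _)]
      exact transition_le_one (isChain_pHat hr) ht (sites_subset_dualSites hx) _
    · simp
  zero x hx y := by
    have hx' : x ∈ I.sites := by
      rcases hx with hx | hx
      · exact hx
      · simpa using succ_mem_sites hx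
    rw [lowerProb, pT, indicatorProb_zero (isChain_pT hr) _ hx']
    simp [hx']
  cross t ht y hy y' _ := by
    by_cases hy' : y' ∈ I.sites
    · have h1 := pHat_eq_lowerProb_sub hr hn ht hy hy'
      have h2 := pHat_reversible hr hn ht hy hy'
      have h3 := (revMeasureHat_pos hr hy').ne'
      simp only [hy', if_true]
      field_simp
      linear_combination revMeasureHat I lam mu y' * h1 + h2
    · simp only [hy', if_false, lowerProb_eq_zero hy']
      ring
  exit t _ a y hy hne hmove y' := by
    split_ifs with hy'
    · rw [pHat_eq_zero_of_absorbed hr hmove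
        ((isChain_pHat hr).move_mem y (sites_subset_dualSites hy) a hne) hy', mul_zero]
    · rfl

open Classical in
/-- The dual chain together with particles which move as the original chain, reflected at the
origin. -/
lemma isInterPair_upper : IsInterPair (Neg.neg ⁻¹' I.sites) (fun x => dualDeath I lam (-x))
    (fun x => dualBirth mu (-x)) (fun x => mu (-x)) (fun x => lam (-x))
    (fun x => revMeasure lam mu (-x)) (fun t x y => upperProbDual I lam mu t (-y) (-x))
    (fun t y y' => if -y' ∈ I.sites then (revMeasure lam mu (-y'))⁻¹ * pT lam mu t (-y) (-y')
      else 0) where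
  ordConnected := ⟨fun _ _ z hz w hw => mem_sites_of_le (x := -z) hz (neg_le_neg hw.2)⟩
  rate_nonneg a x hx := (isChain_pHat hr).reflect.rate_nonneg a x (sites_subset_dualSites hx)
  rate_nonneg' := (isChain_pT hr).reflect.rate_nonneg
  down_mem x hx _ := by
    rw [Set.mem_preimage, neg_sub, ← neg_add_eq_sub]
    exact succ_mem_sites hx
  lyapunov := ((hasLyapunov_pHat hr hn).mono sites_subset_dualSites).reflect
  lyapunov' := (hasLyapunov_pT hr hn).reflect
  pos _ hx := revMeasure_pos_of_sites hr hx
  sol y := ((isSol_indicatorProb (isChain_pHat hr) _).mono sites_subset_dualSites).reflect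
  sol' y' := by
    by_cases hy' : -y' ∈ I.sites
    · simp only [hy', if_true]
      exact ((isSol_transition (isChain_pT hr) (-y')).reflect).const_mul _
    · simp only [hy', if_false]
      exact IsSol.zero
  bounded t ht x hx y :=
    abs_indicatorProb_le_one (isChain_pHat hr) ht _ (sites_subset_dualSites hx)
  bounded' y' := by
    refine ⟨|(revMeasure lam mu (-y'))⁻¹|, fun t ht x hx => ?_⟩
    split_ifs
    · rw [abs_mul]
      refine mul_le_of_le_one_right (abs_nonneg _) ?_
      rw [pT, abs_of_nonneg (transition_nonneg _ _ _ _ _)]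
      exact transition_le_one (isChain_pT hr) ht hx _
    · simp
  zero x hx y := by
    have hx' : -x ∈ I.dualSites := by
      rcases hx with hx | hx
      · exact sites_subset_dualSites hx
      · rw [mem_dualSites_iff]
        simpa [neg_add_eq_sub] using hx
    rw [upperProbDual, pHat, indicatorProb_zero (isChain_pHat hr) _ hx']
    simp [hx']
  cross t ht y hy y' hy' := by
    have hy' : -y' ∈ I.sites := by
      rcases hy' with h | h
      · exact h
      · have := succ_mem_sites (x := -(y' + 1)) h
        simpa using this
    have h1 := pT_eq_upperProbDual_sub hr hn ht hy hy'
    have h2 := pT_reversible hr hn ht hy hy'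
    have h3 := (revMeasure_pos_of_sites hr hy').ne'
    simp only [hy', if_true]
    rw [neg_add, ← sub_eq_add_neg]
    field_simp
    linear_combination revMeasure lam mu (-y') * h1 + h2
  exit t _ a y hy hne hmove :=
    absurd ((isChain_pT hr).reflect.move_mem y hy a hne) hmove

end Duality

/-! ### The kernels as determinants of differences -/

section Kernels

/-- Rescaling rows and columns of a block matrix. -/
lemma det_fromBlocks_eq_interKernel {m n : ℕ} {w : ℤ → ℝ} {g : ℤ → ℤ → ℝ}
    {x x' : Fin m → ℤ} {y y' : Fin n → ℤ}
    {A : Matrix (Fin m) (Fin m) ℝ} {B : Matrix (Fin m) (Fin n) ℝ} {C : Matrix (Fin n) (Fin m) ℝ}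
    {D : Matrix (Fin n) (Fin n) ℝ}
    (hA : ∀ i j, A i j = -(g (x i) (x' j - 1) - g (x i) (x' j)))
    (hB : ∀ i j, B i j = w (y' j) * (g (x i) (y' j) - if (i : ℕ) ≤ j then 1 else 0))
    (hC : ∀ i j, C i j = (w (y i))⁻¹ * ((g (y i + 1) (x' j - 1) - g (y i + 1) (x' j)) -
      (g (y i) (x' j - 1) - g (y i) (x' j))))
    (hD : ∀ i j, D i j = -((w (y i))⁻¹ * w (y' j) * (g (y i + 1) (y' j) - g (y i) (y' j)))) :
    (Matrix.fromBlocks A B C D).det =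
      interKernel w g (Sum.elim x y) (Sum.elim x' y') := by
  set r : Fin m ⊕ Fin n → ℝ := Sum.elim (fun _ => -1) fun i => (w (y i))⁻¹ with hr
  set c : Fin m ⊕ Fin n → ℝ := Sum.elim (fun _ => 1) fun j => -w (y' j) with hc
  have e : Matrix.fromBlocks A B C D = Matrix.of fun s s' => r s *
      (Matrix.of fun s s' => c s' * diffMatrix g x y x' y' s s') s s' := by
    ext s s'
    rcases s with i | i <;> rcases s' with j | j
    · simp [hr, hc, diffMatrix, hA]
    · simp [hr, hc, diffMatrix, hB]
    · simp [hr, hc, diffMatrix, hC]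
    · simp [hr, hc, diffMatrix, hD]; ring
  rw [e, Matrix.det_mul_column, Matrix.det_mul_row, interKernel, Fintype.prod_sum_type,
    Fintype.prod_sum_type]
  simp only [hr, hc, Sum.elim_inl, Sum.elim_inr, Finset.prod_const, Finset.card_univ,
    Fintype.card_fin, Finset.prod_inv_distrib, Finset.prod_neg, one_pow]
  ring

variable {I : Lattice} {lam mu : ℤ → ℝ} (hr : AdmissibleRates lam mu I)
  (hn : NaturalBoundaries lam mu I)

include hr hn

lemma qSucc_eq {n : ℕ} {t : ℝ} (ht : 0 ≤ t) (z z' : WSucc I n) :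
    qSucc I lam mu n t z z' = interKernel (revMeasureHat I lam mu)
      (fun x y => lowerProb I lam mu t y x) (Sum.elim z.1.1 z.1.2) (Sum.elim z'.1.1 z'.1.2) := by
  -- The blocks `B` and `C` are differences by definition; for `A` and `D`, the transition
  -- probabilities have to be written as differences of the distribution function, in the case of
  -- `D` by duality and reversibility.
  refine det_fromBlocks_eq_interKernel (fun i j => ?_) (fun i j => ?_) (fun i j => ?_)
    fun i j => ?_
  · have h := indicatorProb_sub (isChain_pT hr) ht (z.2.1 i) (S := I.sites ∩ Set.Iic (z'.1.1 j))
      (S' := I.sites ∩ Set.Iic (z'.1.1 j - 1)) ⟨z'.2.1 j, Set.self_mem_Iic⟩ ?_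
    · rw [neg_sub]; exact h
    · ext v
      simp only [Set.mem_inter_iff, Set.mem_Iic, Set.mem_sdiff, Set.mem_singleton_iff]
      constructor
      · rintro ⟨h1, h2⟩; exact ⟨⟨h1, by omega⟩, by omega⟩
      · rintro ⟨⟨h1, h2⟩, h3⟩; exact ⟨h1, by omega⟩
  · rfl
  · rfl
  · have h1 := pHat_eq_lowerProb_sub hr hn ht (z.2.2.1 i) (z'.2.2.1 j)
    have h2 := pHat_reversible hr hn ht (z.2.2.1 i) (z'.2.2.1 j)
    have h3 := (revMeasureHat_pos hr (z.2.2.1 i)).ne'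
    simp only [Matrix.of_apply]
    field_simp
    linear_combination h2 + revMeasureHat I lam mu (z'.1.2 j) * h1

/-- Reflection at the origin, together with the reversal of the order of the indices, turns the
interlacing `y₁ ≤ x₁ < y₂ ≤ ⋯` into `x₁ ≤ y₁ < x₂ ≤ ⋯` and upper tails into distribution functions.
-/
lemma qSame_eq {n : ℕ} {t : ℝ} (ht : 0 ≤ t) (z z' : WSame I n) :
    qSame I lam mu n t z z' = interKernel (fun x => revMeasure lam mu (-x))
      (fun x y => upperProbDual I lam mu t (-y) (-x))
      (Sum.elim (fun i => -z.1.1 i.rev) fun j => -z.1.2 j.rev)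
      (Sum.elim (fun i => -z'.1.1 i.rev) fun j => -z'.1.2 j.rev) := by
  have hup := fun x => upperProbDual_eq (lam := lam) (mu := mu) (hy := (z'.2.1 x)) t
  rw [qSame, ← Matrix.det_submatrix_equiv_self (Equiv.sumCongr Fin.revPerm Fin.revPerm),
    ← Matrix.fromBlocks_toBlocks (Matrix.submatrix _ _ _)]
  refine det_fromBlocks_eq_interKernel (fun i j => ?_) (fun i j => ?_) (fun i j => ?_)
    fun i j => ?_
  · have h := indicatorProb_sub (isChain_pHat hr) ht (sites_subset_dualSites (z.2.1 i.rev))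
      (S := I.dualSites ∩ Set.Ici (z'.1.1 j.rev)) (S' := I.dualSites ∩ Set.Ici (z'.1.1 j.rev + 1))
      ⟨sites_subset_dualSites (z'.2.1 j.rev), Set.self_mem_Ici⟩ ?_
    · have e2 : -(-z'.1.1 j.rev - 1) = z'.1.1 j.rev + 1 := by ring
      simp only [e2, neg_neg, neg_sub]
      exact h
    · ext v
      simp only [Set.mem_inter_iff, Set.mem_Ici, Set.mem_sdiff, Set.mem_singleton_iff]
      constructor
      · rintro ⟨h1, h2⟩; exact ⟨⟨h1, by omega⟩, by omega⟩
      · rintro ⟨⟨h1, h2⟩, h3⟩; exact ⟨h1, by omega⟩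
  · simp only [neg_neg, upperProbDual_eq (z'.2.2.1 j.rev)]
    simp [Matrix.toBlocks₁₂]
  · have e1 : -(-z.1.2 i.rev + 1) = z.1.2 i.rev - 1 := by ring
    have e2 : -(-z'.1.1 j.rev - 1) = z'.1.1 j.rev + 1 := by ring
    simp only [e1, e2, neg_neg, hup, upperProbDual_eq (succ_mem_sites (z'.2.1 j.rev))]
    simp [Matrix.toBlocks₂₁, fwd, bwd]
  · have h1 := pT_eq_upperProbDual_sub hr hn ht (z.2.2.1 i.rev) (z'.2.2.1 j.rev)
    have h2 := pT_reversible hr hn ht (z.2.2.1 i.rev) (z'.2.2.1 j.rev)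
    have h3 := (revMeasure_pos_of_sites hr (z.2.2.1 i.rev)).ne'
    have e1 : -(-z.1.2 i.rev + 1) = z.1.2 i.rev - 1 := by ring
    simp only [e1, neg_neg]
    simp only [Matrix.toBlocks₂₂, Matrix.of_apply, Matrix.submatrix_apply, Equiv.sumCongr_apply,
      Sum.map_inr, Matrix.fromBlocks_apply₂₂, Fin.revPerm_apply]
    field_simp
    linear_combination h2 + revMeasure lam mu (z'.1.2 j.rev) * h1

omit hr hn

lemma IsSubMarkovKernel.congr {X : Type*} {q q' : ℝ → X → X → ℝ} (hq : IsSubMarkovKernel q)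
    (h : ∀ t, 0 ≤ t → ∀ x y, q' t x y = q t x y) : IsSubMarkovKernel q' where
  nonneg t ht x y := by rw [h t ht]; exact hq.nonneg t ht x y
  sum_le t ht x F := by simp only [h t ht]; exact hq.sum_le t ht x F
  zero_self x := by rw [h 0 le_rfl]; exact hq.zero_self x
  zero_ne x y hxy := by rw [h 0 le_rfl]; exact hq.zero_ne x y hxy
  hasSum s t hs ht x z := by
    simp only [h s hs, h t ht, h (t + s) (add_nonneg ht hs)]; exact hq.hasSum s t hs ht x z
  tendsto x := (hq.tendsto x).congr' (by
    filter_upwards [self_mem_nhdsWithin] with t ht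
    exact (h t (le_of_lt ht) x x).symm)

lemma interlaced_succ {n : ℕ} {x : Fin (n + 1) → ℤ} {y : Fin n → ℤ} :
    Interlaced x y ↔ ∀ i : Fin n, x i.castSucc ≤ y i ∧ y i < x i.succ := by
  refine ⟨fun h i => ⟨(h i.castSucc i).1 le_rfl, (h i.succ i).2 (by simp)⟩, fun h i j => ?_⟩
  have hx : StrictMono x := Fin.strictMono_iff_lt_succ.2 fun i => (h i).1.trans_lt (h i).2
  refine ⟨fun hij => ?_, fun hji => ?_⟩
  · exact (hx.monotone (show i ≤ j.castSucc from hij)).trans (h j).1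
  · exact (h j).2.trans_le (hx.monotone (show j.succ ≤ i from hji))

/-- The reflected and reversed form of the interlacing which starts with a `y`-particle. -/
lemma interlaced_rev {n : ℕ} {x y : Fin n → ℤ} :
    Interlaced (fun i => -x i.rev) (fun j => -y j.rev) ↔
      (∀ i, y i ≤ x i) ∧ ∀ i j : Fin n, (i : ℕ) + 1 = j → x i < y j := by
  have key : Interlaced (fun i => -x i.rev) (fun j => -y j.rev) ↔
      ∀ i j : Fin n, (j ≤ i → y j ≤ x i) ∧ (i < j → x i < y j) := by
    rw [Interlaced]
    refine Fin.rev_surjective.forall.trans (forall_congr' fun i => Fin.rev_surjective.forall.trans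
      (forall_congr' fun j => ?_))
    have h1 : ((i.rev : ℕ) ≤ j.rev) ↔ j ≤ i := Fin.rev_le_rev
    have h2 : ((j.rev : ℕ) < i.rev) ↔ i < j := Fin.rev_lt_rev
    rw [h1, h2]
    simp
  rw [key]
  refine ⟨fun h => ⟨fun i => (h i i).1 le_rfl, fun i j hij => (h i j).2 (by omega)⟩,
    fun ⟨h1, h2⟩ => ?_⟩
  have hlt : ∀ (p : ℕ) (i j : Fin n), (i : ℕ) + 1 + p = j → x i < y j := by
    intro p
    induction p with
    | zero => exact h2
    | succ p ih =>
      intro i j hij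
      have hk : (i : ℕ) + 1 + p < n := by omega
      exact (ih i ⟨_, hk⟩ rfl).trans_le ((h1 _).trans (h2 ⟨_, hk⟩ j (by simp; omega)).le)
  refine fun i j => ⟨fun hji => ?_, fun hij => ?_⟩
  · rcases hji.eq_or_lt with rfl | h
    · exact h1 _
    · exact ((h1 j).trans (hlt (i - j - 1) j i (by omega)).le).trans (h1 i)
  · exact hlt (j - i - 1) i j (by omega)

include hr hn

theorem isSubMarkovKernel_qSucc (n : ℕ) : IsSubMarkovKernel (qSucc I lam mu n) := by
  refine ((isInterPair_lower hr hn).isSubMarkovKernel (Nat.le_succ n) le_rfl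
    (Or.inr fun x hx => succ_mem_sites hx) (X := WSucc I n)
    (e := fun z => Sum.elim z.1.1 z.1.2) ?_ ?_).congr fun t ht z z' => qSucc_eq hr hn ht z z'
  · intro z z' h
    refine Subtype.ext (Prod.ext (funext fun i => ?_) (funext fun j => ?_))
    · exact congrFun h (.inl i)
    · exact congrFun h (.inr j)
  · ext v
    constructor
    · rintro ⟨z, rfl⟩
      exact ⟨Sum.forall.2 ⟨z.2.1, z.2.2.1⟩, interlaced_succ.2 z.2.2.2⟩
    · rintro ⟨h1, h2⟩
      exact ⟨⟨(fun i => v (.inl i), fun j => v (.inr j)), fun i => h1 _, fun j => h1 _,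
        interlaced_succ.1 h2⟩, Sum.elim_comp_inl_inr v⟩

theorem isSubMarkovKernel_qSame (n : ℕ) : IsSubMarkovKernel (qSame I lam mu n) := by
  refine ((isInterPair_upper hr hn).isSubMarkovKernel le_rfl (Nat.le_succ n) (Or.inl le_rfl)
    (X := WSame I n)
    (e := fun z => Sum.elim (fun i => -z.1.1 i.rev) fun j => -z.1.2 j.rev) ?_ ?_).congr
    fun t ht z z' => qSame_eq hr hn ht z z'
  · intro z z' h
    refine Subtype.ext (Prod.ext (funext fun i => ?_) (funext fun j => ?_))
    · simpa using congrFun h (.inl i.rev)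
    · simpa using congrFun h (.inr j.rev)
  · ext v
    constructor
    · rintro ⟨z, rfl⟩
      refine ⟨Sum.forall.2 ⟨fun i => ?_, fun j => ?_⟩, interlaced_rev.2 z.2.2.2⟩
      · simpa using z.2.1 i.rev
      · simpa using z.2.2.1 j.rev
    · rintro ⟨h1, h2⟩
      refine ⟨⟨(fun i => -v (.inl i.rev), fun j => -v (.inr j.rev)), fun i => h1 _, fun j => h1 _,
        interlaced_rev.1 (by simpa using h2)⟩, ?_⟩
      funext s
      rcases s with i | j <;> simp

end Kernels

/-! ### The kernels as flow probabilities -/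

section Formula

variable {I : Lattice} {lam mu : ℤ → ℝ} (hr : AdmissibleRates lam mu I)
  (hn : NaturalBoundaries lam mu I) {Ω : Type*} [MeasurableSpace Ω] {P : Measure Ω}
  [IsProbabilityMeasure P] {n : ℕ} {t : ℝ}
include hr hn

theorem qSucc_eq_measureReal {N : I.sites × Dir → ℝ → Ω → ℤ}
    (hN : IsArrowField P I.sites lam mu N) (ht : 0 ≤ t) (z z' : WSucc I n) :
    qSucc I lam mu n t z z' =
      (∏ i, revMeasureHat I lam mu (z'.1.2 i)) / (∏ i, revMeasureHat I lam mu (z.1.2 i)) *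
        P.real (eventSup N t z.1.1 z.1.2 z'.1.1 z'.1.2) := by
  have hp := isInterPair_lower hr hn
  rw [qSucc_eq hr hn ht, hN.measureReal_eventSup (isChain_pT hr) (hasLyapunov_pT hr hn) hp.sol
    hp.bounded (fun x hx y => hp.zero x (Or.inl hx) y) (Nat.le_succ n) le_rfl
    (interlaced_succ.2 z.2.2.2) (interlaced_succ.2 z'.2.2.2) z.2.1 z.2.2.1
    (fun j => succ_mem_sites (z.2.2.1 j)) ht]
  rfl

theorem qSame_eq_measureReal {N : I.dualSites × Dir → ℝ → Ω → ℤ}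
    (hN : IsArrowField P I.dualSites (dualBirth mu) (dualDeath I lam) N) (ht : 0 ≤ t)
    (z z' : WSame I n) :
    qSame I lam mu n t z z' =
      (∏ i, revMeasure lam mu (z'.1.2 i)) / (∏ i, revMeasure lam mu (z.1.2 i)) *
        P.real (eventInf N t z.1.1 z.1.2 z'.1.1 z'.1.2) := by
  have hp := isInterPair_upper hr hn
  have hx : ∀ i, -(-z.1.1 i) ∈ I.dualSites := fun i => by
    rw [neg_neg]; exact sites_subset_dualSites (z.2.1 i)
  have hy : ∀ j, z.1.2 j ∈ I.dualSites := fun j => sites_subset_dualSites (z.2.2.1 j)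
  have hy1 : ∀ j, z.1.2 j - 1 ∈ I.dualSites := fun j =>
    mem_dualSites_iff.2 (by simpa using z.2.2.1 j)
  have hJ := isChain_pHat hr
  have hL := hasLyapunov_pHat hr hn
  rw [qSame_eq hr hn ht, hN.measureReal_eventInf hJ hL ht hy hy1,
    hN.reflect.measureReal_eventSup hJ.reflect hL.reflect
      (g := fun t x y => upperProbDual I lam mu t (-y) (-x))
      (fun y => (isSol_indicatorProb hJ _).reflect)
      (fun t ht x hx y => abs_indicatorProb_le_one hJ ht _ hx)
      (fun x hx y => ?_) le_rfl (Nat.le_succ n)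
      (interlaced_rev.2 z.2.2.2) (interlaced_rev.2 z'.2.2.2) (fun i => hx _) (fun j => ?_)
      (fun j => ?_) ht, interKernel]
  · congr 2
    · rw [← Equiv.prod_comp Fin.revPerm]; simp
    · rw [← Equiv.prod_comp Fin.revPerm]; simp
  · rw [upperProbDual, pHat, indicatorProb_zero hJ _ hx]
    have : -x ∈ I.dualSites := hx
    simp [this]
  · simpa using hy j.rev
  · have := hy1 j.rev
    rwa [Set.mem_preimage, neg_add, neg_neg, ← sub_eq_add_neg]

end Formula

end

end CoalescingFlow

open CoalescingFlow in
theorem mainTheorem4 (I : Lattice) (lam mu : ℤ → ℝ) (hrates : AdmissibleRates lam mu I)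
    (hnat : NaturalBoundaries lam mu I) (n : ℕ) :
    -- the kernels on the interlacing space with `n + 1` and `n` particles
    ((∀ t : ℝ, 0 ≤ t → ∀ z, Summable (qSucc I lam mu n t z)) ∧
      IsSubMarkovSemigroup (fun t => kernelOp (qSucc I lam mu n t)) ∧
      HasMarkovProcess (qSucc I lam mu n) ∧
      ∀ (Ω : Type*) [MeasurableSpace Ω] (P : Measure Ω) [IsProbabilityMeasure P]
        (N : I.sites × Dir → ℝ → Ω → ℤ), IsArrowField P I.sites lam mu N →
        ∀ t : ℝ, 0 ≤ t → ∀ z z' : WSucc I n,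
          NullMeasurableSet (eventSup N t z.1.1 z.1.2 z'.1.1 z'.1.2) P ∧
          qSucc I lam mu n t z z' =
            (∏ i, revMeasureHat I lam mu (z'.1.2 i)) / (∏ i, revMeasureHat I lam mu (z.1.2 i)) *
              P.real (eventSup N t z.1.1 z.1.2 z'.1.1 z'.1.2) ∧
          qSucc I lam mu n t z z' =
            (∏ i, revMeasureHat I lam mu (z'.1.2 i)) / (∏ i, revMeasureHat I lam mu (z.1.2 i)) *
              ((-1) ^ n * fwdAll (fun y => (-1) ^ (n + 1) *
                bwdAll (fun x' => lowerCdf P N t z.1.1 y x' z'.1.2) z'.1.1) z.1.2)) ∧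
    -- the kernels on the interlacing space with `n` and `n` particles
    ((∀ t : ℝ, 0 ≤ t → ∀ z, Summable (qSame I lam mu n t z)) ∧
      IsSubMarkovSemigroup (fun t => kernelOp (qSame I lam mu n t)) ∧
      HasMarkovProcess (qSame I lam mu n) ∧
      ∀ (Ω : Type*) [MeasurableSpace Ω] (P : Measure Ω) [IsProbabilityMeasure P]
        (N : I.dualSites × Dir → ℝ → Ω → ℤ),
        IsArrowField P I.dualSites (dualBirth mu) (dualDeath I lam) N →
        ∀ t : ℝ, 0 ≤ t → ∀ z z' : WSame I n,
          NullMeasurableSet (eventInf N t z.1.1 z.1.2 z'.1.1 z'.1.2) P ∧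
          qSame I lam mu n t z z' =
            (∏ i, revMeasure lam mu (z'.1.2 i)) / (∏ i, revMeasure lam mu (z.1.2 i)) *
              P.real (eventInf N t z.1.1 z.1.2 z'.1.1 z'.1.2) ∧
          qSame I lam mu n t z z' =
            (∏ i, revMeasure lam mu (z'.1.2 i)) / (∏ i, revMeasure lam mu (z.1.2 i)) *
              ((-1) ^ n * bwdAll (fun y => (-1) ^ n *
                fwdAll (fun x' => upperCdf P N t z.1.1 y x' z'.1.2) z'.1.1) z.1.2)) := by
  have h1 := isSubMarkovKernel_qSucc hrates hnat n
  have h2 := isSubMarkovKernel_qSame hrates hnat n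
  have sgn : ∀ k l : ℕ, ((-1 : ℝ) ^ l * ((-1) ^ k * ((-1) ^ k * (-1) ^ l))) = 1 := fun k l => by
    rw [← mul_assoc ((-1 : ℝ) ^ k), ← mul_pow, ← mul_assoc, mul_right_comm, ← mul_pow]
    norm_num
  refine ⟨⟨fun t ht z => h1.summable ht z, h1.isSubMarkovSemigroup, h1.exists_markov_realization,
    fun Ω _ P _ N hN t ht z z' => ?_⟩, ⟨fun t ht z => h2.summable ht z, h2.isSubMarkovSemigroup,
    h2.exists_markov_realization, fun Ω _ P _ N hN t ht z z' => ?_⟩⟩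
  · have hd := hN.diffList_lowerCdf (isChain_pT hrates) (hasLyapunov_pT hrates hnat)
      (x := z.1.1) (x' := z'.1.1) (y := z.1.2) (y' := z'.1.2) ht z.2.2.1
      fun j => succ_mem_sites (z.2.2.1 j)
    refine ⟨hd.1, qSucc_eq_measureReal hrates hnat hN ht z z', ?_⟩
    rw [qSucc_eq_measureReal hrates hnat hN ht z z', fwdAll_eq, diffList_const_mul]
    simp only [bwdAll_eq]
    rw [hd.2]
    linear_combination (-(∏ i, revMeasureHat I lam mu (z'.1.2 i)) /
      (∏ i, revMeasureHat I lam mu (z.1.2 i)) *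
        P.real (eventSup N t z.1.1 z.1.2 z'.1.1 z'.1.2)) * sgn (n + 1) n
  · have hd := hN.diffList_upperCdf (isChain_pHat hrates) (hasLyapunov_pHat hrates hnat)
      (x := z.1.1) (x' := z'.1.1) (y := z.1.2) (y' := z'.1.2) ht
      (fun j => sites_subset_dualSites (z.2.2.1 j))
      fun j => mem_dualSites_iff.2 (by simpa using z.2.2.1 j)
    refine ⟨hd.1, qSame_eq_measureReal hrates hnat hN ht z z', ?_⟩
    rw [qSame_eq_measureReal hrates hnat hN ht z z', bwdAll_eq, diffList_const_mul]
    simp only [fwdAll_eq]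
    rw [hd.2]
    linear_combination (-(∏ i, revMeasure lam mu (z'.1.2 i)) /
      (∏ i, revMeasure lam mu (z.1.2 i)) *
        P.real (eventInf N t z.1.1 z.1.2 z'.1.1 z'.1.2)) * sgn n n
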